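/- **Conventions.** 2-categories are strict; "equivalence" in a bicategory means adjoint equivalence; transformations are pseudonatural. A 2-category is *bicategorically contractible* if the unique 2-functor to the terminal 2-category is a biequivalence (a pseudofunctor with an inverse up to pseudonatural equivalence). Let $P$ be a symmetric operad in 2-categories and 2-functors with the cartesian product, with operadic unit $\mathbb 1\in P(1)$, composition $\gamma$, and right actions of the symmetric groups. A *$P$-algebra* is a 2-category $X$ with pseudofunctors $\mu_n\colon P(n)\times X^n\to X$ satisfying strictly the associativity, unit and equivariance laws of an operad action; a morphism of $P$-algebras is a pseudofunctor commuting strictly with the actions. These form a category $P\text{-}\mathrm{Alg}(2\mathrm{Cat}_{ps},\times)$, and $P\text{-}2\mathrm{Cat}$ is its subcategory with the same objects and with those morphisms whose underlying pseudofunctor is a 2-functor. A *choice of multiplication* $\chi$ in $P$ consists of objects $i\in P(0)$ and $t\in P(2)$; adjoint equivalences $\alpha\colon\gamma(t;t,\mathbb 1)\simeq\gamma(t;\mathbb 1,t)$ in $P(3)$, $l\colon\gamma(t;i,\mathbb 1)\simeq\mathbb 1$ and $r\colon\mathbb 1\simeq\gamma(t;\mathbb 1,i)$ in $P(1)$, $\beta\colon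 t\simeq t\cdot(12)$ in $P(2)$; and invertible 2-cells (composites written in diagrammatic order, and using the equalities of objects that follow from the operad axioms) - $\pi\colon \gamma(1;\alpha,1)\,\gamma(\alpha;1,1_t,1)\,\gamma(1;1,\alpha)\cong\gamma(\alpha;1_t,1,1)\,\gamma(\alpha;1,1,1_t)$ in $P(4)$, - $\mu\colon\gamma(1;r,1)\,\gamma(\alpha;1,1_i,1)\,\gamma(1;1,l)\cong 1$ in $P(2)$, - $\lambda\colon\gamma(1;l,1)\cong\gamma(\alpha;1_i,1,1)\,\gamma(l;1_t)$ and $\rho\colon\gamma(1;1,r)\cong\gamma(r;1_t)\,\gamma(\alpha;1,1,1_i)$ in $P(2)$, - $R_{-|--}\colon \gamma(1;\beta,1)\,(\alpha\cdot(12))\,(\gamma(1;1,\beta)\cdot(12))\cong\alpha\,\gamma(\beta;1,1_t)\,(\alpha\cdot(132))$ in $P(3)$, - $R_{--|-}\colon \gamma(1;1,\beta)\,(\alpha^\bullet\cdot(23))\,(\gamma(1;\beta,1)\cdot(23))\cong\alpha^\bullet\,\gamma(\beta;1_t,1)\,(\alpha^\bullet\cdot(123))$ in $P(3)$, - $v\colon\beta\,(\beta\cdot(12))\cong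 1_t$ in $P(2)$. A *symmetric monoidal 2-category* is a symmetric monoidal bicategory whose underlying bicategory is a 2-category: it has a tensor pseudofunctor $(x,y)\mapsto xy$, a unit $e$, equivalences $\alpha\colon(xy)z\simeq x(yz)$, $l\colon ex\simeq x$, $r\colon x\simeq xe$, $\beta\colon xy\simeq yx$, and invertible modifications $\pi,\mu,\lambda,\rho,R_{x|yz},R_{xy|z},v$, subject to the usual three monoidal, four braided, two sylleptic and one symmetric axioms. A *strictly symmetric monoidal pseudofunctor* $F\colon X\to Y$ is a pseudofunctor that commutes strictly with the tensor pseudofunctors and the units and preserves the structure 1-cells $\alpha,l,r,\beta$ and their adjoint inverses up to invertible comparison 2-cells, such that under these comparisons and the constraints of $F$ all remaining data (naturality 2-cells, units and counits of the adjoint equivalences, and modifications) are preserved. It is a *strict functor* if $F$ is a 2-functor and the comparisons are identities. Symmetric monoidal 2-categories form categories $\mathrm{SM2Cat}_{ps}$ with the strictly symmetric monoidal pseudofunctors and $\mathrm{SM2Cat}_s$ with the strict functors. **Theorem.** Suppose that $P(n)$ is bicategorically contractible for every $n\le 5$, and let $\chi$ be a choice of multiplication in $P$. Then $\chi$ determines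 a functor $$\chi^*\colon P\text{-}\mathrm{Alg}(2\mathrm{Cat}_{ps},\times)\to \mathrm{SM2Cat}_{ps}$$ which is the identity on underlying 2-categories and pseudofunctors. The symmetric monoidal structure of $\chi^*X$ is the image of $\chi$ under the action: $xy=\mu_2(t;x,y)$ as a pseudofunctor, $e=\mu_0(i)$, and the equivalences $\alpha,l,r,\beta$ (with their adjoint inverses, naturality 2-cells, units and counits) and the modifications $\pi,\mu,\lambda,\rho,R,R,v$ are the images $\mu_n(\alpha;-),\dots,\mu_n(v;-)$ of their namesakes in $\chi$, up to the unit and composition constraints of the pseudofunctors $\mu_n$. For a morphism $F\colon X\to Y$, the comparison 2-cells of $\chi^*F$ are those induced by the unit constraints of $F$, for example $F(\mu_3(\alpha;1_x,1_y,1_z))=\mu_3(\alpha;F1_x,F1_y,F1_z)\cong\mu_3(\alpha;1_{Fx},1_{Fy},1_{Fz})$. Moreover, $\chi^*$ restricts to a functor $$\chi^*\colon P\text{-}2\mathrm{Cat}\to\mathrm{SM2Cat}_s.$$ -/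

import Mathlib

open CategoryTheory Bicategory
open scoped CategoryTheory.Pseudofunctor.StrongTrans CategoryTheory.Prod

set_option linter.unusedVariables false
set_option linter.checkUnivs false

universe w v u w₁ v₁ u₁ w₂ v₂ u₂ w₃ v₃ u₃ w₄ v₄ u₄ t

namespace SMTwo

/-- The product of a family of bicategories. -/
instance piBicategory {ι : Type t} (A : ι → Type u) [∀ i, Bicategory.{w, v} (A i)] :
    Bicategory.{max t w, max t v} (∀ i, A i) where
  Hom x y := ∀ i, x i ⟶ y i
  id x i := 𝟙 (x i)
  comp f g i := f i ≫ g i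
  homCategory x y :=
    { Hom := fun f g => ∀ i, f i ⟶ g i
      id := fun f i => 𝟙 (f i)
      comp := fun η θ i => η i ≫ θ i
      id_comp := fun _ => funext fun _ => Category.id_comp _
      comp_id := fun _ => funext fun _ => Category.comp_id _
      assoc := fun _ _ _ => funext fun _ => Category.assoc _ _ _ }
  whiskerLeft f _ _ η i := f i ◁ η i
  whiskerRight η h i := η i ▷ h i
  associator f g h :=
    { hom := fun i => (α_ (f i) (g i) (h i)).hom
      inv := fun i => (α_ (f i) (g i) (h i)).inv
      hom_inv_id := funext fun _ => Iso.hom_inv_id _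
      inv_hom_id := funext fun _ => Iso.inv_hom_id _ }
  leftUnitor f :=
    { hom := fun i => (λ_ (f i)).hom
      inv := fun i => (λ_ (f i)).inv
      hom_inv_id := funext fun _ => Iso.hom_inv_id _
      inv_hom_id := funext fun _ => Iso.inv_hom_id _ }
  rightUnitor f :=
    { hom := fun i => (ρ_ (f i)).hom
      inv := fun i => (ρ_ (f i)).inv
      hom_inv_id := funext fun _ => Iso.hom_inv_id _
      inv_hom_id := funext fun _ => Iso.inv_hom_id _ }
  whiskerLeft_id _ _ := funext fun _ => whiskerLeft_id _ _
  whiskerLeft_comp _ _ _ _ _ _ := funext fun _ => whiskerLeft_comp _ _ _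
  id_whiskerLeft _ := funext fun _ => id_whiskerLeft _
  comp_whiskerLeft _ _ _ _ _ := funext fun _ => comp_whiskerLeft _ _ _
  id_whiskerRight _ _ := funext fun _ => id_whiskerRight _ _
  comp_whiskerRight _ _ _ := funext fun _ => comp_whiskerRight _ _ _
  whiskerRight_id _ := funext fun _ => whiskerRight_id _
  whiskerRight_comp _ _ _ := funext fun _ => whiskerRight_comp _ _ _
  whisker_assoc _ _ _ _ _ := funext fun _ => whisker_assoc _ _ _
  whisker_exchange _ _ := funext fun _ => whisker_exchange _ _
  pentagon _ _ _ _ := funext fun _ => pentagon _ _ _ _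
  triangle _ _ := funext fun _ => triangle _ _

variable {B : Type u₁} [Bicategory.{w₁, v₁} B] {C : Type u₂} [Bicategory.{w₂, v₂} C]
  {D : Type u₃} [Bicategory.{w₃, v₃} D]  {E : Type u₄} [Bicategory.{w₄, v₄} E]

/-- The pseudofunctor `d ↦ (F d, G d)` into a product. -/
def pair (F : D ⥤ᵖ B) (G : D ⥤ᵖ C) : D ⥤ᵖ (B × C) where
  obj d := (F.obj d, G.obj d)
  map f := (F.map f, G.map f)
  map₂ η := (F.map₂ η, G.map₂ η)
  map₂_id _ := Prod.ext (F.map₂_id _) (G.map₂_id _)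
  map₂_comp _ _ := Prod.ext (F.map₂_comp _ _) (G.map₂_comp _ _)
  mapId a := Iso.prod (F.mapId a) (G.mapId a)
  mapComp f g := Iso.prod (F.mapComp f g) (G.mapComp f g)
  map₂_whisker_left _ _ _ _ := Prod.ext (F.map₂_whisker_left _ _) (G.map₂_whisker_left _ _)
  map₂_whisker_right _ _ := Prod.ext (F.map₂_whisker_right _ _) (G.map₂_whisker_right _ _)
  map₂_associator _ _ _ := Prod.ext (F.map₂_associator _ _ _) (G.map₂_associator _ _ _)
  map₂_left_unitor _ := Prod.ext (F.map₂_left_unitor _) (G.map₂_left_unitor _)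
  map₂_right_unitor _ := Prod.ext (F.map₂_right_unitor _) (G.map₂_right_unitor _)

/-- The first projection of a product. -/
def fstP (B : Type u₁) [Bicategory.{w₁, v₁} B] (C : Type u₂) [Bicategory.{w₂, v₂} C] :
    (B × C) ⥤ᵖ B where
  obj x := x.1
  map f := f.1
  map₂ η := η.1
  mapId _ := Iso.refl _
  mapComp _ _ := Iso.refl _
  map₂_id _ := rfl
  map₂_comp _ _ := rfl
  map₂_whisker_left f _ _ η := by
    change f.1 ◁ η.1 = 𝟙 _ ≫ (f.1 ◁ η.1) ≫ 𝟙 _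
    simp
  map₂_whisker_right η h := by
    change η.1 ▷ h.1 = 𝟙 _ ≫ (η.1 ▷ h.1) ≫ 𝟙 _
    simp
  map₂_associator f g h := by
    change (α_ f.1 g.1 h.1).hom = 𝟙 _ ≫ 𝟙 _ ▷ _ ≫ (α_ f.1 g.1 h.1).hom ≫ _ ◁ 𝟙 _ ≫ 𝟙 _
    simp
  map₂_left_unitor f := by
    change (λ_ f.1).hom = 𝟙 _ ≫ 𝟙 _ ▷ _ ≫ (λ_ f.1).hom
    simp
  map₂_right_unitor f := by
    change (ρ_ f.1).hom = 𝟙 _ ≫ _ ◁ 𝟙 _ ≫ (ρ_ f.1).hom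
    simp

/-- The second projection of a product. -/
def sndP (B : Type u₁) [Bicategory.{w₁, v₁} B] (C : Type u₂) [Bicategory.{w₂, v₂} C] :
    (B × C) ⥤ᵖ C where
  obj x := x.2
  map f := f.2
  map₂ η := η.2
  mapId _ := Iso.refl _
  mapComp _ _ := Iso.refl _
  map₂_id _ := rfl
  map₂_comp _ _ := rfl
  map₂_whisker_left f _ _ η := by
    change f.2 ◁ η.2 = 𝟙 _ ≫ (f.2 ◁ η.2) ≫ 𝟙 _
    simp
  map₂_whisker_right η h := by
    change η.2 ▷ h.2 = 𝟙 _ ≫ (η.2 ▷ h.2) ≫ 𝟙 _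
    simp
  map₂_associator f g h := by
    change (α_ f.2 g.2 h.2).hom = 𝟙 _ ≫ 𝟙 _ ▷ _ ≫ (α_ f.2 g.2 h.2).hom ≫ _ ◁ 𝟙 _ ≫ 𝟙 _
    simp
  map₂_left_unitor f := by
    change (λ_ f.2).hom = 𝟙 _ ≫ 𝟙 _ ▷ _ ≫ (λ_ f.2).hom
    simp
  map₂_right_unitor f := by
    change (ρ_ f.2).hom = 𝟙 _ ≫ _ ◁ 𝟙 _ ≫ (ρ_ f.2).hom
    simp

/-- The pseudofunctor into a product of a family with the given components. -/
def lift {ι : Type t} {A : ι → Type u} [∀ i, Bicategory.{w, v} (A i)] (F : ∀ i, D ⥤ᵖ A i) :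
    D ⥤ᵖ (∀ i, A i) where
  obj d i := (F i).obj d
  map f i := (F i).map f
  map₂ η i := (F i).map₂ η
  map₂_id _ := funext fun i => (F i).map₂_id _
  map₂_comp _ _ := funext fun i => (F i).map₂_comp _ _
  mapId a :=
    { hom := fun i => ((F i).mapId a).hom
      inv := fun i => ((F i).mapId a).inv
      hom_inv_id := funext fun _ => Iso.hom_inv_id _
      inv_hom_id := funext fun _ => Iso.inv_hom_id _ }
  mapComp f g :=
    { hom := fun i => ((F i).mapComp f g).hom
      inv := fun i => ((F i).mapComp f g).inv
      hom_inv_id := funext fun _ => Iso.hom_inv_id _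
      inv_hom_id := funext fun _ => Iso.inv_hom_id _ }
  map₂_whisker_left _ _ _ _ := funext fun i => (F i).map₂_whisker_left _ _
  map₂_whisker_right _ _ := funext fun i => (F i).map₂_whisker_right _ _
  map₂_associator _ _ _ := funext fun i => (F i).map₂_associator _ _ _
  map₂_left_unitor _ := funext fun i => (F i).map₂_left_unitor _
  map₂_right_unitor _ := funext fun i => (F i).map₂_right_unitor _

/-- The projections of a product of a family. -/
def proj {ι : Type t} (A : ι → Type u) [∀ i, Bicategory.{w, v} (A i)] (i : ι) :
    (∀ i, A i) ⥤ᵖ A i where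
  obj x := x i
  map f := f i
  map₂ η := η i
  mapId _ := Iso.refl _
  mapComp _ _ := Iso.refl _
  map₂_id _ := rfl
  map₂_comp _ _ := rfl
  map₂_whisker_left f _ _ η := by
    change f i ◁ η i = 𝟙 _ ≫ (f i ◁ η i) ≫ 𝟙 _
    simp
  map₂_whisker_right η h := by
    change η i ▷ h i = 𝟙 _ ≫ (η i ▷ h i) ≫ 𝟙 _
    simp
  map₂_associator f g h := by
    change (α_ (f i) (g i) (h i)).hom =
      𝟙 _ ≫ 𝟙 _ ▷ _ ≫ (α_ (f i) (g i) (h i)).hom ≫ _ ◁ 𝟙 _ ≫ 𝟙 _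
    simp
  map₂_left_unitor f := by
    change (λ_ (f i)).hom = 𝟙 _ ≫ 𝟙 _ ▷ _ ≫ (λ_ (f i)).hom
    simp
  map₂_right_unitor f := by
    change (ρ_ (f i)).hom = 𝟙 _ ≫ _ ◁ 𝟙 _ ≫ (ρ_ (f i)).hom
    simp

/-- The constant pseudofunctor at an object. -/
def const (D : Type u₃) [Bicategory.{w₃, v₃} D] (c : C) : D ⥤ᵖ C where
  obj _ := c
  map _ := 𝟙 c
  map₂ _ := 𝟙 _
  mapId _ := Iso.refl _
  mapComp _ _ := (λ_ (𝟙 c)).symm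
  map₂_id _ := rfl
  map₂_comp _ _ := (Category.id_comp _).symm
  map₂_whisker_left _ _ _ _ := by simp
  map₂_whisker_right _ _ := by simp
  map₂_associator _ _ _ := by simp
  map₂_left_unitor _ := by simp
  map₂_right_unitor _ := by simp


theorem pseudofunctor_ext {F G : B ⥤ᵖ C} (h : F.toPrelaxFunctor = G.toPrelaxFunctor)
    (h₀ : HEq F.mapId G.mapId) (h₂ : HEq (@Pseudofunctor.mapComp _ _ _ _ F)
      (@Pseudofunctor.mapComp _ _ _ _ G)) : F = G := by
  cases F
  cases G
  cases h
  cases h₀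
  cases h₂
  rfl

theorem pf_comp_id (F : B ⥤ᵖ C) : F.comp (Pseudofunctor.id C) = F := by
  refine pseudofunctor_ext rfl (heq_of_eq ?_) (heq_of_eq ?_)
  · funext a
    ext
    exact Category.comp_id _
  · funext a b c f g
    ext
    exact Category.comp_id _

theorem pf_id_comp (F : B ⥤ᵖ C) : (Pseudofunctor.id B).comp F = F := by
  refine pseudofunctor_ext rfl (heq_of_eq ?_) (heq_of_eq ?_)
  · funext a
    ext
    exact (congrArg (· ≫ _) (F.map₂_id _)).trans (Category.id_comp _)
  · funext a b c f g
    ext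
    exact (congrArg (· ≫ _) (F.map₂_id _)).trans (Category.id_comp _)

theorem pf_assoc (F : B ⥤ᵖ C) (G : C ⥤ᵖ D) (H : D ⥤ᵖ E) :
    (F.comp G).comp H = F.comp (G.comp H) := by
  refine pseudofunctor_ext rfl (heq_of_eq ?_) (heq_of_eq ?_)
  · funext a
    ext
    exact (congrArg (· ≫ _) (H.map₂_comp _ _)).trans (Category.assoc _ _ _)
  · funext a b c f g
    ext
    exact (congrArg (· ≫ _) (H.map₂_comp _ _)).trans (Category.assoc _ _ _)

theorem comp_pair (K : E ⥤ᵖ D) (F : D ⥤ᵖ B) (G : D ⥤ᵖ C) :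
    K.comp (pair F G) = pair (K.comp F) (K.comp G) := by
  refine pseudofunctor_ext rfl (heq_of_eq ?_) (heq_of_eq ?_)
  · funext a
    ext
    rfl
  · funext a b c f g
    ext
    rfl

theorem comp_lift {ι : Type t} {A : ι → Type u} [∀ i, Bicategory.{w, v} (A i)] (K : E ⥤ᵖ D)
    (F : ∀ i, D ⥤ᵖ A i) : K.comp (lift F) = lift fun i => K.comp (F i) := by
  refine pseudofunctor_ext rfl (heq_of_eq ?_) (heq_of_eq ?_)
  · funext a
    ext
    rfl
  · funext a b c f g
    ext
    rfl

theorem pair_fst (F : D ⥤ᵖ B) (G : D ⥤ᵖ C) : (pair F G).comp (fstP B C) = F := by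
  refine pseudofunctor_ext rfl (heq_of_eq ?_) (heq_of_eq ?_)
  · funext a
    ext
    exact Category.comp_id _
  · funext a b c f g
    ext
    exact Category.comp_id _

theorem pair_snd (F : D ⥤ᵖ B) (G : D ⥤ᵖ C) : (pair F G).comp (sndP B C) = G := by
  refine pseudofunctor_ext rfl (heq_of_eq ?_) (heq_of_eq ?_)
  · funext a
    ext
    exact Category.comp_id _
  · funext a b c f g
    ext
    exact Category.comp_id _

theorem lift_proj {ι : Type t} {A : ι → Type u} [∀ i, Bicategory.{w, v} (A i)]
    (F : ∀ i, D ⥤ᵖ A i) (i : ι) : (lift F).comp (proj A i) = F i := by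
  refine pseudofunctor_ext rfl (heq_of_eq ?_) (heq_of_eq ?_)
  · funext a
    ext
    exact Category.comp_id _
  · funext a b c f g
    ext
    exact Category.comp_id _

theorem pair_eta : pair (fstP B C) (sndP B C) = Pseudofunctor.id (B × C) := rfl

theorem lift_eta {ι : Type t} {A : ι → Type u} [∀ i, Bicategory.{w, v} (A i)] :
    lift (fun i => proj A i) = Pseudofunctor.id (∀ i, A i) := rfl

/-- The product of two pseudofunctors. -/
def prodMap (F : B ⥤ᵖ C) (G : D ⥤ᵖ E) : (B × D) ⥤ᵖ (C × E) :=
  pair ((fstP B D).comp F) ((sndP B D).comp G)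

/-- The power `F^ι` of a pseudofunctor. -/
def powMap (ι : Type t) (F : B ⥤ᵖ C) : (ι → B) ⥤ᵖ (ι → C) :=
  lift fun i => (proj (fun _ => B) i).comp F

/-- A pseudofunctor is a *2-functor* if its unit and composition constraints are identities. -/
def IsTwoFunctor (F : B ⥤ᵖ C) : Prop :=
  (∀ a : B, ∃ h : F.map (𝟙 a) = 𝟙 (F.obj a), F.mapId a = eqToIso h) ∧
  ∀ {a b c : B} (f : a ⟶ b) (g : b ⟶ c), ∃ h : F.map (f ≫ g) = F.map f ≫ F.map g,
    F.mapComp f g = eqToIso h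

theorem isTwoFunctor_id : IsTwoFunctor (Pseudofunctor.id B) :=
  ⟨fun _ => ⟨rfl, rfl⟩, fun _ _ => ⟨rfl, rfl⟩⟩

theorem IsTwoFunctor.comp {F : B ⥤ᵖ C} {G : C ⥤ᵖ D} (hF : IsTwoFunctor F)
    (hG : IsTwoFunctor G) : IsTwoFunctor (F.comp G) := by
  have key : ∀ {a b : C} {f g : a ⟶ b} (h : f = g),
      G.map₂Iso (eqToIso h) = eqToIso (congrArg G.map h) := by
    intro a b f g h
    subst h
    ext
    exact G.map₂_id _
  refine ⟨fun a => ?_, fun f g => ?_⟩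
  · obtain ⟨h, e⟩ := hF.1 a
    obtain ⟨h', e'⟩ := hG.1 (F.obj a)
    refine ⟨(congrArg G.map h).trans h', ?_⟩
    change G.map₂Iso (F.mapId a) ≪≫ G.mapId (F.obj a) = _
    rw [e, e', key, eqToIso_trans]
    rfl
  · obtain ⟨h, e⟩ := hF.2 f g
    obtain ⟨h', e'⟩ := hG.2 (F.map f) (F.map g)
    refine ⟨(congrArg G.map h).trans h', ?_⟩
    change G.map₂Iso (F.mapComp f g) ≪≫ G.mapComp (F.map f) (F.map g) = _
    rw [e, e', key, eqToIso_trans]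
    rfl

/-- A pseudofunctor is a *biequivalence* if it has an inverse up to pseudonatural
(adjoint) equivalence. -/
def IsBiequivalence (F : B ⥤ᵖ C) : Prop :=
  ∃ G : C ⥤ᵖ B, Nonempty (Bicategory.Equivalence (F.comp G) (Pseudofunctor.id B)) ∧
    Nonempty (Bicategory.Equivalence (G.comp F) (Pseudofunctor.id C))

/-- The terminal 2-category. -/
abbrev Terminal : Type := LocallyDiscrete (Discrete PUnit.{1})

/-- A 2-category is *bicategorically contractible* if the unique 2-functor to the terminal
2-category is a biequivalence. -/
def IsContractible (B : Type u₁) [Bicategory.{w₁, v₁} B] : Prop :=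
  IsBiequivalence (const B (⟨⟨PUnit.unit⟩⟩ : Terminal))

/-! ### Operads in 2-categories and their algebras -/

/-- The lexicographic bijection between the positions `(i, j)` in consecutive blocks of lengths
`k 0, k 1, …` and the positions in the concatenation. -/
def blocks {n m : ℕ} (k : Fin n → ℕ) (h : ∑ i, k i = m) : ((i : Fin n) × Fin (k i)) ≃ Fin m :=
  finSigmaFinEquiv.trans (finCongr h)

/-- The permutation which moves the blocks of an arrangement according to `σ`; the `i`-th block,
of length `k (σ i)`, is moved to place `σ i`. -/
def blockPerm {n m : ℕ} (σ : Equiv.Perm (Fin n)) (k : Fin n → ℕ) (h : ∑ i, k i = m)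
    (h' : ∑ i, k (σ i) = m) : Equiv.Perm (Fin m) :=
  (blocks (fun i => k (σ i)) h').symm.trans
    ((Equiv.sigmaCongrLeft (β := fun i => Fin (k i)) σ).trans (blocks k h))

/-- The block sum of permutations. -/
def sumPerm {n m : ℕ} (k : Fin n → ℕ) (h : ∑ i, k i = m) (τ : ∀ i, Equiv.Perm (Fin (k i))) :
    Equiv.Perm (Fin m) :=
  (blocks k h).symm.trans ((Equiv.sigmaCongrRight τ).trans (blocks k h))

/-- A (symmetric) operad in the category of 2-categories and 2-functors, with cartesian product.
The structure map `P n × ∏ i, P (k i) → P (∑ i, k i)` is recorded with target `P m` for each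
`m` equal to `∑ i, k i`. -/
structure Operad where
  /-- the 2-category of `n`-ary operations -/
  obj : ℕ → Type u
  [bicategory : ∀ n, Bicategory.{w, v} (obj n)]
  [strict : ∀ n, Bicategory.Strict (obj n)]
  /-- the operadic unit -/
  one : obj 1
  /-- the operadic composition -/
  gam {n : ℕ} (k : Fin n → ℕ) {m : ℕ} (h : ∑ i, k i = m) :
    (obj n × (∀ i, obj (k i))) ⥤ᵖ obj m
  gam_strict {n : ℕ} (k : Fin n → ℕ) {m : ℕ} (h : ∑ i, k i = m) : IsTwoFunctor (gam k h)
  /-- the right action of the symmetric groups -/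
  act {n : ℕ} (σ : Equiv.Perm (Fin n)) : obj n ⥤ᵖ obj n
  act_strict {n : ℕ} (σ : Equiv.Perm (Fin n)) : IsTwoFunctor (act σ)
  act_one (n : ℕ) : act (1 : Equiv.Perm (Fin n)) = Pseudofunctor.id (obj n)
  act_mul {n : ℕ} (σ τ : Equiv.Perm (Fin n)) : act (σ * τ) = (act σ).comp (act τ)
  /-- `γ(𝟙; p) = p` -/
  one_gam {n : ℕ} (h : ∑ _i : Fin 1, n = n) :
    (pair (const (obj n) one) (lift fun _ : Fin 1 => Pseudofunctor.id (obj n))).comp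
      (gam (fun _ => n) h) = Pseudofunctor.id (obj n)
  /-- `γ(p; 𝟙, …, 𝟙) = p` -/
  gam_one {n : ℕ} (h : ∑ _i : Fin n, 1 = n) :
    (pair (Pseudofunctor.id (obj n)) (lift fun _ : Fin n => const (obj n) one)).comp
      (gam (fun _ => 1) h) = Pseudofunctor.id (obj n)
  /-- `γ(γ(p; q₁, …); r₁₁, …) = γ(p; γ(q₁; r₁₁, …), …)` -/
  gam_assoc {n : ℕ} (k : Fin n → ℕ) {m : ℕ} (h : ∑ i, k i = m) (l : ∀ i, Fin (k i) → ℕ)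
    (s : Fin n → ℕ) (hs : ∀ i, ∑ j, l i j = s i) {N : ℕ} (hN : ∑ i, s i = N)
    (hN' : ∑ a : Fin m, l ((blocks k h).symm a).1 ((blocks k h).symm a).2 = N) :
    (pair
      ((fstP (obj n × (∀ i, obj (k i))) (∀ i, ∀ j, obj (l i j))).comp (gam k h))
      (lift fun a : Fin m => (sndP (obj n × (∀ i, obj (k i))) (∀ i, ∀ j, obj (l i j))).comp
        ((proj (fun i => ∀ j, obj (l i j)) ((blocks k h).symm a).1).comp
          (proj (fun j => obj (l ((blocks k h).symm a).1 j)) ((blocks k h).symm a).2)))).comp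
      (gam (fun a : Fin m => l ((blocks k h).symm a).1 ((blocks k h).symm a).2) hN') =
    (pair
      ((fstP (obj n × (∀ i, obj (k i))) (∀ i, ∀ j, obj (l i j))).comp (fstP _ _))
      (lift fun i : Fin n =>
        (pair
          ((fstP (obj n × (∀ i, obj (k i))) (∀ i, ∀ j, obj (l i j))).comp
            ((sndP _ _).comp (proj (fun i => obj (k i)) i)))
          ((sndP (obj n × (∀ i, obj (k i))) (∀ i, ∀ j, obj (l i j))).comp
            (proj (fun i => ∀ j, obj (l i j)) i))).comp (gam (l i) (hs i)))).comp
      (gam s hN)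
  /-- `γ(p · σ; q_{σ 1}, …, q_{σ n}) = γ(p; q₁, …, qₙ) · σ⟨k⟩` -/
  gam_act {n : ℕ} (σ : Equiv.Perm (Fin n)) (k : Fin n → ℕ) {m : ℕ} (h : ∑ i, k i = m)
    (h' : ∑ i, k (σ i) = m) :
    (pair ((fstP (obj n) (∀ i, obj (k i))).comp (act σ))
      (lift fun i => (sndP (obj n) (∀ i, obj (k i))).comp
        (proj (fun i => obj (k i)) (σ i)))).comp (gam (fun i => k (σ i)) h') =
    (gam k h).comp (act (blockPerm σ k h h'))
  /-- `γ(p; q₁ · τ₁, …, qₙ · τₙ) = γ(p; q₁, …, qₙ) · (τ₁ ⊕ ⋯ ⊕ τₙ)` -/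
  act_gam {n : ℕ} (k : Fin n → ℕ) {m : ℕ} (h : ∑ i, k i = m)
    (τ : ∀ i, Equiv.Perm (Fin (k i))) :
    (pair (fstP (obj n) (∀ i, obj (k i)))
      (lift fun i => (sndP (obj n) (∀ i, obj (k i))).comp
        ((proj (fun i => obj (k i)) i).comp (act (τ i))))).comp (gam k h) =
    (gam k h).comp (act (sumPerm k h τ))

attribute [instance] Operad.bicategory Operad.strict

/-- An algebra over `P` in the category of 2-categories and pseudofunctors, with cartesian
product. -/
structure PAlg (P : Operad.{w, v, u}) where
  /-- the underlying 2-category -/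
  carrier : Type u₁
  [bicategory : Bicategory.{w₁, v₁} carrier]
  [strict : Bicategory.Strict carrier]
  /-- the action of `P` -/
  mu (n : ℕ) : (P.obj n × (Fin n → carrier)) ⥤ᵖ carrier
  /-- `μ(𝟙; x) = x` -/
  mu_one : (pair (const carrier P.one)
    (lift fun _ : Fin 1 => Pseudofunctor.id carrier)).comp (mu 1) = Pseudofunctor.id carrier
  /-- `μ(γ(p; q₁, …, qₙ); x) = μ(p; μ(q₁; x₁), …, μ(qₙ; xₙ))` with `xᵢ` the `i`-th block
  of `x` -/
  mu_gam {n : ℕ} (k : Fin n → ℕ) {m : ℕ} (h : ∑ i, k i = m) :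
    (pair ((fstP (P.obj n × (∀ i, P.obj (k i))) (Fin m → carrier)).comp (P.gam k h))
      (sndP (P.obj n × (∀ i, P.obj (k i))) (Fin m → carrier))).comp (mu m) =
    (pair ((fstP (P.obj n × (∀ i, P.obj (k i))) (Fin m → carrier)).comp (fstP _ _))
      (lift fun i : Fin n =>
        (pair
          ((fstP (P.obj n × (∀ i, P.obj (k i))) (Fin m → carrier)).comp
            ((sndP _ _).comp (proj (fun i => P.obj (k i)) i)))
          ((sndP (P.obj n × (∀ i, P.obj (k i))) (Fin m → carrier)).comp
            (lift fun j : Fin (k i) => proj (fun _ => carrier) (blocks k h ⟨i, j⟩)))).comp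
          (mu (k i)))).comp (mu n)
  /-- `μ(p · σ; x) = μ(p; σ · x)` with `(σ · x)_i = x_{σ⁻¹ i}` -/
  mu_act {n : ℕ} (σ : Equiv.Perm (Fin n)) :
    (prodMap (P.act σ) (Pseudofunctor.id (Fin n → carrier))).comp (mu n) =
    (prodMap (Pseudofunctor.id (P.obj n))
      (lift fun i => proj (fun _ : Fin n => carrier) (σ⁻¹ i))).comp (mu n)

attribute [instance] PAlg.bicategory PAlg.strict

/-- A morphism of `P`-algebras in 2-categories and pseudofunctors: a pseudofunctor commuting with
the action. -/
@[ext]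
structure PAlg.Hom {P : Operad.{w, v, u}} (X Y : PAlg.{w, v, u, w₁, v₁, u₁} P) where
  /-- the underlying pseudofunctor -/
  toPF : X.carrier ⥤ᵖ Y.carrier
  comm (n : ℕ) : (X.mu n).comp toPF =
    (prodMap (Pseudofunctor.id (P.obj n)) (powMap (Fin n) toPF)).comp (Y.mu n)

theorem prodMap_comp_powMap {A : Type u} [Bicategory.{w, v} A] (ι : Type t) (F : B ⥤ᵖ C)
    (G : C ⥤ᵖ D) :
    (prodMap (Pseudofunctor.id A) (powMap ι F)).comp
      (prodMap (Pseudofunctor.id A) (powMap ι G)) =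
    prodMap (Pseudofunctor.id A) (powMap ι (F.comp G)) := by
  simp only [prodMap, powMap, comp_pair, pf_comp_id, pair_fst, comp_lift, ← pf_assoc,
    pair_snd]
  congr 2
  funext i
  rw [lift_proj]

theorem prodMap_id_powMap {A : Type u} [Bicategory.{w, v} A] (ι : Type t) :
    prodMap (Pseudofunctor.id A) (powMap ι (Pseudofunctor.id B)) = Pseudofunctor.id _ := by
  simp only [prodMap, powMap, pf_comp_id, lift_eta, pair_eta]

instance {P : Operad.{w, v, u}} : Category (PAlg.{w, v, u, w₁, v₁, u₁} P) where
  Hom := PAlg.Hom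
  id X := ⟨Pseudofunctor.id _, fun n => by rw [prodMap_id_powMap, pf_comp_id, pf_id_comp]⟩
  comp F G := ⟨F.toPF.comp G.toPF, fun n => by
    rw [← pf_assoc, F.comm, pf_assoc, G.comm, ← pf_assoc, prodMap_comp_powMap]⟩
  id_comp F := PAlg.Hom.ext (pf_id_comp _)
  comp_id F := PAlg.Hom.ext (pf_comp_id _)
  assoc F G H := PAlg.Hom.ext (pf_assoc _ _ _)

/-- A (strict) 2-category. -/
structure TwoCatPs where
  /-- the underlying type of objects -/
  carrier : Type u
  [bicategory : Bicategory.{w, v} carrier]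
  [strict : Bicategory.Strict carrier]

attribute [instance] TwoCatPs.bicategory TwoCatPs.strict

/-- The category of 2-categories and pseudofunctors. -/
instance : Category TwoCatPs.{w, v, u} where
  Hom X Y := X.carrier ⥤ᵖ Y.carrier
  id X := Pseudofunctor.id X.carrier
  comp F G := F.comp G
  id_comp := pf_id_comp
  comp_id := pf_comp_id
  assoc := pf_assoc

/-- The underlying 2-category of a `P`-algebra. -/
def PAlg.forget (P : Operad.{w, v, u}) : PAlg.{w, v, u, w₁, v₁, u₁} P ⥤ TwoCatPs.{w₁, v₁, u₁} where
  obj X := ⟨X.carrier⟩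
  map F := F.toPF

/-- The morphisms of `P`-algebras whose underlying pseudofunctor is a 2-functor. -/
def PAlg.twoFunctors (P : Operad.{w, v, u}) :
    MorphismProperty (PAlg.{w, v, u, w₁, v₁, u₁} P) :=
  fun _ _ F => IsTwoFunctor F.toPF

instance (P : Operad.{w, v, u}) : (PAlg.twoFunctors.{w, v, u, w₁, v₁, u₁} P).IsMultiplicative where
  id_mem _ := isTwoFunctor_id
  comp_mem _ _ := IsTwoFunctor.comp

/-- The category of `P`-algebras in 2-categories and pseudofunctors, and 2-functors commuting
with the action. -/
abbrev PTwoCat (P : Operad.{w, v, u}) := WideSubcategory (PAlg.twoFunctors.{w, v, u, w₁, v₁, u₁} P)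


/-! ### Symmetric monoidal structures on bicategories -/

/-- The tensor product, equivalences and braiding of a symmetric monoidal bicategory, before the
invertible modifications and the axioms. -/
structure MonCells (B : Type u) [Bicategory.{w, v} B] where
  /-- the tensor product `x, y ↦ xy` -/
  tensor : (B × B) ⥤ᵖ B
  /-- the unit object -/
  e : B
  /-- the associativity equivalence `(xy)z ≃ x(yz)` -/
  assoc : Bicategory.Equivalence
    ((pair ((pair (fstP B (B × B)) ((sndP B (B × B)).comp (fstP B B))).comp tensor)
      ((sndP B (B × B)).comp (sndP B B))).comp tensor)
    ((pair (fstP B (B × B)) ((pair ((sndP B (B × B)).comp (fstP B B))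
      ((sndP B (B × B)).comp (sndP B B))).comp tensor)).comp tensor)
  /-- the left unit equivalence `ex ≃ x` -/
  left : Bicategory.Equivalence ((pair (const B e) (Pseudofunctor.id B)).comp tensor)
    (Pseudofunctor.id B)
  /-- the right unit equivalence `x ≃ xe` -/
  right : Bicategory.Equivalence (Pseudofunctor.id B)
    ((pair (Pseudofunctor.id B) (const B e)).comp tensor)
  /-- the braiding equivalence `xy ≃ yx` -/
  braid : Bicategory.Equivalence ((pair (fstP B B) (sndP B B)).comp tensor)
    ((pair (sndP B B) (fstP B B)).comp tensor)

/-- A square in a bicategory with vertical sides `p`, `q`, filled by an invertible 2-cell. -/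
abbrev Sq {a b a' b' : B} (u : a ⟶ a') (v : b ⟶ b') (p : a ⟶ b) (q : a' ⟶ b') :=
  u ≫ q ≅ p ≫ v

/-- Pasting of squares along a common side. -/
def Sq.comp {a b c a' b' c' : B} {u : a ⟶ a'} {v : b ⟶ b'} {w : c ⟶ c'} {p : a ⟶ b}
    {q : a' ⟶ b'} {p' : b ⟶ c} {q' : b' ⟶ c'} (s : Sq u v p q) (t : Sq v w p' q') :
    Sq u w (p ≫ p') (q ≫ q') :=
  (α_ _ _ _).symm ≪≫ whiskerRightIso s q' ≪≫ α_ _ _ _ ≪≫ whiskerLeftIso p t ≪≫ (α_ _ _ _).symm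

/-- The identity square. -/
def Sq.id {a a' : B} (u : a ⟶ a') : Sq u u (𝟙 a) (𝟙 a') :=
  ρ_ u ≪≫ (λ_ u).symm

namespace MonCells

variable (M : MonCells B) {x x' x'' y y' z z' w w' : B}

/-- `xy` -/
def o (x y : B) : B := M.tensor.obj (x, y)

/-- `fg` -/
def m (f : x ⟶ x') (g : y ⟶ y') : M.o x y ⟶ M.o x' y' := M.tensor.map (f ×ₘ g)

/-- `fg` on invertible 2-cells -/
def mIso {f f' : x ⟶ x'} {g g' : y ⟶ y'} (η : f ≅ f') (θ : g ≅ g') : M.m f g ≅ M.m f' g' :=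
  M.tensor.map₂Iso (Iso.prod η θ)

/-- `(f ≫ f')(g ≫ g') ≅ fg ≫ f'g'` -/
def mComp {x₁ x₂ x₃ y₁ y₂ y₃ : B} (f : x₁ ⟶ x₂) (f' : x₂ ⟶ x₃) (g : y₁ ⟶ y₂) (g' : y₂ ⟶ y₃) :
    M.m (f ≫ f') (g ≫ g') ≅ M.m f g ≫ M.m f' g' :=
  M.tensor.mapComp (f ×ₘ g) (f' ×ₘ g')

/-- `𝟙𝟙 ≅ 𝟙` -/
def mId (x y : B) : M.m (𝟙 x) (𝟙 y) ≅ 𝟙 (M.o x y) := M.tensor.mapId (x, y)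

/-- `α : (xy)z ⟶ x(yz)` -/
def a (x y z : B) : M.o (M.o x y) z ⟶ M.o x (M.o y z) := M.assoc.hom.app (x, y, z)

/-- the chosen inverse `α• : x(yz) ⟶ (xy)z` -/
def ai (x y z : B) : M.o x (M.o y z) ⟶ M.o (M.o x y) z := M.assoc.inv.app (x, y, z)

/-- `l : ex ⟶ x` -/
def l (x : B) : M.o M.e x ⟶ x := M.left.hom.app x

/-- `l•` -/
def li (x : B) : x ⟶ M.o M.e x := M.left.inv.app x

/-- `r : x ⟶ xe` -/
def r (x : B) : x ⟶ M.o x M.e := M.right.hom.app x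

/-- `r•` -/
def ri (x : B) : M.o x M.e ⟶ x := M.right.inv.app x

/-- `β : xy ⟶ yx` -/
def b (x y : B) : M.o x y ⟶ M.o y x := M.braid.hom.app (x, y)

/-- `β•` -/
def bi (x y : B) : M.o y x ⟶ M.o x y := M.braid.inv.app (x, y)

/-! The pseudonaturality squares. -/

def aSq (f : x ⟶ x') (g : y ⟶ y') (h : z ⟶ z') :
    Sq (M.m (M.m f g) h) (M.m f (M.m g h)) (M.a x y z) (M.a x' y' z') :=
  M.assoc.hom.naturality (f ×ₘ (g ×ₘ h))

def aiSq (f : x ⟶ x') (g : y ⟶ y') (h : z ⟶ z') :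
    Sq (M.m f (M.m g h)) (M.m (M.m f g) h) (M.ai x y z) (M.ai x' y' z') :=
  M.assoc.inv.naturality (f ×ₘ (g ×ₘ h))

def lSq (f : x ⟶ x') : Sq (M.m (𝟙 M.e) f) f (M.l x) (M.l x') := M.left.hom.naturality f

def liSq (f : x ⟶ x') : Sq f (M.m (𝟙 M.e) f) (M.li x) (M.li x') := M.left.inv.naturality f

def rSq (f : x ⟶ x') : Sq f (M.m f (𝟙 M.e)) (M.r x) (M.r x') := M.right.hom.naturality f

def riSq (f : x ⟶ x') : Sq (M.m f (𝟙 M.e)) f (M.ri x) (M.ri x') := M.right.inv.naturality f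

def bSq (f : x ⟶ x') (g : y ⟶ y') : Sq (M.m f g) (M.m g f) (M.b x y) (M.b x' y') :=
  M.braid.hom.naturality (f ×ₘ g)

def biSq (f : x ⟶ x') (g : y ⟶ y') : Sq (M.m g f) (M.m f g) (M.bi x y) (M.bi x' y') :=
  M.braid.inv.naturality (f ×ₘ g)

/-! The units and counits of the adjoint equivalences. -/

def aUnit (x y z : B) : 𝟙 (M.o (M.o x y) z) ≅ M.a x y z ≫ M.ai x y z where
  hom := M.assoc.unit.hom.as.app (x, y, z)
  inv := M.assoc.unit.inv.as.app (x, y, z)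
  hom_inv_id := congrArg (fun t => t.as.app (x, y, z)) M.assoc.unit.hom_inv_id
  inv_hom_id := congrArg (fun t => t.as.app (x, y, z)) M.assoc.unit.inv_hom_id

def aCounit (x y z : B) : M.ai x y z ≫ M.a x y z ≅ 𝟙 (M.o x (M.o y z)) where
  hom := M.assoc.counit.hom.as.app (x, y, z)
  inv := M.assoc.counit.inv.as.app (x, y, z)
  hom_inv_id := congrArg (fun t => t.as.app (x, y, z)) M.assoc.counit.hom_inv_id
  inv_hom_id := congrArg (fun t => t.as.app (x, y, z)) M.assoc.counit.inv_hom_id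

def lUnit (x : B) : 𝟙 (M.o M.e x) ⟶ M.l x ≫ M.li x := M.left.unit.hom.as.app x

def lCounit (x : B) : M.li x ≫ M.l x ⟶ 𝟙 x := M.left.counit.hom.as.app x

def rUnit (x : B) : 𝟙 x ⟶ M.r x ≫ M.ri x := M.right.unit.hom.as.app x

def rCounit (x : B) : M.ri x ≫ M.r x ⟶ 𝟙 (M.o x M.e) := M.right.counit.hom.as.app x

def bUnit (x y : B) : 𝟙 (M.o x y) ⟶ M.b x y ≫ M.bi x y := M.braid.unit.hom.as.app (x, y)

def bCounit (x y : B) : M.bi x y ≫ M.b x y ⟶ 𝟙 (M.o y x) := M.braid.counit.hom.as.app (x, y)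

/-- The tensor product of squares. -/
def mSq {a b a' b' c d c' d' : B} {u : a ⟶ a'} {v : b ⟶ b'} {p : a ⟶ b} {q : a' ⟶ b'}
    {s : c ⟶ c'} {t : d ⟶ d'} {p' : c ⟶ d} {q' : c' ⟶ d'} (α : Sq u v p q) (β : Sq s t p' q') :
    Sq (M.m u s) (M.m v t) (M.m p p') (M.m q q') :=
  (M.mComp u q s q').symm ≪≫ M.mIso α β ≪≫ M.mComp p v p' t

/-! Whiskering by an object on the left and on the right: `xf` and `fy`. -/

/-- `xf` -/
abbrev lw (x : B) (f : y ⟶ y') : M.o x y ⟶ M.o x y' := M.m (𝟙 x) f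

/-- `fy` -/
abbrev rw (f : x ⟶ x') (y : B) : M.o x y ⟶ M.o x' y := M.m f (𝟙 y)

variable {a₀ a₁ a₂ a₃ a₄ a₅ : B}

def lwC (x : B) (f : a₀ ⟶ a₁) (g : a₁ ⟶ a₂) : M.lw x (f ≫ g) ≅ M.lw x f ≫ M.lw x g :=
  M.mIso (λ_ (𝟙 x)).symm (Iso.refl _) ≪≫ M.mComp (𝟙 x) (𝟙 x) f g

def rwC (f : a₀ ⟶ a₁) (g : a₁ ⟶ a₂) (y : B) : M.rw (f ≫ g) y ≅ M.rw f y ≫ M.rw g y :=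
  M.mIso (Iso.refl _) (λ_ (𝟙 y)).symm ≪≫ M.mComp f g (𝟙 y) (𝟙 y)

def lwC₃ (x : B) (f : a₀ ⟶ a₁) (g : a₁ ⟶ a₂) (h : a₂ ⟶ a₃) :
    M.lw x (f ≫ g ≫ h) ≅ M.lw x f ≫ M.lw x g ≫ M.lw x h :=
  M.lwC x f (g ≫ h) ≪≫ whiskerLeftIso _ (M.lwC x g h)

def rwC₃ (f : a₀ ⟶ a₁) (g : a₁ ⟶ a₂) (h : a₂ ⟶ a₃) (y : B) :
    M.rw (f ≫ g ≫ h) y ≅ M.rw f y ≫ M.rw g y ≫ M.rw h y :=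
  M.rwC f (g ≫ h) y ≪≫ whiskerLeftIso _ (M.rwC g h y)

def lwC₅ (x : B) (f : a₀ ⟶ a₁) (g : a₁ ⟶ a₂) (h : a₂ ⟶ a₃) (i : a₃ ⟶ a₄) (j : a₄ ⟶ a₅) :
    M.lw x (f ≫ g ≫ h ≫ i ≫ j) ≅
      M.lw x f ≫ M.lw x g ≫ M.lw x h ≫ M.lw x i ≫ M.lw x j :=
  M.lwC x f (g ≫ h ≫ i ≫ j) ≪≫ whiskerLeftIso _ (M.lwC x g (h ≫ i ≫ j) ≪≫
    whiskerLeftIso _ (M.lwC₃ x h i j))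

def rwC₅ (f : a₀ ⟶ a₁) (g : a₁ ⟶ a₂) (h : a₂ ⟶ a₃) (i : a₃ ⟶ a₄) (j : a₄ ⟶ a₅) (y : B) :
    M.rw (f ≫ g ≫ h ≫ i ≫ j) y ≅
      M.rw f y ≫ M.rw g y ≫ M.rw h y ≫ M.rw i y ≫ M.rw j y :=
  M.rwC f (g ≫ h ≫ i ≫ j) y ≪≫ whiskerLeftIso _ (M.rwC g (h ≫ i ≫ j) y ≪≫
    whiskerLeftIso _ (M.rwC₃ h i j y))

/-- The interchange isomorphism `fy ≫ x'g ≅ xg ≫ fy'`. -/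
def interchange (f : x ⟶ x') (g : y ⟶ y') :
    M.rw f y ≫ M.lw x' g ≅ M.lw x g ≫ M.rw f y' :=
  (M.mComp f (𝟙 x') (𝟙 y) g).symm ≪≫
    M.mIso (ρ_ f ≪≫ (λ_ f).symm) (λ_ g ≪≫ (ρ_ g).symm) ≪≫ M.mComp (𝟙 x) f g (𝟙 y')

/-! The pseudonaturality in one variable. -/

def aNat₁ (f : x ⟶ x') (y z : B) :
    M.rw (M.rw f y) z ≫ M.a x' y z ≅ M.a x y z ≫ M.rw f (M.o y z) :=
  M.aSq f (𝟙 y) (𝟙 z) ≪≫ whiskerLeftIso _ (M.mIso (Iso.refl f) (M.mId y z))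

def aNat₂ (x : B) (g : y ⟶ y') (z : B) :
    M.rw (M.lw x g) z ≫ M.a x y' z ≅ M.a x y z ≫ M.lw x (M.rw g z) :=
  M.aSq (𝟙 x) g (𝟙 z)

def aNat₃ (x y : B) (h : z ⟶ z') :
    M.lw (M.o x y) h ≫ M.a x y z' ≅ M.a x y z ≫ M.lw x (M.lw y h) :=
  whiskerRightIso (M.mIso (M.mId x y).symm (Iso.refl h)) _ ≪≫ M.aSq (𝟙 x) (𝟙 y) h

def aiNat₁ (f : x ⟶ x') (y z : B) :
    M.rw f (M.o y z) ≫ M.ai x' y z ≅ M.ai x y z ≫ M.rw (M.rw f y) z :=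
  whiskerRightIso (M.mIso (Iso.refl f) (M.mId y z).symm) _ ≪≫ M.aiSq f (𝟙 y) (𝟙 z)

def aiNat₂ (x : B) (g : y ⟶ y') (z : B) :
    M.lw x (M.rw g z) ≫ M.ai x y' z ≅ M.ai x y z ≫ M.rw (M.lw x g) z :=
  M.aiSq (𝟙 x) g (𝟙 z)

def aiNat₃ (x y : B) (h : z ⟶ z') :
    M.lw x (M.lw y h) ≫ M.ai x y z' ≅ M.ai x y z ≫ M.lw (M.o x y) h :=
  M.aiSq (𝟙 x) (𝟙 y) h ≪≫ whiskerLeftIso _ (M.mIso (M.mId x y) (Iso.refl h))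

def bNat₁ (f : x ⟶ x') (y : B) : M.rw f y ≫ M.b x' y ≅ M.b x y ≫ M.lw y f :=
  M.bSq f (𝟙 y)

def bNat₂ (x : B) (g : y ⟶ y') : M.lw x g ≫ M.b x y' ≅ M.b x y ≫ M.rw g x :=
  M.bSq (𝟙 x) g

/-! The equivalences obtained from `α` by whiskering with an object. -/

def lwUnit (w x y z : B) : 𝟙 (M.o w (M.o (M.o x y) z)) ≅
    M.lw w (M.a x y z) ≫ M.lw w (M.ai x y z) :=
  (M.mId _ _).symm ≪≫ M.mIso (Iso.refl _) (M.aUnit x y z) ≪≫ M.lwC w _ _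

def lwCounit (w x y z : B) : M.lw w (M.ai x y z) ≫ M.lw w (M.a x y z) ≅
    𝟙 (M.o w (M.o x (M.o y z))) :=
  (M.lwC w _ _).symm ≪≫ M.mIso (Iso.refl _) (M.aCounit x y z) ≪≫ M.mId _ _

def rwCounit (x y z w : B) : M.rw (M.ai x y z) w ≫ M.rw (M.a x y z) w ≅
    𝟙 (M.o (M.o x (M.o y z)) w) :=
  (M.rwC _ _ w).symm ≪≫ M.mIso (M.aCounit x y z) (Iso.refl _) ≪≫ M.mId _ _

end MonCells

/-- The data of a symmetric monoidal bicategory. -/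
structure SymMonData (B : Type u) [Bicategory.{w, v} B] extends MonCells B where
  pi (x y z w : B) :
    toMonCells.rw (toMonCells.a x y z) w ≫ toMonCells.a x (toMonCells.o y z) w ≫
      toMonCells.lw x (toMonCells.a y z w) ≅
    toMonCells.a (toMonCells.o x y) z w ≫ toMonCells.a x y (toMonCells.o z w)
  pi_natural {x y z w x' y' z' w' : B} (f : x ⟶ x') (g : y ⟶ y') (h : z ⟶ z') (k : w ⟶ w') :
    toMonCells.m (toMonCells.m (toMonCells.m f g) h) k ◁ (pi x' y' z' w').hom ≫
      (Sq.comp (toMonCells.aSq (toMonCells.m f g) h k)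
        (toMonCells.aSq f g (toMonCells.m h k))).hom =
    (Sq.comp (toMonCells.mSq (toMonCells.aSq f g h) (Sq.id k))
      (Sq.comp (toMonCells.aSq f (toMonCells.m g h) k)
        (toMonCells.mSq (Sq.id f) (toMonCells.aSq g h k)))).hom ≫
      (pi x y z w).hom ▷ toMonCells.m f (toMonCells.m g (toMonCells.m h k))
  mu (x y : B) :
    toMonCells.rw (toMonCells.r x) y ≫ toMonCells.a x toMonCells.e y ≫
      toMonCells.lw x (toMonCells.l y) ≅ 𝟙 (toMonCells.o x y)
  mu_natural {x y x' y' : B} (f : x ⟶ x') (g : y ⟶ y') :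
    toMonCells.m f g ◁ (mu x' y').hom ≫ (Sq.id (toMonCells.m f g)).hom =
    (Sq.comp (toMonCells.mSq (toMonCells.rSq f) (Sq.id g))
      (Sq.comp (toMonCells.aSq f (𝟙 toMonCells.e) g)
        (toMonCells.mSq (Sq.id f) (toMonCells.lSq g)))).hom ≫
      (mu x y).hom ▷ toMonCells.m f g
  lam (x y : B) :
    toMonCells.rw (toMonCells.l x) y ≅
      toMonCells.a toMonCells.e x y ≫ toMonCells.l (toMonCells.o x y)
  lam_natural {x y x' y' : B} (f : x ⟶ x') (g : y ⟶ y') :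
    toMonCells.m (toMonCells.m (𝟙 toMonCells.e) f) g ◁ (lam x' y').hom ≫
      (Sq.comp (toMonCells.aSq (𝟙 toMonCells.e) f g) (toMonCells.lSq (toMonCells.m f g))).hom =
    (toMonCells.mSq (toMonCells.lSq f) (Sq.id g)).hom ≫ (lam x y).hom ▷ toMonCells.m f g
  rho (x y : B) :
    toMonCells.lw x (toMonCells.r y) ≅
      toMonCells.r (toMonCells.o x y) ≫ toMonCells.a x y toMonCells.e
  rho_natural {x y x' y' : B} (f : x ⟶ x') (g : y ⟶ y') :
    toMonCells.m f g ◁ (rho x' y').hom ≫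
      (Sq.comp (toMonCells.rSq (toMonCells.m f g)) (toMonCells.aSq f g (𝟙 toMonCells.e))).hom =
    (toMonCells.mSq (Sq.id f) (toMonCells.rSq g)).hom ≫
      (rho x y).hom ▷ toMonCells.m f (toMonCells.m g (𝟙 toMonCells.e))
  /-- `R_{x|yz}` -/
  R (x y z : B) :
    toMonCells.rw (toMonCells.b x y) z ≫ toMonCells.a y x z ≫
      toMonCells.lw y (toMonCells.b x z) ≅
    toMonCells.a x y z ≫ toMonCells.b x (toMonCells.o y z) ≫ toMonCells.a y z x
  R_natural {x y z x' y' z' : B} (f : x ⟶ x') (g : y ⟶ y') (h : z ⟶ z') :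
    toMonCells.m (toMonCells.m f g) h ◁ (R x' y' z').hom ≫
      (Sq.comp (toMonCells.aSq f g h)
        (Sq.comp (toMonCells.bSq f (toMonCells.m g h)) (toMonCells.aSq g h f))).hom =
    (Sq.comp (toMonCells.mSq (toMonCells.bSq f g) (Sq.id h))
      (Sq.comp (toMonCells.aSq g f h)
        (toMonCells.mSq (Sq.id g) (toMonCells.bSq f h)))).hom ≫
      (R x y z).hom ▷ toMonCells.m g (toMonCells.m h f)
  /-- `R_{xy|z}` -/
  S (x y z : B) :
    toMonCells.lw x (toMonCells.b y z) ≫ toMonCells.ai x z y ≫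
      toMonCells.rw (toMonCells.b x z) y ≅
    toMonCells.ai x y z ≫ toMonCells.b (toMonCells.o x y) z ≫ toMonCells.ai z x y
  S_natural {x y z x' y' z' : B} (f : x ⟶ x') (g : y ⟶ y') (h : z ⟶ z') :
    toMonCells.m f (toMonCells.m g h) ◁ (S x' y' z').hom ≫
      (Sq.comp (toMonCells.aiSq f g h)
        (Sq.comp (toMonCells.bSq (toMonCells.m f g) h) (toMonCells.aiSq h f g))).hom =
    (Sq.comp (toMonCells.mSq (Sq.id f) (toMonCells.bSq g h))
      (Sq.comp (toMonCells.aiSq f h g)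
        (toMonCells.mSq (toMonCells.bSq f h) (Sq.id g)))).hom ≫
      (S x y z).hom ▷ toMonCells.m (toMonCells.m h f) g
  /-- the syllepsis -/
  syl (x y : B) : toMonCells.b x y ≫ toMonCells.b y x ≅ 𝟙 (toMonCells.o x y)
  syl_natural {x y x' y' : B} (f : x ⟶ x') (g : y ⟶ y') :
    toMonCells.m f g ◁ (syl x' y').hom ≫ (Sq.id (toMonCells.m f g)).hom =
    (Sq.comp (toMonCells.bSq f g) (toMonCells.bSq g f)).hom ≫
      (syl x y).hom ▷ toMonCells.m f g


namespace SymMonData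

variable (M : SymMonData B)

/-! The invertible modifications whiskered by an object. -/

def rwPi (x y z w u : B) :
    M.rw (M.rw (M.a x y z) w) u ≫ M.rw (M.a x (M.o y z) w) u ≫ M.rw (M.lw x (M.a y z w)) u ≅
    M.rw (M.a (M.o x y) z w) u ≫ M.rw (M.a x y (M.o z w)) u :=
  (M.rwC₃ _ _ _ u).symm ≪≫ M.mIso (M.pi x y z w) (Iso.refl _) ≪≫ M.rwC _ _ u

def lwPi (x y z w u : B) :
    M.lw x (M.rw (M.a y z w) u) ≫ M.lw x (M.a y (M.o z w) u) ≫ M.lw x (M.lw y (M.a z w u)) ≅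
    M.lw x (M.a (M.o y z) w u) ≫ M.lw x (M.a y z (M.o w u)) :=
  (M.lwC₃ x _ _ _).symm ≪≫ M.mIso (Iso.refl _) (M.pi y z w u) ≪≫ M.lwC x _ _

def rwMu (x y z : B) :
    M.rw (M.rw (M.r x) y) z ≫ M.rw (M.a x M.e y) z ≫ M.rw (M.lw x (M.l y)) z ≅
    𝟙 (M.o (M.o x y) z) :=
  (M.rwC₃ _ _ _ z).symm ≪≫ M.mIso (M.mu x y) (Iso.refl _) ≪≫ M.mId _ _

def lwMu (x y z : B) :
    M.lw x (M.rw (M.r y) z) ≫ M.lw x (M.a y M.e z) ≫ M.lw x (M.lw y (M.l z)) ≅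
    𝟙 (M.o x (M.o y z)) :=
  (M.lwC₃ x _ _ _).symm ≪≫ M.mIso (Iso.refl _) (M.mu y z) ≪≫ M.mId _ _

def lwLam (x y z : B) :
    M.lw x (M.rw (M.l y) z) ≅ M.lw x (M.a M.e y z) ≫ M.lw x (M.l (M.o y z)) :=
  M.mIso (Iso.refl _) (M.lam y z) ≪≫ M.lwC x _ _

def rwRho (x y z : B) :
    M.rw (M.lw x (M.r y)) z ≅ M.rw (M.r (M.o x y)) z ≫ M.rw (M.a x y M.e) z :=
  M.mIso (M.rho x y) (Iso.refl _) ≪≫ M.rwC _ _ z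

def rwR (x y z w : B) :
    M.rw (M.rw (M.b x y) z) w ≫ M.rw (M.a y x z) w ≫ M.rw (M.lw y (M.b x z)) w ≅
    M.rw (M.a x y z) w ≫ M.rw (M.b x (M.o y z)) w ≫ M.rw (M.a y z x) w :=
  (M.rwC₃ _ _ _ w).symm ≪≫ M.mIso (M.R x y z) (Iso.refl _) ≪≫ M.rwC₃ _ _ _ w

def lwR (y x z w : B) :
    M.lw y (M.rw (M.b x z) w) ≫ M.lw y (M.a z x w) ≫ M.lw y (M.lw z (M.b x w)) ≅
    M.lw y (M.a x z w) ≫ M.lw y (M.b x (M.o z w)) ≫ M.lw y (M.a z w x) :=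
  (M.lwC₃ y _ _ _).symm ≪≫ M.mIso (Iso.refl _) (M.R x z w) ≪≫ M.lwC₃ y _ _ _

def lwS (x y z w : B) :
    M.lw x (M.lw y (M.b z w)) ≫ M.lw x (M.ai y w z) ≫ M.lw x (M.rw (M.b y w) z) ≅
    M.lw x (M.ai y z w) ≫ M.lw x (M.b (M.o y z) w) ≫ M.lw x (M.ai w y z) :=
  (M.lwC₃ x _ _ _).symm ≪≫ M.mIso (Iso.refl _) (M.S y z w) ≪≫ M.lwC₃ x _ _ _

def rwS (x y w z : B) :
    M.rw (M.lw x (M.b y w)) z ≫ M.rw (M.ai x w y) z ≫ M.rw (M.rw (M.b x w) y) z ≅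
    M.rw (M.ai x y w) z ≫ M.rw (M.b (M.o x y) w) z ≫ M.rw (M.ai w x y) z :=
  (M.rwC₃ _ _ _ z).symm ≪≫ M.mIso (M.S x y w) (Iso.refl _) ≪≫ M.rwC₃ _ _ _ z

def lwSyl (x y z : B) : M.lw x (M.b y z) ≫ M.lw x (M.b z y) ≅ 𝟙 (M.o x (M.o y z)) :=
  (M.lwC x _ _).symm ≪≫ M.mIso (Iso.refl _) (M.syl y z) ≪≫ M.mId _ _

def rwSyl (x y z : B) : M.rw (M.b x y) z ≫ M.rw (M.b y x) z ≅ 𝟙 (M.o (M.o x y) z) :=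
  (M.rwC _ _ z).symm ≪≫ M.mIso (M.syl x y) (Iso.refl _) ≪≫ M.mId _ _

/-- The equality of two pastings over the associahedron `K₅`. -/
def AssocAxiom : Prop := ∀ x y z w u : B,
  𝟙 (M.rw (M.rw (M.a x y z) w) u ≫ M.rw (M.a x (M.o y z) w) u ≫
      M.rw (M.lw x (M.a y z w)) u ≫ M.a x (M.o y (M.o z w)) u ≫ M.lw x (M.a y (M.o z w) u) ≫
      M.lw x (M.lw y (M.a z w u))) ⊗≫
    (M.rwPi x y z w u).hom ▷ (M.a x (M.o y (M.o z w)) u ≫ M.lw x (M.a y (M.o z w) u) ≫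
      M.lw x (M.lw y (M.a z w u))) ⊗≫
    M.rw (M.a (M.o x y) z w) u ◁ (M.pi x y (M.o z w) u).hom ▷ M.lw x (M.lw y (M.a z w u)) ⊗≫
    (M.rw (M.a (M.o x y) z w) u ≫ M.a (M.o x y) (M.o z w) u) ◁ (M.aNat₃ x y (M.a z w u)).inv ⊗≫
    (M.pi (M.o x y) z w u).hom ▷ M.a x y (M.o z (M.o w u)) ⊗≫
    𝟙 (M.a (M.o (M.o x y) z) w u ≫ M.a (M.o x y) z (M.o w u) ≫ M.a x y (M.o z (M.o w u))) =
  𝟙 (M.rw (M.rw (M.a x y z) w) u ≫ M.rw (M.a x (M.o y z) w) u ≫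
      M.rw (M.lw x (M.a y z w)) u ≫ M.a x (M.o y (M.o z w)) u ≫ M.lw x (M.a y (M.o z w) u) ≫
      M.lw x (M.lw y (M.a z w u))) ⊗≫
    (M.rw (M.rw (M.a x y z) w) u ≫ M.rw (M.a x (M.o y z) w) u) ◁
      (M.aNat₂ x (M.a y z w) u).hom ▷
        (M.lw x (M.a y (M.o z w) u) ≫ M.lw x (M.lw y (M.a z w u))) ⊗≫
    (M.rw (M.rw (M.a x y z) w) u ≫ M.rw (M.a x (M.o y z) w) u ≫ M.a x (M.o (M.o y z) w) u) ◁
      (M.lwPi x y z w u).hom ⊗≫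
    M.rw (M.rw (M.a x y z) w) u ◁ (M.pi x (M.o y z) w u).hom ▷ M.lw x (M.a y z (M.o w u)) ⊗≫
    (M.aNat₁ (M.a x y z) w u).hom ▷
      (M.a x (M.o y z) (M.o w u) ≫ M.lw x (M.a y z (M.o w u))) ⊗≫
    M.a (M.o (M.o x y) z) w u ◁ (M.pi x y z (M.o w u)).hom ⊗≫
    𝟙 (M.a (M.o (M.o x y) z) w u ≫ M.a (M.o x y) z (M.o w u) ≫ M.a x y (M.o z (M.o w u)))

/-- The left normalization axiom. -/
def LeftNormalization : Prop := ∀ x y z : B,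
  𝟙 (M.rw (M.rw (M.r x) y) z ≫ M.rw (M.a x M.e y) z ≫ M.a x (M.o M.e y) z ≫
      M.lw x (M.a M.e y z) ≫ M.lw x (M.l (M.o y z))) ⊗≫
    M.rw (M.rw (M.r x) y) z ◁ (M.pi x M.e y z).hom ▷ M.lw x (M.l (M.o y z)) ⊗≫
    (M.aNat₁ (M.r x) y z).hom ▷ (M.a x M.e (M.o y z) ≫ M.lw x (M.l (M.o y z))) ⊗≫
    M.a x y z ◁ (M.mu x (M.o y z)).hom ⊗≫
    𝟙 (M.a x y z) =
  𝟙 (M.rw (M.rw (M.r x) y) z ≫ M.rw (M.a x M.e y) z ≫ M.a x (M.o M.e y) z ≫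
      M.lw x (M.a M.e y z) ≫ M.lw x (M.l (M.o y z))) ⊗≫
    (M.rw (M.rw (M.r x) y) z ≫ M.rw (M.a x M.e y) z ≫ M.a x (M.o M.e y) z) ◁
      (M.lwLam x y z).inv ⊗≫
    (M.rw (M.rw (M.r x) y) z ≫ M.rw (M.a x M.e y) z) ◁ (M.aNat₂ x (M.l y) z).inv ⊗≫
    (M.rwMu x y z).hom ▷ M.a x y z ⊗≫
    𝟙 (M.a x y z)

/-- The right normalization axiom. -/
def RightNormalization : Prop := ∀ x y z : B,
  𝟙 (M.rw (M.lw x (M.r y)) z ≫ M.a x (M.o y M.e) z ≫ M.lw x (M.a y M.e z) ≫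
      M.lw x (M.lw y (M.l z))) ⊗≫
    (M.rwRho x y z).hom ▷ (M.a x (M.o y M.e) z ≫ M.lw x (M.a y M.e z) ≫
      M.lw x (M.lw y (M.l z))) ⊗≫
    M.rw (M.r (M.o x y)) z ◁ (M.pi x y M.e z).hom ▷ M.lw x (M.lw y (M.l z)) ⊗≫
    (M.rw (M.r (M.o x y)) z ≫ M.a (M.o x y) M.e z) ◁ (M.aNat₃ x y (M.l z)).inv ⊗≫
    (M.mu (M.o x y) z).hom ▷ M.a x y z ⊗≫
    𝟙 (M.a x y z) =
  𝟙 (M.rw (M.lw x (M.r y)) z ≫ M.a x (M.o y M.e) z ≫ M.lw x (M.a y M.e z) ≫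
      M.lw x (M.lw y (M.l z))) ⊗≫
    (M.aNat₂ x (M.r y) z).hom ▷ (M.lw x (M.a y M.e z) ≫ M.lw x (M.lw y (M.l z))) ⊗≫
    M.a x y z ◁ (M.lwMu x y z).hom ⊗≫
    𝟙 (M.a x y z)

/-- The two ways to braid `x` past `yzw` agree. -/
def BraidAxiom₁ : Prop := ∀ x y z w : B,
  𝟙 (M.rw (M.rw (M.b x y) z) w ≫ M.rw (M.a y x z) w ≫ M.rw (M.lw y (M.b x z)) w ≫
      M.a y (M.o z x) w ≫ M.lw y (M.a z x w) ≫ M.lw y (M.lw z (M.b x w))) ⊗≫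
    (M.rwR x y z w).hom ▷ (M.a y (M.o z x) w ≫ M.lw y (M.a z x w) ≫
      M.lw y (M.lw z (M.b x w))) ⊗≫
    (M.rw (M.a x y z) w ≫ M.rw (M.b x (M.o y z)) w) ◁ (M.pi y z x w).hom ▷
      M.lw y (M.lw z (M.b x w)) ⊗≫
    (M.rw (M.a x y z) w ≫ M.rw (M.b x (M.o y z)) w ≫ M.a (M.o y z) x w) ◁
      (M.aNat₃ y z (M.b x w)).inv ⊗≫
    M.rw (M.a x y z) w ◁ (M.R x (M.o y z) w).hom ▷ M.a y z (M.o w x) ⊗≫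
    (M.rw (M.a x y z) w ≫ M.a x (M.o y z) w ≫ M.b x (M.o (M.o y z) w)) ◁
      (M.pi y z w x).inv ⊗≫
    (M.rw (M.a x y z) w ≫ M.a x (M.o y z) w) ◁ (M.bNat₂ x (M.a y z w)).inv ▷
      (M.a y (M.o z w) x ≫ M.lw y (M.a z w x)) ⊗≫
    (M.pi x y z w).hom ▷ (M.b x (M.o y (M.o z w)) ≫ M.a y (M.o z w) x ≫ M.lw y (M.a z w x)) ⊗≫
    𝟙 (M.a (M.o x y) z w ≫ M.a x y (M.o z w) ≫ M.b x (M.o y (M.o z w)) ≫ M.a y (M.o z w) x ≫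
      M.lw y (M.a z w x)) =
  𝟙 (M.rw (M.rw (M.b x y) z) w ≫ M.rw (M.a y x z) w ≫ M.rw (M.lw y (M.b x z)) w ≫
      M.a y (M.o z x) w ≫ M.lw y (M.a z x w) ≫ M.lw y (M.lw z (M.b x w))) ⊗≫
    (M.rw (M.rw (M.b x y) z) w ≫ M.rw (M.a y x z) w) ◁ (M.aNat₂ y (M.b x z) w).hom ▷
      (M.lw y (M.a z x w) ≫ M.lw y (M.lw z (M.b x w))) ⊗≫
    (M.rw (M.rw (M.b x y) z) w ≫ M.rw (M.a y x z) w ≫ M.a y (M.o x z) w) ◁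
      (M.lwR y x z w).hom ⊗≫
    M.rw (M.rw (M.b x y) z) w ◁ (M.pi y x z w).hom ▷
      (M.lw y (M.b x (M.o z w)) ≫ M.lw y (M.a z w x)) ⊗≫
    (M.aNat₁ (M.b x y) z w).hom ▷ (M.a y x (M.o z w) ≫ M.lw y (M.b x (M.o z w)) ≫
      M.lw y (M.a z w x)) ⊗≫
    M.a (M.o x y) z w ◁ (M.R x y (M.o z w)).hom ▷ M.lw y (M.a z w x) ⊗≫
    𝟙 (M.a (M.o x y) z w ≫ M.a x y (M.o z w) ≫ M.b x (M.o y (M.o z w)) ≫ M.a y (M.o z w) x ≫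
      M.lw y (M.a z w x))


/-- An invertible 2-cell whiskered on both sides. -/
def wh {a b c d : B} (f : a ⟶ b) {p q : b ⟶ c} (η : p ≅ q) (g : c ⟶ d) :
    f ≫ p ≫ g ≅ f ≫ q ≫ g :=
  whiskerLeftIso f (whiskerRightIso η g)

/-! Variants of `π` in which some of the edges are replaced by their chosen inverses. -/

def piV₁ (x y z w : B) : M.ai (M.o x y) z w ≫ M.rw (M.a x y z) w ≅
    M.a x y (M.o z w) ≫ M.lw x (M.ai y z w) ≫ M.ai x (M.o y z) w :=
  Iso.refl (M.ai (M.o x y) z w ≫ M.rw (M.a x y z) w) ≪⊗≫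
    wh (M.ai (M.o x y) z w ≫ M.rw (M.a x y z) w) (M.aUnit x (M.o y z) w) (𝟙 _) ≪⊗≫
    wh (M.ai (M.o x y) z w ≫ M.rw (M.a x y z) w ≫ M.a x (M.o y z) w) (M.lwUnit x y z w)
      (M.ai x (M.o y z) w) ≪⊗≫
    wh (M.ai (M.o x y) z w) (M.pi x y z w) (M.lw x (M.ai y z w) ≫ M.ai x (M.o y z) w) ≪⊗≫
    wh (𝟙 _) (M.aCounit (M.o x y) z w)
      (M.a x y (M.o z w) ≫ M.lw x (M.ai y z w) ≫ M.ai x (M.o y z) w) ≪⊗≫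
    Iso.refl (M.a x y (M.o z w) ≫ M.lw x (M.ai y z w) ≫ M.ai x (M.o y z) w)

def piV₂ (x y z w : B) : M.ai x (M.o y z) w ≫ M.rw (M.ai x y z) w ≅
    M.lw x (M.a y z w) ≫ M.ai x y (M.o z w) ≫ M.ai (M.o x y) z w :=
  Iso.refl (M.ai x (M.o y z) w ≫ M.rw (M.ai x y z) w) ≪⊗≫
    wh (M.ai x (M.o y z) w ≫ M.rw (M.ai x y z) w) (M.aUnit (M.o x y) z w) (𝟙 _) ≪⊗≫
    wh (M.ai x (M.o y z) w ≫ M.rw (M.ai x y z) w ≫ M.a (M.o x y) z w) (M.aUnit x y (M.o z w))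
      (M.ai (M.o x y) z w) ≪⊗≫
    wh (M.ai x (M.o y z) w ≫ M.rw (M.ai x y z) w) (M.pi x y z w).symm
      (M.ai x y (M.o z w) ≫ M.ai (M.o x y) z w) ≪⊗≫
    wh (M.ai x (M.o y z) w) (M.rwCounit x y z w) (M.a x (M.o y z) w ≫ M.lw x (M.a y z w) ≫
      M.ai x y (M.o z w) ≫ M.ai (M.o x y) z w) ≪⊗≫
    wh (𝟙 _) (M.aCounit x (M.o y z) w) (M.lw x (M.a y z w) ≫
      M.ai x y (M.o z w) ≫ M.ai (M.o x y) z w) ≪⊗≫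
    Iso.refl (M.lw x (M.a y z w) ≫ M.ai x y (M.o z w) ≫ M.ai (M.o x y) z w)

def piV₃ (x y z w : B) : M.ai (M.o x y) z w ≫ M.rw (M.a x y z) w ≫ M.a x (M.o y z) w ≫
      M.lw x (M.a y z w) ≅ M.a x y (M.o z w) :=
  whiskerLeftIso (M.ai (M.o x y) z w) (M.pi x y z w) ≪⊗≫
    wh (𝟙 _) (M.aCounit (M.o x y) z w) (M.a x y (M.o z w)) ≪⊗≫
    Iso.refl (M.a x y (M.o z w))

def piV₄ (x y z w : B) : M.ai x y (M.o z w) ≅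
    M.lw x (M.ai y z w) ≫ M.ai x (M.o y z) w ≫ M.rw (M.ai x y z) w ≫ M.a (M.o x y) z w :=
  Iso.refl (M.ai x y (M.o z w)) ≪⊗≫
    wh (𝟙 _) (M.lwCounit x y z w).symm (M.ai x y (M.o z w)) ≪⊗≫
    wh (M.lw x (M.ai y z w)) (M.aCounit x (M.o y z) w).symm
      (M.lw x (M.a y z w) ≫ M.ai x y (M.o z w)) ≪⊗≫
    wh (M.lw x (M.ai y z w) ≫ M.ai x (M.o y z) w) (M.rwCounit x y z w).symm
      (M.a x (M.o y z) w ≫ M.lw x (M.a y z w) ≫ M.ai x y (M.o z w)) ≪⊗≫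
    wh (M.lw x (M.ai y z w) ≫ M.ai x (M.o y z) w ≫ M.rw (M.ai x y z) w) (M.pi x y z w)
      (M.ai x y (M.o z w)) ≪⊗≫
    wh (M.lw x (M.ai y z w) ≫ M.ai x (M.o y z) w ≫ M.rw (M.ai x y z) w ≫ M.a (M.o x y) z w)
      (M.aUnit x y (M.o z w)).symm (𝟙 _) ≪⊗≫
    Iso.refl (M.lw x (M.ai y z w) ≫ M.ai x (M.o y z) w ≫ M.rw (M.ai x y z) w ≫
      M.a (M.o x y) z w)

def piV₅ (x y z w : B) : M.a (M.o x y) z w ≫ M.a x y (M.o z w) ≫ M.lw x (M.ai y z w) ≅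
    M.rw (M.a x y z) w ≫ M.a x (M.o y z) w :=
  Iso.refl (M.a (M.o x y) z w ≫ M.a x y (M.o z w) ≫ M.lw x (M.ai y z w)) ≪⊗≫
    wh (𝟙 _) (M.pi x y z w).symm (M.lw x (M.ai y z w)) ≪⊗≫
    wh (M.rw (M.a x y z) w ≫ M.a x (M.o y z) w) (M.lwUnit x y z w).symm (𝟙 _) ≪⊗≫
    Iso.refl (M.rw (M.a x y z) w ≫ M.a x (M.o y z) w)

def piV₆ (x y z w : B) : M.a x (M.o y z) w ≫ M.lw x (M.a y z w) ≫ M.ai x y (M.o z w) ≅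
    M.rw (M.ai x y z) w ≫ M.a (M.o x y) z w :=
  Iso.refl (M.a x (M.o y z) w ≫ M.lw x (M.a y z w) ≫ M.ai x y (M.o z w)) ≪⊗≫
    wh (𝟙 _) (M.rwCounit x y z w).symm
      (M.a x (M.o y z) w ≫ M.lw x (M.a y z w) ≫ M.ai x y (M.o z w)) ≪⊗≫
    wh (M.rw (M.ai x y z) w) (M.pi x y z w) (M.ai x y (M.o z w)) ≪⊗≫
    wh (M.rw (M.ai x y z) w ≫ M.a (M.o x y) z w) (M.aUnit x y (M.o z w)).symm (𝟙 _) ≪⊗≫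
    Iso.refl (M.rw (M.ai x y z) w ≫ M.a (M.o x y) z w)

/-- The mate of `π`. -/
def piI (x y z w : B) : M.ai x y (M.o z w) ≫ M.ai (M.o x y) z w ≅
    M.lw x (M.ai y z w) ≫ M.ai x (M.o y z) w ≫ M.rw (M.ai x y z) w :=
  whiskerRightIso (M.piV₄ x y z w) (M.ai (M.o x y) z w) ≪⊗≫
    wh (M.lw x (M.ai y z w) ≫ M.ai x (M.o y z) w ≫ M.rw (M.ai x y z) w)
      (M.aUnit (M.o x y) z w).symm (𝟙 _) ≪⊗≫
    Iso.refl (M.lw x (M.ai y z w) ≫ M.ai x (M.o y z) w ≫ M.rw (M.ai x y z) w)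

/-- The braiding of `xy` past `z`, decomposed. -/
def sTil (x y z : B) : M.a x y z ≫ M.lw x (M.b y z) ≫ M.ai x z y ≫ M.rw (M.b x z) y ≫
      M.a z x y ≅ M.b (M.o x y) z :=
  Iso.refl (M.a x y z ≫ M.lw x (M.b y z) ≫ M.ai x z y ≫ M.rw (M.b x z) y ≫ M.a z x y) ≪⊗≫
    wh (M.a x y z) (M.S x y z) (M.a z x y) ≪⊗≫
    wh (𝟙 _) (M.aUnit x y z).symm (M.b (M.o x y) z ≫ M.ai z x y ≫ M.a z x y) ≪⊗≫
    wh (M.b (M.o x y) z) (M.aCounit z x y) (𝟙 _) ≪⊗≫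
    Iso.refl (M.b (M.o x y) z)

/-- The braiding of `x` past `yz`, decomposed. -/
def rTil (x y z : B) : M.ai x y z ≫ M.rw (M.b x y) z ≫ M.a y x z ≫ M.lw y (M.b x z) ≫
      M.ai y z x ≅ M.b x (M.o y z) :=
  Iso.refl (M.ai x y z ≫ M.rw (M.b x y) z ≫ M.a y x z ≫ M.lw y (M.b x z) ≫ M.ai y z x) ≪⊗≫
    wh (M.ai x y z) (M.R x y z) (M.ai y z x) ≪⊗≫
    wh (𝟙 _) (M.aCounit x y z) (M.b x (M.o y z) ≫ M.a y z x ≫ M.ai y z x) ≪⊗≫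
    wh (M.b x (M.o y z)) (M.aUnit y z x).symm (𝟙 _) ≪⊗≫
    Iso.refl (M.b x (M.o y z))

/-- The two ways to braid `xyz` past `w` agree. -/
def BraidAxiom₂ : Prop := ∀ x y z w : B,
  Iso.refl (M.lw x (M.lw y (M.b z w)) ≫ M.lw x (M.ai y w z) ≫ M.lw x (M.rw (M.b y w) z) ≫
      M.ai x (M.o w y) z ≫ M.rw (M.ai x w y) z ≫ M.rw (M.rw (M.b x w) y) z) ≪⊗≫
    whiskerRightIso (M.lwS x y z w)
      (M.ai x (M.o w y) z ≫ M.rw (M.ai x w y) z ≫ M.rw (M.rw (M.b x w) y) z) ≪⊗≫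
    wh (M.lw x (M.ai y z w) ≫ M.lw x (M.b (M.o y z) w)) (M.piI x w y z).symm
      (M.rw (M.rw (M.b x w) y) z) ≪⊗≫
    wh (M.lw x (M.ai y z w) ≫ M.lw x (M.b (M.o y z) w) ≫ M.ai x w (M.o y z))
      (M.aiNat₁ (M.b x w) y z).symm (𝟙 _) ≪⊗≫
    wh (M.lw x (M.ai y z w)) (M.S x (M.o y z) w) (M.ai (M.o w x) y z) ≪⊗≫
    wh (M.lw x (M.ai y z w) ≫ M.ai x (M.o y z) w ≫ M.b (M.o x (M.o y z)) w) (M.piI w x y z)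
      (𝟙 _) ≪⊗≫
    wh (M.lw x (M.ai y z w) ≫ M.ai x (M.o y z) w) (M.bNat₁ (M.ai x y z) w).symm
      (M.ai w (M.o x y) z ≫ M.rw (M.ai w x y) z) ≪⊗≫
    wh (𝟙 _) (M.piI x y z w).symm
      (M.b (M.o (M.o x y) z) w ≫ M.ai w (M.o x y) z ≫ M.rw (M.ai w x y) z) ≪⊗≫
    Iso.refl (M.ai x y (M.o z w) ≫ M.ai (M.o x y) z w ≫ M.b (M.o (M.o x y) z) w ≫
      M.ai w (M.o x y) z ≫ M.rw (M.ai w x y) z) =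
  Iso.refl (M.lw x (M.lw y (M.b z w)) ≫ M.lw x (M.ai y w z) ≫ M.lw x (M.rw (M.b y w) z) ≫
      M.ai x (M.o w y) z ≫ M.rw (M.ai x w y) z ≫ M.rw (M.rw (M.b x w) y) z) ≪⊗≫
    wh (M.lw x (M.lw y (M.b z w)) ≫ M.lw x (M.ai y w z)) (M.aiNat₂ x (M.b y w) z)
      (M.rw (M.ai x w y) z ≫ M.rw (M.rw (M.b x w) y) z) ≪⊗≫
    wh (M.lw x (M.lw y (M.b z w)) ≫ M.lw x (M.ai y w z) ≫ M.ai x (M.o y w) z)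
      (M.rwS x y w z) (𝟙 _) ≪⊗≫
    wh (M.lw x (M.lw y (M.b z w))) (M.piI x y w z).symm
      (M.rw (M.b (M.o x y) w) z ≫ M.rw (M.ai w x y) z) ≪⊗≫
    wh (𝟙 _) (M.aiNat₃ x y (M.b z w))
      (M.ai (M.o x y) w z ≫ M.rw (M.b (M.o x y) w) z ≫ M.rw (M.ai w x y) z) ≪⊗≫
    wh (M.ai x y (M.o z w)) (M.S (M.o x y) z w) (M.rw (M.ai w x y) z) ≪⊗≫
    Iso.refl (M.ai x y (M.o z w) ≫ M.ai (M.o x y) z w ≫ M.b (M.o (M.o x y) z) w ≫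
      M.ai w (M.o x y) z ≫ M.rw (M.ai w x y) z)

def rwSTil (x y z w : B) : M.rw (M.a x y z) w ≫ M.rw (M.lw x (M.b y z)) w ≫
      M.rw (M.ai x z y) w ≫ M.rw (M.rw (M.b x z) y) w ≫ M.rw (M.a z x y) w ≅
    M.rw (M.b (M.o x y) z) w :=
  (M.rwC₅ _ _ _ _ _ w).symm ≪≫ M.mIso (M.sTil x y z) (Iso.refl _)

def lwSTil (z x y w : B) : M.lw z (M.a x y w) ≫ M.lw z (M.lw x (M.b y w)) ≫
      M.lw z (M.ai x w y) ≫ M.lw z (M.rw (M.b x w) y) ≫ M.lw z (M.a w x y) ≅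
    M.lw z (M.b (M.o x y) w) :=
  (M.lwC₅ z _ _ _ _ _).symm ≪≫ M.mIso (Iso.refl _) (M.sTil x y w)

def lwRTil (x y z w : B) : M.lw x (M.ai y z w) ≫ M.lw x (M.rw (M.b y z) w) ≫
      M.lw x (M.a z y w) ≫ M.lw x (M.lw z (M.b y w)) ≫ M.lw x (M.ai z w y) ≅
    M.lw x (M.b y (M.o z w)) :=
  (M.lwC₅ x _ _ _ _ _).symm ≪≫ M.mIso (Iso.refl _) (M.rTil y z w)

def rwRTil (x z w y : B) : M.rw (M.ai x z w) y ≫ M.rw (M.rw (M.b x z) w) y ≫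
      M.rw (M.a z x w) y ≫ M.rw (M.lw z (M.b x w)) y ≫ M.rw (M.ai z w x) y ≅
    M.rw (M.b x (M.o z w)) y :=
  (M.rwC₅ _ _ _ _ _ y).symm ≪≫ M.mIso (M.rTil x z w) (Iso.refl _)

/-! The comparison of the two decompositions of the braiding of `xy` past `zw` into four
braidings of single factors. -/

def shuffle₁ (x y z w : B) :
    M.ai (M.o x y) z w ≫ M.rw (M.a x y z) w ≫ M.rw (M.lw x (M.b y z)) w ≫
      M.rw (M.ai x z y) w ≫ M.rw (M.rw (M.b x z) y) w ≅
    M.a x y (M.o z w) ≫ M.lw x (M.ai y z w) ≫ M.lw x (M.rw (M.b y z) w) ≫ M.lw x (M.a z y w) ≫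
      M.ai x z (M.o y w) ≫ M.rw (M.b x z) (M.o y w) ≫ M.ai (M.o z x) y w :=
  Iso.refl (M.ai (M.o x y) z w ≫ M.rw (M.a x y z) w ≫ M.rw (M.lw x (M.b y z)) w ≫
      M.rw (M.ai x z y) w ≫ M.rw (M.rw (M.b x z) y) w) ≪⊗≫
    wh (𝟙 _) (M.piV₁ x y z w) (M.rw (M.lw x (M.b y z)) w ≫ M.rw (M.ai x z y) w ≫
      M.rw (M.rw (M.b x z) y) w) ≪⊗≫
    wh (M.a x y (M.o z w) ≫ M.lw x (M.ai y z w)) (M.aiNat₂ x (M.b y z) w).symm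
      (M.rw (M.ai x z y) w ≫ M.rw (M.rw (M.b x z) y) w) ≪⊗≫
    wh (M.a x y (M.o z w) ≫ M.lw x (M.ai y z w) ≫ M.lw x (M.rw (M.b y z) w))
      (M.piV₂ x z y w) (M.rw (M.rw (M.b x z) y) w) ≪⊗≫
    wh (M.a x y (M.o z w) ≫ M.lw x (M.ai y z w) ≫ M.lw x (M.rw (M.b y z) w) ≫
      M.lw x (M.a z y w) ≫ M.ai x z (M.o y w)) (M.aiNat₁ (M.b x z) y w).symm (𝟙 _) ≪⊗≫
    Iso.refl (M.a x y (M.o z w) ≫ M.lw x (M.ai y z w) ≫ M.lw x (M.rw (M.b y z) w) ≫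
      M.lw x (M.a z y w) ≫ M.ai x z (M.o y w) ≫ M.rw (M.b x z) (M.o y w) ≫ M.ai (M.o z x) y w)

def shuffle₂ (x y z w : B) :
    M.ai (M.o z x) y w ≫ M.rw (M.a z x y) w ≫ M.a z (M.o x y) w ≫ M.lw z (M.a x y w) ≫
      M.lw z (M.lw x (M.b y w)) ≅
    M.lw (M.o z x) (M.b y w) ≫ M.a z x (M.o w y) :=
  Iso.refl (M.ai (M.o z x) y w ≫ M.rw (M.a z x y) w ≫ M.a z (M.o x y) w ≫ M.lw z (M.a x y w) ≫
      M.lw z (M.lw x (M.b y w))) ≪⊗≫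
    wh (𝟙 _) (M.piV₃ z x y w) (M.lw z (M.lw x (M.b y w))) ≪⊗≫
    (M.aNat₃ z x (M.b y w)).symm

def shuffle₃ (x y z w : B) :
    M.ai x z (M.o y w) ≫ M.rw (M.b x z) (M.o y w) ≫ M.lw (M.o z x) (M.b y w) ≅
    M.lw x (M.lw z (M.b y w)) ≫ M.ai x z (M.o w y) ≫ M.rw (M.b x z) (M.o w y) :=
  Iso.refl (M.ai x z (M.o y w) ≫ M.rw (M.b x z) (M.o y w) ≫ M.lw (M.o z x) (M.b y w)) ≪⊗≫
    wh (M.ai x z (M.o y w)) (M.interchange (M.b x z) (M.b y w)) (𝟙 _) ≪⊗≫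
    wh (𝟙 _) (M.aiNat₃ x z (M.b y w)).symm (M.rw (M.b x z) (M.o w y)) ≪⊗≫
    Iso.refl (M.lw x (M.lw z (M.b y w)) ≫ M.ai x z (M.o w y) ≫ M.rw (M.b x z) (M.o w y))

def shuffle₄ (x y z w : B) :
    M.ai x z (M.o w y) ≫ M.rw (M.b x z) (M.o w y) ≅
    M.lw x (M.ai z w y) ≫ M.ai x (M.o z w) y ≫ M.rw (M.ai x z w) y ≫ M.rw (M.rw (M.b x z) w) y ≫
      M.a (M.o z x) w y :=
  Iso.refl (M.ai x z (M.o w y) ≫ M.rw (M.b x z) (M.o w y)) ≪⊗≫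
    wh (𝟙 _) (M.piV₄ x z w y) (M.rw (M.b x z) (M.o w y)) ≪⊗≫
    wh (M.lw x (M.ai z w y) ≫ M.ai x (M.o z w) y ≫ M.rw (M.ai x z w) y)
      (M.aNat₁ (M.b x z) w y).symm (𝟙 _) ≪⊗≫
    Iso.refl (M.lw x (M.ai z w y) ≫ M.ai x (M.o z w) y ≫ M.rw (M.ai x z w) y ≫
      M.rw (M.rw (M.b x z) w) y ≫ M.a (M.o z x) w y)

def shuffle₅ (x y z w : B) :
    M.a (M.o z x) w y ≫ M.a z x (M.o w y) ≫ M.lw z (M.ai x w y) ≫ M.lw z (M.rw (M.b x w) y) ≫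
      M.lw z (M.a w x y) ≫ M.ai z w (M.o x y) ≅
    M.rw (M.a z x w) y ≫ M.rw (M.lw z (M.b x w)) y ≫ M.rw (M.ai z w x) y ≫ M.a (M.o z w) x y :=
  Iso.refl (M.a (M.o z x) w y ≫ M.a z x (M.o w y) ≫ M.lw z (M.ai x w y) ≫
      M.lw z (M.rw (M.b x w) y) ≫ M.lw z (M.a w x y) ≫ M.ai z w (M.o x y)) ≪⊗≫
    wh (𝟙 _) (M.piV₅ z x w y) (M.lw z (M.rw (M.b x w) y) ≫ M.lw z (M.a w x y) ≫
      M.ai z w (M.o x y)) ≪⊗≫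
    wh (M.rw (M.a z x w) y) (M.aNat₂ z (M.b x w) y).symm
      (M.lw z (M.a w x y) ≫ M.ai z w (M.o x y)) ≪⊗≫
    wh (M.rw (M.a z x w) y ≫ M.rw (M.lw z (M.b x w)) y) (M.piV₆ z w x y) (𝟙 _) ≪⊗≫
    Iso.refl (M.rw (M.a z x w) y ≫ M.rw (M.lw z (M.b x w)) y ≫ M.rw (M.ai z w x) y ≫
      M.a (M.o z w) x y)

/-- The two ways to braid `xy` past `zw` agree. -/
def BraidAxiom₃ : Prop := ∀ x y z w : B,
  Iso.refl (M.ai (M.o x y) z w ≫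
      (M.rw (M.a x y z) w ≫ M.rw (M.lw x (M.b y z)) w ≫ M.rw (M.ai x z y) w ≫
        M.rw (M.rw (M.b x z) y) w ≫ M.rw (M.a z x y) w) ≫ M.a z (M.o x y) w ≫
      (M.lw z (M.a x y w) ≫ M.lw z (M.lw x (M.b y w)) ≫ M.lw z (M.ai x w y) ≫
        M.lw z (M.rw (M.b x w) y) ≫ M.lw z (M.a w x y)) ≫ M.ai z w (M.o x y)) ≪⊗≫
    wh (M.ai (M.o x y) z w) (M.rwSTil x y z w) (M.a z (M.o x y) w ≫
      (M.lw z (M.a x y w) ≫ M.lw z (M.lw x (M.b y w)) ≫ M.lw z (M.ai x w y) ≫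
        M.lw z (M.rw (M.b x w) y) ≫ M.lw z (M.a w x y)) ≫ M.ai z w (M.o x y)) ≪⊗≫
    wh (M.ai (M.o x y) z w ≫ M.rw (M.b (M.o x y) z) w ≫ M.a z (M.o x y) w)
      (M.lwSTil z x y w) (M.ai z w (M.o x y)) ≪⊗≫
    M.rTil (M.o x y) z w =
  Iso.refl (M.ai (M.o x y) z w ≫
      (M.rw (M.a x y z) w ≫ M.rw (M.lw x (M.b y z)) w ≫ M.rw (M.ai x z y) w ≫
        M.rw (M.rw (M.b x z) y) w ≫ M.rw (M.a z x y) w) ≫ M.a z (M.o x y) w ≫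
      (M.lw z (M.a x y w) ≫ M.lw z (M.lw x (M.b y w)) ≫ M.lw z (M.ai x w y) ≫
        M.lw z (M.rw (M.b x w) y) ≫ M.lw z (M.a w x y)) ≫ M.ai z w (M.o x y)) ≪⊗≫
    wh (𝟙 _) (M.shuffle₁ x y z w) (M.rw (M.a z x y) w ≫ M.a z (M.o x y) w ≫
      M.lw z (M.a x y w) ≫ M.lw z (M.lw x (M.b y w)) ≫ M.lw z (M.ai x w y) ≫
      M.lw z (M.rw (M.b x w) y) ≫ M.lw z (M.a w x y) ≫ M.ai z w (M.o x y)) ≪⊗≫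
    wh (M.a x y (M.o z w) ≫ M.lw x (M.ai y z w) ≫ M.lw x (M.rw (M.b y z) w) ≫
        M.lw x (M.a z y w) ≫ M.ai x z (M.o y w) ≫ M.rw (M.b x z) (M.o y w))
      (M.shuffle₂ x y z w)
      (M.lw z (M.ai x w y) ≫ M.lw z (M.rw (M.b x w) y) ≫ M.lw z (M.a w x y) ≫
        M.ai z w (M.o x y)) ≪⊗≫
    wh (M.a x y (M.o z w) ≫ M.lw x (M.ai y z w) ≫ M.lw x (M.rw (M.b y z) w) ≫
        M.lw x (M.a z y w)) (M.shuffle₃ x y z w)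
      (M.a z x (M.o w y) ≫ M.lw z (M.ai x w y) ≫ M.lw z (M.rw (M.b x w) y) ≫
        M.lw z (M.a w x y) ≫ M.ai z w (M.o x y)) ≪⊗≫
    wh (M.a x y (M.o z w) ≫ M.lw x (M.ai y z w) ≫ M.lw x (M.rw (M.b y z) w) ≫
        M.lw x (M.a z y w) ≫ M.lw x (M.lw z (M.b y w))) (M.shuffle₄ x y z w)
      (M.a z x (M.o w y) ≫ M.lw z (M.ai x w y) ≫ M.lw z (M.rw (M.b x w) y) ≫
        M.lw z (M.a w x y) ≫ M.ai z w (M.o x y)) ≪⊗≫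
    wh (M.a x y (M.o z w) ≫ M.lw x (M.ai y z w) ≫ M.lw x (M.rw (M.b y z) w) ≫
        M.lw x (M.a z y w) ≫ M.lw x (M.lw z (M.b y w)) ≫ M.lw x (M.ai z w y) ≫
        M.ai x (M.o z w) y ≫ M.rw (M.ai x z w) y ≫ M.rw (M.rw (M.b x z) w) y)
      (M.shuffle₅ x y z w) (𝟙 _) ≪⊗≫
    wh (M.a x y (M.o z w)) (M.lwRTil x y z w) (M.ai x (M.o z w) y ≫
        M.rw (M.ai x z w) y ≫ M.rw (M.rw (M.b x z) w) y ≫ M.rw (M.a z x w) y ≫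
        M.rw (M.lw z (M.b x w)) y ≫ M.rw (M.ai z w x) y ≫ M.a (M.o z w) x y) ≪⊗≫
    wh (M.a x y (M.o z w) ≫ M.lw x (M.b y (M.o z w)) ≫ M.ai x (M.o z w) y)
      (M.rwRTil x z w y) (M.a (M.o z w) x y) ≪⊗≫
    M.sTil x y (M.o z w)

/-- The Yang–Baxter axiom. -/
def BraidAxiom₄ : Prop := ∀ x y z : B,
  Iso.refl (M.a x y z ≫ M.lw x (M.b y z) ≫ M.ai x z y ≫ M.rw (M.b x z) y ≫ M.a z x y ≫
      M.lw z (M.b x y)) ≪⊗≫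
    wh (𝟙 _) (M.sTil x y z) (M.lw z (M.b x y)) ≪⊗≫
    (M.bNat₁ (M.b x y) z).symm ≪⊗≫
    whiskerLeftIso (M.rw (M.b x y) z) (M.sTil y x z).symm ≪⊗≫
    Iso.refl (M.rw (M.b x y) z ≫ M.a y x z ≫ M.lw y (M.b x z) ≫ M.ai y z x ≫
      M.rw (M.b y z) x ≫ M.a z y x) =
  Iso.refl (M.a x y z ≫ M.lw x (M.b y z) ≫ M.ai x z y ≫ M.rw (M.b x z) y ≫ M.a z x y ≫
      M.lw z (M.b x y)) ≪⊗≫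
    wh (M.a x y z ≫ M.lw x (M.b y z) ≫ M.ai x z y) (M.R x z y) (𝟙 _) ≪⊗≫
    wh (M.a x y z ≫ M.lw x (M.b y z)) (M.aCounit x z y) (M.b x (M.o z y) ≫ M.a z y x) ≪⊗≫
    wh (M.a x y z) (M.bNat₂ x (M.b y z)) (M.a z y x) ≪⊗≫
    wh (M.a x y z ≫ M.b x (M.o y z)) (M.aUnit y z x) (M.rw (M.b y z) x ≫ M.a z y x) ≪⊗≫
    wh (𝟙 _) (M.R x y z).symm (M.ai y z x ≫ M.rw (M.b y z) x ≫ M.a z y x) ≪⊗≫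
    Iso.refl (M.rw (M.b x y) z ≫ M.a y x z ≫ M.lw y (M.b x z) ≫ M.ai y z x ≫
      M.rw (M.b y z) x ≫ M.a z y x)

/-- The first sylleptic axiom. -/
def SyllepticAxiom₁ : Prop := ∀ x y z : B,
  Iso.refl (M.rw (M.b x y) z ≫ M.a y x z ≫ M.lw y (M.b x z) ≫ M.lw y (M.b z x) ≫
      M.ai y x z ≫ M.rw (M.b y x) z) ≪⊗≫
    wh (𝟙 _) (M.R x y z) (M.lw y (M.b z x) ≫ M.ai y x z ≫ M.rw (M.b y x) z) ≪⊗≫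
    wh (M.a x y z ≫ M.b x (M.o y z) ≫ M.a y z x) (M.S y z x) (𝟙 _) ≪⊗≫
    wh (M.a x y z ≫ M.b x (M.o y z)) (M.aUnit y z x).symm
      (M.b (M.o y z) x ≫ M.ai x y z) ≪⊗≫
    wh (M.a x y z) (M.syl x (M.o y z)) (M.ai x y z) ≪⊗≫
    (M.aUnit x y z).symm =
  Iso.refl (M.rw (M.b x y) z ≫ M.a y x z ≫ M.lw y (M.b x z) ≫ M.lw y (M.b z x) ≫
      M.ai y x z ≫ M.rw (M.b y x) z) ≪⊗≫
    wh (M.rw (M.b x y) z ≫ M.a y x z) (M.lwSyl y x z) (M.ai y x z ≫ M.rw (M.b y x) z) ≪⊗≫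
    wh (M.rw (M.b x y) z) (M.aUnit y x z).symm (M.rw (M.b y x) z) ≪⊗≫
    M.rwSyl x y z

/-- The second sylleptic axiom. -/
def SyllepticAxiom₂ : Prop := ∀ x y z : B,
  Iso.refl (M.lw x (M.b y z) ≫ M.ai x z y ≫ M.rw (M.b x z) y ≫ M.rw (M.b z x) y ≫
      M.a x z y ≫ M.lw x (M.b z y)) ≪⊗≫
    wh (𝟙 _) (M.S x y z) (M.rw (M.b z x) y ≫ M.a x z y ≫ M.lw x (M.b z y)) ≪⊗≫
    wh (M.ai x y z ≫ M.b (M.o x y) z ≫ M.ai z x y) (M.R z x y) (𝟙 _) ≪⊗≫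
    wh (M.ai x y z ≫ M.b (M.o x y) z) (M.aCounit z x y)
      (M.b z (M.o x y) ≫ M.a x y z) ≪⊗≫
    wh (M.ai x y z) (M.syl (M.o x y) z) (M.a x y z) ≪⊗≫
    M.aCounit x y z =
  Iso.refl (M.lw x (M.b y z) ≫ M.ai x z y ≫ M.rw (M.b x z) y ≫ M.rw (M.b z x) y ≫
      M.a x z y ≫ M.lw x (M.b z y)) ≪⊗≫
    wh (M.lw x (M.b y z) ≫ M.ai x z y) (M.rwSyl x z y) (M.a x z y ≫ M.lw x (M.b z y)) ≪⊗≫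
    wh (M.lw x (M.b y z)) (M.aCounit x z y) (M.lw x (M.b z y)) ≪⊗≫
    M.lwSyl x y z

/-- The symmetry axiom. -/
def SymmetryAxiom : Prop := ∀ x y : B,
  Iso.refl (M.b x y ≫ M.b y x ≫ M.b x y) ≪⊗≫ whiskerRightIso (M.syl x y) (M.b x y) ≪⊗≫
      Iso.refl (M.b x y) =
    whiskerLeftIso (M.b x y) (M.syl y x) ≪⊗≫ Iso.refl (M.b x y)

end SymMonData

/-- A symmetric monoidal structure on a bicategory: the three axioms of a monoidal bicategory,
the four axioms of the braiding, the two axioms of the syllepsis, and the symmetry axiom. -/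
structure SymMon (B : Type u) [Bicategory.{w, v} B] extends SymMonData B where
  assoc_axiom : toSymMonData.AssocAxiom
  left_normalization : toSymMonData.LeftNormalization
  right_normalization : toSymMonData.RightNormalization
  braid_axiom₁ : toSymMonData.BraidAxiom₁
  braid_axiom₂ : toSymMonData.BraidAxiom₂
  braid_axiom₃ : toSymMonData.BraidAxiom₃
  braid_axiom₄ : toSymMonData.BraidAxiom₄
  sylleptic_axiom₁ : toSymMonData.SyllepticAxiom₁
  sylleptic_axiom₂ : toSymMonData.SyllepticAxiom₂
  symmetry_axiom : toSymMonData.SymmetryAxiom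

/-! ### Comparison of 1-cells with equal endpoints -/

/-- An invertible 2-cell between 1-cells whose sources and targets are equal. -/
structure Cmp {a b a' b' : B} (f : a ⟶ b) (g : a' ⟶ b') where
  src : a = a'
  tgt : b = b'
  /-- the 2-cell -/
  iso : f ≅ g.cast src.symm tgt.symm

/-- The 2-cell `θ'` corresponds to `θ` under comparisons of the sources and of the targets. -/
def Carries {a b a' b' : B} {f g : a ⟶ b} {f' g' : a' ⟶ b'} (φ : Cmp f f') (ψ : Cmp g g')
    (θ : f ⟶ g) (θ' : f' ⟶ g') : Prop :=
  HEq (φ.iso.inv ≫ θ ≫ ψ.iso.hom) θ'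

namespace Cmp

section

variable {a b c a' b' c' a'' b'' c'' : B}

/-- A 2-cell between parallel 1-cells. -/
def ofIso {f g : a ⟶ b} (i : f ≅ g) : Cmp f g := ⟨rfl, rfl, i⟩

/-- Composition of comparisons. -/
def trans {f : a ⟶ b} {g : a' ⟶ b'} {h : a'' ⟶ b''} (φ : Cmp f g) (ψ : Cmp g h) :
    Cmp f h := by
  obtain ⟨rfl, rfl, i⟩ := φ
  obtain ⟨rfl, rfl, j⟩ := ψ
  exact ⟨rfl, rfl, (show f ≅ g from i) ≪≫ (show g ≅ h from j)⟩

/-- Horizontal composition of comparisons. -/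
def comp {f : a ⟶ b} {g : b ⟶ c} {f' : a' ⟶ b'} {g' : b' ⟶ c'} (φ : Cmp f f')
    (ψ : Cmp g g') : Cmp (f ≫ g) (f' ≫ g') := by
  obtain ⟨rfl, rfl, i⟩ := φ
  obtain ⟨_, rfl, j⟩ := ψ
  exact ⟨rfl, rfl, whiskerRightIso (show f ≅ f' from i) g ≪≫
    whiskerLeftIso f' (show g ≅ g' from j)⟩

/-- The image of a comparison under a pseudofunctor. -/
def map (F : B ⥤ᵖ C) {f : a ⟶ b} {g : a' ⟶ b'} (φ : Cmp f g) :
    Cmp (F.map f) (F.map g) := by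
  obtain ⟨rfl, rfl, i⟩ := φ
  exact ⟨rfl, rfl, F.map₂Iso (show f ≅ g from i)⟩

/-- The comparison of equal 1-cells. -/
def ofHEq {f : a ⟶ b} {g : a' ⟶ b'} (h₁ : a = a') (h₂ : b = b') (h : HEq f g) :
    Cmp f g := by
  subst h₁ h₂
  exact ⟨rfl, rfl, eqToIso (eq_of_heq h)⟩

/-- A comparison is an identity. -/
def IsEq {f : a ⟶ b} {g : a' ⟶ b'} (φ : Cmp f g) : Prop :=
  ∃ h : f = g.cast φ.src.symm φ.tgt.symm, φ.iso = eqToIso h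

theorem IsEq.eq {f : a ⟶ b} {g : a' ⟶ b'} {φ : Cmp f g} (h : φ.IsEq) :
    ∃ (h₁ : a = a') (h₂ : b = b') (h : HEq f g), φ = ofHEq h₁ h₂ h := by
  obtain ⟨rfl, rfl, i⟩ := φ
  obtain ⟨e, e'⟩ := h
  obtain rfl : f = g := e
  exact ⟨rfl, rfl, HEq.rfl, congrArg (Cmp.mk rfl rfl) e'⟩

theorem IsEq.trans {f : a ⟶ b} {g : a' ⟶ b'} {h : a'' ⟶ b''} {φ : Cmp f g} {ψ : Cmp g h}
    (hφ : φ.IsEq) (hψ : ψ.IsEq) : (φ.trans ψ).IsEq := by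
  obtain ⟨rfl, rfl, h, rfl⟩ := hφ.eq
  obtain rfl := eq_of_heq h
  obtain ⟨rfl, rfl, h, rfl⟩ := hψ.eq
  obtain rfl := eq_of_heq h
  exact ⟨rfl, Iso.ext (Category.id_comp _)⟩

theorem IsEq.map (F : B ⥤ᵖ C) {f : a ⟶ b} {g : a' ⟶ b'} {φ : Cmp f g} (h : φ.IsEq) :
    (φ.map F).IsEq := by
  obtain ⟨rfl, rfl, e, rfl⟩ := h.eq
  obtain rfl := eq_of_heq e
  exact ⟨rfl, Iso.ext (F.map₂_id _)⟩

theorem trans_assoc {a₃ b₃ : B} {f : a ⟶ b} {g : a' ⟶ b'} {h : a'' ⟶ b''} {k : a₃ ⟶ b₃}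
    (φ : Cmp f g) (ψ : Cmp g h) (χ : Cmp h k) :
    (φ.trans ψ).trans χ = φ.trans (ψ.trans χ) := by
  obtain ⟨rfl, rfl, i⟩ := φ
  obtain ⟨rfl, rfl, j⟩ := ψ
  obtain ⟨rfl, rfl, k⟩ := χ
  exact congrArg (Cmp.mk rfl rfl) (Iso.trans_assoc _ _ _)

theorem map_trans (F : B ⥤ᵖ C) {f : a ⟶ b} {g : a' ⟶ b'} {h : a'' ⟶ b''} (φ : Cmp f g)
    (ψ : Cmp g h) : (φ.trans ψ).map F = (φ.map F).trans (ψ.map F) := by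
  obtain ⟨rfl, rfl, i⟩ := φ
  obtain ⟨rfl, rfl, j⟩ := ψ
  exact congrArg (Cmp.mk rfl rfl) (Iso.ext (F.map₂_comp _ _))

theorem map_id {f : a ⟶ b} {g : a' ⟶ b'} (φ : Cmp f g) : φ.map (Pseudofunctor.id B) = φ := by
  obtain ⟨rfl, rfl, i⟩ := φ
  rfl

theorem map_comp (F : B ⥤ᵖ C) (G : C ⥤ᵖ D) {f : a ⟶ b} {g : a' ⟶ b'} (φ : Cmp f g) :
    φ.map (F.comp G) = (φ.map F).map G := by
  obtain ⟨rfl, rfl, i⟩ := φ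
  rfl

theorem ofIso_refl_trans {f : a ⟶ b} {g : a' ⟶ b'} (φ : Cmp f g) :
    (ofIso (Iso.refl f)).trans φ = φ := by
  obtain ⟨rfl, rfl, i⟩ := φ
  exact congrArg (Cmp.mk rfl rfl) (Iso.ext (Category.id_comp _))

theorem trans_ofIso_refl {f : a ⟶ b} {g : a' ⟶ b'} (φ : Cmp f g) :
    φ.trans (ofIso (Iso.refl g)) = φ := by
  obtain ⟨rfl, rfl, i⟩ := φ
  exact congrArg (Cmp.mk rfl rfl) (Iso.ext (Category.comp_id _))

theorem id_map_trans {F : B ⥤ᵖ C} {f : a ⟶ b} {p q : C} {g : p ⟶ q} (φ : Cmp (F.map f) g) :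
    (map F (ofIso (Iso.refl f))).trans φ = φ :=
  (congrArg (Cmp.trans · φ) (congrArg (Cmp.mk rfl rfl) (Iso.ext (F.map₂_id _)))).trans
    (ofIso_refl_trans φ)

theorem map_id_trans {f : a ⟶ b} {g : a' ⟶ b'} (φ : Cmp f g) :
    (φ.map (Pseudofunctor.id B)).trans (ofIso (Iso.refl g)) = φ :=
  (trans_ofIso_refl _).trans (map_id φ)

theorem map_trans_assoc {G : C ⥤ᵖ D} {p q p' q' : C} {f : p ⟶ q}
    {g : p' ⟶ q'} {r s : D} {h : r ⟶ s} {r' s' : E} {k : r' ⟶ s'} {H : D ⥤ᵖ E}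
    (φ : Cmp f g) (ψ : Cmp (G.map g) h) (χ : Cmp (H.map h) k) :
    (((φ.map G).trans ψ).map H).trans χ = (φ.map (G.comp H)).trans ((ψ.map H).trans χ) := by
  rw [map_trans, trans_assoc, map_comp]
  rfl

theorem ofHEq_trans {f : a ⟶ b} {g : a' ⟶ b'} {h : a'' ⟶ b''} (h₁ : a = a') (h₂ : b = b')
    (e : HEq f g) (h₁' : a' = a'') (h₂' : b' = b'') (e' : HEq g h) :
    (ofHEq h₁ h₂ e).trans (ofHEq h₁' h₂' e') =
      ofHEq (h₁.trans h₁') (h₂.trans h₂') (e.trans e') := by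
  subst h₁ h₂ h₁' h₂'
  obtain rfl := eq_of_heq e
  obtain rfl := eq_of_heq e'
  exact congrArg (Cmp.mk rfl rfl) (Iso.ext (Category.id_comp _))

theorem map_ofHEq (F : B ⥤ᵖ C) {f : a ⟶ b} {g : a' ⟶ b'} (h₁ : a = a') (h₂ : b = b')
    (e : HEq f g) : (ofHEq h₁ h₂ e).map F =
      ofHEq (congrArg F.obj h₁) (congrArg F.obj h₂) (by subst h₁ h₂; cases e; rfl) := by
  subst h₁ h₂
  obtain rfl := eq_of_heq e
  exact congrArg (Cmp.mk rfl rfl) (Iso.ext (F.map₂_id _))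

theorem carries_trans {f g : a ⟶ b} {f' g' : a' ⟶ b'} {f'' g'' : a'' ⟶ b''} {φ : Cmp f f'}
    {ψ : Cmp g g'} {φ' : Cmp f' f''} {ψ' : Cmp g' g''} {θ : f ⟶ g} {θ' : f' ⟶ g'}
    {θ'' : f'' ⟶ g''} (h : Carries φ ψ θ θ') (h' : Carries φ' ψ' θ' θ'') :
    Carries (φ.trans φ') (ψ.trans ψ') θ θ'' := by
  obtain ⟨rfl, rfl, i⟩ := φ
  obtain ⟨_, _, j⟩ := ψ
  obtain ⟨rfl, rfl, k⟩ := φ'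
  obtain ⟨_, _, l⟩ := ψ'
  obtain rfl := eq_of_heq h
  obtain rfl := eq_of_heq h'
  apply heq_of_eq
  change f ≅ f' at i
  change f' ≅ f'' at k
  change g ≅ g' at j
  change g' ≅ g'' at l
  change (k.inv ≫ i.inv) ≫ θ ≫ (j.hom ≫ l.hom) = k.inv ≫ (i.inv ≫ θ ≫ j.hom) ≫ l.hom
  simp only [Category.assoc]

theorem carries_map (F : B ⥤ᵖ C) {f g : a ⟶ b} {f' g' : a' ⟶ b'} {φ : Cmp f f'}
    {ψ : Cmp g g'} {θ : f ⟶ g} {θ' : f' ⟶ g'} (h : Carries φ ψ θ θ') :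
    Carries (φ.map F) (ψ.map F) (F.map₂ θ) (F.map₂ θ') := by
  obtain ⟨rfl, rfl, i⟩ := φ
  obtain ⟨_, _, j⟩ := ψ
  obtain rfl := eq_of_heq h
  apply heq_of_eq
  exact ((F.map₂_comp _ _).trans (congrArg _ (F.map₂_comp _ _))).symm

theorem carries_refl {f g : a ⟶ b} (θ : f ⟶ g) :
    Carries (ofIso (Iso.refl f)) (ofIso (Iso.refl g)) θ θ :=
  heq_of_eq ((Category.id_comp _).trans (Category.comp_id _))

end

/-- The comparison of the values of equal pseudofunctors. -/
def ofPF {F G : B ⥤ᵖ C} (h : F = G) {a b : B} (f : a ⟶ b) : Cmp (F.map f) (G.map f) :=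
  ofHEq (by rw [h]) (by rw [h]) (by rw [h])

theorem ofPF_trans_map {F G : B ⥤ᵖ C} (h : F = G) {a b a' b' : B} {f : a ⟶ b} {f' : a' ⟶ b'}
    (φ : Cmp f f') : (ofPF h f).trans (φ.map G) = (φ.map F).trans (ofPF h f') := by
  subst h
  exact (ofIso_refl_trans _).trans (trans_ofIso_refl _).symm

/-- The pair of two comparisons. -/
def pair {a b a' b' : B} {c d c' d' : C} {f : a ⟶ b} {f' : a' ⟶ b'} {g : c ⟶ d}
    {g' : c' ⟶ d'} (φ : Cmp f f') (ψ : Cmp g g') :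
    Cmp (B := B × C) (f ×ₘ g) (f' ×ₘ g') := by
  obtain ⟨rfl, rfl, i⟩ := φ
  obtain ⟨rfl, rfl, j⟩ := ψ
  exact ⟨rfl, rfl, Iso.prod (show f ≅ f' from i) (show g ≅ g' from j)⟩

theorem pair_trans {a b a' b' a'' b'' : B} {c d c' d' c'' d'' : C} {f : a ⟶ b} {f' : a' ⟶ b'}
    {f'' : a'' ⟶ b''} {g : c ⟶ d} {g' : c' ⟶ d'} {g'' : c'' ⟶ d''}
    (φ : Cmp f f') (φ' : Cmp f' f'') (ψ : Cmp g g') (ψ' : Cmp g' g'') :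
    (φ.trans φ').pair (ψ.trans ψ') = (φ.pair ψ).trans (φ'.pair ψ') := by
  obtain ⟨rfl, rfl, i⟩ := φ
  obtain ⟨rfl, rfl, j⟩ := ψ
  obtain ⟨rfl, rfl, k⟩ := φ'
  obtain ⟨rfl, rfl, l⟩ := ψ'
  rfl

theorem pair_map (F : B ⥤ᵖ D) (G : C ⥤ᵖ E) {a b a' b' : B} {c d c' d' : C} {f : a ⟶ b}
    {f' : a' ⟶ b'} {g : c ⟶ d} {g' : c' ⟶ d'} (φ : Cmp f f') (ψ : Cmp g g') :
    (φ.map F).pair (ψ.map G) = (φ.pair ψ).map (prodMap F G) := by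
  obtain ⟨rfl, rfl, i⟩ := φ
  obtain ⟨rfl, rfl, j⟩ := ψ
  rfl

end Cmp

section

variable (F : B ⥤ᵖ C) (G : C ⥤ᵖ D)

/-- The comparison of an image of an identity with an identity. -/
def idCmp {a : B} {a' : C} (h : F.obj a = a') : Cmp (F.map (𝟙 a)) (𝟙 a') :=
  (Cmp.ofIso (F.mapId a)).trans (Cmp.ofHEq h h (by rw [h]))

/-- The comparison of the image of a composite of 1-cells. -/
def compCmp {a b c : B} {f : a ⟶ b} {g : b ⟶ c} {a' b' c' : C} {f' : a' ⟶ b'} {g' : b' ⟶ c'}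
    (φ : Cmp (F.map f) f') (ψ : Cmp (F.map g) g') : Cmp (F.map (f ≫ g)) (f' ≫ g') :=
  (Cmp.ofIso (F.mapComp f g)).trans (φ.comp ψ)

theorem idCmp_comp {a : B} {a' : C} {a'' : D} (h : F.obj a = a') (h' : G.obj a' = a'') :
    idCmp (F.comp G) ((congrArg G.obj h).trans h') =
      ((idCmp F h).map G).trans (idCmp G h') := by
  subst h h'
  refine congrArg (Cmp.mk rfl rfl) (Iso.ext ?_)
  change (G.map₂ (F.mapId a).hom ≫ (G.mapId _).hom) ≫ 𝟙 _ =
    G.map₂ ((F.mapId a).hom ≫ 𝟙 _) ≫ (G.mapId _).hom ≫ 𝟙 _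
  rw [Category.comp_id, Category.comp_id, Category.comp_id]

theorem compCmp_comp {a b c : B} {f : a ⟶ b} {g : b ⟶ c} {a' b' c' : C} {f' : a' ⟶ b'}
    {g' : b' ⟶ c'} {a'' b'' c'' : D} {f'' : a'' ⟶ b''} {g'' : b'' ⟶ c''}
    (φ : Cmp (F.map f) f') (ψ : Cmp (F.map g) g') (φ' : Cmp (G.map f') f'')
    (ψ' : Cmp (G.map g') g'') :
    compCmp (F.comp G) ((φ.map G).trans φ') ((ψ.map G).trans ψ') =
      ((compCmp F φ ψ).map G).trans (compCmp G φ' ψ') := by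
  obtain ⟨rfl, rfl, i⟩ := φ
  obtain ⟨_, rfl, j⟩ := ψ
  obtain ⟨rfl, rfl, k⟩ := φ'
  obtain ⟨_, rfl, l⟩ := ψ'
  change F.map f ≅ f' at i
  change G.map f' ≅ f'' at k
  change F.map g ≅ g' at j
  change G.map g' ≅ g'' at l
  refine congrArg (Cmp.mk rfl rfl) (Iso.ext ?_)
  change (G.map₂ (F.mapComp f g).hom ≫ (G.mapComp (F.map f) (F.map g)).hom) ≫
      ((G.map₂ i.hom ≫ k.hom) ▷ G.map (F.map g) ≫ f'' ◁ (G.map₂ j.hom ≫ l.hom)) =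
    G.map₂ ((F.mapComp f g).hom ≫ (i.hom ▷ F.map g ≫ f' ◁ j.hom)) ≫
      ((G.mapComp f' g').hom ≫ (k.hom ▷ G.map g' ≫ f'' ◁ l.hom))
  simp only [PrelaxFunctor.map₂_comp, Pseudofunctor.map₂_whisker_left,
    Pseudofunctor.map₂_whisker_right, comp_whiskerRight, whiskerLeft_comp, Category.assoc,
    Iso.inv_hom_id_assoc, whisker_exchange_assoc]

end


theorem Carries.comp_pf {F : B ⥤ᵖ C} {G : C ⥤ᵖ D} {a b : B} {f g : a ⟶ b} {a' b' : C}
    {f' g' : a' ⟶ b'} {a'' b'' : D} {f'' g'' : a'' ⟶ b''} {φ : Cmp (F.map f) f'}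
    {ψ : Cmp (F.map g) g'} {φ' : Cmp (G.map f') f''} {ψ' : Cmp (G.map g') g''} {θ : f ⟶ g}
    {θ' : f' ⟶ g'} {θ'' : f'' ⟶ g''} {Φ : Cmp ((F.comp G).map f) f''}
    {Ψ : Cmp ((F.comp G).map g) g''} (h : Carries φ ψ (F.map₂ θ) θ')
    (h' : Carries φ' ψ' (G.map₂ θ') θ'') (hΦ : Φ = (φ.map G).trans φ')
    (hΨ : Ψ = (ψ.map G).trans ψ') : Carries Φ Ψ ((F.comp G).map₂ θ) θ'' := by
  subst hΦ hΨ
  exact Cmp.carries_trans (Cmp.carries_map G h) h'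

/-! ### Strictly symmetric monoidal pseudofunctors -/

section

theorem prodMap_comp_prodMap (F : B ⥤ᵖ C) (G : C ⥤ᵖ D) :
    (prodMap F F).comp (prodMap G G) = prodMap (F.comp G) (F.comp G) := by
  simp only [prodMap, comp_pair, ← pf_assoc, pair_fst, pair_snd]

theorem prodMap_id : prodMap (Pseudofunctor.id B) (Pseudofunctor.id B) = Pseudofunctor.id _ := by
  simp only [prodMap, pf_comp_id, pair_eta]

/-- A pseudofunctor which preserves the tensor product and the unit strictly, with comparisons
of the images of the structural 1-cells with the structural 1-cells of the target. -/
structure StrictCells (F : B ⥤ᵖ C) (M : MonCells B) (N : MonCells C) where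
  tensor_eq : M.tensor.comp F = (prodMap F F).comp N.tensor
  unit_eq : F.obj M.e = N.e
  a (x y z : B) : Cmp (F.map (M.a x y z)) (N.a (F.obj x) (F.obj y) (F.obj z))
  ai (x y z : B) : Cmp (F.map (M.ai x y z)) (N.ai (F.obj x) (F.obj y) (F.obj z))
  l (x : B) : Cmp (F.map (M.l x)) (N.l (F.obj x))
  li (x : B) : Cmp (F.map (M.li x)) (N.li (F.obj x))
  r (x : B) : Cmp (F.map (M.r x)) (N.r (F.obj x))
  ri (x : B) : Cmp (F.map (M.ri x)) (N.ri (F.obj x))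
  b (x y : B) : Cmp (F.map (M.b x y)) (N.b (F.obj x) (F.obj y))
  bi (x y : B) : Cmp (F.map (M.bi x y)) (N.bi (F.obj x) (F.obj y))

namespace StrictCells

variable {F : B ⥤ᵖ C} {G : C ⥤ᵖ D} {M : MonCells B} {N : MonCells C} {L : MonCells D}

@[ext]
theorem ext' {c d : StrictCells F M N} (ha : c.a = d.a) (hai : c.ai = d.ai) (hl : c.l = d.l)
    (hli : c.li = d.li) (hr : c.r = d.r) (hri : c.ri = d.ri) (hb : c.b = d.b)
    (hbi : c.bi = d.bi) : c = d := by
  cases c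
  cases d
  cases ha
  cases hai
  cases hl
  cases hli
  cases hr
  cases hri
  cases hb
  cases hbi
  rfl

/-- All comparisons are identities. -/
structure IsStrict (c : StrictCells F M N) : Prop where
  a (x y z : B) : (c.a x y z).IsEq
  ai (x y z : B) : (c.ai x y z).IsEq
  l (x : B) : (c.l x).IsEq
  li (x : B) : (c.li x).IsEq
  r (x : B) : (c.r x).IsEq
  ri (x : B) : (c.ri x).IsEq
  b (x y : B) : (c.b x y).IsEq
  bi (x y : B) : (c.bi x y).IsEq

variable (c : StrictCells F M N) (d : StrictCells G N L)

theorem o_eq (c : StrictCells F M N) (x y : B) : F.obj (M.o x y) = N.o (F.obj x) (F.obj y) :=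
  congrArg (fun K : (B × B) ⥤ᵖ C => K.obj (x, y)) c.tensor_eq

/-- The comparison for a tensor product of 1-cells. -/
def tC {x x' y y' : B} {f : x ⟶ x'} {g : y ⟶ y'} {u u' v v' : C} {f' : u ⟶ u'} {g' : v ⟶ v'}
    (φ : Cmp (F.map f) f') (ψ : Cmp (F.map g) g') : Cmp (F.map (M.m f g)) (N.m f' g') :=
  (Cmp.ofPF c.tensor_eq (f ×ₘ g)).trans ((φ.pair ψ).map N.tensor)

/-! The comparisons at objects which are given up to equality. -/

def aC {x y z : B} {x' y' z' : C} (hx : F.obj x = x') (hy : F.obj y = y') (hz : F.obj z = z') :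
    Cmp (F.map (M.a x y z)) (N.a x' y' z') :=
  (c.a x y z).trans (Cmp.ofHEq (by rw [hx, hy, hz]) (by rw [hx, hy, hz]) (by rw [hx, hy, hz]))

def lC {x : B} {x' : C} (hx : F.obj x = x') : Cmp (F.map (M.l x)) (N.l x') :=
  (c.l x).trans (Cmp.ofHEq (by rw [hx]) (by rw [hx]) (by rw [hx]))

def rC {x : B} {x' : C} (hx : F.obj x = x') : Cmp (F.map (M.r x)) (N.r x') :=
  (c.r x).trans (Cmp.ofHEq (by rw [hx]) (by rw [hx]) (by rw [hx]))

def bC {x y : B} {x' y' : C} (hx : F.obj x = x') (hy : F.obj y = y') :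
    Cmp (F.map (M.b x y)) (N.b x' y') :=
  (c.b x y).trans (Cmp.ofHEq (by rw [hx, hy]) (by rw [hx, hy]) (by rw [hx, hy]))

/-- The trivial comparison. -/
def fC (F : B ⥤ᵖ C) {x x' : B} (f : x ⟶ x') : Cmp (F.map f) (F.map f) := Cmp.ofIso (Iso.refl _)

/-- The identity. -/
def ident (M : MonCells B) : StrictCells (Pseudofunctor.id B) M M where
  tensor_eq := by rw [prodMap_id, pf_comp_id, pf_id_comp]
  unit_eq := rfl
  a x y z := Cmp.ofIso (Iso.refl (M.a x y z))
  ai x y z := Cmp.ofIso (Iso.refl (M.ai x y z))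
  l x := Cmp.ofIso (Iso.refl (M.l x))
  li x := Cmp.ofIso (Iso.refl (M.li x))
  r x := Cmp.ofIso (Iso.refl (M.r x))
  ri x := Cmp.ofIso (Iso.refl (M.ri x))
  b x y := Cmp.ofIso (Iso.refl (M.b x y))
  bi x y := Cmp.ofIso (Iso.refl (M.bi x y))

/-- Composition. -/
def comp : StrictCells (F.comp G) M L where
  tensor_eq := by
    rw [← pf_assoc, c.tensor_eq, pf_assoc, d.tensor_eq, ← pf_assoc, prodMap_comp_prodMap]
  unit_eq := (congrArg G.obj c.unit_eq).trans d.unit_eq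
  a x y z := ((c.a x y z).map G).trans (d.a _ _ _)
  ai x y z := ((c.ai x y z).map G).trans (d.ai _ _ _)
  l x := ((c.l x).map G).trans (d.l _)
  li x := ((c.li x).map G).trans (d.li _)
  r x := ((c.r x).map G).trans (d.r _)
  ri x := ((c.ri x).map G).trans (d.ri _)
  b x y := ((c.b x y).map G).trans (d.b _ _)
  bi x y := ((c.bi x y).map G).trans (d.bi _ _)

theorem fC_comp {x x' : B} (f : x ⟶ x') :
    fC (F.comp G) f = ((fC F f).map G).trans (fC G (F.map f)) := by
  refine congrArg (Cmp.mk rfl rfl) (Iso.ext ?_)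
  exact ((congrArg (· ≫ _) (G.map₂_id _)).trans (Category.comp_id _)).symm

theorem glue {p₁ q₁ p₂ q₂ p₃ q₃ p₄ q₄ p₅ q₅ p₆ q₆ : D} {f₁ : p₁ ⟶ q₁} {f₂ : p₂ ⟶ q₂}
    {f₃ : p₃ ⟶ q₃} {f₄ : p₄ ⟶ q₄} {f₅ : p₅ ⟶ q₅} {f₆ : p₆ ⟶ q₆} (X : Cmp f₁ f₂)
    (X' : Cmp f₂ f₃) (Y : Cmp f₃ f₄) (Z : Cmp f₄ f₅) (W : Cmp f₂ f₆) (V : Cmp f₆ f₄)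
    (h : X'.trans Y = W.trans V) :
    (X.trans X').trans (Y.trans Z) = (X.trans W).trans (V.trans Z) := by
  rw [Cmp.trans_assoc, ← Cmp.trans_assoc X', h, Cmp.trans_assoc, Cmp.trans_assoc]

theorem tC_comp {x x' y y' : B} {f : x ⟶ x'} {g : y ⟶ y'} {u u' v v' : C} {f' : u ⟶ u'}
    {g' : v ⟶ v'} {p p' q q' : D} {f'' : p ⟶ p'} {g'' : q ⟶ q'} {φ : Cmp (F.map f) f'}
    {ψ : Cmp (F.map g) g'} {φ' : Cmp (G.map f') f''} {ψ' : Cmp (G.map g') g''}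
    {Φ : Cmp ((F.comp G).map f) f''} {Ψ : Cmp ((F.comp G).map g) g''}
    (hΦ : Φ = (φ.map G).trans φ') (hΨ : Ψ = (ψ.map G).trans ψ') :
    (c.comp d).tC Φ Ψ = ((c.tC φ ψ).map G).trans (d.tC φ' ψ') := by
  subst hΦ hΨ
  have h : Cmp.ofPF (c.comp d).tensor_eq (f ×ₘ g) =
      ((Cmp.ofPF c.tensor_eq (f ×ₘ g)).map G).trans
        (Cmp.ofPF d.tensor_eq (F.map f ×ₘ F.map g)) := by
    rw [Cmp.ofPF, Cmp.ofPF, Cmp.map_ofHEq]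
    exact (Cmp.ofHEq_trans _ _ _ _ _ _).symm
  have h' : (((φ.pair ψ).map N.tensor).map G).trans (Cmp.ofPF d.tensor_eq (f' ×ₘ g')) =
      (Cmp.ofPF d.tensor_eq (F.map f ×ₘ F.map g)).trans
        (((φ.map G).pair (ψ.map G)).map L.tensor) := by
    rw [Cmp.pair_map]
    exact ((congrArg (Cmp.trans · _) (Cmp.map_comp _ _ _).symm).trans
      (Cmp.ofPF_trans_map d.tensor_eq (φ.pair ψ)).symm).trans
      (congrArg (Cmp.trans _) (Cmp.map_comp _ _ _))
  have e₁ : (((φ.map G).trans φ').pair ((ψ.map G).trans ψ')).map L.tensor =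
      (((φ.map G).pair (ψ.map G)).map L.tensor).trans ((φ'.pair ψ').map L.tensor) :=
    (congrArg (Cmp.map L.tensor) (Cmp.pair_trans _ _ _ _)).trans (Cmp.map_trans _ _ _)
  have e₂ := Cmp.map_trans G (Cmp.ofPF c.tensor_eq (f ×ₘ g)) ((φ.pair ψ).map N.tensor)
  exact ((congrArg (Cmp.trans _) e₁).trans (congrArg (Cmp.trans · _) h)).trans
    ((glue _ _ _ _ _ _ h'.symm).trans (congrArg (Cmp.trans · _) e₂.symm))

theorem compCmp_comp' {x y z : B} {f : x ⟶ y} {g : y ⟶ z} {x' y' z' : C} {f' : x' ⟶ y'}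
    {g' : y' ⟶ z'} {x'' y'' z'' : D} {f'' : x'' ⟶ y''} {g'' : y'' ⟶ z''} {φ : Cmp (F.map f) f'}
    {ψ : Cmp (F.map g) g'} {φ' : Cmp (G.map f') f''} {ψ' : Cmp (G.map g') g''}
    {Φ : Cmp ((F.comp G).map f) f''} {Ψ : Cmp ((F.comp G).map g) g''}
    (hΦ : Φ = (φ.map G).trans φ') (hΨ : Ψ = (ψ.map G).trans ψ') :
    compCmp (F.comp G) Φ Ψ = ((compCmp F φ ψ).map G).trans (compCmp G φ' ψ') := by
  subst hΦ hΨ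
  exact compCmp_comp F G φ ψ φ' ψ'

theorem trans_refl' {x y : B} {f : x ⟶ y} {x' y' : C} {f' : x' ⟶ y'} {x'' y'' : D}
    {f'' : x'' ⟶ y''} (φ : Cmp (F.map f) f') (φ' : Cmp (G.map f') f'') (h₁ : x'' = x'')
    (h₂ : y'' = y'') (h : HEq f'' f'') :
    ((φ.map G).trans φ').trans (Cmp.ofHEq h₁ h₂ h) =
      ((φ.trans (Cmp.ofIso (Iso.refl f'))).map G).trans
        (φ'.trans (Cmp.ofIso (Iso.refl f''))) := by
  rw [Cmp.trans_ofIso_refl, Cmp.trans_ofIso_refl]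
  exact Cmp.trans_ofIso_refl _

theorem aC_comp {x y z : B} {x' y' z' : C} {x'' y'' z'' : D} (hx : F.obj x = x')
    (hy : F.obj y = y') (hz : F.obj z = z') (hx' : G.obj x' = x'') (hy' : G.obj y' = y'')
    (hz' : G.obj z' = z'') :
    (c.comp d).aC ((congrArg G.obj hx).trans hx') ((congrArg G.obj hy).trans hy')
      ((congrArg G.obj hz).trans hz') = ((c.aC hx hy hz).map G).trans (d.aC hx' hy' hz') := by
  subst hx hy hz hx' hy' hz'
  exact trans_refl' _ _ _ _ _

theorem lC_comp {x : B} {x' : C} {x'' : D} (hx : F.obj x = x') (hx' : G.obj x' = x'') :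
    (c.comp d).lC ((congrArg G.obj hx).trans hx') = ((c.lC hx).map G).trans (d.lC hx') := by
  subst hx hx'
  exact trans_refl' _ _ _ _ _

theorem rC_comp {x : B} {x' : C} {x'' : D} (hx : F.obj x = x') (hx' : G.obj x' = x'') :
    (c.comp d).rC ((congrArg G.obj hx).trans hx') = ((c.rC hx).map G).trans (d.rC hx') := by
  subst hx hx'
  exact trans_refl' (F := F) (G := G) (c.r x) (d.r _) rfl rfl HEq.rfl

theorem bC_comp {x y : B} {x' y' : C} {x'' y'' : D} (hx : F.obj x = x') (hy : F.obj y = y')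
    (hx' : G.obj x' = x'') (hy' : G.obj y' = y'') :
    (c.comp d).bC ((congrArg G.obj hx).trans hx') ((congrArg G.obj hy).trans hy') =
      ((c.bC hx hy).map G).trans (d.bC hx' hy') := by
  subst hx hy hx' hy'
  exact trans_refl' _ _ _ _ _

theorem tC_ident {x x' y y' : B} {f : x ⟶ x'} {g : y ⟶ y'}
    {Φ : Cmp ((Pseudofunctor.id B).map f) f} {Ψ : Cmp ((Pseudofunctor.id B).map g) g}
    (hΦ : Φ = Cmp.ofIso (Iso.refl f)) (hΨ : Ψ = Cmp.ofIso (Iso.refl g)) :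
    (ident M).tC Φ Ψ = Cmp.ofIso (Iso.refl (M.m f g)) := by
  subst hΦ hΨ
  refine congrArg (Cmp.mk rfl rfl) (Iso.ext ?_)
  exact (Category.id_comp _).trans (M.tensor.map₂_id (f ×ₘ g))

theorem compCmp_ident {x y z : B} {f : x ⟶ y} {g : y ⟶ z}
    {Φ : Cmp ((Pseudofunctor.id B).map f) f} {Ψ : Cmp ((Pseudofunctor.id B).map g) g}
    (hΦ : Φ = Cmp.ofIso (Iso.refl f)) (hΨ : Ψ = Cmp.ofIso (Iso.refl g)) :
    compCmp (Pseudofunctor.id B) Φ Ψ = Cmp.ofIso (Iso.refl (f ≫ g)) := by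
  subst hΦ hΨ
  refine congrArg (Cmp.mk rfl rfl) (Iso.ext ?_)
  change 𝟙 (f ≫ g) ≫ (𝟙 f ▷ g ≫ f ◁ 𝟙 g) = 𝟙 (f ≫ g)
  rw [id_whiskerRight, whiskerLeft_id, Category.id_comp, Category.id_comp]

theorem idCmp_ident (x : B) (h : (Pseudofunctor.id B).obj x = x) :
    idCmp (Pseudofunctor.id B) (a := x) (a' := x) h = Cmp.ofIso (Iso.refl (𝟙 x)) :=
  congrArg (Cmp.mk rfl rfl) (Iso.ext (Category.id_comp _))

theorem ofHEq_ident {x y : B} (f : x ⟶ y) (h₁ : x = x) (h₂ : y = y) (h : HEq f f) :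
    (Cmp.ofIso (Iso.refl f)).trans (Cmp.ofHEq h₁ h₂ h) = Cmp.ofIso (Iso.refl f) :=
  Cmp.trans_ofIso_refl _

theorem carries_ident {x y : B} {f g : x ⟶ y} (θ : f ⟶ g)
    {Φ : Cmp ((Pseudofunctor.id B).map f) f} {Ψ : Cmp ((Pseudofunctor.id B).map g) g}
    (hΦ : Φ = Cmp.ofIso (Iso.refl f)) (hΨ : Ψ = Cmp.ofIso (Iso.refl g)) :
    Carries Φ Ψ ((Pseudofunctor.id B).map₂ θ) θ := by
  subst hΦ hΨ
  exact Cmp.carries_refl θ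

end StrictCells

end

namespace StrictCells

variable {F : B ⥤ᵖ C} {M : MonCells B} {N : MonCells C} (c : StrictCells F M N)

/-- The comparison of the image of an identity. -/
abbrev iC (F : B ⥤ᵖ C) (x : B) : Cmp (F.map (𝟙 x)) (𝟙 (F.obj x)) := idCmp F rfl

/-- The comparison of the image of the identity of the unit object. -/
abbrev uC : Cmp (F.map (𝟙 M.e)) (𝟙 N.e) := idCmp F c.unit_eq

/-- The comparison of the image of the identity of a tensor product. -/
abbrev oC (x y : B) : Cmp (F.map (𝟙 (M.o x y))) (𝟙 (N.o (F.obj x) (F.obj y))) :=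
  idCmp F (c.o_eq x y)

end StrictCells

open StrictCells in
/-- A *strictly symmetric monoidal pseudofunctor* structure on `F`: the tensor product and the
unit are preserved strictly, and the comparisons of the structural 1-cells are compatible with
the pseudonaturality of the structural equivalences, with their units and counits, and with all
the structural modifications. -/
structure StrictSymMon (F : B ⥤ᵖ C) (S : SymMon B) (T : SymMon C) extends
    StrictCells F S.toMonCells T.toMonCells where
  map_aSq {x y z x' y' z' : B} (f : x ⟶ x') (g : y ⟶ y') (h : z ⟶ z') :
    Carries
      (compCmp F (toStrictCells.tC (toStrictCells.tC (fC F f) (fC F g)) (fC F h)) (a x' y' z'))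
      (compCmp F (a x y z) (toStrictCells.tC (fC F f) (toStrictCells.tC (fC F g) (fC F h))))
      (F.map₂ (S.aSq f g h).hom) (T.aSq (F.map f) (F.map g) (F.map h)).hom
  map_aiSq {x y z x' y' z' : B} (f : x ⟶ x') (g : y ⟶ y') (h : z ⟶ z') :
    Carries
      (compCmp F (toStrictCells.tC (fC F f) (toStrictCells.tC (fC F g) (fC F h))) (ai x' y' z'))
      (compCmp F (ai x y z) (toStrictCells.tC (toStrictCells.tC (fC F f) (fC F g)) (fC F h)))
      (F.map₂ (S.aiSq f g h).hom) (T.aiSq (F.map f) (F.map g) (F.map h)).hom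
  map_lSq {x x' : B} (f : x ⟶ x') :
    Carries (compCmp F (toStrictCells.tC toStrictCells.uC (fC F f)) (l x'))
      (compCmp F (l x) (fC F f)) (F.map₂ (S.lSq f).hom) (T.lSq (F.map f)).hom
  map_liSq {x x' : B} (f : x ⟶ x') :
    Carries (compCmp F (fC F f) (li x'))
      (compCmp F (li x) (toStrictCells.tC toStrictCells.uC (fC F f)))
      (F.map₂ (S.liSq f).hom) (T.liSq (F.map f)).hom
  map_rSq {x x' : B} (f : x ⟶ x') :
    Carries (compCmp F (fC F f) (r x'))
      (compCmp F (r x) (toStrictCells.tC (fC F f) toStrictCells.uC))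
      (F.map₂ (S.rSq f).hom) (T.rSq (F.map f)).hom
  map_riSq {x x' : B} (f : x ⟶ x') :
    Carries (compCmp F (toStrictCells.tC (fC F f) toStrictCells.uC) (ri x'))
      (compCmp F (ri x) (fC F f)) (F.map₂ (S.riSq f).hom) (T.riSq (F.map f)).hom
  map_bSq {x y x' y' : B} (f : x ⟶ x') (g : y ⟶ y') :
    Carries (compCmp F (toStrictCells.tC (fC F f) (fC F g)) (b x' y'))
      (compCmp F (b x y) (toStrictCells.tC (fC F g) (fC F f)))
      (F.map₂ (S.bSq f g).hom) (T.bSq (F.map f) (F.map g)).hom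
  map_biSq {x y x' y' : B} (f : x ⟶ x') (g : y ⟶ y') :
    Carries (compCmp F (toStrictCells.tC (fC F g) (fC F f)) (bi x' y'))
      (compCmp F (bi x y) (toStrictCells.tC (fC F f) (fC F g)))
      (F.map₂ (S.biSq f g).hom) (T.biSq (F.map f) (F.map g)).hom
  map_aUnit (x y z : B) :
    Carries (idCmp F ((toStrictCells.o_eq (S.o x y) z).trans
        (congrArg (T.o · (F.obj z)) (toStrictCells.o_eq x y))))
      (compCmp F (a x y z) (ai x y z)) (F.map₂ (S.aUnit x y z).hom) (T.aUnit _ _ _).hom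
  map_aCounit (x y z : B) :
    Carries (compCmp F (ai x y z) (a x y z))
      (idCmp F ((toStrictCells.o_eq x (S.o y z)).trans
        (congrArg (T.o (F.obj x)) (toStrictCells.o_eq y z))))
      (F.map₂ (S.aCounit x y z).hom) (T.aCounit _ _ _).hom
  map_lUnit (x : B) :
    Carries (idCmp F ((toStrictCells.o_eq S.e x).trans (congrArg (T.o · (F.obj x)) unit_eq)))
      (compCmp F (l x) (li x)) (F.map₂ (S.lUnit x)) (T.lUnit _)
  map_lCounit (x : B) :
    Carries (compCmp F (li x) (l x)) (iC F x) (F.map₂ (S.lCounit x)) (T.lCounit _)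
  map_rUnit (x : B) :
    Carries (iC F x) (compCmp F (r x) (ri x)) (F.map₂ (S.rUnit x)) (T.rUnit _)
  map_rCounit (x : B) :
    Carries (compCmp F (ri x) (r x))
      (idCmp F ((toStrictCells.o_eq x S.e).trans (congrArg (T.o (F.obj x)) unit_eq)))
      (F.map₂ (S.rCounit x)) (T.rCounit _)
  map_bUnit (x y : B) :
    Carries (toStrictCells.oC x y) (compCmp F (b x y) (bi x y)) (F.map₂ (S.bUnit x y))
      (T.bUnit _ _)
  map_bCounit (x y : B) :
    Carries (compCmp F (bi x y) (b x y)) (toStrictCells.oC y x) (F.map₂ (S.bCounit x y))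
      (T.bCounit _ _)
  map_pi (x y z w : B) :
    Carries
      (compCmp F (toStrictCells.tC (a x y z) (iC F w))
        (compCmp F (toStrictCells.aC rfl (toStrictCells.o_eq y z) rfl)
          (toStrictCells.tC (iC F x) (a y z w))))
      (compCmp F (toStrictCells.aC (toStrictCells.o_eq x y) rfl rfl)
        (toStrictCells.aC rfl rfl (toStrictCells.o_eq z w)))
      (F.map₂ (S.pi x y z w).hom) (T.pi _ _ _ _).hom
  map_mu (x y : B) :
    Carries
      (compCmp F (toStrictCells.tC (r x) (iC F y))
        (compCmp F (toStrictCells.aC rfl unit_eq rfl) (toStrictCells.tC (iC F x) (l y))))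
      (toStrictCells.oC x y)
      (F.map₂ (S.mu x y).hom) (T.mu _ _).hom
  map_lam (x y : B) :
    Carries (toStrictCells.tC (l x) (iC F y))
      (compCmp F (toStrictCells.aC unit_eq rfl rfl) (toStrictCells.lC (toStrictCells.o_eq x y)))
      (F.map₂ (S.lam x y).hom) (T.lam _ _).hom
  map_rho (x y : B) :
    Carries (toStrictCells.tC (iC F x) (r y))
      (compCmp F (toStrictCells.rC (toStrictCells.o_eq x y)) (toStrictCells.aC rfl rfl unit_eq))
      (F.map₂ (S.rho x y).hom) (T.rho _ _).hom
  map_R (x y z : B) :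
    Carries
      (compCmp F (toStrictCells.tC (b x y) (iC F z))
        (compCmp F (a y x z) (toStrictCells.tC (iC F y) (b x z))))
      (compCmp F (a x y z)
        (compCmp F (toStrictCells.bC rfl (toStrictCells.o_eq y z)) (a y z x)))
      (F.map₂ (S.R x y z).hom) (T.R _ _ _).hom
  map_S (x y z : B) :
    Carries
      (compCmp F (toStrictCells.tC (iC F x) (b y z))
        (compCmp F (ai x z y) (toStrictCells.tC (b x z) (iC F y))))
      (compCmp F (ai x y z)
        (compCmp F (toStrictCells.bC (toStrictCells.o_eq x y) rfl) (ai z x y)))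
      (F.map₂ (S.S x y z).hom) (T.S _ _ _).hom
  map_syl (x y : B) :
    Carries (compCmp F (b x y) (b y x)) (toStrictCells.oC x y) (F.map₂ (S.syl x y).hom)
      (T.syl _ _).hom

namespace StrictSymMon

open StrictCells

variable {F : B ⥤ᵖ C} {G : C ⥤ᵖ D} {S : SymMon B} {T : SymMon C} {U : SymMon D}

theorem ext' {c d : StrictSymMon F S T} (h : c.toStrictCells = d.toStrictCells) : c = d := by
  cases c
  cases d
  cases h
  rfl

/-- The identity. -/
def ident (S : SymMon B) : StrictSymMon (Pseudofunctor.id B) S S where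
  toStrictCells := StrictCells.ident S.toMonCells
  map_aSq f g h := carries_ident _ (compCmp_ident (tC_ident (tC_ident rfl rfl) rfl) rfl)
    (compCmp_ident rfl (tC_ident rfl (tC_ident rfl rfl)))
  map_aiSq f g h := carries_ident _ (compCmp_ident (tC_ident rfl (tC_ident rfl rfl)) rfl)
    (compCmp_ident rfl (tC_ident (tC_ident rfl rfl) rfl))
  map_lSq f := carries_ident _ (compCmp_ident (tC_ident (idCmp_ident _ _) rfl) rfl)
    (compCmp_ident rfl rfl)
  map_liSq f := carries_ident _ (compCmp_ident rfl rfl)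
    (compCmp_ident rfl (tC_ident (idCmp_ident _ _) rfl))
  map_rSq f := carries_ident _ (compCmp_ident rfl rfl)
    (compCmp_ident rfl (tC_ident rfl (idCmp_ident _ _)))
  map_riSq f := carries_ident _ (compCmp_ident (tC_ident rfl (idCmp_ident _ _)) rfl)
    (compCmp_ident rfl rfl)
  map_bSq f g := carries_ident _ (compCmp_ident (tC_ident rfl rfl) rfl)
    (compCmp_ident rfl (tC_ident rfl rfl))
  map_biSq f g := carries_ident _ (compCmp_ident (tC_ident rfl rfl) rfl)
    (compCmp_ident rfl (tC_ident rfl rfl))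
  map_aUnit x y z := carries_ident _ (idCmp_ident _ _) (compCmp_ident rfl rfl)
  map_aCounit x y z := carries_ident _ (compCmp_ident rfl rfl) (idCmp_ident _ _)
  map_lUnit x := carries_ident _ (idCmp_ident _ _) (compCmp_ident rfl rfl)
  map_lCounit x := carries_ident _ (compCmp_ident rfl rfl) (idCmp_ident _ _)
  map_rUnit x := carries_ident _ (idCmp_ident _ _) (compCmp_ident rfl rfl)
  map_rCounit x := carries_ident _ (compCmp_ident rfl rfl) (idCmp_ident _ _)
  map_bUnit x y := carries_ident _ (idCmp_ident _ _) (compCmp_ident rfl rfl)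
  map_bCounit x y := carries_ident _ (compCmp_ident rfl rfl) (idCmp_ident _ _)
  map_pi x y z w := carries_ident _
    (compCmp_ident (tC_ident rfl (idCmp_ident _ _)) (compCmp_ident (ofHEq_ident _ _ _ _)
      (tC_ident (idCmp_ident _ _) rfl)))
    (compCmp_ident (ofHEq_ident _ _ _ _) (ofHEq_ident _ _ _ _))
  map_mu x y := carries_ident _
    (compCmp_ident (tC_ident rfl (idCmp_ident _ _)) (compCmp_ident (ofHEq_ident _ _ _ _)
      (tC_ident (idCmp_ident _ _) rfl))) (idCmp_ident _ _)
  map_lam x y := carries_ident _ (tC_ident rfl (idCmp_ident _ _))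
    (compCmp_ident (ofHEq_ident _ _ _ _) (ofHEq_ident _ _ _ _))
  map_rho x y := carries_ident _ (tC_ident (idCmp_ident _ _) rfl)
    (compCmp_ident (ofHEq_ident _ _ _ _) (ofHEq_ident _ _ _ _))
  map_R x y z := carries_ident _
    (compCmp_ident (tC_ident rfl (idCmp_ident _ _)) (compCmp_ident rfl
      (tC_ident (idCmp_ident _ _) rfl)))
    (compCmp_ident rfl (compCmp_ident (ofHEq_ident _ _ _ _) rfl))
  map_S x y z := carries_ident _
    (compCmp_ident (tC_ident (idCmp_ident _ _) rfl) (compCmp_ident rfl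
      (tC_ident rfl (idCmp_ident _ _))))
    (compCmp_ident rfl (compCmp_ident (ofHEq_ident _ _ _ _) rfl))
  map_syl x y := carries_ident _ (compCmp_ident rfl rfl) (idCmp_ident _ _)

/-- Composition. -/
def comp (c : StrictSymMon F S T) (d : StrictSymMon G T U) : StrictSymMon (F.comp G) S U where
  toStrictCells := c.toStrictCells.comp d.toStrictCells
  map_aSq f g h := Carries.comp_pf (c.map_aSq f g h) (d.map_aSq _ _ _)
    (compCmp_comp' (tC_comp _ _ (tC_comp _ _ (fC_comp f) (fC_comp g)) (fC_comp h)) rfl)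
    (compCmp_comp' rfl (tC_comp _ _ (fC_comp f) (tC_comp _ _ (fC_comp g) (fC_comp h))))
  map_aiSq f g h := Carries.comp_pf (c.map_aiSq f g h) (d.map_aiSq _ _ _)
    (compCmp_comp' (tC_comp _ _ (fC_comp f) (tC_comp _ _ (fC_comp g) (fC_comp h))) rfl)
    (compCmp_comp' rfl (tC_comp _ _ (tC_comp _ _ (fC_comp f) (fC_comp g)) (fC_comp h)))
  map_lSq f := Carries.comp_pf (c.map_lSq f) (d.map_lSq _)
    (compCmp_comp' (tC_comp _ _ (idCmp_comp F G _ _) (fC_comp f)) rfl)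
    (compCmp_comp' rfl (fC_comp f))
  map_liSq f := Carries.comp_pf (c.map_liSq f) (d.map_liSq _)
    (compCmp_comp' (fC_comp f) rfl)
    (compCmp_comp' rfl (tC_comp _ _ (idCmp_comp F G _ _) (fC_comp f)))
  map_rSq f := Carries.comp_pf (c.map_rSq f) (d.map_rSq _)
    (compCmp_comp' (fC_comp f) rfl)
    (compCmp_comp' rfl (tC_comp _ _ (fC_comp f) (idCmp_comp F G _ _)))
  map_riSq f := Carries.comp_pf (c.map_riSq f) (d.map_riSq _)
    (compCmp_comp' (tC_comp _ _ (fC_comp f) (idCmp_comp F G _ _)) rfl)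
    (compCmp_comp' rfl (fC_comp f))
  map_bSq f g := Carries.comp_pf (c.map_bSq f g) (d.map_bSq _ _)
    (compCmp_comp' (tC_comp _ _ (fC_comp f) (fC_comp g)) rfl)
    (compCmp_comp' rfl (tC_comp _ _ (fC_comp g) (fC_comp f)))
  map_biSq f g := Carries.comp_pf (c.map_biSq f g) (d.map_biSq _ _)
    (compCmp_comp' (tC_comp _ _ (fC_comp g) (fC_comp f)) rfl)
    (compCmp_comp' rfl (tC_comp _ _ (fC_comp f) (fC_comp g)))
  map_aUnit x y z := Carries.comp_pf (c.map_aUnit x y z) (d.map_aUnit _ _ _)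
    (idCmp_comp F G _ _) (compCmp_comp' rfl rfl)
  map_aCounit x y z := Carries.comp_pf (c.map_aCounit x y z) (d.map_aCounit _ _ _)
    (compCmp_comp' rfl rfl) (idCmp_comp F G _ _)
  map_lUnit x := Carries.comp_pf (c.map_lUnit x) (d.map_lUnit _)
    (idCmp_comp F G _ _) (compCmp_comp' rfl rfl)
  map_lCounit x := Carries.comp_pf (c.map_lCounit x) (d.map_lCounit _)
    (compCmp_comp' rfl rfl) (idCmp_comp F G _ _)
  map_rUnit x := Carries.comp_pf (c.map_rUnit x) (d.map_rUnit _)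
    (idCmp_comp F G _ _) (compCmp_comp' rfl rfl)
  map_rCounit x := Carries.comp_pf (c.map_rCounit x) (d.map_rCounit _)
    (compCmp_comp' rfl rfl) (idCmp_comp F G _ _)
  map_bUnit x y := Carries.comp_pf (c.map_bUnit x y) (d.map_bUnit _ _)
    (idCmp_comp F G _ _) (compCmp_comp' rfl rfl)
  map_bCounit x y := Carries.comp_pf (c.map_bCounit x y) (d.map_bCounit _ _)
    (compCmp_comp' rfl rfl) (idCmp_comp F G _ _)
  map_pi x y z w := Carries.comp_pf (c.map_pi x y z w) (d.map_pi _ _ _ _)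
    (compCmp_comp' (tC_comp _ _ rfl (idCmp_comp F G _ _))
      (compCmp_comp' (aC_comp _ _ _ _ _ _ _ _) (tC_comp _ _ (idCmp_comp F G _ _) rfl)))
    (compCmp_comp' (aC_comp _ _ _ _ _ _ _ _) (aC_comp _ _ _ _ _ _ _ _))
  map_mu x y := Carries.comp_pf (c.map_mu x y) (d.map_mu _ _)
    (compCmp_comp' (tC_comp _ _ rfl (idCmp_comp F G _ _))
      (compCmp_comp' (aC_comp _ _ _ _ _ _ _ _) (tC_comp _ _ (idCmp_comp F G _ _) rfl)))
    (idCmp_comp F G _ _)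
  map_lam x y := Carries.comp_pf (c.map_lam x y) (d.map_lam _ _)
    (tC_comp _ _ rfl (idCmp_comp F G _ _))
    (compCmp_comp' (aC_comp _ _ _ _ _ _ _ _) (lC_comp _ _ _ _))
  map_rho x y := Carries.comp_pf (c.map_rho x y) (d.map_rho _ _)
    (tC_comp _ _ (idCmp_comp F G _ _) rfl)
    (compCmp_comp' (rC_comp _ _ _ _) (aC_comp _ _ _ _ _ _ _ _))
  map_R x y z := Carries.comp_pf (c.map_R x y z) (d.map_R _ _ _)
    (compCmp_comp' (tC_comp _ _ rfl (idCmp_comp F G _ _))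
      (compCmp_comp' rfl (tC_comp _ _ (idCmp_comp F G _ _) rfl)))
    (compCmp_comp' rfl (compCmp_comp' (bC_comp _ _ _ _ _ _) rfl))
  map_S x y z := Carries.comp_pf (c.map_S x y z) (d.map_S _ _ _)
    (compCmp_comp' (tC_comp _ _ (idCmp_comp F G _ _) rfl)
      (compCmp_comp' rfl (tC_comp _ _ rfl (idCmp_comp F G _ _))))
    (compCmp_comp' rfl (compCmp_comp' (bC_comp _ _ _ _ _ _) rfl))
  map_syl x y := Carries.comp_pf (c.map_syl x y) (d.map_syl _ _)
    (compCmp_comp' rfl rfl) (idCmp_comp F G _ _)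

end StrictSymMon

/-- A symmetric monoidal 2-category: a symmetric monoidal bicategory whose underlying bicategory
is a 2-category. -/
structure SMTwoCatPs where
  /-- the underlying type of objects -/
  carrier : Type u
  [bicategory : Bicategory.{w, v} carrier]
  [strict : Bicategory.Strict carrier]
  /-- the symmetric monoidal structure -/
  str : SymMon carrier

attribute [instance] SMTwoCatPs.bicategory SMTwoCatPs.strict

/-- A strictly symmetric monoidal pseudofunctor. -/
structure SMTwoCatPs.Hom (X Y : SMTwoCatPs.{w, v, u}) where
  /-- the underlying pseudofunctor -/
  toPF : X.carrier ⥤ᵖ Y.carrier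
  /-- the preservation of the symmetric monoidal structure -/
  str : StrictSymMon toPF X.str Y.str

theorem SMTwoCatPs.Hom.ext' {X Y : SMTwoCatPs.{w, v, u}} {F G : SMTwoCatPs.Hom X Y}
    (h : F.toPF = G.toPF) (ha : HEq F.str.a G.str.a) (hai : HEq F.str.ai G.str.ai)
    (hl : HEq F.str.l G.str.l) (hli : HEq F.str.li G.str.li) (hr : HEq F.str.r G.str.r)
    (hri : HEq F.str.ri G.str.ri) (hb : HEq F.str.b G.str.b) (hbi : HEq F.str.bi G.str.bi) :
    F = G := by
  obtain ⟨F, c⟩ := F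
  obtain ⟨G, d⟩ := G
  obtain rfl : F = G := h
  exact congrArg _ (StrictSymMon.ext' (StrictCells.ext' (eq_of_heq ha) (eq_of_heq hai)
    (eq_of_heq hl) (eq_of_heq hli) (eq_of_heq hr) (eq_of_heq hri) (eq_of_heq hb)
    (eq_of_heq hbi)))

/-- The category of symmetric monoidal 2-categories and strictly symmetric monoidal
pseudofunctors. -/
instance : Category SMTwoCatPs.{w, v, u} where
  Hom := SMTwoCatPs.Hom
  id X := ⟨Pseudofunctor.id X.carrier, StrictSymMon.ident X.str⟩
  comp F G := ⟨F.toPF.comp G.toPF, F.str.comp G.str⟩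
  id_comp F := SMTwoCatPs.Hom.ext' (pf_id_comp _)
    (heq_of_eq (by funext x y z; exact Cmp.id_map_trans (F := F.toPF) (F.str.a x y z)))
    (heq_of_eq (by funext x y z; exact Cmp.id_map_trans (F := F.toPF) (F.str.ai x y z)))
    (heq_of_eq (by funext x; exact Cmp.id_map_trans (F := F.toPF) (F.str.l x)))
    (heq_of_eq (by funext x; exact Cmp.id_map_trans (F := F.toPF) (F.str.li x)))
    (heq_of_eq (by funext x; exact Cmp.id_map_trans (F := F.toPF) (F.str.r x)))
    (heq_of_eq (by funext x; exact Cmp.id_map_trans (F := F.toPF) (F.str.ri x)))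
    (heq_of_eq (by funext x y; exact Cmp.id_map_trans (F := F.toPF) (F.str.b x y)))
    (heq_of_eq (by funext x y; exact Cmp.id_map_trans (F := F.toPF) (F.str.bi x y)))
  comp_id F := SMTwoCatPs.Hom.ext' (pf_comp_id _)
    (heq_of_eq (by funext x y z; exact Cmp.map_id_trans (F.str.a x y z)))
    (heq_of_eq (by funext x y z; exact Cmp.map_id_trans (F.str.ai x y z)))
    (heq_of_eq (by funext x; exact Cmp.map_id_trans (F.str.l x)))
    (heq_of_eq (by funext x; exact Cmp.map_id_trans (F.str.li x)))
    (heq_of_eq (by funext x; exact Cmp.map_id_trans (F.str.r x)))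
    (heq_of_eq (by funext x; exact Cmp.map_id_trans (F.str.ri x)))
    (heq_of_eq (by funext x y; exact Cmp.map_id_trans (F.str.b x y)))
    (heq_of_eq (by funext x y; exact Cmp.map_id_trans (F.str.bi x y)))
  assoc F G H := SMTwoCatPs.Hom.ext' (pf_assoc _ _ _)
    (heq_of_eq (by funext x y z; exact Cmp.map_trans_assoc (F.str.a x y z) (G.str.a _ _ _) (H.str.a _ _ _)))
    (heq_of_eq (by funext x y z; exact Cmp.map_trans_assoc (F.str.ai x y z) (G.str.ai _ _ _) (H.str.ai _ _ _)))
    (heq_of_eq (by funext x; exact Cmp.map_trans_assoc (F.str.l x) (G.str.l _) (H.str.l _)))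
    (heq_of_eq (by funext x; exact Cmp.map_trans_assoc (F.str.li x) (G.str.li _) (H.str.li _)))
    (heq_of_eq (by funext x; exact Cmp.map_trans_assoc (F.str.r x) (G.str.r _) (H.str.r _)))
    (heq_of_eq (by funext x; exact Cmp.map_trans_assoc (F.str.ri x) (G.str.ri _) (H.str.ri _)))
    (heq_of_eq (by funext x y; exact Cmp.map_trans_assoc (F.str.b x y) (G.str.b _ _) (H.str.b _ _)))
    (heq_of_eq (by funext x y; exact Cmp.map_trans_assoc (F.str.bi x y) (G.str.bi _ _) (H.str.bi _ _)))

/-- The underlying 2-category of a symmetric monoidal 2-category. -/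
def SMTwoCatPs.forget : SMTwoCatPs.{w, v, u} ⥤ TwoCatPs.{w, v, u} where
  obj X := ⟨X.carrier⟩
  map F := F.toPF

/-- The strictly symmetric monoidal pseudofunctors which are strict functors: the underlying
pseudofunctor is a 2-functor, and all comparisons are identities. -/
def SMTwoCatPs.strictFunctors : MorphismProperty SMTwoCatPs.{w, v, u} :=
  fun _ _ F => IsTwoFunctor F.toPF ∧ F.str.toStrictCells.IsStrict

instance : SMTwoCatPs.strictFunctors.{w, v, u}.IsMultiplicative where
  id_mem X := ⟨isTwoFunctor_id, by constructor <;> intros <;> exact ⟨rfl, rfl⟩⟩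
  comp_mem F G hF hG := ⟨hF.1.comp hG.1,
    { a := fun x y z => ((hF.2.a x y z).map _).trans (hG.2.a _ _ _)
      ai := fun x y z => ((hF.2.ai x y z).map _).trans (hG.2.ai _ _ _)
      l := fun x => ((hF.2.l x).map _).trans (hG.2.l _)
      li := fun x => ((hF.2.li x).map _).trans (hG.2.li _)
      r := fun x => ((hF.2.r x).map _).trans (hG.2.r _)
      ri := fun x => ((hF.2.ri x).map _).trans (hG.2.ri _)
      b := fun x y => ((hF.2.b x y).map _).trans (hG.2.b _ _)
      bi := fun x y => ((hF.2.bi x y).map _).trans (hG.2.bi _ _) }⟩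

/-- The category of symmetric monoidal 2-categories and strict functors. -/
abbrev SMTwoCatS := WideSubcategory SMTwoCatPs.strictFunctors.{w, v, u}

/-! ### Choices of multiplication -/

namespace Operad

variable (P : Operad.{w, v, u})

variable {P} in
/-- A family with one element. -/
def fam₁ {k : ℕ} (q : P.obj k) : ∀ i : Fin 1, P.obj (![k] i)
  | 0 => q

variable {P} in
/-- A family with two elements. -/
def fam₂ {k₀ k₁ : ℕ} (q : P.obj k₀) (r : P.obj k₁) : ∀ i : Fin 2, P.obj (![k₀, k₁] i)
  | 0 => q
  | 1 => r

variable {P} in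
/-- A family with three elements. -/
def fam₃ {k₀ k₁ k₂ : ℕ} (q : P.obj k₀) (r : P.obj k₁) (s : P.obj k₂) :
    ∀ i : Fin 3, P.obj (![k₀, k₁, k₂] i)
  | 0 => q
  | 1 => r
  | 2 => s

/-- `γ(p; q)` -/
def g₁ {k m : ℕ} (h : ∑ i, ![k] i = m) (p : P.obj 1) (q : P.obj k) : P.obj m :=
  (P.gam ![k] h).obj (p, fam₁ q)

/-- `γ(p; q, r)` -/
def g₂ {k₀ k₁ m : ℕ} (h : ∑ i, ![k₀, k₁] i = m) (p : P.obj 2) (q : P.obj k₀) (r : P.obj k₁) :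
    P.obj m :=
  (P.gam ![k₀, k₁] h).obj (p, fam₂ q r)

/-- `γ(p; q, r, s)` -/
def g₃ {k₀ k₁ k₂ m : ℕ} (h : ∑ i, ![k₀, k₁, k₂] i = m) (p : P.obj 3) (q : P.obj k₀)
    (r : P.obj k₁) (s : P.obj k₂) : P.obj m :=
  (P.gam ![k₀, k₁, k₂] h).obj (p, fam₃ q r s)

theorem assoc_obj {n : ℕ} (k : Fin n → ℕ) {m : ℕ} (h : ∑ i, k i = m) (l : ∀ i, Fin (k i) → ℕ)
    (s : Fin n → ℕ) (hs : ∀ i, ∑ j, l i j = s i) {N : ℕ} (hN : ∑ i, s i = N)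
    (p : P.obj n) (q : ∀ i, P.obj (k i)) (r : ∀ i j, P.obj (l i j))
    (l' : Fin m → ℕ) (hl' : ∀ i j, l' (blocks k h ⟨i, j⟩) = l i j) (hN' : ∑ a, l' a = N)
    (r' : ∀ a, P.obj (l' a)) (hr' : ∀ i j, HEq (r' (blocks k h ⟨i, j⟩)) (r i j))
    (u : ∀ i, P.obj (s i)) (hu : ∀ i, (P.gam (l i) (hs i)).obj (q i, r i) = u i) :
    (P.gam l' hN').obj ((P.gam k h).obj (p, q), r') = (P.gam s hN).obj (p, u) := by
  obtain rfl : u = fun i => (P.gam (l i) (hs i)).obj (q i, r i) := funext fun i => (hu i).symm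
  have e : l' = fun a : Fin m => l ((blocks k h).symm a).1 ((blocks k h).symm a).2 := by
    funext a
    obtain ⟨⟨i, j⟩, rfl⟩ := (blocks k h).surjective a
    rw [hl']
    exact congrArg (fun z : (i : Fin n) × Fin (k i) => l z.1 z.2)
      ((blocks k h).symm_apply_apply ⟨i, j⟩).symm
  subst e
  have e' : r' = fun a : Fin m => r ((blocks k h).symm a).1 ((blocks k h).symm a).2 := by
    funext a
    obtain ⟨⟨i, j⟩, rfl⟩ := (blocks k h).surjective a
    refine eq_of_heq ((hr' i j).trans ?_)
    exact congr_arg_heq (fun z : (i : Fin n) × Fin (k i) => r z.1 z.2)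
      ((blocks k h).symm_apply_apply ⟨i, j⟩).symm
  subst e'
  exact congrArg (fun K => K.obj ((p, q), r)) (P.gam_assoc k h l s hs hN hN')

theorem gam_congr {n : ℕ} {k k' : Fin n → ℕ} {m : ℕ} (h : ∑ i, k i = m) (h' : ∑ i, k' i = m)
    (p : P.obj n) (q : ∀ i, P.obj (k i)) (q' : ∀ i, P.obj (k' i)) (hk : ∀ i, k i = k' i)
    (hq : ∀ i, HEq (q i) (q' i)) : (P.gam k h).obj (p, q) = (P.gam k' h').obj (p, q') := by
  obtain rfl : k = k' := funext hk
  obtain rfl : q = q' := funext fun i => eq_of_heq (hq i)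
  rfl

theorem one_obj {k : ℕ} (h : ∑ i, ![k] i = k) (q : P.obj k) : P.g₁ h P.one q = q :=
  (P.gam_congr h (by simp) _ _ (fun _ => q) (fun i => by fin_cases i; rfl)
    (fun i => by fin_cases i; rfl)).trans
  (congrArg (fun K => K.obj q) (P.one_gam (n := k) (by simp)))

theorem obj_one₂ (h : ∑ i, ![1, 1] i = 2) (p : P.obj 2) : P.g₂ h p P.one P.one = p :=
  (P.gam_congr h (by simp) _ _ (fun _ => P.one) (fun i => by fin_cases i <;> rfl)
    (fun i => by fin_cases i <;> rfl)).trans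
  (congrArg (fun K => K.obj p) (P.gam_one (n := 2) (by simp)))

variable (t : P.obj 2) (i : P.obj 0)

/-- `γ(t; t, 𝟙)` -/
def tl : P.obj 3 := P.g₂ rfl t t P.one

/-- `γ(t; 𝟙, t)` -/
def tr : P.obj 3 := P.g₂ rfl t P.one t

/-- `γ(t; t, 𝟙) ∘ (q, r, s) = γ(t; γ(t; q, r), s)` -/
theorem tl_obj {a b c ab N : ℕ} (hab : ∑ i, ![a, b] i = ab) (h : ∑ i, ![ab, c] i = N)
    (h' : ∑ i, ![a, b, c] i = N) (q : P.obj a) (r : P.obj b) (s : P.obj c) :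
    P.g₃ h' (P.tl t) q r s = P.g₂ h t (P.g₂ hab t q r) s := by
  refine P.assoc_obj ![2, 1] rfl
    (fun i => match i with | 0 => ![a, b] | 1 => ![c]) ![ab, c]
    (fun i => match i with | 0 => hab | 1 => Fin.sum_univ_one _) h t _
    (fun i => match i with | 0 => fam₂ q r | 1 => fam₁ s) ![a, b, c] ?_ h' _ ?_ _ ?_
  · intro i j
    fin_cases i <;> fin_cases j <;> rfl
  · intro i j
    fin_cases i <;> fin_cases j <;> rfl
  · intro i
    fin_cases i
    · rfl
    · exact P.one_obj (by simp) s

/-- `γ(t; 𝟙, t) ∘ (q, r, s) = γ(t; q, γ(t; r, s))` -/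
theorem tr_obj {a b c bc N : ℕ} (hbc : ∑ i, ![b, c] i = bc) (h : ∑ i, ![a, bc] i = N)
    (h' : ∑ i, ![a, b, c] i = N) (q : P.obj a) (r : P.obj b) (s : P.obj c) :
    P.g₃ h' (P.tr t) q r s = P.g₂ h t q (P.g₂ hbc t r s) := by
  refine P.assoc_obj ![1, 2] rfl
    (fun i => match i with | 0 => ![a] | 1 => ![b, c]) ![a, bc]
    (fun i => match i with | 0 => Fin.sum_univ_one _ | 1 => hbc) h t _
    (fun i => match i with | 0 => fam₁ q | 1 => fam₂ r s) ![a, b, c] ?_ h' _ ?_ _ ?_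
  · intro i j
    fin_cases i <;> fin_cases j <;> rfl
  · intro i j
    fin_cases i <;> fin_cases j <;> rfl
  · intro i
    fin_cases i
    · exact P.one_obj (by simp) q
    · rfl

theorem zero_obj {k : Fin 0 → ℕ} (h : ∑ i, k i = 0) (q : ∀ i, P.obj (k i)) :
    (P.gam k h).obj (i, q) = i :=
  (P.gam_congr h rfl _ _ (fun _ => P.one) (fun j => j.elim0) (fun j => j.elim0)).trans
  (congrArg (fun K => K.obj i) (P.gam_one (n := 0) rfl))

/-- `γ(t; i, 𝟙) ∘ q = γ(t; i, q)` -/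
theorem unit_left_obj {c : ℕ} (h : ∑ i, ![c] i = c) (h' : ∑ i, ![0, c] i = c) (q : P.obj c) :
    P.g₁ h (P.g₂ rfl t i P.one) q = P.g₂ h' t i q := by
  refine P.assoc_obj ![0, 1] rfl
    (fun i => match i with | 0 => fun j => j.elim0 | 1 => ![c]) ![0, c]
    (fun i => match i with | 0 => rfl | 1 => Fin.sum_univ_one _) h' t _
    (fun i => match i with | 0 => fun j => j.elim0 | 1 => fam₁ q) ![c] ?_ h _ ?_ _ ?_
  · intro i j
    fin_cases i
    · exact j.elim0
    · fin_cases j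
      rfl
  · intro i j
    fin_cases i
    · exact j.elim0
    · fin_cases j
      rfl
  · intro i
    fin_cases i
    · exact P.zero_obj _ _ _
    · exact P.one_obj (by simp) q

/-- `γ(t; 𝟙, i) ∘ q = γ(t; q, i)` -/
theorem unit_right_obj {c : ℕ} (h : ∑ i, ![c] i = c) (h' : ∑ i, ![c, 0] i = c) (q : P.obj c) :
    P.g₁ h (P.g₂ rfl t P.one i) q = P.g₂ h' t q i := by
  refine P.assoc_obj ![1, 0] rfl
    (fun i => match i with | 0 => ![c] | 1 => fun j => j.elim0) ![c, 0]
    (fun i => match i with | 0 => Fin.sum_univ_one _ | 1 => rfl) h' t _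
    (fun i => match i with | 0 => fam₁ q | 1 => fun j => j.elim0) ![c] ?_ h _ ?_ _ ?_
  · intro i j
    fin_cases i
    · fin_cases j
      rfl
    · exact j.elim0
  · intro i j
    fin_cases i
    · fin_cases j
      rfl
    · exact j.elim0
  · intro i
    fin_cases i
    · exact P.one_obj (by simp) q
    · exact P.zero_obj _ _ _

/-- The permutation `(12)` on two or three letters. -/
def σ₁₂ {n : ℕ} : Equiv.Perm (Fin (n + 2)) := Equiv.swap 0 1

/-- The permutation `(23)`. -/
def σ₂₃ : Equiv.Perm (Fin 3) := Equiv.swap 1 2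

/-- The permutation `(132)`, i.e. `1 ↦ 3 ↦ 2 ↦ 1`. -/
def σ₁₃₂ : Equiv.Perm (Fin 3) := Equiv.swap 1 2 * Equiv.swap 0 1

/-- The permutation `(123)`, i.e. `1 ↦ 2 ↦ 3 ↦ 1`. -/
def σ₁₂₃ : Equiv.Perm (Fin 3) := Equiv.swap 0 1 * Equiv.swap 1 2

/-- `p · σ` -/
abbrev dot {n : ℕ} (p : P.obj n) (σ : Equiv.Perm (Fin n)) : P.obj n := (P.act σ).obj p

theorem dot_one {n : ℕ} (p : P.obj n) : P.dot p 1 = p := congrArg (fun K => K.obj p) (P.act_one n)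

theorem dot_mul {n : ℕ} (p : P.obj n) (σ τ : Equiv.Perm (Fin n)) :
    P.dot p (σ * τ) = P.dot (P.dot p σ) τ := congrArg (fun K => K.obj p) (P.act_mul σ τ)

theorem sumPerm₂₁ : sumPerm ![2, 1] (rfl : _ = 3)
    (fun i => match i with | 0 => (σ₁₂ : Equiv.Perm (Fin 2)) | 1 => 1) = σ₁₂ := by
  ext j
  fin_cases j <;> rfl

theorem sumPerm₁₂ : sumPerm ![1, 2] (rfl : _ = 3)
    (fun i => match i with | 0 => 1 | 1 => (σ₁₂ : Equiv.Perm (Fin 2))) = σ₂₃ := by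
  ext j
  fin_cases j <;> rfl

theorem blockPerm₂₁ : blockPerm (σ₁₂ : Equiv.Perm (Fin 2)) ![2, 1] (rfl : _ = 3) rfl = σ₁₃₂ := by
  ext j
  fin_cases j <;> rfl

theorem blockPerm₁₂ : blockPerm (σ₁₂ : Equiv.Perm (Fin 2)) ![1, 2] (rfl : _ = 3) rfl = σ₁₂₃ := by
  ext j
  fin_cases j <;> rfl

theorem braid_left_obj : P.g₂ rfl t (P.dot t σ₁₂) P.one = P.dot (P.tl t) σ₁₂ := by
  refine (P.gam_congr rfl rfl _ _ _ (fun _ => rfl) ?_).trans ((congrArg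
    (fun K => K.obj (t, fam₂ t P.one)) (P.act_gam ![2, 1] rfl
    (fun i => match i with | 0 => (σ₁₂ : Equiv.Perm (Fin 2)) | 1 => 1))).trans
    (congrArg (P.dot (P.tl t)) sumPerm₂₁))
  intro i
  fin_cases i
  · rfl
  · exact heq_of_eq (P.dot_one _).symm

theorem braid_right_obj : P.g₂ rfl t P.one (P.dot t σ₁₂) = P.dot (P.tr t) σ₂₃ := by
  refine (P.gam_congr rfl rfl _ _ _ (fun _ => rfl) ?_).trans ((congrArg
    (fun K => K.obj (t, fam₂ P.one t)) (P.act_gam ![1, 2] rfl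
    (fun i => match i with | 0 => 1 | 1 => (σ₁₂ : Equiv.Perm (Fin 2))))).trans
    (congrArg (P.dot (P.tr t)) sumPerm₁₂))
  intro i
  fin_cases i
  · exact heq_of_eq (P.dot_one _).symm
  · rfl

theorem dot_obj_left : P.g₂ rfl (P.dot t σ₁₂) P.one t = P.dot (P.tl t) σ₁₃₂ := by
  refine (P.gam_congr (k := ![1, 2]) (k' := fun i => ![2, 1] ((σ₁₂ : Equiv.Perm (Fin 2)) i)) rfl rfl
    (P.dot t σ₁₂) (fam₂ P.one t)
    (fun i => fam₂ t P.one ((σ₁₂ : Equiv.Perm (Fin 2)) i)) ?_ ?_).trans ((congrArg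
    (fun K => K.obj (t, fam₂ t P.one)) (P.gam_act (n := 2) σ₁₂ ![2, 1] rfl rfl)).trans
    (congrArg (P.dot (P.tl t)) blockPerm₂₁))
  · intro i
    fin_cases i <;> rfl
  · intro i
    fin_cases i <;> rfl

theorem dot_obj_right : P.g₂ rfl (P.dot t σ₁₂) t P.one = P.dot (P.tr t) σ₁₂₃ := by
  refine (P.gam_congr (k := ![2, 1]) (k' := fun i => ![1, 2] ((σ₁₂ : Equiv.Perm (Fin 2)) i)) rfl rfl
    (P.dot t σ₁₂) (fam₂ t P.one)
    (fun i => fam₂ P.one t ((σ₁₂ : Equiv.Perm (Fin 2)) i)) ?_ ?_).trans ((congrArg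
    (fun K => K.obj (t, fam₂ P.one t)) (P.gam_act (n := 2) σ₁₂ ![1, 2] rfl rfl)).trans
    (congrArg (P.dot (P.tr t)) blockPerm₁₂))
  · intro i
    fin_cases i <;> rfl
  · intro i
    fin_cases i <;> rfl

/-! The 1-cells `γ(f; g)`, `γ(f; g, g')`, `γ(f; g, g', g'')` and `f · σ`. -/

variable {P} in
def fam₁Map {k : ℕ} {q q' : P.obj k} (g : q ⟶ q') : fam₁ q ⟶ fam₁ q'
  | 0 => g

variable {P} in
def fam₂Map {k₀ k₁ : ℕ} {q q' : P.obj k₀} {r r' : P.obj k₁} (g : q ⟶ q') (g' : r ⟶ r') :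
    fam₂ q r ⟶ fam₂ q' r'
  | 0 => g
  | 1 => g'

variable {P} in
def fam₃Map {k₀ k₁ k₂ : ℕ} {q q' : P.obj k₀} {r r' : P.obj k₁} {s s' : P.obj k₂} (g : q ⟶ q')
    (g' : r ⟶ r') (g'' : s ⟶ s') : fam₃ q r s ⟶ fam₃ q' r' s'
  | 0 => g
  | 1 => g'
  | 2 => g''

def g₁Map {k m : ℕ} (h : ∑ i, ![k] i = m) {p p' : P.obj 1} {q q' : P.obj k} (f : p ⟶ p')
    (g : q ⟶ q') : P.g₁ h p q ⟶ P.g₁ h p' q' :=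
  (P.gam ![k] h).map (f ×ₘ fam₁Map g)

def g₂Map {k₀ k₁ m : ℕ} (h : ∑ i, ![k₀, k₁] i = m) {p p' : P.obj 2} {q q' : P.obj k₀}
    {r r' : P.obj k₁} (f : p ⟶ p') (g : q ⟶ q') (g' : r ⟶ r') :
    P.g₂ h p q r ⟶ P.g₂ h p' q' r' :=
  (P.gam ![k₀, k₁] h).map (f ×ₘ fam₂Map g g')

def g₃Map {k₀ k₁ k₂ m : ℕ} (h : ∑ i, ![k₀, k₁, k₂] i = m) {p p' : P.obj 3} {q q' : P.obj k₀}
    {r r' : P.obj k₁} {s s' : P.obj k₂} (f : p ⟶ p') (g : q ⟶ q') (g' : r ⟶ r')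
    (g'' : s ⟶ s') : P.g₃ h p q r s ⟶ P.g₃ h p' q' r' s' :=
  (P.gam ![k₀, k₁, k₂] h).map (f ×ₘ fam₃Map g g' g'')

abbrev dotMap {n : ℕ} {p q : P.obj n} (f : p ⟶ q) (σ : Equiv.Perm (Fin n)) :
    P.dot p σ ⟶ P.dot q σ := (P.act σ).map f

end Operad

namespace Operad

variable (P : Operad.{w, v, u}) (t : P.obj 2) (i : P.obj 0)

theorem pi_obj₁ : P.g₃ (m := 4) rfl (P.tl t) P.one t P.one = P.g₂ rfl t (P.tr t) P.one :=
  P.tl_obj t rfl rfl rfl _ _ _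

theorem pi_obj₂ : P.g₃ (m := 4) rfl (P.tr t) P.one t P.one = P.g₂ rfl t P.one (P.tl t) :=
  P.tr_obj t rfl rfl rfl _ _ _

theorem pi_obj₃ : P.g₃ (m := 4) rfl (P.tl t) t P.one P.one = P.g₂ rfl t (P.tl t) P.one :=
  P.tl_obj t rfl rfl rfl _ _ _

theorem pi_obj₄ : P.g₃ (m := 4) rfl (P.tr t) P.one P.one t = P.g₂ rfl t P.one (P.tr t) :=
  P.tr_obj t rfl rfl rfl _ _ _

theorem pi_obj₅ : P.g₃ (m := 4) rfl (P.tr t) t P.one P.one =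
    P.g₃ rfl (P.tl t) P.one P.one t :=
  (P.tr_obj t (rfl : ∑ i, ![1, 1] i = 2) rfl rfl t P.one P.one).trans
    ((congrArg (P.g₂ rfl t t) (P.obj_one₂ rfl t)).trans
      ((congrArg (P.g₂ rfl t · t) (P.obj_one₂ rfl t).symm).trans
        (P.tl_obj t (rfl : ∑ i, ![1, 1] i = 2) rfl rfl P.one P.one t).symm))

theorem mu_obj₁ : P.g₃ (m := 2) rfl (P.tl t) P.one i P.one =
    P.g₂ rfl t (P.g₂ rfl t P.one i) P.one :=
  P.tl_obj t rfl rfl rfl _ _ _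

theorem mu_obj₂ : P.g₃ (m := 2) rfl (P.tr t) P.one i P.one =
    P.g₂ rfl t P.one (P.g₂ rfl t i P.one) :=
  P.tr_obj t rfl rfl rfl _ _ _

theorem lam_obj₁ : P.g₃ (m := 2) rfl (P.tl t) i P.one P.one =
    P.g₂ rfl t (P.g₂ rfl t i P.one) P.one :=
  P.tl_obj t rfl rfl rfl _ _ _

theorem lam_obj₂ : P.g₃ (m := 2) rfl (P.tr t) i P.one P.one =
    P.g₁ rfl (P.g₂ rfl t i P.one) t :=
  (P.tr_obj t (rfl : ∑ i, ![1, 1] i = 2) rfl rfl i P.one P.one).trans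
    ((congrArg (P.g₂ rfl t i) (P.obj_one₂ rfl t)).trans (P.unit_left_obj t i rfl rfl t).symm)

theorem lam_obj₃ : P.g₁ (m := 2) rfl P.one t = P.g₂ rfl t P.one P.one :=
  (P.one_obj rfl t).trans (P.obj_one₂ rfl t).symm

theorem rho_obj₁ : P.g₃ (m := 2) rfl (P.tr t) P.one P.one i =
    P.g₂ rfl t P.one (P.g₂ rfl t P.one i) :=
  P.tr_obj t rfl rfl rfl _ _ _

theorem rho_obj₂ : P.g₁ rfl (P.g₂ rfl t P.one i) t =
    P.g₃ (m := 2) rfl (P.tl t) P.one P.one i :=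
  (P.unit_right_obj t i rfl rfl t).trans
    ((congrArg (P.g₂ rfl t · i) (P.obj_one₂ rfl t).symm).trans
      (P.tl_obj t (rfl : ∑ i, ![1, 1] i = 2) rfl rfl P.one P.one i).symm)

theorem R_obj : P.dot (P.dot (P.tr t) σ₂₃) σ₁₂ = P.dot (P.tr t) σ₁₃₂ :=
  (P.dot_mul (P.tr t) _ _).symm

theorem S_obj : P.dot (P.dot (P.tl t) σ₁₂) σ₂₃ = P.dot (P.tl t) σ₁₂₃ :=
  (P.dot_mul (P.tl t) _ _).symm

theorem v_obj : P.dot (P.dot t σ₁₂) σ₁₂ = t :=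
  (P.dot_mul t σ₁₂ σ₁₂).symm.trans
    ((congrArg (P.dot t) (Equiv.swap_mul_self 0 1)).trans (P.dot_one t))

variable {P t} in
/-- `γ(𝟙; b, 𝟙) : γ(t; t, 𝟙) ⟶ γ(t; t, 𝟙) · (12)` -/
def braidLeft (b : t ⟶ P.dot t σ₁₂) : P.tl t ⟶ P.dot (P.tl t) σ₁₂ :=
  Quiver.Hom.cast (u := P.tl t) rfl (P.braid_left_obj t) (P.g₂Map rfl (𝟙 t) b (𝟙 P.one))

variable {P t} in
/-- `γ(𝟙; 𝟙, b) : γ(t; 𝟙, t) ⟶ γ(t; 𝟙, t) · (23)` -/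
def braidRight (b : t ⟶ P.dot t σ₁₂) : P.tr t ⟶ P.dot (P.tr t) σ₂₃ :=
  Quiver.Hom.cast (u := P.tr t) rfl (P.braid_right_obj t) (P.g₂Map rfl (𝟙 t) (𝟙 P.one) b)

variable {P t} in
/-- `γ(b; 𝟙, 𝟙) : γ(t; 𝟙, t) ⟶ γ(t; t, 𝟙) · (132)` -/
def dotLeft (b : t ⟶ P.dot t σ₁₂) : P.tr t ⟶ P.dot (P.tl t) σ₁₃₂ :=
  Quiver.Hom.cast (u := P.tr t) rfl (P.dot_obj_left t) (P.g₂Map rfl b (𝟙 P.one) (𝟙 t))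

variable {P t} in
/-- `γ(b; 𝟙, 𝟙) : γ(t; t, 𝟙) ⟶ γ(t; 𝟙, t) · (123)` -/
def dotRight (b : t ⟶ P.dot t σ₁₂) : P.tl t ⟶ P.dot (P.tr t) σ₁₂₃ :=
  Quiver.Hom.cast (u := P.tl t) rfl (P.dot_obj_right t) (P.g₂Map rfl b (𝟙 t) (𝟙 P.one))

end Operad

/-- A *choice of multiplication* in an operad. -/
structure ChoiceOfMult (P : Operad.{w, v, u}) where
  i : P.obj 0
  t : P.obj 2
  /-- `γ(t; t, 𝟙) ≃ γ(t; 𝟙, t)` -/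
  α : Bicategory.Equivalence (P.tl t) (P.tr t)
  /-- `γ(t; i, 𝟙) ≃ 𝟙` -/
  l : Bicategory.Equivalence (P.g₂ (m := 1) rfl t i P.one) P.one
  /-- `𝟙 ≃ γ(t; 𝟙, i)` -/
  r : Bicategory.Equivalence P.one (P.g₂ (m := 1) rfl t P.one i)
  π : P.g₂Map (m := 4) rfl (𝟙 t) α.hom (𝟙 P.one) ≫
      (P.g₃Map (m := 4) rfl α.hom (𝟙 P.one) (𝟙 t) (𝟙 P.one)).cast (P.pi_obj₁ t) (P.pi_obj₂ t) ≫
        P.g₂Map (m := 4) rfl (𝟙 t) (𝟙 P.one) α.hom ≅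
    (P.g₃Map (m := 4) rfl α.hom (𝟙 t) (𝟙 P.one) (𝟙 P.one)).cast (P.pi_obj₃ t) (P.pi_obj₅ t) ≫
      (P.g₃Map (m := 4) rfl α.hom (𝟙 P.one) (𝟙 P.one) (𝟙 t)).cast rfl (P.pi_obj₄ t)
  μ : P.g₂Map (m := 2) rfl (𝟙 t) r.hom (𝟙 P.one) ≫
      (P.g₃Map (m := 2) rfl α.hom (𝟙 P.one) (𝟙 i) (𝟙 P.one)).cast (P.mu_obj₁ t i) (P.mu_obj₂ t i) ≫
        P.g₂Map (m := 2) rfl (𝟙 t) (𝟙 P.one) l.hom ≅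
    𝟙 (P.g₂ (m := 2) rfl t P.one P.one)
  lam : P.g₂Map (m := 2) rfl (𝟙 t) l.hom (𝟙 P.one) ≅
    (P.g₃Map (m := 2) rfl α.hom (𝟙 i) (𝟙 P.one) (𝟙 P.one)).cast (P.lam_obj₁ t i) (P.lam_obj₂ t i) ≫
      (P.g₁Map (m := 2) rfl l.hom (𝟙 t)).cast rfl (P.lam_obj₃ t)
  ρ : P.g₂Map (m := 2) rfl (𝟙 t) (𝟙 P.one) r.hom ≅
    (P.g₁Map (m := 2) rfl r.hom (𝟙 t)).cast (P.lam_obj₃ t) (P.rho_obj₂ t i) ≫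
      (P.g₃Map (m := 2) rfl α.hom (𝟙 P.one) (𝟙 P.one) (𝟙 i)).cast rfl (P.rho_obj₁ t i)
  /-- `t ≃ t · (12)` -/
  β : Bicategory.Equivalence t (P.dot t Operad.σ₁₂)
  /-- `R_{-|--}` -/
  R : Operad.braidLeft β.hom ≫ P.dotMap α.hom Operad.σ₁₂ ≫
      (P.dotMap (Operad.braidRight β.hom) Operad.σ₁₂).cast rfl (P.R_obj t) ≅
    α.hom ≫ Operad.dotLeft β.hom ≫ P.dotMap α.hom Operad.σ₁₃₂
  /-- `R_{--|-}` -/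
  S : Operad.braidRight β.hom ≫ P.dotMap α.inv Operad.σ₂₃ ≫
      (P.dotMap (Operad.braidLeft β.hom) Operad.σ₂₃).cast rfl (P.S_obj t) ≅
    α.inv ≫ Operad.dotRight β.hom ≫ P.dotMap α.inv Operad.σ₁₂₃
  v : β.hom ≫ (P.dotMap β.hom Operad.σ₁₂).cast rfl (P.v_obj t) ≅ 𝟙 t

/-! ### The symmetric monoidal structure determined by a choice of multiplication -/

/-- Two 1-cells are equal. -/
structure Same {a b a' b' : B} (f : a ⟶ b) (g : a' ⟶ b') : Prop where
  src : a = a'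
  tgt : b = b'
  heq : HEq f g

/-- The identity comparison of equal 1-cells. -/
def Same.cmp {a b a' b' : B} {f : a ⟶ b} {g : a' ⟶ b'} (h : Same f g) : Cmp f g :=
  Cmp.ofHEq h.src h.tgt h.heq

theorem Same.trans {a b a' b' a'' b'' : B} {f : a ⟶ b} {g : a' ⟶ b'} {h : a'' ⟶ b''}
    (i : Same f g) (j : Same g h) : Same f h :=
  ⟨i.src.trans j.src, i.tgt.trans j.tgt, i.heq.trans j.heq⟩

theorem Same.of_pf {F G : B ⥤ᵖ C} (h : F = G) {a b : B} (f : a ⟶ b) :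
    Same (F.map f) (G.map f) := by
  subst h
  exact ⟨rfl, rfl, HEq.rfl⟩

theorem Same.map {a b a' b' : B} {f : a ⟶ b} {g : a' ⟶ b'} (h : Same f g) (F : B ⥤ᵖ C) :
    Same (F.map f) (F.map g) := by
  obtain ⟨rfl, rfl, h⟩ := h
  obtain rfl := eq_of_heq h
  exact ⟨rfl, rfl, HEq.rfl⟩

theorem Same.of_cast {a b a' b' : B} (f : a ⟶ b) (h : a = a') (h' : b = b') :
    Same (f.cast h h') f := by
  subst h h'
  exact ⟨rfl, rfl, HEq.rfl⟩

theorem Same.pi {ι : Type t} {A : ι → Type u} [∀ i, Bicategory.{w, v} (A i)]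
    {a b a' b' : ∀ i, A i} {f : a ⟶ b} {g : a' ⟶ b'} (h : ∀ i, Same (f i) (g i)) :
    Same f g := by
  obtain rfl : a = a' := funext fun i => (h i).src
  obtain rfl : b = b' := funext fun i => (h i).tgt
  exact ⟨rfl, rfl, heq_of_eq (funext fun i => eq_of_heq (h i).heq)⟩

theorem Same.refl {a b : B} (f : a ⟶ b) : Same f f := ⟨rfl, rfl, HEq.rfl⟩

theorem Same.symm {a b a' b' : B} {f : a ⟶ b} {g : a' ⟶ b'} (h : Same f g) : Same g f :=
  ⟨h.src.symm, h.tgt.symm, h.heq.symm⟩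

theorem Same.prod {a b a' b' : B} {c d c' d' : C} {f : a ⟶ b} {f' : a' ⟶ b'} {g : c ⟶ d}
    {g' : c' ⟶ d'} (h : Same f f') (h' : Same g g') :
    Same (B := B × C) (f ×ₘ g) (f' ×ₘ g') := by
  obtain ⟨rfl, rfl, h⟩ := h
  obtain ⟨rfl, rfl, h'⟩ := h'
  obtain rfl := eq_of_heq h
  obtain rfl := eq_of_heq h'
  exact Same.refl _

/-- A family of comparisons. -/
def Cmp.pi {ι : Type t} {A : ι → Type u} [∀ i, Bicategory.{w, v} (A i)] {a b a' b' : ∀ i, A i}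
    {f : a ⟶ b} {g : a' ⟶ b'} (φ : ∀ i, Cmp (f i) (g i)) : Cmp f g := by
  obtain rfl : a = a' := funext fun i => (φ i).src
  obtain rfl : b = b' := funext fun i => (φ i).tgt
  exact ⟨rfl, rfl,
    { hom := fun i => (φ i).iso.hom
      inv := fun i => (φ i).iso.inv
      hom_inv_id := funext fun i => (φ i).iso.hom_inv_id
      inv_hom_id := funext fun i => (φ i).iso.inv_hom_id }⟩

namespace PAlg

variable {P : Operad.{w, v, u}} (X : PAlg.{w, v, u, w₁, v₁, u₁} P)

/-- The action `p ↦ μ(p; x)` on fixed objects. -/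
def ev {n : ℕ} (x : Fin n → X.carrier) : P.obj n ⥤ᵖ X.carrier :=
  (pair (Pseudofunctor.id (P.obj n)) (const (P.obj n) x)).comp (X.mu n)

/-- `μ(f; F)` for 1-cells. -/
abbrev app {n : ℕ} {p q : P.obj n} (f : p ⟶ q) {x y : Fin n → X.carrier} (F : x ⟶ y) :
    (X.mu n).obj (p, x) ⟶ (X.mu n).obj (q, y) :=
  (X.mu n).map (f ×ₘ F)

/-- The pseudofunctor `x, y ↦ μ(t; x, y)`. -/
def tens (t : P.obj 2) : (X.carrier × X.carrier) ⥤ᵖ X.carrier :=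
  (pair (const _ t) (lift fun i : Fin 2 =>
    match i with
    | 0 => fstP X.carrier X.carrier
    | 1 => sndP X.carrier X.carrier)).comp (X.mu 2)

/-- `μ(𝟙; F) ≫ μ(φ; 𝟙) ≅ μ(φ; 𝟙) ≫ μ(𝟙; F)` -/
def nat {n : ℕ} {p q : P.obj n} (φ : p ⟶ q) {x y : Fin n → X.carrier} (F : x ⟶ y) :
    X.app (𝟙 p) F ≫ (X.ev y).map φ ≅ (X.ev x).map φ ≫ X.app (𝟙 q) F :=
  ((X.mu n).mapComp (𝟙 p ×ₘ F) (φ ×ₘ 𝟙 y)).symm ≪≫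
    (X.mu n).map₂Iso (Iso.prod (λ_ φ ≪≫ (ρ_ φ).symm) (ρ_ F ≪≫ (λ_ F).symm)) ≪≫
      (X.mu n).mapComp (φ ×ₘ 𝟙 x) (𝟙 q ×ₘ F)

/-- `μ(𝟙; F) = F` -/
theorem one_same {x y : Fin 1 → X.carrier} (F : x ⟶ y) : Same (X.app (𝟙 P.one) F) (F 0) := by
  have h : Same F (fun _ => F 0 : (fun _ => x 0 : Fin 1 → X.carrier) ⟶ fun _ => y 0) :=
    Same.pi fun i => match i with
      | 0 => Same.refl _
  exact (((Same.refl (𝟙 P.one)).prod h).map (X.mu 1)).trans (Same.of_pf X.mu_one (F 0))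

/-- `μ(f · σ; F) = μ(f; σ · F)` -/
theorem act_same {n : ℕ} (σ : Equiv.Perm (Fin n)) {p q : P.obj n} (f : p ⟶ q)
    {x y : Fin n → X.carrier} (F : x ⟶ y) :
    Same (X.app (P.dotMap f σ) F) (X.app f (fun i => F (σ⁻¹ i) :
      (fun i => x (σ⁻¹ i)) ⟶ fun i => y (σ⁻¹ i))) :=
  Same.of_pf (X.mu_act σ) (f ×ₘ F)

/-- The `i`-th block. -/
abbrev blk {A : Type t} {n m : ℕ} (k : Fin n → ℕ) (h : ∑ i, k i = m) (x : Fin m → A) (i : Fin n) :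
    Fin (k i) → A :=
  fun j => x (blocks k h ⟨i, j⟩)

/-- `μ(γ(f; g); F) = μ(f; μ(g₁; F₁), …)` -/
theorem gam_same {n m : ℕ} (k : Fin n → ℕ) (h : ∑ i, k i = m) {p p' : P.obj n} (f : p ⟶ p')
    {q q' : ∀ i, P.obj (k i)} (g : q ⟶ q') {x y : Fin m → X.carrier} (F : x ⟶ y) :
    Same (X.app ((P.gam k h).map (f ×ₘ g)) F)
      (X.app f (fun i => X.app (g i) (fun j => F (blocks k h ⟨i, j⟩) :
        blk k h x i ⟶ blk k h y i) :
        (fun i => (X.mu (k i)).obj (q i, blk k h x i)) ⟶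
          fun i => (X.mu (k i)).obj (q' i, blk k h y i))) :=
  Same.of_pf (X.mu_gam k h) ((f ×ₘ g) ×ₘ F)

/-- The comparison of `μ(γ(f; g); F)` with `μ(f; G)` induced by comparisons of `μ(gᵢ; Fᵢ)`
with `Gᵢ`. -/
def gamC {n m : ℕ} (k : Fin n → ℕ) (h : ∑ i, k i = m) {p p' : P.obj n} (f : p ⟶ p')
    {q q' : ∀ i, P.obj (k i)} (g : q ⟶ q') {x y : Fin m → X.carrier} (F : x ⟶ y)
    {a b : Fin n → X.carrier} {G : a ⟶ b}
    (φ : ∀ i, Cmp (X.app (g i) (fun j => F (blocks k h ⟨i, j⟩) : blk k h x i ⟶ blk k h y i))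
      (G i)) :
    Cmp (X.app ((P.gam k h).map (f ×ₘ g)) F) (X.app f G) :=
  (X.gam_same k h f g F).cmp.trans (((Cmp.ofIso (Iso.refl f)).pair (Cmp.pi φ)).map (X.mu n))

end PAlg

/-- The tensor product, unit and structure 1-cells are the images of those of the choice of
multiplication: `xy = μ(t; x, y)`, `e = μ(i)`, `α = μ(α; x, y, z)`, and so on. -/
structure InducedCells {P : Operad.{w, v, u}} (χ : ChoiceOfMult P)
    (X : PAlg.{w, v, u, w₁, v₁, u₁} P) (s : MonCells X.carrier) : Prop where
  tensor : s.tensor = X.tens χ.t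
  unit (x : Fin 0 → X.carrier) : (X.mu 0).obj (χ.i, x) = s.e
  a (x : Fin 3 → X.carrier) : Same ((X.ev x).map χ.α.hom) (s.a (x 0) (x 1) (x 2))
  ai (x : Fin 3 → X.carrier) : Same ((X.ev x).map χ.α.inv) (s.ai (x 0) (x 1) (x 2))
  l (x : Fin 1 → X.carrier) : Same ((X.ev x).map χ.l.hom) (s.l (x 0))
  li (x : Fin 1 → X.carrier) : Same ((X.ev x).map χ.l.inv) (s.li (x 0))
  r (x : Fin 1 → X.carrier) : Same ((X.ev x).map χ.r.hom) (s.r (x 0))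
  ri (x : Fin 1 → X.carrier) : Same ((X.ev x).map χ.r.inv) (s.ri (x 0))
  b (x : Fin 2 → X.carrier) : Same ((X.ev x).map χ.β.hom) (s.b (x 0) (x 1))
  bi (x : Fin 2 → X.carrier) : Same ((X.ev x).map χ.β.inv) (s.bi (x 0) (x 1))

namespace InducedCells

section

variable {P : Operad.{w, v, u}} {χ : ChoiceOfMult P} {X : PAlg.{w, v, u, w₁, v₁, u₁} P}
  {s : MonCells X.carrier} (H : InducedCells χ X s)

theorem tens_same (H : InducedCells χ X s) {x y : Fin 2 → X.carrier} (F : x ⟶ y) :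
    Same (X.app (𝟙 χ.t) F) (s.m (F 0) (F 1)) := by
  refine Same.trans (((Same.refl (𝟙 χ.t)).prod ?_).map (X.mu 2))
    (Same.of_pf H.tensor.symm (F 0 ×ₘ F 1))
  exact Same.pi fun i => match i with
    | 0 => Same.refl _
    | 1 => Same.refl _

theorem tens_obj (H : InducedCells χ X s) (x : Fin 2 → X.carrier) :
    (X.ev x).obj χ.t = s.o (x 0) (x 1) :=
  (H.tens_same (𝟙 x)).src

/-- `μ(γ(𝟙; g, g'); F) ≅ μ(g; F₀) ⊗ μ(g'; F₁)` -/
def tenC (H : InducedCells χ X s) {k₀ k₁ m : ℕ} (h : ∑ i, ![k₀, k₁] i = m) {q q' : P.obj k₀}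
    {r r' : P.obj k₁} (g : q ⟶ q') (g' : r ⟶ r') {x y : Fin m → X.carrier} (F : x ⟶ y)
    {a b a' b' : X.carrier} {G : a ⟶ b} {G' : a' ⟶ b'}
    (φ : Cmp (X.app g (fun j => F (blocks ![k₀, k₁] h ⟨0, j⟩) :
      PAlg.blk ![k₀, k₁] h x 0 ⟶ PAlg.blk ![k₀, k₁] h y 0)) G)
    (ψ : Cmp (X.app g' (fun j => F (blocks ![k₀, k₁] h ⟨1, j⟩) :
      PAlg.blk ![k₀, k₁] h x 1 ⟶ PAlg.blk ![k₀, k₁] h y 1)) G') :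
    Cmp (X.app (P.g₂Map h (𝟙 χ.t) g g') F) (s.m G G') :=
  (X.gamC ![k₀, k₁] h (𝟙 χ.t) (Operad.fam₂Map g g') F (a := ![a, a']) (b := ![b, b'])
    (G := fun i => match i with
      | 0 => G
      | 1 => G') (fun i => match i with
        | 0 => φ
        | 1 => ψ)).trans (H.tens_same _).cmp

theorem id_g₂ {k₀ k₁ m : ℕ} (h : ∑ i, ![k₀, k₁] i = m) (p : P.obj 2) (q : P.obj k₀)
    (r : P.obj k₁) : 𝟙 (P.g₂ h p q r) = P.g₂Map h (𝟙 p) (𝟙 q) (𝟙 r) := by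
  refine ((P.gam_strict _ h).1 _).choose.symm.trans ?_
  refine congrArg (P.gam ![k₀, k₁] h).map (Prod.ext rfl (funext fun i => ?_))
  match i with
  | 0 => rfl
  | 1 => rfl

/-- The comparison for the identity of `γ(t; q, r)`. -/
def tenIdC (H : InducedCells χ X s) {k₀ k₁ m : ℕ} (h : ∑ i, ![k₀, k₁] i = m) (q : P.obj k₀)
    (r : P.obj k₁) {x y : Fin m → X.carrier} (F : x ⟶ y)
    {a b a' b' : X.carrier} {G : a ⟶ b} {G' : a' ⟶ b'}
    (φ : Cmp (X.app (𝟙 q) (fun j => F (blocks ![k₀, k₁] h ⟨0, j⟩) :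
      PAlg.blk ![k₀, k₁] h x 0 ⟶ PAlg.blk ![k₀, k₁] h y 0)) G)
    (ψ : Cmp (X.app (𝟙 r) (fun j => F (blocks ![k₀, k₁] h ⟨1, j⟩) :
      PAlg.blk ![k₀, k₁] h x 1 ⟶ PAlg.blk ![k₀, k₁] h y 1)) G') :
    Cmp (X.app (𝟙 (P.g₂ h χ.t q r)) F) (s.m G G') :=
  (Cmp.ofHEq rfl rfl (by rw [id_g₂])).trans (H.tenC h (𝟙 q) (𝟙 r) F φ ψ)

/-- `μ(𝟙; F) = (F₀F₁)F₂` for the operation `γ(t; t, 𝟙)` -/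
def tlC (H : InducedCells χ X s) {x y : Fin 3 → X.carrier} (F : x ⟶ y) :
    Cmp (X.app (𝟙 (P.tl χ.t)) F) (s.m (s.m (F 0) (F 1)) (F 2)) :=
  H.tenIdC rfl χ.t P.one F (H.tens_same _).cmp (X.one_same _).cmp

/-- `μ(𝟙; F) = F₀(F₁F₂)` for the operation `γ(t; 𝟙, t)` -/
def trC (H : InducedCells χ X s) {x y : Fin 3 → X.carrier} (F : x ⟶ y) :
    Cmp (X.app (𝟙 (P.tr χ.t)) F) (s.m (F 0) (s.m (F 1) (F 2))) :=
  H.tenIdC rfl P.one χ.t F (X.one_same _).cmp (H.tens_same _).cmp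

/-- `μ(𝟙; F) ≅ 𝟙` for the operation `i` -/
def unitC (H : InducedCells χ X s) {x y : Fin 0 → X.carrier} (F : x ⟶ y) :
    Cmp (X.app (𝟙 χ.i) F) (𝟙 s.e) :=
  (Cmp.ofHEq rfl (congrArg (fun z => (X.mu 0).obj (χ.i, z)) (funext fun i => i.elim0))
    (by
      obtain rfl : x = y := funext fun i => i.elim0
      exact heq_of_eq (congrArg (fun z => (X.mu 0).map (𝟙 χ.i ×ₘ z))
        (funext fun i => i.elim0)))).trans (idCmp (X.ev x) (H.unit x))

/-- `μ(𝟙; F) ≅ 𝟙F₀` for the operation `γ(t; i, 𝟙)` -/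
def ulC (H : InducedCells χ X s) {x y : Fin 1 → X.carrier} (F : x ⟶ y) :
    Cmp (X.app (𝟙 (P.g₂ (m := 1) rfl χ.t χ.i P.one)) F) (s.m (𝟙 s.e) (F 0)) :=
  H.tenIdC rfl χ.i P.one F (H.unitC _) (X.one_same _).cmp

/-- `μ(𝟙; F) ≅ F₀𝟙` for the operation `γ(t; 𝟙, i)` -/
def urC (H : InducedCells χ X s) {x y : Fin 1 → X.carrier} (F : x ⟶ y) :
    Cmp (X.app (𝟙 (P.g₂ (m := 1) rfl χ.t P.one χ.i)) F) (s.m (F 0) (𝟙 s.e)) :=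
  H.tenIdC rfl P.one χ.i F (X.one_same _).cmp (H.unitC _)

/-- `μ(𝟙; F) = F₁F₀` for the operation `t · (12)` -/
theorem dot_same (H : InducedCells χ X s) {x y : Fin 2 → X.carrier} (F : x ⟶ y) :
    Same (X.app (𝟙 (P.dot χ.t Operad.σ₁₂)) F) (s.m (F 1) (F 0)) :=
  have e : Same (X.app (𝟙 (P.dot χ.t Operad.σ₁₂)) F) (X.app (P.dotMap (𝟙 χ.t) Operad.σ₁₂) F) :=
    ⟨rfl, rfl, heq_of_eq (congrArg (fun f => X.app f F)
      ((P.act_strict (Operad.σ₁₂ (n := 0))).1 χ.t).choose.symm)⟩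
  (e.trans (X.act_same Operad.σ₁₂ (𝟙 χ.t) F)).trans (H.tens_same _)

/-- The comparison of the image of a 1-cell with changed endpoints. -/
def castC {n : ℕ} {p q p' q' : P.obj n} (f : p ⟶ q) (h : p = p') (h' : q = q')
    (x : Fin n → X.carrier) {a b : X.carrier} {g : a ⟶ b} (φ : Cmp ((X.ev x).map f) g) :
    Cmp ((X.ev x).map (f.cast h h')) g :=
  (((Same.of_cast f h h').map (X.ev x)).cmp).trans φ

/-- `μ(γ(𝟙; g, g'); x) ≅ μ(g; x₀) ⊗ μ(g'; x₁)` -/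
def evC (H : InducedCells χ X s) {k₀ k₁ m : ℕ} (h : ∑ i, ![k₀, k₁] i = m) {q q' : P.obj k₀}
    {r r' : P.obj k₁} (g : q ⟶ q') (g' : r ⟶ r') (x : Fin m → X.carrier)
    {a b a' b' : X.carrier} {G : a ⟶ b} {G' : a' ⟶ b'}
    (φ : Cmp ((X.ev (PAlg.blk ![k₀, k₁] h x 0)).map g) G)
    (ψ : Cmp ((X.ev (PAlg.blk ![k₀, k₁] h x 1)).map g') G') :
    Cmp ((X.ev x).map (P.g₂Map h (𝟙 χ.t) g g')) (s.m G G') :=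
  H.tenC h g g' (𝟙 x) φ ψ

/-- `μ(𝟙; x) = 𝟙` for the operadic unit -/
def oneC (X : PAlg.{w, v, u, w₁, v₁, u₁} P) (x : Fin 1 → X.carrier) :
    Cmp ((X.ev x).map (𝟙 P.one)) (𝟙 (x 0)) :=
  (X.one_same (𝟙 x)).cmp

/-- `μ(γ(α; 𝟙, 𝟙, 𝟙); x) ≅ α` -/
def aC (H : InducedCells χ X s) {k₀ k₁ k₂ m : ℕ} (h : ∑ i, ![k₀, k₁, k₂] i = m)
    (q : P.obj k₀) (q' : P.obj k₁) (q'' : P.obj k₂) (x : Fin m → X.carrier)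
    {y y' y'' : X.carrier} (h₀ : (X.ev (PAlg.blk ![k₀, k₁, k₂] h x 0)).obj q = y)
    (h₁ : (X.ev (PAlg.blk ![k₀, k₁, k₂] h x 1)).obj q' = y')
    (h₂ : (X.ev (PAlg.blk ![k₀, k₁, k₂] h x 2)).obj q'' = y'') :
    Cmp ((X.ev x).map (P.g₃Map h χ.α.hom (𝟙 q) (𝟙 q') (𝟙 q''))) (s.a y y' y'') :=
  (X.gamC ![k₀, k₁, k₂] h χ.α.hom (Operad.fam₃Map (𝟙 q) (𝟙 q') (𝟙 q'')) (𝟙 x) (G := 𝟙 ![y, y', y''])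
    (fun i => match i with
      | 0 => idCmp (X.ev (PAlg.blk ![k₀, k₁, k₂] h x 0)) h₀
      | 1 => idCmp (X.ev (PAlg.blk ![k₀, k₁, k₂] h x 1)) h₁
      | 2 => idCmp (X.ev (PAlg.blk ![k₀, k₁, k₂] h x 2)) h₂)).trans (H.a ![y, y', y'']).cmp

/-- `μ(γ(β; 𝟙, 𝟙); x) ≅ β` -/
def bC (H : InducedCells χ X s) {k₀ k₁ m : ℕ} (h : ∑ i, ![k₀, k₁] i = m)
    (q : P.obj k₀) (q' : P.obj k₁) (x : Fin m → X.carrier)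
    {y y' : X.carrier} (h₀ : (X.ev (PAlg.blk ![k₀, k₁] h x 0)).obj q = y)
    (h₁ : (X.ev (PAlg.blk ![k₀, k₁] h x 1)).obj q' = y') :
    Cmp ((X.ev x).map (P.g₂Map h χ.β.hom (𝟙 q) (𝟙 q'))) (s.b y y') :=
  (X.gamC ![k₀, k₁] h χ.β.hom (Operad.fam₂Map (𝟙 q) (𝟙 q')) (𝟙 x) (G := 𝟙 ![y, y'])
    (fun i => match i with
      | 0 => idCmp (X.ev (PAlg.blk ![k₀, k₁] h x 0)) h₀
      | 1 => idCmp (X.ev (PAlg.blk ![k₀, k₁] h x 1)) h₁)).trans (H.b ![y, y']).cmp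

/-- `μ(γ(l; 𝟙); x) ≅ l` -/
def lC (H : InducedCells χ X s) {k m : ℕ} (h : ∑ i, ![k] i = m) (q : P.obj k)
    (x : Fin m → X.carrier) {y : X.carrier} (h₀ : (X.ev (PAlg.blk ![k] h x 0)).obj q = y) :
    Cmp ((X.ev x).map (P.g₁Map h χ.l.hom (𝟙 q))) (s.l y) :=
  (X.gamC ![k] h χ.l.hom (Operad.fam₁Map (𝟙 q)) (𝟙 x) (G := 𝟙 ![y])
    (fun i => match i with
      | 0 => idCmp (X.ev (PAlg.blk ![k] h x 0)) h₀)).trans (H.l ![y]).cmp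

/-- `μ(γ(r; 𝟙); x) ≅ r` -/
def rC (H : InducedCells χ X s) {k m : ℕ} (h : ∑ i, ![k] i = m) (q : P.obj k)
    (x : Fin m → X.carrier) {y : X.carrier} (h₀ : (X.ev (PAlg.blk ![k] h x 0)).obj q = y) :
    Cmp ((X.ev x).map (P.g₁Map h χ.r.hom (𝟙 q))) (s.r y) :=
  (X.gamC ![k] h χ.r.hom (Operad.fam₁Map (𝟙 q)) (𝟙 x) (G := 𝟙 ![y])
    (fun i => match i with
      | 0 => idCmp (X.ev (PAlg.blk ![k] h x 0)) h₀)).trans (H.r ![y]).cmp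

/-- `μ(f · σ; x) = μ(f; σ · x)` -/
def actC {n : ℕ} (σ : Equiv.Perm (Fin n)) {p q : P.obj n} (f : p ⟶ q) (x : Fin n → X.carrier)
    {a b : X.carrier} {g : a ⟶ b} (φ : Cmp ((X.ev fun i => x (σ⁻¹ i)).map f) g) :
    Cmp ((X.ev x).map (P.dotMap f σ)) g :=
  (X.act_same σ f (𝟙 x)).cmp.trans φ

/-- `μ(γ(𝟙; β, 𝟙); x, y, z) = βz` -/
def blC (H : InducedCells χ X s) (x : Fin 3 → X.carrier) :
    Cmp ((X.ev x).map (Operad.braidLeft χ.β.hom)) (s.rw (s.b (x 0) (x 1)) (x 2)) :=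
  castC (p' := P.tl χ.t) _ rfl (P.braid_left_obj χ.t) x
    (H.evC rfl χ.β.hom (𝟙 P.one) x (H.b _).cmp (oneC X _))

/-- `μ(γ(𝟙; 𝟙, β); x, y, z) = xβ` -/
def brC (H : InducedCells χ X s) (x : Fin 3 → X.carrier) :
    Cmp ((X.ev x).map (Operad.braidRight χ.β.hom)) (s.lw (x 0) (s.b (x 1) (x 2))) :=
  castC (p' := P.tr χ.t) _ rfl (P.braid_right_obj χ.t) x
    (H.evC rfl (𝟙 P.one) χ.β.hom x (oneC X _) (H.b _).cmp)

end

end InducedCells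

theorem PAlg.one_obj {P : Operad.{w, v, u}} (X : PAlg.{w, v, u, w₁, v₁, u₁} P)
    (x : Fin 1 → X.carrier) : (X.ev x).obj P.one = x 0 :=
  (X.one_same (𝟙 x)).src

theorem InducedCells.unit_obj₁ {P : Operad.{w, v, u}} {χ : ChoiceOfMult P}
    {X : PAlg.{w, v, u, w₁, v₁, u₁} P} {s : MonCells X.carrier} (H : InducedCells χ X s)
    (x : Fin 0 → X.carrier) : (X.ev x).obj χ.i = s.e := H.unit x

open InducedCells in
/-- The symmetric monoidal structure on a `P`-algebra is the one determined by the choice of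
multiplication: the tensor product, the unit, the adjoint equivalences and the invertible
modifications are the images of their namesakes under the action. -/
structure Induced {P : Operad.{w, v, u}} (χ : ChoiceOfMult P) (X : PAlg.{w, v, u, w₁, v₁, u₁} P)
    (s : SymMon X.carrier) : Prop extends cells : InducedCells χ X s.toMonCells where
  aSq {x y : Fin 3 → X.carrier} (F : x ⟶ y) :
    Carries ((cells.tlC F).comp (cells.a y).cmp) ((cells.a x).cmp.comp (cells.trC F))
      (X.nat χ.α.hom F).hom (s.aSq (F 0) (F 1) (F 2)).hom
  aiSq {x y : Fin 3 → X.carrier} (F : x ⟶ y) :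
    Carries ((cells.trC F).comp (cells.ai y).cmp) ((cells.ai x).cmp.comp (cells.tlC F))
      (X.nat χ.α.inv F).hom (s.aiSq (F 0) (F 1) (F 2)).hom
  lSq {x y : Fin 1 → X.carrier} (F : x ⟶ y) :
    Carries ((cells.ulC F).comp (cells.l y).cmp) ((cells.l x).cmp.comp (X.one_same F).cmp)
      (X.nat χ.l.hom F).hom (s.lSq (F 0)).hom
  liSq {x y : Fin 1 → X.carrier} (F : x ⟶ y) :
    Carries ((X.one_same F).cmp.comp (cells.li y).cmp) ((cells.li x).cmp.comp (cells.ulC F))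
      (X.nat χ.l.inv F).hom (s.liSq (F 0)).hom
  rSq {x y : Fin 1 → X.carrier} (F : x ⟶ y) :
    Carries ((X.one_same F).cmp.comp (cells.r y).cmp) ((cells.r x).cmp.comp (cells.urC F))
      (X.nat χ.r.hom F).hom (s.rSq (F 0)).hom
  riSq {x y : Fin 1 → X.carrier} (F : x ⟶ y) :
    Carries ((cells.urC F).comp (cells.ri y).cmp) ((cells.ri x).cmp.comp (X.one_same F).cmp)
      (X.nat χ.r.inv F).hom (s.riSq (F 0)).hom
  bSq {x y : Fin 2 → X.carrier} (F : x ⟶ y) :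
    Carries ((cells.tens_same F).cmp.comp (cells.b y).cmp)
      ((cells.b x).cmp.comp (cells.dot_same F).cmp)
      (X.nat χ.β.hom F).hom (s.bSq (F 0) (F 1)).hom
  biSq {x y : Fin 2 → X.carrier} (F : x ⟶ y) :
    Carries ((cells.dot_same F).cmp.comp (cells.bi y).cmp)
      ((cells.bi x).cmp.comp (cells.tens_same F).cmp)
      (X.nat χ.β.inv F).hom (s.biSq (F 0) (F 1)).hom
  aUnit (x : Fin 3 → X.carrier) :
    Carries (idCmp (X.ev x) (cells.a x).src) (compCmp (X.ev x) (cells.a x).cmp (cells.ai x).cmp)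
      ((X.ev x).map₂ χ.α.unit.hom) (s.aUnit (x 0) (x 1) (x 2)).hom
  aCounit (x : Fin 3 → X.carrier) :
    Carries (compCmp (X.ev x) (cells.ai x).cmp (cells.a x).cmp) (idCmp (X.ev x) (cells.a x).tgt)
      ((X.ev x).map₂ χ.α.counit.hom) (s.aCounit (x 0) (x 1) (x 2)).hom
  lUnit (x : Fin 1 → X.carrier) :
    Carries (idCmp (X.ev x) (cells.l x).src) (compCmp (X.ev x) (cells.l x).cmp (cells.li x).cmp)
      ((X.ev x).map₂ χ.l.unit.hom) (s.lUnit (x 0))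
  lCounit (x : Fin 1 → X.carrier) :
    Carries (compCmp (X.ev x) (cells.li x).cmp (cells.l x).cmp) (idCmp (X.ev x) (cells.l x).tgt)
      ((X.ev x).map₂ χ.l.counit.hom) (s.lCounit (x 0))
  rUnit (x : Fin 1 → X.carrier) :
    Carries (idCmp (X.ev x) (cells.r x).src) (compCmp (X.ev x) (cells.r x).cmp (cells.ri x).cmp)
      ((X.ev x).map₂ χ.r.unit.hom) (s.rUnit (x 0))
  rCounit (x : Fin 1 → X.carrier) :
    Carries (compCmp (X.ev x) (cells.ri x).cmp (cells.r x).cmp) (idCmp (X.ev x) (cells.r x).tgt)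
      ((X.ev x).map₂ χ.r.counit.hom) (s.rCounit (x 0))
  bUnit (x : Fin 2 → X.carrier) :
    Carries (idCmp (X.ev x) (cells.b x).src) (compCmp (X.ev x) (cells.b x).cmp (cells.bi x).cmp)
      ((X.ev x).map₂ χ.β.unit.hom) (s.bUnit (x 0) (x 1))
  bCounit (x : Fin 2 → X.carrier) :
    Carries (compCmp (X.ev x) (cells.bi x).cmp (cells.b x).cmp) (idCmp (X.ev x) (cells.b x).tgt)
      ((X.ev x).map₂ χ.β.counit.hom) (s.bCounit (x 0) (x 1))
  pi (x : Fin 4 → X.carrier) :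
    Carries
      (compCmp (X.ev x)
        (cells.evC rfl χ.α.hom (𝟙 P.one) x (cells.a _).cmp (oneC X _))
        (compCmp (X.ev x)
          (castC _ (P.pi_obj₁ χ.t) (P.pi_obj₂ χ.t) x
            (cells.aC rfl P.one χ.t P.one x (X.one_obj _) (cells.tens_obj _) (X.one_obj _)))
          (cells.evC rfl (𝟙 P.one) χ.α.hom x (oneC X _) (cells.a _).cmp)))
      (compCmp (X.ev x)
        (castC _ (P.pi_obj₃ χ.t) (P.pi_obj₅ χ.t) x
          (cells.aC rfl χ.t P.one P.one x (cells.tens_obj _) (X.one_obj _) (X.one_obj _)))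
        (castC _ rfl (P.pi_obj₄ χ.t) x
          (cells.aC rfl P.one P.one χ.t x (X.one_obj _) (X.one_obj _) (cells.tens_obj _))))
      ((X.ev x).map₂ χ.π.hom) (s.pi (x 0) (x 1) (x 2) (x 3)).hom
  mu (x : Fin 2 → X.carrier) :
    Carries
      (compCmp (X.ev x)
        (cells.evC rfl χ.r.hom (𝟙 P.one) x (cells.r _).cmp (oneC X _))
        (compCmp (X.ev x)
          (castC _ (P.mu_obj₁ χ.t χ.i) (P.mu_obj₂ χ.t χ.i) x
            (cells.aC rfl P.one χ.i P.one x (X.one_obj _) (cells.unit_obj₁ _) (X.one_obj _)))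
          (cells.evC rfl (𝟙 P.one) χ.l.hom x (oneC X _) (cells.l _).cmp)))
      (idCmp (X.ev x)
        (cells.evC (m := 2) rfl (𝟙 P.one) (𝟙 P.one) x (oneC X _) (oneC X _)).src)
      ((X.ev x).map₂ χ.μ.hom) (s.mu (x 0) (x 1)).hom
  lam (x : Fin 2 → X.carrier) :
    Carries
      (cells.evC rfl χ.l.hom (𝟙 P.one) x (cells.l _).cmp (oneC X _))
      (compCmp (X.ev x)
        (castC _ (P.lam_obj₁ χ.t χ.i) (P.lam_obj₂ χ.t χ.i) x
          (cells.aC rfl χ.i P.one P.one x (cells.unit_obj₁ _) (X.one_obj _) (X.one_obj _)))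
        (castC _ rfl (P.lam_obj₃ χ.t) x (cells.lC rfl χ.t x (cells.tens_obj _))))
      ((X.ev x).map₂ χ.lam.hom) (s.lam (x 0) (x 1)).hom
  rho (x : Fin 2 → X.carrier) :
    Carries
      (cells.evC rfl (𝟙 P.one) χ.r.hom x (oneC X _) (cells.r _).cmp)
      (compCmp (X.ev x)
        (castC _ (P.lam_obj₃ χ.t) (P.rho_obj₂ χ.t χ.i) x
          (cells.rC rfl χ.t x (cells.tens_obj _)))
        (castC _ rfl (P.rho_obj₁ χ.t χ.i) x
          (cells.aC rfl P.one P.one χ.i x (X.one_obj _) (X.one_obj _) (cells.unit_obj₁ _))))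
      ((X.ev x).map₂ χ.ρ.hom) (s.rho (x 0) (x 1)).hom
  R (x : Fin 3 → X.carrier) :
    Carries
      (compCmp (X.ev x) (cells.blC x)
        (compCmp (X.ev x) (actC Operad.σ₁₂ _ x (cells.a _).cmp)
          (castC _ rfl (P.R_obj χ.t) x (actC Operad.σ₁₂ _ x (cells.brC _)))))
      (compCmp (X.ev x) (cells.a x).cmp
        (compCmp (X.ev x)
          (castC (p' := P.tr χ.t) _ rfl (P.dot_obj_left χ.t) x
            (cells.bC rfl P.one χ.t x (X.one_obj _) (cells.tens_obj _)))
          (actC Operad.σ₁₃₂ _ x (cells.a _).cmp)))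
      ((X.ev x).map₂ χ.R.hom) (s.R (x 0) (x 1) (x 2)).hom
  S (x : Fin 3 → X.carrier) :
    Carries
      (compCmp (X.ev x) (cells.brC x)
        (compCmp (X.ev x) (actC Operad.σ₂₃ _ x (cells.ai _).cmp)
          (castC _ rfl (P.S_obj χ.t) x (actC Operad.σ₂₃ _ x (cells.blC _)))))
      (compCmp (X.ev x) (cells.ai x).cmp
        (compCmp (X.ev x)
          (castC (p' := P.tl χ.t) _ rfl (P.dot_obj_right χ.t) x
            (cells.bC rfl χ.t P.one x (cells.tens_obj _) (X.one_obj _)))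
          (actC Operad.σ₁₂₃ _ x (cells.ai _).cmp)))
      ((X.ev x).map₂ χ.S.hom) (s.S (x 0) (x 1) (x 2)).hom
  syl (x : Fin 2 → X.carrier) :
    Carries
      (compCmp (X.ev x) (cells.b x).cmp
        (castC _ rfl (P.v_obj χ.t) x (actC Operad.σ₁₂ _ x (cells.b _).cmp)))
      (idCmp (X.ev x) (cells.tens_obj x))
      ((X.ev x).map₂ χ.v.hom) (s.syl (x 0) (x 1)).hom

/-- The comparison `F(μ(φ; x)) = μ(φ; F(𝟙), …) ≅ μ(φ; F x)` for a morphism `F` of algebras. -/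
def PAlg.homC {P : Operad.{w, v, u}} {X Y : PAlg.{w, v, u, w₁, v₁, u₁} P} (F : X ⟶ Y) {n : ℕ}
    {p q : P.obj n} (φ : p ⟶ q) (x : Fin n → X.carrier) :
    Cmp (F.toPF.map ((X.ev x).map φ)) ((Y.ev fun i => F.toPF.obj (x i)).map φ) :=
  let y : Fin n → Y.carrier := fun i => F.toPF.obj (x i)
  let ψ : Cmp (B := Fin n → Y.carrier) (fun i => F.toPF.map (𝟙 (x i)) : y ⟶ y) (𝟙 y) :=
    Cmp.pi fun i => Cmp.ofIso (F.toPF.mapId (x i))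
  (Cmp.ofPF (F.comm n) (φ ×ₘ 𝟙 x)).trans (((Cmp.ofIso (Iso.refl φ)).pair ψ).map (Y.mu n))

/-- The comparisons of the structure 1-cells which make a morphism of algebras strictly
symmetric monoidal are the ones obtained from the unit constraints of its underlying
pseudofunctor. -/
structure Canonical {P : Operad.{w, v, u}} {χ : ChoiceOfMult P}
    {X Y : PAlg.{w, v, u, w₁, v₁, u₁} P} (F : X ⟶ Y) {s : MonCells X.carrier}
    {s' : MonCells Y.carrier} (H : InducedCells χ X s) (H' : InducedCells χ Y s')
    (c : StrictCells F.toPF s s') : Prop where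
  a (x : Fin 3 → X.carrier) :
    ((H.a x).cmp.map F.toPF).trans (c.a _ _ _) = (PAlg.homC F χ.α.hom x).trans (H'.a _).cmp
  ai (x : Fin 3 → X.carrier) :
    ((H.ai x).cmp.map F.toPF).trans (c.ai _ _ _) = (PAlg.homC F χ.α.inv x).trans (H'.ai _).cmp
  l (x : Fin 1 → X.carrier) :
    ((H.l x).cmp.map F.toPF).trans (c.l _) = (PAlg.homC F χ.l.hom x).trans (H'.l _).cmp
  li (x : Fin 1 → X.carrier) :
    ((H.li x).cmp.map F.toPF).trans (c.li _) = (PAlg.homC F χ.l.inv x).trans (H'.li _).cmp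
  r (x : Fin 1 → X.carrier) :
    ((H.r x).cmp.map F.toPF).trans (c.r _) = (PAlg.homC F χ.r.hom x).trans (H'.r _).cmp
  ri (x : Fin 1 → X.carrier) :
    ((H.ri x).cmp.map F.toPF).trans (c.ri _) = (PAlg.homC F χ.r.inv x).trans (H'.ri _).cmp
  b (x : Fin 2 → X.carrier) :
    ((H.b x).cmp.map F.toPF).trans (c.b _ _) = (PAlg.homC F χ.β.hom x).trans (H'.b _).cmp
  bi (x : Fin 2 → X.carrier) :
    ((H.bi x).cmp.map F.toPF).trans (c.bi _ _) = (PAlg.homC F χ.β.inv x).trans (H'.bi _).cmp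

end SMTwo

namespace SMTwo

section

variable {B : Type u₁} [Bicategory.{w₁, v₁} B] {C : Type u₂} [Bicategory.{w₂, v₂} C]
  {D : Type u₃} [Bicategory.{w₃, v₃} D]  {E : Type u₄} [Bicategory.{w₄, v₄} E]

/-! ### Calculus of comparisons -/

namespace Cmp

section

variable {a b c a' b' c' a'' b'' c'' : B}

/-- The inverse of a comparison. -/
def symm {f : a ⟶ b} {g : a' ⟶ b'} (φ : Cmp f g) : Cmp g f := by
  obtain ⟨rfl, rfl, i⟩ := φ
  exact ⟨rfl, rfl, (show f ≅ g from i).symm⟩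

theorem trans_symm {f : a ⟶ b} {g : a' ⟶ b'} (φ : Cmp f g) :
    φ.trans φ.symm = ofIso (Iso.refl f) := by
  obtain ⟨rfl, rfl, i⟩ := φ
  exact congrArg (Cmp.mk rfl rfl) (Iso.self_symm_id _)

theorem symm_trans {f : a ⟶ b} {g : a' ⟶ b'} (φ : Cmp f g) :
    φ.symm.trans φ = ofIso (Iso.refl g) := by
  obtain ⟨rfl, rfl, i⟩ := φ
  exact congrArg (Cmp.mk rfl rfl) (Iso.symm_self_id _)

theorem symm_trans_trans {f : a ⟶ b} {g : a' ⟶ b'} {h : a'' ⟶ b''} (φ : Cmp f g)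
    (ψ : Cmp f h) : φ.trans (φ.symm.trans ψ) = ψ := by
  rw [← trans_assoc, trans_symm, ofIso_refl_trans]

theorem trans_symm_trans {f : a ⟶ b} {g : a' ⟶ b'} {h : a'' ⟶ b''} (φ : Cmp f g)
    (ψ : Cmp g h) : φ.symm.trans (φ.trans ψ) = ψ := by
  rw [← trans_assoc, symm_trans, ofIso_refl_trans]

theorem trans_left_cancel {f : a ⟶ b} {g : a' ⟶ b'} {h : a'' ⟶ b''} {φ : Cmp f g}
    {ψ ψ' : Cmp g h} (e : φ.trans ψ = φ.trans ψ') : ψ = ψ' := by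
  rw [← trans_symm_trans φ ψ, e, trans_symm_trans]

theorem ofIso_injective {f g : a ⟶ b} {i j : f ≅ g} (h : ofIso i = ofIso j) : i = j := by
  cases h
  rfl

theorem ofIso_trans {f g h : a ⟶ b} (i : f ≅ g) (j : g ≅ h) :
    (ofIso i).trans (ofIso j) = ofIso (i ≪≫ j) := rfl

/-- A comparison of parallel 1-cells as an isomorphism. -/
def toIso {f g : a ⟶ b} (φ : Cmp f g) : f ≅ g := φ.iso

theorem ofIso_toIso {f g : a ⟶ b} (φ : Cmp f g) : ofIso φ.toIso = φ := rfl

theorem symm_map (F : B ⥤ᵖ C) {f : a ⟶ b} {g : a' ⟶ b'} (φ : Cmp f g) :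
    φ.symm.map F = (φ.map F).symm := by
  obtain ⟨rfl, rfl, i⟩ := φ
  rfl

theorem trans_eq_iff {f : a ⟶ b} {g : a' ⟶ b'} {h : a'' ⟶ b''} {φ : Cmp f g} {ψ : Cmp g h}
    {χ : Cmp f h} : φ.trans ψ = χ ↔ ψ = φ.symm.trans χ :=
  ⟨fun e => by rw [← e, trans_symm_trans], fun e => by rw [e, symm_trans_trans]⟩

theorem map_ofIso_refl (F : B ⥤ᵖ C) (f : a ⟶ b) :
    (ofIso (Iso.refl f)).map F = ofIso (Iso.refl (F.map f)) :=
  congrArg (Cmp.mk rfl rfl) (Iso.ext (F.map₂_id _))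

theorem IsEq.refl (f : a ⟶ b) : (ofIso (Iso.refl f)).IsEq := ⟨rfl, rfl⟩

theorem IsEq.of_eq {f g : a ⟶ b} (h : f = g) : (ofIso (eqToIso h)).IsEq := ⟨h, rfl⟩

theorem ofHEq_isEq {f : a ⟶ b} {g : a' ⟶ b'} (h₁ : a = a') (h₂ : b = b') (h : HEq f g) :
    (ofHEq h₁ h₂ h).IsEq := by
  subst h₁ h₂
  exact ⟨eq_of_heq h, rfl⟩

theorem IsEq.unique {f : a ⟶ b} {g : a' ⟶ b'} {φ ψ : Cmp f g} (h : φ.IsEq) (h' : ψ.IsEq) :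
    φ = ψ := by
  obtain ⟨_, _, _, rfl⟩ := h.eq
  obtain ⟨_, _, _, rfl⟩ := h'.eq
  rfl

theorem IsEq.same {f : a ⟶ b} {g : a' ⟶ b'} {φ : Cmp f g} (h : φ.IsEq) : Same f g := by
  obtain ⟨h₁, h₂, e, rfl⟩ := h.eq
  exact ⟨h₁, h₂, e⟩

theorem _root_.SMTwo.Same.isEq {f : a ⟶ b} {g : a' ⟶ b'} (h : Same f g) : h.cmp.IsEq :=
  ofHEq_isEq _ _ _

theorem IsEq.symm {f : a ⟶ b} {g : a' ⟶ b'} {φ : Cmp f g} (h : φ.IsEq) : φ.symm.IsEq := by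
  obtain ⟨rfl, rfl, e, rfl⟩ := h.eq
  obtain rfl := eq_of_heq e
  exact ⟨rfl, rfl⟩

theorem IsEq.pair {a b a' b' : B} {c d c' d' : C} {f : a ⟶ b} {f' : a' ⟶ b'} {g : c ⟶ d}
    {g' : c' ⟶ d'} {φ : Cmp f f'} {ψ : Cmp g g'} (h : φ.IsEq) (h' : ψ.IsEq) :
    (φ.pair ψ).IsEq := by
  obtain ⟨rfl, rfl, e, rfl⟩ := h.eq
  obtain ⟨rfl, rfl, e', rfl⟩ := h'.eq
  obtain rfl := eq_of_heq e
  obtain rfl := eq_of_heq e'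
  exact ⟨rfl, rfl⟩

theorem IsEq.comp {f : a ⟶ b} {g : b ⟶ c} {f' : a' ⟶ b'} {g' : b' ⟶ c'} {φ : Cmp f f'}
    {ψ : Cmp g g'} (h : φ.IsEq) (h' : ψ.IsEq) : (φ.comp ψ).IsEq := by
  obtain ⟨rfl, rfl, e, rfl⟩ := h.eq
  obtain ⟨_, rfl, e', rfl⟩ := h'.eq
  obtain rfl := eq_of_heq e
  obtain rfl := eq_of_heq e'
  refine ⟨rfl, Iso.ext ?_⟩
  change 𝟙 f ▷ g ≫ f ◁ 𝟙 g = 𝟙 (f ≫ g)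
  simp

theorem ofPF_isEq {F G : B ⥤ᵖ C} (h : F = G) (f : a ⟶ b) : (ofPF h f).IsEq :=
  ofHEq_isEq _ _ _

theorem comp_trans {f : a ⟶ b} {g : b ⟶ c} {f' : a' ⟶ b'} {g' : b' ⟶ c'} {f'' : a'' ⟶ b''}
    {g'' : b'' ⟶ c''} (φ : Cmp f f') (ψ : Cmp g g') (φ' : Cmp f' f'') (ψ' : Cmp g' g'') :
    (φ.trans φ').comp (ψ.trans ψ') = (φ.comp ψ).trans (φ'.comp ψ') := by
  obtain ⟨rfl, rfl, i⟩ := φ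
  obtain ⟨_, rfl, j⟩ := ψ
  obtain ⟨rfl, rfl, k⟩ := φ'
  obtain ⟨_, rfl, l⟩ := ψ'
  change f ≅ f' at i
  change f' ≅ f'' at k
  change g ≅ g' at j
  change g' ≅ g'' at l
  refine congrArg (Cmp.mk rfl rfl) (Iso.ext ?_)
  change (i.hom ≫ k.hom) ▷ g ≫ f'' ◁ (j.hom ≫ l.hom) =
    (i.hom ▷ g ≫ f' ◁ j.hom) ≫ (k.hom ▷ g' ≫ f'' ◁ l.hom)
  simp only [comp_whiskerRight, whiskerLeft_comp, Category.assoc, whisker_exchange_assoc]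

/-- Comparisons of the sources and of the targets which are compatible with given 2-cells. -/
theorem _root_.SMTwo.carries_iff {f g : a ⟶ b} {f' g' : a' ⟶ b'} {φ : Cmp f f'} {ψ : Cmp g g'}
    {θ : f ≅ g} {θ' : f' ≅ g'} :
    Carries φ ψ θ.hom θ'.hom ↔ (ofIso θ).trans ψ = φ.trans (ofIso θ') := by
  obtain ⟨rfl, rfl, i⟩ := φ
  obtain ⟨_, _, j⟩ := ψ
  change f ≅ f' at i
  change g ≅ g' at j
  have h : (ofIso θ).trans (ofIso j) = (ofIso i).trans (ofIso θ') ↔ θ ≪≫ j = i ≪≫ θ' :=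
    ⟨fun e => ofIso_injective e, fun e => congrArg ofIso e⟩
  refine Iff.trans ?_ h.symm
  change HEq (i.inv ≫ θ.hom ≫ j.hom) θ'.hom ↔ _
  rw [heq_iff_eq, Iso.inv_comp_eq, Iso.ext_iff]
  rfl

/-- Conjugation of an invertible 2-cell by comparisons. -/
def conj {f g : a ⟶ b} {f' g' : a' ⟶ b'} (φ : Cmp f f') (ψ : Cmp g g') (θ : f ≅ g) : f' ≅ g' :=
  toIso (φ.symm.trans ((ofIso θ).trans ψ))

theorem carries_conj {f g : a ⟶ b} {f' g' : a' ⟶ b'} (φ : Cmp f f') (ψ : Cmp g g') (θ : f ≅ g) :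
    Carries φ ψ θ.hom (conj φ ψ θ).hom := by
  rw [carries_iff, conj, ofIso_toIso, symm_trans_trans]

end

section

variable {ι : Type t} {A : ι → Type u} [∀ i, Bicategory.{w, v} (A i)] {a b a' b' a'' b'' : ∀ i, A i}

theorem pi_trans {f : a ⟶ b} {g : a' ⟶ b'} {h : a'' ⟶ b''} (φ : ∀ i, Cmp (f i) (g i))
    (ψ : ∀ i, Cmp (g i) (h i)) :
    (Cmp.pi φ : Cmp f g).trans (Cmp.pi ψ : Cmp g h) = Cmp.pi fun i => (φ i).trans (ψ i) := by
  obtain rfl : a = a' := funext fun i => (φ i).src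
  obtain rfl : b = b' := funext fun i => (φ i).tgt
  obtain rfl : a = a'' := funext fun i => (ψ i).src
  obtain rfl : b = b'' := funext fun i => (ψ i).tgt
  rfl

theorem IsEq.pi {f : a ⟶ b} {g : a' ⟶ b'} {φ : ∀ i, Cmp (f i) (g i)} (h : ∀ i, (φ i).IsEq) :
    (Cmp.pi φ : Cmp f g).IsEq := by
  obtain rfl : a = a' := funext fun i => (φ i).src
  obtain rfl : b = b' := funext fun i => (φ i).tgt
  have e : f = g := funext fun i => (h i).choose
  subst e
  exact ⟨rfl, Iso.ext (funext fun i => congrArg Iso.hom (h i).choose_spec)⟩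

/-- A comparison in a product is determined by its components. -/
theorem eq_pi {f : a ⟶ b} {g : a' ⟶ b'} (φ : Cmp f g) :
    φ = Cmp.pi fun i => φ.map (proj A i) := by
  obtain ⟨rfl, rfl, i⟩ := φ
  rfl

theorem pi_map_proj {f : a ⟶ b} {g : a' ⟶ b'} (φ : ∀ i, Cmp (f i) (g i)) (i : ι) :
    (Cmp.pi φ : Cmp f g).map (proj A i) = φ i := by
  obtain rfl : a = a' := funext fun i => (φ i).src
  obtain rfl : b = b' := funext fun i => (φ i).tgt
  rfl

theorem pi_ext {f : a ⟶ b} {g : a' ⟶ b'} {φ ψ : Cmp f g}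
    (h : ∀ i, φ.map (proj A i) = ψ.map (proj A i)) : φ = ψ := by
  rw [eq_pi φ, eq_pi ψ]
  exact congrArg Cmp.pi (funext h)

theorem map_lift (F : ∀ i, D ⥤ᵖ A i) {x y x' y' : D} {f : x ⟶ y} {f' : x' ⟶ y'} (φ : Cmp f f') :
    φ.map (lift F) = Cmp.pi fun i => φ.map (F i) := by
  obtain ⟨rfl, rfl, i⟩ := φ
  rfl

end

theorem map_pair (F : D ⥤ᵖ B) (G : D ⥤ᵖ C) {x y x' y' : D} {f : x ⟶ y} {f' : x' ⟶ y'}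
    (φ : Cmp f f') : φ.map (SMTwo.pair F G) = (φ.map F).pair (φ.map G) := by
  obtain ⟨rfl, rfl, i⟩ := φ
  rfl

theorem pair_map_fst {a b a' b' : B} {c d c' d' : C} {f : a ⟶ b} {f' : a' ⟶ b'} {g : c ⟶ d}
    {g' : c' ⟶ d'} (φ : Cmp f f') (ψ : Cmp g g') : (φ.pair ψ).map (fstP B C) = φ := by
  obtain ⟨rfl, rfl, i⟩ := φ
  obtain ⟨rfl, rfl, j⟩ := ψ
  rfl

theorem pair_map_snd {a b a' b' : B} {c d c' d' : C} {f : a ⟶ b} {f' : a' ⟶ b'} {g : c ⟶ d}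
    {g' : c' ⟶ d'} (φ : Cmp f f') (ψ : Cmp g g') : (φ.pair ψ).map (sndP B C) = ψ := by
  obtain ⟨rfl, rfl, i⟩ := φ
  obtain ⟨rfl, rfl, j⟩ := ψ
  rfl

theorem eq_pair {x y x' y' : B × C} {f : x ⟶ y} {f' : x' ⟶ y'} (φ : Cmp f f') :
    φ = (φ.map (fstP B C)).pair (φ.map (sndP B C)) := by
  obtain ⟨rfl, rfl, i⟩ := φ
  rfl

end Cmp

section

variable (F : B ⥤ᵖ C)

theorem compCmp_trans {a b c : B} {f : a ⟶ b} {g : b ⟶ c} {a' b' c' a'' b'' c'' : C}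
    {f' : a' ⟶ b'} {g' : b' ⟶ c'} {f'' : a'' ⟶ b''} {g'' : b'' ⟶ c''} (φ : Cmp (F.map f) f')
    (ψ : Cmp (F.map g) g') (φ' : Cmp f' f'') (ψ' : Cmp g' g'') :
    compCmp F (φ.trans φ') (ψ.trans ψ') = (compCmp F φ ψ).trans (φ'.comp ψ') := by
  rw [compCmp, compCmp, Cmp.comp_trans, Cmp.trans_assoc]

theorem compCmp_natural {a b c a₁ b₁ c₁ : B} {f : a ⟶ b} {g : b ⟶ c} {f₁ : a₁ ⟶ b₁}
    {g₁ : b₁ ⟶ c₁} {a' b' c' : C} {f' : a' ⟶ b'} {g' : b' ⟶ c'} (δ : Cmp f f₁) (δ' : Cmp g g₁)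
    (φ : Cmp (F.map f₁) f') (ψ : Cmp (F.map g₁) g') :
    ((δ.comp δ').map F).trans (compCmp F φ ψ) =
      compCmp F ((δ.map F).trans φ) ((δ'.map F).trans ψ) := by
  obtain ⟨rfl, rfl, i⟩ := δ
  obtain ⟨_, rfl, j⟩ := δ'
  rw [compCmp, compCmp, Cmp.comp_trans, ← Cmp.trans_assoc, ← Cmp.trans_assoc]
  congr 1
  change f ≅ f₁ at i
  change g ≅ g₁ at j
  refine congrArg (Cmp.mk rfl rfl) (Iso.ext ?_)
  change F.map₂ (i.hom ▷ g ≫ f₁ ◁ j.hom) ≫ (F.mapComp f₁ g₁).hom =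
    (F.mapComp f g).hom ≫ F.map₂ i.hom ▷ F.map g ≫ F.map f₁ ◁ F.map₂ j.hom
  simp only [PrelaxFunctor.map₂_comp, Pseudofunctor.map₂_whisker_left,
    Pseudofunctor.map₂_whisker_right, Category.assoc, Iso.inv_hom_id_assoc, Iso.inv_hom_id,
    Category.comp_id]

theorem compCmp_assoc {a b c d : B} {f : a ⟶ b} {g : b ⟶ c} {h : c ⟶ d} {a' b' c' d' : C}
    {f' : a' ⟶ b'} {g' : b' ⟶ c'} {h' : c' ⟶ d'} (φ : Cmp (F.map f) f') (ψ : Cmp (F.map g) g')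
    (χ : Cmp (F.map h) h') :
    ((Cmp.ofIso (α_ f g h)).map F).trans (compCmp F φ (compCmp F ψ χ)) =
      (compCmp F (compCmp F φ ψ) χ).trans (Cmp.ofIso (α_ f' g' h')) := by
  obtain ⟨rfl, rfl, i⟩ := φ
  obtain ⟨_, rfl, j⟩ := ψ
  obtain ⟨_, rfl, k⟩ := χ
  change F.map f ≅ f' at i
  change F.map g ≅ g' at j
  change F.map h ≅ h' at k
  refine congrArg (Cmp.mk rfl rfl) (Iso.ext ?_)
  change F.map₂ (α_ f g h).hom ≫ (F.mapComp f (g ≫ h)).hom ≫ i.hom ▷ F.map (g ≫ h) ≫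
      f' ◁ ((F.mapComp g h).hom ≫ j.hom ▷ F.map h ≫ g' ◁ k.hom) =
    ((F.mapComp (f ≫ g) h).hom ≫ ((F.mapComp f g).hom ≫ i.hom ▷ F.map g ≫ f' ◁ j.hom) ▷ F.map h ≫
      (f' ≫ g') ◁ k.hom) ≫ (α_ f' g' h').hom
  rw [F.map₂_associator]
  simp only [Category.assoc, Iso.inv_hom_id_assoc, comp_whiskerRight, whiskerLeft_comp,
    ← whisker_exchange_assoc, comp_whiskerLeft, whisker_assoc, Iso.inv_hom_id_assoc,
    Iso.inv_hom_id, Category.comp_id, whiskerRight_comp]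
  simp only [← whiskerLeft_comp_assoc, ← whiskerLeft_comp]
  simp

theorem compCmp_id_left {a b : B} {f : a ⟶ b} {a' b' : C} {f' : a' ⟶ b'} (h : F.obj a = a')
    (φ : Cmp (F.map f) f') :
    ((Cmp.ofIso (λ_ f)).map F).trans φ =
      (compCmp F (idCmp F h) φ).trans (Cmp.ofIso (λ_ f')) := by
  obtain ⟨rfl, rfl, i⟩ := φ
  change F.map f ≅ f' at i
  refine congrArg (Cmp.mk rfl rfl) (Iso.ext ?_)
  change F.map₂ (λ_ f).hom ≫ i.hom = ((F.mapComp (𝟙 a) f).hom ≫ ((F.mapId a).hom ≫ 𝟙 _) ▷ _ ≫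
    𝟙 (F.obj a) ◁ i.hom) ≫ (λ_ f').hom
  simp

theorem compCmp_id_right {a b : B} {f : a ⟶ b} {a' b' : C} {f' : a' ⟶ b'} (h : F.obj b = b')
    (φ : Cmp (F.map f) f') :
    ((Cmp.ofIso (ρ_ f)).map F).trans φ =
      (compCmp F φ (idCmp F h)).trans (Cmp.ofIso (ρ_ f')) := by
  obtain ⟨rfl, rfl, i⟩ := φ
  change F.map f ≅ f' at i
  refine congrArg (Cmp.mk rfl rfl) (Iso.ext ?_)
  change F.map₂ (ρ_ f).hom ≫ i.hom = ((F.mapComp f (𝟙 b)).hom ≫ i.hom ▷ _ ≫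
    f' ◁ ((F.mapId b).hom ≫ 𝟙 _)) ≫ (ρ_ f').hom
  simp [← whisker_exchange_assoc]

theorem compCmp_ofPF {G : B ⥤ᵖ C} (h : F = G) {a b c : B} {f : a ⟶ b} {g : b ⟶ c}
    {a' b' c' : C} {f' : a' ⟶ b'} {g' : b' ⟶ c'} (φ : Cmp (G.map f) f') (ψ : Cmp (G.map g) g') :
    compCmp F ((Cmp.ofPF h f).trans φ) ((Cmp.ofPF h g).trans ψ) =
      (Cmp.ofPF h (f ≫ g)).trans (compCmp G φ ψ) := by
  subst h
  have e : ∀ {a b : B} (f : a ⟶ b), Cmp.ofPF (rfl : F = F) f = Cmp.ofIso (Iso.refl _) :=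
    fun f => rfl
  rw [e, e, e, Cmp.ofIso_refl_trans, Cmp.ofIso_refl_trans, Cmp.ofIso_refl_trans]

theorem idCmp_ofPF {G : B ⥤ᵖ C} (h : F = G) {a : B} {a' : C} (e : G.obj a = a') :
    idCmp F ((congrArg (fun H : B ⥤ᵖ C => H.obj a) h).trans e) =
      (Cmp.ofPF h (𝟙 a)).trans (idCmp G e) := by
  subst h
  exact (Cmp.ofIso_refl_trans _).symm

variable {F}

theorem idCmp_isEq (hF : IsTwoFunctor F) {a : B} {a' : C} (h : F.obj a = a') :
    (idCmp F h).IsEq := by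
  obtain ⟨h, e⟩ := hF.1 a
  refine Cmp.IsEq.trans ?_ (Cmp.ofHEq_isEq _ _ _)
  rw [e]
  exact Cmp.IsEq.of_eq h

end

section

variable [Bicategory.Strict B] {a b c d : B}

theorem Cmp.associator_isEq (f : a ⟶ b) (g : b ⟶ c) (h : c ⟶ d) : (Cmp.ofIso (α_ f g h)).IsEq :=
  ⟨Bicategory.Strict.assoc f g h, Bicategory.Strict.associator_eqToIso f g h⟩

theorem Cmp.leftUnitor_isEq (f : a ⟶ b) : (Cmp.ofIso (λ_ f)).IsEq :=
  ⟨Bicategory.Strict.id_comp f, Bicategory.Strict.leftUnitor_eqToIso f⟩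

theorem Cmp.rightUnitor_isEq (f : a ⟶ b) : (Cmp.ofIso (ρ_ f)).IsEq :=
  ⟨Bicategory.Strict.comp_id f, Bicategory.Strict.rightUnitor_eqToIso f⟩

end

end

end SMTwo

namespace SMTwo

section

variable {B : Type u₁} [Bicategory.{w₁, v₁} B] {C : Type u₂} [Bicategory.{w₂, v₂} C]
  {D : Type u₃} [Bicategory.{w₃, v₃} D]  {A : Type u₄} [Bicategory.{w₄, v₄} A]

/-! ### Images of squares under pseudofunctors -/

theorem sq_comp_hom {a b a' b' c c' : B} {u : a ⟶ a'} {v : b ⟶ b'}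
    {p : a ⟶ b} {q : a' ⟶ b'} {w : c ⟶ c'} {p' : b ⟶ c} {q' : b' ⟶ c'} (s : Sq u v p q)
    (s' : Sq v w p' q') : (Sq.comp s s').hom = (α_ _ _ _).inv ≫ s.hom ▷ q' ≫ (α_ _ _ _).hom ≫
      p ◁ s'.hom ≫ (α_ _ _ _).inv := rfl

theorem glue_squares {a b a' b' : B} {u u' u'' : a ⟶ a'} {v v' v'' : b ⟶ b'} {p : a ⟶ b}
    {q : a' ⟶ b'} {x : u ⟶ u'} {x' : u' ⟶ u''} {y : v ⟶ v'} {y' : v' ⟶ v''}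
    {s : u ≫ q ⟶ p ≫ v} {s' : u' ≫ q ⟶ p ≫ v'} {s'' : u'' ≫ q ⟶ p ≫ v''}
    (h : x ▷ q ≫ s' = s ≫ p ◁ y) (h' : s' ≫ p ◁ y' = x' ▷ q ≫ s'') :
    s ≫ p ◁ (y ≫ y') = (x ≫ x') ▷ q ≫ s'' := by
  rw [whiskerLeft_comp, ← Category.assoc, ← h, Category.assoc, h', comp_whiskerRight,
    Category.assoc]

section

variable (M : B ⥤ᵖ C) {a b a' b' a'' b'' : B}

theorem map₂_leftUnitor_inv {a b : B} (f : a ⟶ b) : M.map₂ (λ_ f).inv =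
    (λ_ (M.map f)).inv ≫ (M.mapId a).inv ▷ M.map f ≫ (M.mapComp (𝟙 a) f).inv := by
  rw [← cancel_mono (M.map₂ (λ_ f).hom), ← M.map₂_comp, Iso.inv_hom_id, M.map₂_id]
  simp

theorem map₂_rightUnitor_inv {a b : B} (f : a ⟶ b) : M.map₂ (ρ_ f).inv =
    (ρ_ (M.map f)).inv ≫ M.map f ◁ (M.mapId b).inv ≫ (M.mapComp f (𝟙 b)).inv := by
  rw [← cancel_mono (M.map₂ (ρ_ f).hom), ← M.map₂_comp, Iso.inv_hom_id, M.map₂_id]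
  simp

theorem map₂_associator_inv {a b c d : B} (f : a ⟶ b) (g : b ⟶ c) (h : c ⟶ d) :
    M.map₂ (α_ f g h).inv = (M.mapComp f (g ≫ h)).hom ≫ M.map f ◁ (M.mapComp g h).hom ≫
      (α_ _ _ _).inv ≫ (M.mapComp f g).inv ▷ M.map h ≫ (M.mapComp (f ≫ g) h).inv := by
  rw [← cancel_mono (M.map₂ (α_ f g h).hom), ← M.map₂_comp, Iso.inv_hom_id, M.map₂_id]
  simp

/-- The image of a square under a pseudofunctor. -/
def mapSq {u : a ⟶ a'} {v : b ⟶ b'} {p : a ⟶ b} {q : a' ⟶ b'} (s : Sq u v p q) :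
    Sq (M.map u) (M.map v) (M.map p) (M.map q) :=
  (M.mapComp u q).symm ≪≫ M.map₂Iso s ≪≫ M.mapComp p v

theorem mapSq_hom {u : a ⟶ a'} {v : b ⟶ b'} {p : a ⟶ b} {q : a' ⟶ b'} (s : Sq u v p q) :
    (mapSq M s).hom = (M.mapComp u q).inv ≫ M.map₂ s.hom ≫ (M.mapComp p v).hom := rfl

theorem mapSq_vertical {u u' : a ⟶ a'} {v v' : b ⟶ b'} {p : a ⟶ b} {q : a' ⟶ b'}
    {s : Sq u v p q} {s' : Sq u' v' p q} {x : u ⟶ u'} {y : v ⟶ v'}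
    (h : x ▷ q ≫ s'.hom = s.hom ≫ p ◁ y) :
    M.map₂ x ▷ M.map q ≫ (mapSq M s').hom = (mapSq M s).hom ≫ M.map p ◁ M.map₂ y := by
  have e := congrArg M.map₂ h
  rw [M.map₂_comp, M.map₂_comp, M.map₂_whisker_right, M.map₂_whisker_left] at e
  rw [mapSq_hom, mapSq_hom, ← cancel_epi (M.mapComp u q).hom,
    ← cancel_mono (M.mapComp p v').inv]
  simpa using e

theorem mapSq_horizontal {u : a ⟶ a'} {v : b ⟶ b'} {p p' : a ⟶ b} {q q' : a' ⟶ b'}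
    {s : Sq u v p q} {s' : Sq u v p' q'} {x : p ⟶ p'} {y : q ⟶ q'}
    (h : u ◁ y ≫ s'.hom = s.hom ≫ x ▷ v) :
    M.map u ◁ M.map₂ y ≫ (mapSq M s').hom = (mapSq M s).hom ≫ M.map₂ x ▷ M.map v := by
  have e := congrArg M.map₂ h
  rw [M.map₂_comp, M.map₂_comp, M.map₂_whisker_right, M.map₂_whisker_left] at e
  rw [mapSq_hom, mapSq_hom, ← cancel_epi (M.mapComp u q).hom,
    ← cancel_mono (M.mapComp p' v).inv]
  simpa using e

theorem mapSq_id {p : a ⟶ b} {s : Sq (𝟙 a) (𝟙 b) p p} (h : s.hom = (λ_ p).hom ≫ (ρ_ p).inv) :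
    (mapSq M s).hom ≫ M.map p ◁ (M.mapId b).hom =
      (M.mapId a).hom ▷ M.map p ≫ (λ_ (M.map p)).hom ≫ (ρ_ (M.map p)).inv := by
  rw [mapSq_hom, h, M.map₂_comp, map₂_rightUnitor_inv]
  simp [← whiskerLeft_comp]

theorem mapSq_id' {u : a ⟶ b} {s : Sq u u (𝟙 a) (𝟙 b)} (h : s.hom = (ρ_ u).hom ≫ (λ_ u).inv) :
    (mapSq M s).hom ≫ (M.mapId a).hom ▷ M.map u =
      M.map u ◁ (M.mapId b).hom ≫ (ρ_ (M.map u)).hom ≫ (λ_ (M.map u)).inv := by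
  rw [mapSq_hom, h, M.map₂_comp, map₂_leftUnitor_inv]
  simp [← comp_whiskerRight]

theorem mapSq_comp {u : a ⟶ a'} {v : b ⟶ b'} {p : a ⟶ b} {q : a' ⟶ b'} {u' : a' ⟶ a''}
    {v' : b' ⟶ b''} {q' : a'' ⟶ b''} {s : Sq u v p q} {s' : Sq u' v' q q'}
    {r : Sq (u ≫ u') (v ≫ v') p q'}
    (h : r.hom = (α_ _ _ _).hom ≫ u ◁ s'.hom ≫ (α_ _ _ _).inv ≫ s.hom ▷ v' ≫ (α_ _ _ _).hom) :
    (mapSq M r).hom ≫ M.map p ◁ (M.mapComp v v').hom =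
      (M.mapComp u u').hom ▷ M.map q' ≫ (α_ _ _ _).hom ≫ M.map u ◁ (mapSq M s').hom ≫
        (α_ _ _ _).inv ≫ (mapSq M s).hom ▷ M.map v' ≫ (α_ _ _ _).hom := by
  simp only [mapSq_hom, h]
  simp [map₂_associator_inv]

theorem mapSq_comp' {c c' : B} {u : a ⟶ a'} {v : b ⟶ b'} {p : a ⟶ b} {q : a' ⟶ b'} {w : c ⟶ c'}
    {p' : b ⟶ c} {q' : b' ⟶ c'} {s : Sq u v p q} {s' : Sq v w p' q'}
    {r : Sq u w (p ≫ p') (q ≫ q')} (h : r.hom = (Sq.comp s s').hom) :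
    (mapSq M r).hom ≫ (M.mapComp p p').hom ▷ M.map w =
      M.map u ◁ (M.mapComp q q').hom ≫ (Sq.comp (mapSq M s) (mapSq M s')).hom := by
  rw [sq_comp_hom] at h ⊢
  simp only [mapSq_hom, h]
  simp [map₂_associator_inv]

end

/-! ### Pseudofunctors of two variables -/

section

variable (M : (B × C) ⥤ᵖ D)

/-- `a ↦ M(p, Q a)` -/
abbrev sec (p : B) (Q : A ⥤ᵖ C) : A ⥤ᵖ D := (pair (const A p) Q).comp M

/-- `b ↦ M(b, c)` -/
abbrev evalAt (c : C) : B ⥤ᵖ D := (pair (Pseudofunctor.id B) (const B c)).comp M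

/-- The interchange square of `κ` and `F` in a product. -/
def exchange {p q : B} (κ : p ⟶ q) {x y : C} (F : x ⟶ y) :
    Sq (B := B × C) (𝟙 p ×ₘ F) (𝟙 q ×ₘ F) (κ ×ₘ 𝟙 x) (κ ×ₘ 𝟙 y) :=
  Iso.prod (λ_ κ ≪≫ (ρ_ κ).symm) (ρ_ F ≪≫ (λ_ F).symm)

/-- The transformation `M(p, Q -) ⟶ M(q, Q -)` induced by `κ : p ⟶ q`. -/
def secMap (Q : A ⥤ᵖ C) {p q : B} (κ : p ⟶ q) : sec M p Q ⟶ sec M q Q where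
  app a := (evalAt M (Q.obj a)).map κ
  naturality f := mapSq M (exchange κ (Q.map f))
  naturality_naturality {a b f g} η := by
    refine mapSq_vertical M (u := 𝟙 p ×ₘ Q.map f) (u' := 𝟙 p ×ₘ Q.map g)
      (v := 𝟙 q ×ₘ Q.map f) (v' := 𝟙 q ×ₘ Q.map g) (x := (𝟙 (𝟙 p), Q.map₂ η))
      (y := (𝟙 (𝟙 q), Q.map₂ η)) (Prod.ext ?_ ?_)
    · change 𝟙 (𝟙 p) ▷ κ ≫ (λ_ κ).hom ≫ (ρ_ κ).inv = ((λ_ κ).hom ≫ (ρ_ κ).inv) ≫ κ ◁ 𝟙 (𝟙 q)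
      simp
    · change Q.map₂ η ▷ 𝟙 _ ≫ (ρ_ _).hom ≫ (λ_ _).inv = ((ρ_ _).hom ≫ (λ_ _).inv) ≫ 𝟙 _ ◁ Q.map₂ η
      simp
  naturality_id a := by
    have h := mapSq_vertical M (s := exchange κ (Q.map (𝟙 a))) (s' := exchange κ (𝟙 (Q.obj a)))
      (x := (𝟙 (𝟙 p), (Q.mapId a).hom)) (y := (𝟙 (𝟙 q), (Q.mapId a).hom)) (Prod.ext (by
        change 𝟙 (𝟙 p) ▷ κ ≫ (λ_ κ).hom ≫ (ρ_ κ).inv = ((λ_ κ).hom ≫ (ρ_ κ).inv) ≫ κ ◁ 𝟙 (𝟙 q)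
        simp) (by
        change (Q.mapId a).hom ▷ 𝟙 _ ≫ (ρ_ _).hom ≫ (λ_ _).inv =
          ((ρ_ _).hom ≫ (λ_ _).inv) ≫ 𝟙 _ ◁ (Q.mapId a).hom
        simp))
    have h' := mapSq_id M (p := κ ×ₘ 𝟙 (Q.obj a)) (s := exchange κ (𝟙 (Q.obj a)))
      (Prod.ext rfl (by
        change (ρ_ (𝟙 (Q.obj a))).hom ≫ (λ_ _).inv = (λ_ _).hom ≫ (ρ_ _).inv
        simp [unitors_equal, unitors_inv_equal]))
    exact glue_squares h h'
  naturality_comp {a b c} f g := by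
    have h := mapSq_vertical M (s := exchange κ (Q.map (f ≫ g)))
      (s' := Iso.prod (whiskerRightIso (λ_ (𝟙 p)) κ ≪≫ λ_ κ ≪≫ (ρ_ κ).symm ≪≫
        whiskerLeftIso κ (λ_ (𝟙 q)).symm) (ρ_ (Q.map f ≫ Q.map g) ≪≫ (λ_ _).symm))
      (x := ((λ_ (𝟙 p)).inv, (Q.mapComp f g).hom)) (y := ((λ_ (𝟙 q)).inv, (Q.mapComp f g).hom))
      (u' := (𝟙 p ×ₘ Q.map f) ≫ (𝟙 p ×ₘ Q.map g)) (v' := (𝟙 q ×ₘ Q.map f) ≫ (𝟙 q ×ₘ Q.map g))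
      (Prod.ext (by
        change (λ_ (𝟙 p)).inv ▷ κ ≫ (λ_ (𝟙 p)).hom ▷ κ ≫ (λ_ κ).hom ≫ (ρ_ κ).inv ≫
          κ ◁ (λ_ (𝟙 q)).inv = ((λ_ κ).hom ≫ (ρ_ κ).inv) ≫ κ ◁ (λ_ (𝟙 q)).inv
        simp) (by
        change (Q.mapComp f g).hom ▷ 𝟙 _ ≫ (ρ_ _).hom ≫ (λ_ _).inv =
          ((ρ_ _).hom ≫ (λ_ _).inv) ≫ 𝟙 _ ◁ (Q.mapComp f g).hom
        simp))
    have h' := mapSq_comp M (s := exchange κ (Q.map f)) (s' := exchange κ (Q.map g))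
      (r := Iso.prod (whiskerRightIso (λ_ (𝟙 p)) κ ≪≫ λ_ κ ≪≫ (ρ_ κ).symm ≪≫
        whiskerLeftIso κ (λ_ (𝟙 q)).symm) (ρ_ (Q.map f ≫ Q.map g) ≪≫ (λ_ _).symm))
      (Prod.ext (by
        change (λ_ (𝟙 p)).hom ▷ κ ≫ (λ_ κ).hom ≫ (ρ_ κ).inv ≫ κ ◁ (λ_ (𝟙 q)).inv =
          (α_ _ _ _).hom ≫ 𝟙 p ◁ ((λ_ κ).hom ≫ (ρ_ κ).inv) ≫ (α_ _ _ _).inv ≫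
            ((λ_ κ).hom ≫ (ρ_ κ).inv) ▷ 𝟙 q ≫ (α_ _ _ _).hom
        bicategory) (by
        change (ρ_ (Q.map f ≫ Q.map g)).hom ≫ (λ_ _).inv =
          (α_ _ _ _).hom ≫ Q.map f ◁ ((ρ_ _).hom ≫ (λ_ _).inv) ≫ (α_ _ _ _).inv ≫
            ((ρ_ _).hom ≫ (λ_ _).inv) ▷ Q.map g ≫ (α_ _ _ _).hom
        bicategory))
    exact glue_squares h h'

theorem glue_squares' {D : Type u₃} [Bicategory.{w₃, v₃} D] {a b a' b' : D} {u : a ⟶ a'}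
    {v : b ⟶ b'} {p p' p'' : a ⟶ b} {q q' q'' : a' ⟶ b'} {x : p ⟶ p'} {x' : p' ⟶ p''}
    {y : q ⟶ q'} {y' : q' ⟶ q''} {s : u ≫ q ⟶ p ≫ v} {s' : u ≫ q' ⟶ p' ≫ v}
    {s'' : u ≫ q'' ⟶ p'' ≫ v} (h : u ◁ y ≫ s' = s ≫ x ▷ v) (h' : u ◁ y' ≫ s'' = s' ≫ x' ▷ v) :
    u ◁ (y ≫ y') ≫ s'' = s ≫ (x ≫ x') ▷ v := by
  rw [whiskerLeft_comp, Category.assoc, h', ← Category.assoc, h, comp_whiskerRight,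
    Category.assoc]

theorem exchange_natural {p q : B} {κ κ' : p ⟶ q} (η : κ ⟶ κ') {x y : C} (F : x ⟶ y) :
    M.map (𝟙 p ×ₘ F) ◁ (evalAt M y).map₂ η ≫ (mapSq M (exchange κ' F)).hom =
      (mapSq M (exchange κ F)).hom ≫ (evalAt M x).map₂ η ▷ M.map (𝟙 q ×ₘ F) := by
  refine mapSq_horizontal M (p := κ ×ₘ 𝟙 x) (p' := κ' ×ₘ 𝟙 x) (q := κ ×ₘ 𝟙 y)
    (q' := κ' ×ₘ 𝟙 y) (x := (η, 𝟙 (𝟙 x))) (y := (η, 𝟙 (𝟙 y))) (Prod.ext ?_ ?_)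
  · change 𝟙 p ◁ η ≫ (λ_ κ').hom ≫ (ρ_ κ').inv = ((λ_ κ).hom ≫ (ρ_ κ).inv) ≫ η ▷ 𝟙 q
    simp
  · change F ◁ 𝟙 (𝟙 y) ≫ (ρ_ F).hom ≫ (λ_ F).inv = ((ρ_ F).hom ≫ (λ_ F).inv) ≫ 𝟙 (𝟙 x) ▷ F
    simp

theorem evalAt_mapId (p : B) (x : C) : (evalAt M x).mapId p = M.mapId (p, x) :=
  Iso.ext ((congrArg (· ≫ _) (M.map₂_id _)).trans (Category.id_comp _))

theorem exchange_id (p : B) {x y : C} (F : x ⟶ y) :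
    M.map (𝟙 p ×ₘ F) ◁ (M.mapId (p, y)).inv ≫ (mapSq M (exchange (𝟙 p) F)).hom =
      ((ρ_ (M.map (𝟙 p ×ₘ F))).hom ≫ (λ_ (M.map (𝟙 p ×ₘ F))).inv) ≫
        (M.mapId (p, x)).inv ▷ M.map (𝟙 p ×ₘ F) := by
  have h := mapSq_id' M (s := exchange (𝟙 p) F) (Prod.ext (by
    change (λ_ (𝟙 p)).hom ≫ (ρ_ _).inv = (ρ_ (𝟙 p)).hom ≫ (λ_ _).inv
    simp [unitors_equal, unitors_inv_equal]) rfl)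
  rw [← cancel_epi (M.map (𝟙 p ×ₘ F) ◁ (M.mapId (p, y)).hom),
    ← cancel_mono ((M.mapId (p, x)).hom ▷ M.map (𝟙 p ×ₘ F))]
  have e₁ : M.map (𝟙 p ×ₘ F) ◁ (M.mapId (p, y)).hom ≫ M.map (𝟙 p ×ₘ F) ◁ (M.mapId (p, y)).inv =
      𝟙 _ := by rw [← whiskerLeft_comp, Iso.hom_inv_id, whiskerLeft_id]
  have e₂ : (M.mapId (p, x)).inv ▷ M.map (𝟙 p ×ₘ F) ≫ (M.mapId (p, x)).hom ▷ M.map (𝟙 p ×ₘ F) =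
      𝟙 _ := by rw [← comp_whiskerRight, Iso.inv_hom_id, id_whiskerRight]
  rw [← Category.assoc, e₁, Category.id_comp, h]
  simp only [Category.assoc, e₂, Category.comp_id]

theorem exchange_comp {p q r : B} (κ : p ⟶ q) (κ' : q ⟶ r) {x y : C} (F : x ⟶ y) :
    (mapSq M (exchange (κ ≫ κ') F)).hom ≫
        ((evalAt M x).mapComp κ κ').hom ▷ M.map (𝟙 r ×ₘ F) =
      M.map (𝟙 p ×ₘ F) ◁ ((evalAt M y).mapComp κ κ').hom ≫
        (Sq.comp (mapSq M (exchange κ F)) (mapSq M (exchange κ' F))).hom := by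
  have h := mapSq_horizontal M (s := exchange (κ ≫ κ') F) (s' := Iso.prod
      (λ_ (κ ≫ κ') ≪≫ (ρ_ (κ ≫ κ')).symm) (whiskerLeftIso F (λ_ (𝟙 y)) ≪≫ ρ_ F ≪≫ (λ_ F).symm ≪≫
        whiskerRightIso (λ_ (𝟙 x)).symm F)) (p' := (κ ×ₘ 𝟙 x) ≫ (κ' ×ₘ 𝟙 x))
    (q' := (κ ×ₘ 𝟙 y) ≫ (κ' ×ₘ 𝟙 y)) (x := (𝟙 (κ ≫ κ'), (λ_ (𝟙 x)).inv))
    (y := (𝟙 (κ ≫ κ'), (λ_ (𝟙 y)).inv)) (Prod.ext (by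
      change 𝟙 p ◁ 𝟙 _ ≫ (λ_ (κ ≫ κ')).hom ≫ (ρ_ (κ ≫ κ')).inv =
        ((λ_ (κ ≫ κ')).hom ≫ (ρ_ (κ ≫ κ')).inv) ≫ 𝟙 _ ▷ 𝟙 r
      simp) (by
      change F ◁ (λ_ (𝟙 y)).inv ≫ F ◁ (λ_ (𝟙 y)).hom ≫ (ρ_ F).hom ≫ (λ_ F).inv ≫
        (λ_ (𝟙 x)).inv ▷ F = ((ρ_ F).hom ≫ (λ_ F).inv) ≫ (λ_ (𝟙 x)).inv ▷ F
      simp))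
  have h' := mapSq_comp' M (s := exchange κ F) (s' := exchange κ' F) (r := Iso.prod
      (λ_ (κ ≫ κ') ≪≫ (ρ_ (κ ≫ κ')).symm) (whiskerLeftIso F (λ_ (𝟙 y)) ≪≫ ρ_ F ≪≫ (λ_ F).symm ≪≫
        whiskerRightIso (λ_ (𝟙 x)).symm F)) (Prod.ext (by
      change (λ_ (κ ≫ κ')).hom ≫ (ρ_ (κ ≫ κ')).inv = (α_ _ _ _).inv ≫
        ((λ_ κ).hom ≫ (ρ_ κ).inv) ▷ κ' ≫ (α_ _ _ _).hom ≫ κ ◁ ((λ_ κ').hom ≫ (ρ_ κ').inv) ≫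
        (α_ _ _ _).inv
      bicategory) (by
      change F ◁ (λ_ (𝟙 y)).hom ≫ (ρ_ F).hom ≫ (λ_ F).inv ≫ (λ_ (𝟙 x)).inv ▷ F =
        (α_ _ _ _).inv ≫ ((ρ_ F).hom ≫ (λ_ F).inv) ▷ 𝟙 y ≫ (α_ _ _ _).hom ≫
          𝟙 x ◁ ((ρ_ F).hom ≫ (λ_ F).inv) ≫ (α_ _ _ _).inv
      bicategory))
  have e : ∀ {a b a' b' : D} {u : a ⟶ a'} {v : b ⟶ b'} {p p' p'' : a ⟶ b} {q q' q'' : a' ⟶ b'}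
      {x : p ⟶ p'} {x' : p' ⟶ p''} {y : q ⟶ q'} {y' : q' ⟶ q''} {s : u ≫ q ⟶ p ≫ v}
      {s' : u ≫ q' ⟶ p' ≫ v} {s'' : u ≫ q'' ⟶ p'' ≫ v} (h : u ◁ y ≫ s' = s ≫ x ▷ v)
      (h' : s' ≫ x' ▷ v = u ◁ y' ≫ s''), s ≫ (x ≫ x') ▷ v = u ◁ (y ≫ y') ≫ s'' :=
    fun h h' => (glue_squares' h h'.symm).symm
  exact e h h'

theorem flip_square {D : Type u₃} [Bicategory.{w₃, v₃} D] {a b a' b' : D} {u : a ⟶ a'}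
    {v : b ⟶ b'} {p p' : a ⟶ b} {q q' : a' ⟶ b'} {x : p ≅ p'} {y : q ≅ q'} {s : u ≫ q ⟶ p ≫ v}
    {s' : u ≫ q' ⟶ p' ≫ v} (h : u ◁ y.hom ≫ s' = s ≫ x.hom ▷ v) :
    u ◁ y.inv ≫ s = s' ≫ x.inv ▷ v := by
  rw [← cancel_epi (u ◁ y.hom), ← cancel_mono (x.hom ▷ v)]
  simp [h]

variable {M}

/-- The unit of the image of an equivalence. -/
def secUnit (Q : A ⥤ᵖ C) {p q : B} (e : Bicategory.Equivalence p q) :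
    𝟙 (sec M p Q) ≅ secMap M Q e.hom ≫ secMap M Q e.inv :=
  Pseudofunctor.StrongTrans.isoMk (fun a => (M.mapId (p, Q.obj a)).symm ≪≫
      (evalAt M (Q.obj a)).map₂Iso e.unit ≪≫ (evalAt M (Q.obj a)).mapComp e.hom e.inv)
    (fun {a b} f => glue_squares' (exchange_id M p (Q.map f))
      (glue_squares' (exchange_natural M e.unit.hom (Q.map f))
        (exchange_comp M e.hom e.inv (Q.map f)).symm))

/-- The counit of the image of an equivalence. -/
def secCounit (Q : A ⥤ᵖ C) {p q : B} (e : Bicategory.Equivalence p q) :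
    secMap M Q e.inv ≫ secMap M Q e.hom ≅ 𝟙 (sec M q Q) :=
  Pseudofunctor.StrongTrans.isoMk (fun a => ((evalAt M (Q.obj a)).mapComp e.inv e.hom).symm ≪≫
      (evalAt M (Q.obj a)).map₂Iso e.counit ≪≫ M.mapId (q, Q.obj a))
    (fun {a b} f => glue_squares' (flip_square (exchange_comp M e.inv e.hom (Q.map f)).symm)
      (glue_squares' (exchange_natural M e.counit.hom (Q.map f))
        (flip_square (x := (M.mapId (q, Q.obj a)).symm) (y := (M.mapId (q, Q.obj b)).symm)
          (exchange_id M q (Q.map f)))))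

theorem leftZigzag_eq {a b : B} {f : a ⟶ b} {g : b ⟶ a} (η : 𝟙 a ⟶ f ≫ g) (δ : g ≫ f ⟶ 𝟙 b) :
    leftZigzag η δ = η ▷ f ≫ (α_ f g f).hom ≫ f ◁ δ := by
  simp [leftZigzag, bicategoricalComp]

theorem left_triangle_iff {a b : B} {f : a ⟶ b} {g : b ⟶ a} (η : 𝟙 a ≅ f ≫ g)
    (δ : g ≫ f ≅ 𝟙 b) : leftZigzagIso η δ = λ_ f ≪≫ (ρ_ f).symm ↔
      η.hom ▷ f ≫ (α_ f g f).hom ≫ f ◁ δ.hom = (λ_ f).hom ≫ (ρ_ f).inv := by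
  rw [Iso.ext_iff, leftZigzagIso_hom, leftZigzag_eq]
  rfl

/-- The image `M(e, Q -)` of an equivalence. -/
def secEquiv (Q : A ⥤ᵖ C) {p q : B} (e : Bicategory.Equivalence p q) :
    Bicategory.Equivalence (sec M p Q) (sec M q Q) where
  hom := secMap M Q e.hom
  inv := secMap M Q e.inv
  unit := secUnit Q e
  counit := secCounit Q e
  left_triangle := by
    refine (left_triangle_iff _ _).2 (Pseudofunctor.StrongTrans.homCategory.ext fun a => ?_)
    have h := ((evalAt M (Q.obj a)).mapAdjunction (Adjunction.mk e.unit.hom e.counit.hom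
      e.left_triangle_hom e.right_triangle_hom)).left_triangle
    simp only [Pseudofunctor.mapAdjunction_unit, Pseudofunctor.mapAdjunction_counit] at h
    rw [leftZigzag_eq, evalAt_mapId, evalAt_mapId] at h
    exact h

end

/-! ### Identity-on-objects comparisons of pseudofunctors -/

/-- A comparison of two pseudofunctors which agree on objects: an icon with invertible 2-cells. -/
structure Icon (F G : A ⥤ᵖ D) where
  cmp {a b : A} (f : a ⟶ b) : Cmp (F.map f) (G.map f)
  obj_eq (a : A) : F.obj a = G.obj a
  natural {a b : A} {f g : a ⟶ b} (η : f ⟶ g) :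
    Carries (cmp f) (cmp g) (F.map₂ η) (G.map₂ η)
  id (a : A) : (cmp (𝟙 a)).trans (Cmp.ofIso (G.mapId a)) = idCmp F (obj_eq a)
  comp {a b c : A} (f : a ⟶ b) (g : b ⟶ c) :
    (cmp (f ≫ g)).trans (Cmp.ofIso (G.mapComp f g)) = compCmp F (cmp f) (cmp g)

namespace Icon

variable {F G H : A ⥤ᵖ D}

/-- The icon of equal pseudofunctors. -/
def ofEq (h : F = G) : Icon F G where
  cmp f := Cmp.ofPF h f
  obj_eq a := by rw [h]
  natural η := by
    subst h
    exact Cmp.carries_refl _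
  id a := by
    subst h
    exact (Cmp.ofIso_refl_trans _).trans (Cmp.trans_ofIso_refl _).symm
  comp f g := by
    subst h
    refine (Cmp.ofIso_refl_trans _).trans ((Cmp.trans_ofIso_refl _).symm.trans ?_)
    exact congrArg _ ((Cmp.IsEq.refl _).unique ((Cmp.IsEq.refl _).comp (Cmp.IsEq.refl _)))

/-- Composition of icons. -/
def trans (I : Icon F G) (J : Icon G H) : Icon F H where
  cmp f := (I.cmp f).trans (J.cmp f)
  obj_eq a := (I.obj_eq a).trans (J.obj_eq a)
  natural η := Cmp.carries_trans (I.natural η) (J.natural η)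
  id a := by
    rw [Cmp.trans_assoc, J.id, idCmp, ← Cmp.trans_assoc, I.id, idCmp, idCmp, Cmp.trans_assoc,
      Cmp.ofHEq_trans]
  comp f g := by
    rw [Cmp.trans_assoc, J.comp, compCmp, ← Cmp.trans_assoc, I.comp, ← compCmp_trans]

/-- Icons composed with a pseudofunctor. -/
def whisker (I : Icon F G) (K : D ⥤ᵖ C) : Icon (F.comp K) (G.comp K) where
  cmp f := (I.cmp f).map K
  obj_eq a := congrArg K.obj (I.obj_eq a)
  natural η := Cmp.carries_map K (I.natural η)
  id a := by
    have h' := idCmp_comp F K (I.obj_eq a) rfl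
    refine Eq.trans ?_ h'.symm
    refine Eq.trans (Cmp.trans_assoc ((I.cmp (𝟙 a)).map K) ((Cmp.ofIso (G.mapId a)).map K)
      (Cmp.ofIso (K.mapId _))).symm (Eq.trans (congrArg (Cmp.trans · _)
        ((Cmp.map_trans K _ _).symm.trans (congrArg (Cmp.map K) (I.id a)))) ?_)
    exact congrArg _ (Cmp.trans_ofIso_refl _).symm
  comp f g := by
    have h' := compCmp_comp F K (I.cmp f) (I.cmp g) (Cmp.ofIso (Iso.refl _))
      (Cmp.ofIso (Iso.refl _))
    rw [Cmp.trans_ofIso_refl, Cmp.trans_ofIso_refl] at h'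
    refine Eq.trans ?_ h'.symm
    refine Eq.trans (Cmp.trans_assoc ((I.cmp (f ≫ g)).map K) ((Cmp.ofIso (G.mapComp f g)).map K)
      (Cmp.ofIso (K.mapComp _ _))).symm (Eq.trans (congrArg (Cmp.trans · _)
        ((Cmp.map_trans K _ _).symm.trans (congrArg (Cmp.map K) (I.comp f g)))) ?_)
    refine congrArg _ ((Cmp.trans_ofIso_refl _).symm.trans (congrArg _ ?_))
    exact (Cmp.IsEq.refl _).unique ((Cmp.IsEq.refl _).comp (Cmp.IsEq.refl _))

theorem _root_.SMTwo.Carries.pair {a b a' b' : B} {c d c' d' : C} {f g : a ⟶ b} {f' g' : a' ⟶ b'}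
    {h k : c ⟶ d} {h' k' : c' ⟶ d'} {φ : Cmp f f'} {ψ : Cmp g g'} {φ' : Cmp h h'}
    {ψ' : Cmp k k'} {θ : f ⟶ g} {θ' : f' ⟶ g'} {ζ : h ⟶ k} {ζ' : h' ⟶ k'}
    (e : Carries φ ψ θ θ') (e' : Carries φ' ψ' ζ ζ') :
    Carries (φ.pair φ') (ψ.pair ψ') (show (f ×ₘ h) ⟶ (g ×ₘ k) from (θ, ζ))
      (show (f' ×ₘ h') ⟶ (g' ×ₘ k') from (θ', ζ')) := by
  obtain ⟨rfl, rfl, i⟩ := φ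
  obtain ⟨_, _, j⟩ := ψ
  obtain ⟨rfl, rfl, i'⟩ := φ'
  obtain ⟨_, _, j'⟩ := ψ'
  obtain rfl := eq_of_heq e
  obtain rfl := eq_of_heq e'
  exact HEq.rfl

theorem _root_.SMTwo.Cmp.comp_pair {a b c a' b' c' : B} {x y z x' y' z' : C} {f : a ⟶ b}
    {g : b ⟶ c} {f' : a' ⟶ b'} {g' : b' ⟶ c'} {h : x ⟶ y} {k : y ⟶ z} {h' : x' ⟶ y'}
    {k' : y' ⟶ z'} (φ : Cmp f f') (ψ : Cmp g g') (φ' : Cmp h h') (ψ' : Cmp k k') :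
    (φ.comp ψ).pair (φ'.comp ψ') = ((φ.pair φ').comp (ψ.pair ψ') :
      Cmp (B := B × C) ((f ×ₘ h) ≫ (g ×ₘ k)) ((f' ×ₘ h') ≫ (g' ×ₘ k'))) := by
  obtain ⟨rfl, rfl, i⟩ := φ
  obtain ⟨_, rfl, j⟩ := ψ
  obtain ⟨rfl, rfl, i'⟩ := φ'
  obtain ⟨_, rfl, j'⟩ := ψ'
  rfl

/-- Pairs of icons. -/
def pair {F' G' : A ⥤ᵖ C} (I : Icon F G) (I' : Icon F' G') :
    Icon (SMTwo.pair F F') (SMTwo.pair G G') where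
  cmp f := (I.cmp f).pair (I'.cmp f)
  obj_eq a := Prod.ext (I.obj_eq a) (I'.obj_eq a)
  natural η := Carries.pair (I.natural η) (I'.natural η)
  id a := by
    refine Eq.trans (Cmp.pair_trans (I.cmp (𝟙 a)) (Cmp.ofIso (G.mapId a)) (I'.cmp (𝟙 a))
      (Cmp.ofIso (G'.mapId a))).symm (Eq.trans (congrArg₂ Cmp.pair (I.id a) (I'.id a)) ?_)
    refine (Cmp.pair_trans _ _ _ _).trans (congrArg (Cmp.trans (Cmp.ofIso _)) ?_)
    exact ((Cmp.ofHEq_isEq _ _ _).pair (Cmp.ofHEq_isEq _ _ _)).unique (Cmp.ofHEq_isEq _ _ _)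
  comp f g := by
    refine Eq.trans (Cmp.pair_trans (I.cmp (f ≫ g)) (Cmp.ofIso (G.mapComp f g)) (I'.cmp (f ≫ g))
      (Cmp.ofIso (G'.mapComp f g))).symm (Eq.trans (congrArg₂ Cmp.pair (I.comp f g)
        (I'.comp f g)) ?_)
    refine (Cmp.pair_trans _ _ _ _).trans (congrArg (Cmp.trans (Cmp.ofIso _)) ?_)
    exact Cmp.comp_pair _ _ _ _

/-- The icon from the image of a constant pseudofunctor to a constant pseudofunctor. -/
def ofConst (K : C ⥤ᵖ D) (c : C) {d : D} (h : K.obj c = d) :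
    Icon ((const A c).comp K) (const A d) where
  cmp f := idCmp K h
  obj_eq a := h
  natural η := by
    subst h
    have e := Cmp.carries_refl (𝟙 (K.map (𝟙 c)))
    have : ((const A c).comp K).map₂ η = 𝟙 _ := K.map₂_id _
    rw [this]
    refine heq_of_eq ?_
    change (idCmp K rfl).iso.inv ≫ 𝟙 _ ≫ (idCmp K rfl).iso.hom = 𝟙 _
    rw [Category.id_comp, Iso.inv_hom_id]
  id a := by
    subst h
    refine (Cmp.trans_ofIso_refl _).trans ?_
    refine congrArg (Cmp.trans · _) (congrArg Cmp.ofIso (Iso.ext ?_))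
    exact ((congrArg (· ≫ _) (K.map₂_id _)).trans (Category.id_comp _)).symm
  comp f g := by
    subst h
    have h := compCmp_id_left K rfl (idCmp K (rfl : K.obj c = K.obj c))
    have h' : compCmp ((const A c).comp K) (f := f) (g := g) (idCmp K rfl) (idCmp K rfl) =
        ((Cmp.ofIso (λ_ (𝟙 c))).map K).symm.trans
          (compCmp K (idCmp K (rfl : K.obj c = K.obj c)) (idCmp K rfl)) :=
      Cmp.trans_assoc ((Cmp.ofIso (λ_ (𝟙 c)).symm).map K) (Cmp.ofIso (K.mapComp _ _)) _
    refine Eq.trans ?_ h'.symm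
    refine Cmp.trans_eq_iff.1 ((Cmp.trans_assoc _ _ _).symm.trans ?_)
    refine (congrArg (Cmp.trans · _) h).trans ?_
    refine (Cmp.trans_assoc _ _ _).trans ((congrArg _ ?_).trans (Cmp.trans_ofIso_refl _))
    exact (Cmp.trans_symm (Cmp.ofIso (λ_ (𝟙 (K.obj c)))))

/-- The comparison of the identities of equal objects. -/
def _root_.SMTwo.Cmp.one {a b : B} (h : a = b) : Cmp (𝟙 a) (𝟙 b) :=
  Cmp.ofHEq h h (by rw [h])

section

variable {a b c : D} {a' b' c' : D} {u : a ⟶ a'} {v : b ⟶ b'} {w : c ⟶ c'} {f f' : a ⟶ b}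
  {g g' : a' ⟶ b'}

/-- A square with its horizontal sides replaced by isomorphic ones. -/
def _root_.SMTwo.Sq.replace (i : f ≅ f') (j : g ≅ g') (n : f ≫ v ≅ u ≫ g) : f' ≫ v ≅ u ≫ g' :=
  whiskerRightIso i.symm v ≪≫ n ≪≫ whiskerLeftIso u j

theorem replace_hom (i : f ≅ f') (j : g ≅ g') (n : f ≫ v ≅ u ≫ g) :
    (Sq.replace i j n).hom = i.inv ▷ v ≫ n.hom ≫ u ◁ j.hom := rfl

theorem replace_natural {h h' : a ⟶ b} {k k' : a' ⟶ b'} {i : f ≅ f'} {j : g ≅ g'} {i' : h ≅ h'}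
    {j' : k ≅ k'} {n : f ≫ v ≅ u ≫ g} {m : h ≫ v ≅ u ≫ k} {x : f ⟶ h} {x' : f' ⟶ h'} {y : g ⟶ k}
    {y' : g' ⟶ k'} (e : x ▷ v ≫ m.hom = n.hom ≫ u ◁ y) (ex : i.hom ≫ x' = x ≫ i'.hom)
    (ey : j.hom ≫ y' = y ≫ j'.hom) :
    x' ▷ v ≫ (Sq.replace i' j' m).hom = (Sq.replace i j n).hom ≫ u ◁ y' := by
  rw [← cancel_epi (i.hom ▷ v), ← comp_whiskerRight_assoc, ex, replace_hom, replace_hom]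
  simp only [Category.assoc, comp_whiskerRight, hom_inv_whiskerRight_assoc, ← whiskerLeft_comp, ey]
  rw [whiskerLeft_comp, reassoc_of% e]

theorem replace_id {f f' : a ⟶ a} {g g' : a' ⟶ a'} {i : f ≅ f'} {j : g ≅ g'} {n : f ≫ u ≅ u ≫ g}
    {x : f ≅ 𝟙 a} {x' : f' ≅ 𝟙 a} {y : g ≅ 𝟙 a'} {y' : g' ≅ 𝟙 a'} (ex : i.hom ≫ x'.hom = x.hom)
    (ey : j.hom ≫ y'.hom = y.hom)
    (e : n.hom ≫ u ◁ y.hom = x.hom ▷ u ≫ (λ_ u).hom ≫ (ρ_ u).inv) :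
    (Sq.replace i j n).hom ≫ u ◁ y'.hom = x'.hom ▷ u ≫ (λ_ u).hom ≫ (ρ_ u).inv := by
  rw [replace_hom, Category.assoc, Category.assoc, ← whiskerLeft_comp, ey, e, ← ex]
  simp

theorem replace_comp {p p' : b ⟶ c} {q q' : b' ⟶ c'} {r r' : a ⟶ c} {s s' : a' ⟶ c'}
    {i : f ≅ f'} {j : g ≅ g'} {k : p ≅ p'} {l : q ≅ q'} {o : r ≅ r'} {t : s ≅ s'}
    {n : f ≫ v ≅ u ≫ g} {m : p ≫ w ≅ v ≫ q} {z : r ≫ w ≅ u ≫ s} {x : r ≅ f ≫ p}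
    {x' : r' ≅ f' ≫ p'} {y : s ≅ g ≫ q} {y' : s' ≅ g' ≫ q'}
    (ex : o.hom ≫ x'.hom = x.hom ≫ i.hom ▷ p ≫ f' ◁ k.hom)
    (ey : t.hom ≫ y'.hom = y.hom ≫ j.hom ▷ q ≫ g' ◁ l.hom)
    (e : z.hom ≫ u ◁ y.hom = x.hom ▷ w ≫ (α_ _ _ _).hom ≫ f ◁ m.hom ≫ (α_ _ _ _).inv ≫
      n.hom ▷ q ≫ (α_ _ _ _).hom) :
    (Sq.replace o t z).hom ≫ u ◁ y'.hom = x'.hom ▷ w ≫ (α_ _ _ _).hom ≫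
      f' ◁ (Sq.replace k l m).hom ≫ (α_ _ _ _).inv ≫ (Sq.replace i j n).hom ▷ q' ≫
        (α_ _ _ _).hom := by
  rw [replace_hom, Category.assoc, Category.assoc, ← whiskerLeft_comp, ey, whiskerLeft_comp,
    reassoc_of% e, ← cancel_epi (o.hom ▷ w), hom_inv_whiskerRight_assoc,
    ← comp_whiskerRight_assoc, ex, replace_hom, replace_hom]
  simp only [comp_whiskerRight, whiskerLeft_comp, whisker_assoc, Category.assoc,
    Iso.inv_hom_id_assoc, whiskerLeft_hom_inv_whiskerRight_assoc, Iso.inv_hom_id,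
    Category.comp_id]
  congr 1
  rw [associator_naturality_left_assoc, ← whisker_exchange_assoc, ← whisker_exchange_assoc,
    associator_inv_naturality_left_assoc]
  simp only [← comp_whiskerRight_assoc, Iso.hom_inv_id, id_whiskerRight, Category.id_comp]
  rw [associator_inv_naturality_right_assoc, whisker_exchange_assoc,
    associator_naturality_right_assoc, ← whiskerLeft_comp, ← whiskerLeft_comp, whisker_exchange]

theorem replace_modification {a' : D} {u u' : a ⟶ a'} {v v' : b ⟶ b'} {g g' : a' ⟶ b'}
    {i : f ≅ f'} {j : g ≅ g'} {n : f ≫ v ≅ u ≫ g} {n' : f ≫ v' ≅ u' ≫ g} {x : u ⟶ u'} {y : v ⟶ v'}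
    (e : f ◁ y ≫ n'.hom = n.hom ≫ x ▷ g) :
    f' ◁ y ≫ (Sq.replace i j n').hom = (Sq.replace i j n).hom ≫ x ▷ g' := by
  rw [replace_hom, replace_hom, whisker_exchange_assoc, reassoc_of% e]
  simp [whisker_exchange]

theorem replace_glue {a₂ b₂ : D} {u' : a' ⟶ a₂} {v' : b' ⟶ b₂} {k k' : a₂ ⟶ b₂}
    {i : f ≅ f'} {j : g ≅ g'} {l : k ≅ k'} (n : f ≫ v ≅ u ≫ g) (m : g ≫ v' ≅ u' ≫ k) :
    (Sq.replace (u := u ≫ u') (v := v ≫ v') i l ((α_ f v v').symm ≪≫ whiskerRightIso n v' ≪≫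
      α_ u g v' ≪≫ whiskerLeftIso u m ≪≫ (α_ u u' k).symm)).hom =
    ((α_ f' v v').symm ≪≫ whiskerRightIso (Sq.replace i j n) v' ≪≫ α_ u g' v' ≪≫
      whiskerLeftIso u (Sq.replace j l m) ≪≫ (α_ u u' k').symm).hom := by
  simp [replace_hom]

theorem replace_refl (i : f ≅ f') :
    (Sq.replace i i (ρ_ f ≪≫ (λ_ f).symm)).hom = (ρ_ f' ≪≫ (λ_ f').symm).hom := by
  simp [replace_hom]

theorem replace_unit {v : b' ⟶ b} {u : a' ⟶ a} {u' : a ⟶ a'} {v' : b ⟶ b'} {i : f ≅ f'} {j : g ≅ g'}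
    {n : f ≫ v' ≅ u' ≫ g} {m : g ≫ v ≅ u ≫ f} {x : 𝟙 a ⟶ u' ≫ u} {y : 𝟙 b ⟶ v' ≫ v}
    (e : f ◁ y ≫ ((α_ f v' v).symm ≪≫ whiskerRightIso n v ≪≫ α_ u' g v ≪≫
      whiskerLeftIso u' m ≪≫ (α_ u' u f).symm).hom = (ρ_ f ≪≫ (λ_ f).symm).hom ≫ x ▷ f) :
    f' ◁ y ≫ ((α_ f' v' v).symm ≪≫ whiskerRightIso (Sq.replace i j n) v ≪≫ α_ u' g' v ≪≫
      whiskerLeftIso u' (Sq.replace j i m) ≪≫ (α_ u' u f').symm).hom =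
      (ρ_ f' ≪≫ (λ_ f').symm).hom ≫ x ▷ f' := by
  rw [← replace_glue, ← replace_refl i]
  exact replace_modification e

theorem replace_counit {v : b' ⟶ b} {u : a' ⟶ a} {u' : a ⟶ a'} {v' : b ⟶ b'} {i : f ≅ f'}
    {j : g ≅ g'} {n : f ≫ v' ≅ u' ≫ g} {m : g ≫ v ≅ u ≫ f} {x : u' ≫ u ⟶ 𝟙 a} {y : v' ≫ v ⟶ 𝟙 b}
    (e : f ◁ y ≫ (ρ_ f ≪≫ (λ_ f).symm).hom = ((α_ f v' v).symm ≪≫ whiskerRightIso n v ≪≫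
      α_ u' g v ≪≫ whiskerLeftIso u' m ≪≫ (α_ u' u f).symm).hom ≫ x ▷ f) :
    f' ◁ y ≫ (ρ_ f' ≪≫ (λ_ f').symm).hom = ((α_ f' v' v).symm ≪≫
      whiskerRightIso (Sq.replace i j n) v ≪≫ α_ u' g' v ≪≫
      whiskerLeftIso u' (Sq.replace j i m) ≪≫ (α_ u' u f').symm).hom ≫ x ▷ f' := by
  rw [← replace_glue, ← replace_refl i]
  exact replace_modification e

theorem _root_.SMTwo.Sq.replace_carries (i : f ≅ f') (j : g ≅ g') (n : f ≫ v ≅ u ≫ g) :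
    Carries ((Cmp.ofIso i).comp (Cmp.ofIso (Iso.refl v)))
      ((Cmp.ofIso (Iso.refl u)).comp (Cmp.ofIso j)) n.hom (Sq.replace i j n).hom := by
  refine heq_of_eq ?_
  change (whiskerRightIso i v ≪≫ whiskerLeftIso f' (Iso.refl v)).inv ≫ n.hom ≫
    (whiskerRightIso (Iso.refl u) g ≪≫ whiskerLeftIso u j).hom = _
  simp [replace_hom]

end

theorem _root_.SMTwo.Cmp.carries_one (u : a ⟶ b) (v : b ⟶ a) (x : 𝟙 a ⟶ u ≫ v) :
    Carries (B := D) (Cmp.one (B := D) rfl) ((Same.refl u).cmp.comp (Same.refl v).cmp) x x := by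
  refine heq_of_eq ?_
  change (Iso.refl (𝟙 a)).inv ≫ x ≫
    (whiskerRightIso (Iso.refl u) v ≪≫ whiskerLeftIso u (Iso.refl v)).hom = _
  simp

theorem _root_.SMTwo.Cmp.carries_one' (u : a ⟶ b) (v : b ⟶ a) (x : u ≫ v ⟶ 𝟙 a) :
    Carries (B := D) ((Same.refl u).cmp.comp (Same.refl v).cmp) (Cmp.one (B := D) rfl) x x := by
  refine heq_of_eq ?_
  change (whiskerRightIso (Iso.refl u) v ≪≫ whiskerLeftIso u (Iso.refl v)).inv ≫ x ≫
    (Iso.refl (𝟙 a)).hom = _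
  simp

/-- An equivalence of pseudofunctors can be transported along icons. -/
theorem exists_transfer {F F' G G' : A ⥤ᵖ D} (I : Icon F F') (J : Icon G G')
    (e : Bicategory.Equivalence F G) :
    ∃ (e' : Bicategory.Equivalence F' G') (h : ∀ a, Same (e.hom.app a) (e'.hom.app a))
      (h' : ∀ a, Same (e.inv.app a) (e'.inv.app a)),
      (∀ {a b : A} (f : a ⟶ b), Carries ((I.cmp f).comp (h b).cmp) ((h a).cmp.comp (J.cmp f))
        (e.hom.naturality f).hom (e'.hom.naturality f).hom) ∧
      (∀ {a b : A} (f : a ⟶ b), Carries ((J.cmp f).comp (h' b).cmp) ((h' a).cmp.comp (I.cmp f))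
        (e.inv.naturality f).hom (e'.inv.naturality f).hom) ∧
      (∀ a, Carries (Cmp.one (I.obj_eq a)) ((h a).cmp.comp (h' a).cmp)
        (e.unit.hom.as.app a) (e'.unit.hom.as.app a)) ∧
      ∀ a, Carries ((h' a).cmp.comp (h a).cmp) (Cmp.one (J.obj_eq a))
        (e.counit.hom.as.app a) (e'.counit.hom.as.app a) := by
  obtain ⟨⟨⟨⟨obj', map'⟩, map₂'⟩, p₁, p₂⟩, mapId', mapComp', p₃, p₄, p₅, p₆, p₇⟩ := F'
  obtain rfl : F.obj = obj' := funext I.obj_eq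
  obtain ⟨⟨⟨⟨obj₂, map''⟩, map₂''⟩, q₁, q₂⟩, mapId'', mapComp'', q₃, q₄, q₅, q₆, q₇⟩ := G'
  obtain rfl : G.obj = obj₂ := funext J.obj_eq
  let i {a b : A} (f : a ⟶ b) : F.map f ≅ map' f := (I.cmp f).iso
  let j {a b : A} (f : a ⟶ b) : G.map f ≅ map'' f := (J.cmp f).iso
  have i₂ {a b : A} {f g : a ⟶ b} (η : f ⟶ g) : (i f).hom ≫ map₂' η = F.map₂ η ≫ (i g).hom := by
    have h := eq_of_heq (I.natural η)
    exact (congrArg ((i f).hom ≫ ·) h.symm).trans (Iso.hom_inv_id_assoc (i f) _)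
  have j₂ {a b : A} {f g : a ⟶ b} (η : f ⟶ g) : (j f).hom ≫ map₂'' η = G.map₂ η ≫ (j g).hom := by
    have h := eq_of_heq (J.natural η)
    exact (congrArg ((j f).hom ≫ ·) h.symm).trans (Iso.hom_inv_id_assoc (j f) _)
  have i₀ (a : A) : (i (𝟙 a)).hom ≫ (mapId' a).hom = (F.mapId a).hom :=
    congrArg Iso.hom (Cmp.ofIso_injective ((I.id a).trans (Cmp.trans_ofIso_refl _)))
  have j₀ (a : A) : (j (𝟙 a)).hom ≫ (mapId'' a).hom = (G.mapId a).hom :=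
    congrArg Iso.hom (Cmp.ofIso_injective ((J.id a).trans (Cmp.trans_ofIso_refl _)))
  have i₁ {a b c : A} (f : a ⟶ b) (g : b ⟶ c) : (i (f ≫ g)).hom ≫ (mapComp' f g).hom =
      (F.mapComp f g).hom ≫ (i f).hom ▷ F.map g ≫ map' f ◁ (i g).hom :=
    congrArg Iso.hom (Cmp.ofIso_injective (I.comp f g))
  have j₁ {a b c : A} (f : a ⟶ b) (g : b ⟶ c) : (j (f ≫ g)).hom ≫ (mapComp'' f g).hom =
      (G.mapComp f g).hom ≫ (j f).hom ▷ G.map g ≫ map'' f ◁ (j g).hom :=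
    congrArg Iso.hom (Cmp.ofIso_injective (J.comp f g))
  let tr (τ : F ⟶ G) : Pseudofunctor.StrongTrans (C := D)
      ⟨⟨⟨⟨F.obj, map'⟩, map₂'⟩, p₁, p₂⟩, mapId', mapComp', p₃, p₄, p₅, p₆, p₇⟩
      ⟨⟨⟨⟨G.obj, map''⟩, map₂''⟩, q₁, q₂⟩, mapId'', mapComp'', q₃, q₄, q₅, q₆, q₇⟩ :=
    { app := τ.app
      naturality f := Sq.replace (i f) (j f) (τ.naturality f)
      naturality_naturality η := replace_natural (τ.naturality_naturality η) (i₂ η) (j₂ η)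
      naturality_id a := replace_id (i₀ a) (j₀ a) (τ.naturality_id a)
      naturality_comp f g := replace_comp (i₁ f g) (j₁ f g) (τ.naturality_comp f g) }
  let tr' (τ : G ⟶ F) : Pseudofunctor.StrongTrans (C := D)
      ⟨⟨⟨⟨G.obj, map''⟩, map₂''⟩, q₁, q₂⟩, mapId'', mapComp'', q₃, q₄, q₅, q₆, q₇⟩
      ⟨⟨⟨⟨F.obj, map'⟩, map₂'⟩, p₁, p₂⟩, mapId', mapComp', p₃, p₄, p₅, p₆, p₇⟩ :=
    { app := τ.app
      naturality f := Sq.replace (j f) (i f) (τ.naturality f)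
      naturality_naturality η := replace_natural (τ.naturality_naturality η) (j₂ η) (i₂ η)
      naturality_id a := replace_id (j₀ a) (i₀ a) (τ.naturality_id a)
      naturality_comp f g := replace_comp (j₁ f g) (i₁ f g) (τ.naturality_comp f g) }
  let η : 𝟙 _ ≅ tr e.hom ≫ tr' e.inv := Pseudofunctor.StrongTrans.isoMk
    (fun a => ⟨e.unit.hom.as.app a, e.unit.inv.as.app a,
      congrArg (·.as.app a) e.unit.hom_inv_id, congrArg (·.as.app a) e.unit.inv_hom_id⟩)
    (fun {a b} f => replace_unit (e.unit.hom.as.naturality f))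
  let δ : tr' e.inv ≫ tr e.hom ≅ 𝟙 _ := Pseudofunctor.StrongTrans.isoMk
    (fun a => ⟨e.counit.hom.as.app a, e.counit.inv.as.app a,
      congrArg (·.as.app a) e.counit.hom_inv_id, congrArg (·.as.app a) e.counit.inv_hom_id⟩)
    (fun {a b} f => replace_counit (e.counit.hom.as.naturality f))
  refine ⟨⟨tr e.hom, tr' e.inv, η, δ, ?_⟩, fun a => .refl _, fun a => .refl _,
    fun {a b} f => ?_, fun {a b} f => ?_, fun a => ?_, fun a => ?_⟩
  · refine (left_triangle_iff _ _).2 (Pseudofunctor.StrongTrans.homCategory.ext fun a => ?_)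
    exact congrArg (·.as.app a) ((left_triangle_iff _ _).1 e.left_triangle)
  · exact Sq.replace_carries (u := e.hom.app a) (v := e.hom.app b) (i f) (j f) (e.hom.naturality f)
  · exact Sq.replace_carries (u := e.inv.app a) (v := e.inv.app b) (j f) (i f) (e.inv.naturality f)
  · exact Cmp.carries_one _ _ _
  · exact Cmp.carries_one' _ _ _

end Icon

end

end SMTwo

namespace SMTwo

/-! ### Positions in consecutive blocks -/

theorem blocks_val {n m : ℕ} (k : Fin n → ℕ) (h : ∑ i, k i = m) (i : Fin n) (j : Fin (k i)) :
    (blocks k h ⟨i, j⟩ : ℕ) = ∑ l : Fin i.1, k (Fin.castLE i.2.le l) + j :=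
  finSigmaFinEquiv_apply ⟨i, j⟩

theorem blocks_lt {n m : ℕ} (k : Fin n → ℕ) (h : ∑ i, k i = m) {i i' : Fin n} (hi : i < i')
    (j : Fin (k i)) (j' : Fin (k i')) : blocks k h ⟨i, j⟩ < blocks k h ⟨i', j'⟩ := by
  rw [Fin.lt_def, blocks_val, blocks_val]
  have e : ∑ l : Fin (i.1 + 1), k (Fin.castLE i.2 l) ≤ ∑ l : Fin i'.1, k (Fin.castLE i'.2.le l) := by
    obtain ⟨d, hd⟩ := Nat.exists_eq_add_of_le (Nat.succ_le_of_lt hi)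
    have : ∀ (N : ℕ) (hN : N ≤ n) (e : N = i.1 + 1 + d),
        ∑ l : Fin (i.1 + 1), k (Fin.castLE i.2 l) ≤ ∑ l : Fin N, k (Fin.castLE hN l) := by
      rintro _ hN rfl
      exact le_of_le_of_eq (Nat.le_add_right _ _)
        (Fin.sum_univ_add (fun l : Fin (i.1 + 1 + d) => k (Fin.castLE hN l))).symm
    exact this _ _ hd
  rw [Fin.sum_univ_castSucc] at e
  have := j.2
  have e' : k (Fin.castLE i.2 (Fin.last i.1)) = k i := rfl
  have e'' : ∑ l : Fin i.1, k (Fin.castLE i.2 l.castSucc) =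
    ∑ l : Fin i.1, k (Fin.castLE i.2.le l) := rfl
  omega

theorem blocks_lt' {n m : ℕ} (k : Fin n → ℕ) (h : ∑ i, k i = m) (i : Fin n) {j j' : Fin (k i)}
    (hj : j < j') : blocks k h ⟨i, j⟩ < blocks k h ⟨i, j'⟩ := by
  rw [Fin.lt_def, blocks_val, blocks_val]
  exact Nat.add_lt_add_left hj _

/-- Blocks of blocks are read lexicographically. -/
theorem blocks_blocks {n : ℕ} (k : Fin n → ℕ) {m : ℕ} (h : ∑ i, k i = m) (l : Fin m → ℕ)
    (s : Fin n → ℕ) (hs : ∀ i, ∑ j, l (blocks k h ⟨i, j⟩) = s i) {N : ℕ} (hN : ∑ i, s i = N)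
    (hN' : ∑ a, l a = N) (i : Fin n) (j : Fin (k i)) (c : Fin (l (blocks k h ⟨i, j⟩))) :
    blocks l hN' ⟨blocks k h ⟨i, j⟩, c⟩ =
      blocks s hN ⟨i, blocks (fun j => l (blocks k h ⟨i, j⟩)) (hs i) ⟨j, c⟩⟩ := by
  let z : (i : Fin n) × (j : Fin (k i)) × Fin (l (blocks k h ⟨i, j⟩)) → Fin N := fun a =>
    blocks s hN ⟨a.1, blocks (fun j => l (blocks k h ⟨a.1, j⟩)) (hs a.1) a.2⟩
  let y : (i : Fin n) × (j : Fin (k i)) × Fin (l (blocks k h ⟨i, j⟩)) ≃ Fin N :=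
    ((Equiv.sigmaAssoc (fun i j => Fin (l (blocks k h ⟨i, j⟩)))).symm.trans
      (Equiv.sigmaCongrLeft (β := fun a => Fin (l a)) (blocks k h))).trans (blocks l hN')
  have hy : ∀ i j c, y ⟨i, j, c⟩ = blocks l hN' ⟨blocks k h ⟨i, j⟩, c⟩ := fun _ _ _ => rfl
  have hz : StrictMono (fun a => z (y.symm a)) := by
    intro a b hab
    obtain ⟨⟨i, j, c⟩, rfl⟩ := y.surjective a
    obtain ⟨⟨i', j', c'⟩, rfl⟩ := y.surjective b
    simp only [Equiv.symm_apply_apply]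
    rw [hy, hy] at hab
    rcases lt_trichotomy i i' with hi | rfl | hi
    · exact blocks_lt s hN hi _ _
    · rcases lt_trichotomy j j' with hj | rfl | hj
      · exact blocks_lt' s hN i (blocks_lt _ (hs i) hj _ _)
      · rcases lt_trichotomy c c' with hc | rfl | hc
        · exact blocks_lt' s hN i (blocks_lt' _ (hs i) j hc)
        · exact absurd hab (lt_irrefl _)
        · exact absurd (hab.trans (blocks_lt' l hN' _ hc)) (lt_irrefl _)
      · exact absurd (hab.trans (blocks_lt l hN' (blocks_lt' k h i hj) _ _)) (lt_irrefl _)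
    · exact absurd (hab.trans (blocks_lt l hN' (blocks_lt k h hi _ _) _ _)) (lt_irrefl _)
  have e : (fun a => z (y.symm a)) = id := by
    have := Subsingleton.elim (hz.orderIsoOfSurjective _
      (Finite.surjective_of_injective hz.injective)) (OrderIso.refl _)
    exact funext fun a => congrArg (fun o : Fin N ≃o Fin N => o a) this
  have := congrFun e (y ⟨i, j, c⟩)
  rw [Equiv.symm_apply_apply] at this
  exact this.symm

namespace Operad

variable (P : Operad.{w, v, u})

/-- The action of a bijection `Fin n ≃ Fin m`. -/
def re {n m : ℕ} (ρ : Fin n ≃ Fin m) : P.obj m ⥤ᵖ P.obj n := by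
  obtain rfl : n = m := Fin.equiv_iff_eq.1 ⟨ρ⟩
  exact P.act ρ

theorem re_strict {n m : ℕ} (ρ : Fin n ≃ Fin m) : IsTwoFunctor (P.re ρ) := by
  obtain rfl : n = m := Fin.equiv_iff_eq.1 ⟨ρ⟩
  exact P.act_strict ρ

theorem re_refl (n : ℕ) : P.re (Equiv.refl (Fin n)) = Pseudofunctor.id _ := P.act_one n

theorem re_trans {n m k : ℕ} (ρ : Fin n ≃ Fin m) (τ : Fin m ≃ Fin k) :
    (P.re τ).comp (P.re ρ) = P.re (ρ.trans τ) := by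
  obtain rfl : n = m := Fin.equiv_iff_eq.1 ⟨ρ⟩
  obtain rfl : n = k := Fin.equiv_iff_eq.1 ⟨τ⟩
  exact (P.act_mul τ ρ).symm

variable {P}

theorem gam_re {n : ℕ} {k k' : Fin n → ℕ} {m m' : ℕ} (h : ∑ i, k i = m) (h' : ∑ i, k' i = m')
    (σ : ∀ i, Fin (k i) ≃ Fin (k' i)) (ρ : Fin m ≃ Fin m')
    (hρ : ∀ i j, ρ (blocks k h ⟨i, j⟩) = blocks k' h' ⟨i, σ i j⟩) {p p' : P.obj n} (f : p ⟶ p')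
    {q q' : ∀ i, P.obj (k' i)} (g : q ⟶ q') :
    Same ((P.gam k h).map (f ×ₘ fun i => (P.re (σ i)).map (g i) :
      (p, fun i => (P.re (σ i)).obj (q i)) ⟶ (p', fun i => (P.re (σ i)).obj (q' i))))
      ((P.re ρ).map ((P.gam k' h').map (f ×ₘ g))) := by
  obtain rfl : k = k' := funext fun i => Fin.equiv_iff_eq.1 ⟨σ i⟩
  obtain rfl : m = m' := h.symm.trans h'
  have e := Same.of_pf (P.act_gam k h σ) (f ×ₘ g)
  obtain rfl : ρ = sumPerm k h σ := Equiv.ext fun a => by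
    obtain ⟨⟨i, j⟩, rfl⟩ := (blocks k h).surjective a
    simp [hρ, sumPerm]
  exact e

theorem gam_act_same {n : ℕ} (σ : Equiv.Perm (Fin n)) {k : Fin n → ℕ} {m m' : ℕ}
    (h : ∑ i, k i = m) (h' : ∑ i, k (σ i) = m') (ρ : Fin m' ≃ Fin m)
    (hρ : ∀ i j, ρ (blocks (fun i => k (σ i)) h' ⟨i, j⟩) = blocks k h ⟨σ i, j⟩)
    {p p' : P.obj n} (f : p ⟶ p') {q q' : ∀ i, P.obj (k i)} (g : q ⟶ q') :
    Same ((P.gam (fun i => k (σ i)) h').map ((P.act σ).map f ×ₘ fun i => g (σ i) :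
      ((P.act σ).obj p, fun i => q (σ i)) ⟶ ((P.act σ).obj p', fun i => q' (σ i))))
      ((P.re ρ).map ((P.gam k h).map (f ×ₘ g))) := by
  obtain rfl : m' = m := Fin.equiv_iff_eq.1 ⟨ρ⟩
  have e := Same.of_pf (P.gam_act σ k h h') (f ×ₘ g)
  obtain rfl : ρ = blockPerm σ k h h' := Equiv.ext fun a => by
    obtain ⟨⟨i, j⟩, rfl⟩ := (blocks (fun i => k (σ i)) h').surjective a
    simp only [hρ, blockPerm, Equiv.trans_apply, Equiv.symm_apply_apply]
    rfl
  exact e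

/-- The type of 1-cells of `P n`. -/
abbrev Arr (P : Operad.{w, v, u}) (n : ℕ) := (p : P.obj n) × (q : P.obj n) × (p ⟶ q)

theorem gam_gam_aux {n : ℕ} (k : Fin n → ℕ) {m : ℕ} (h : ∑ i, k i = m)
    (l : ∀ i, Fin (k i) → ℕ) (s : Fin n → ℕ) (hs : ∀ i, ∑ j, l i j = s i) {N : ℕ}
    (hN : ∑ i, s i = N) {p p' : P.obj n} (f : p ⟶ p') {q q' : ∀ i, P.obj (k i)} (g : q ⟶ q')
    (r : ∀ i j, P.Arr (l i j)) (l' : Fin m → ℕ) (hl' : ∀ i j, l' (blocks k h ⟨i, j⟩) = l i j)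
    (hN' : ∑ a, l' a = N) (r' : ∀ a, P.Arr (l' a))
    (hr' : ∀ i j, HEq (r' (blocks k h ⟨i, j⟩)) (r i j)) :
    Same ((P.gam l' hN').map ((P.gam k h).map (f ×ₘ g) ×ₘ fun a => (r' a).2.2 :
      ((P.gam k h).obj (p, q), fun a => (r' a).1) ⟶ ((P.gam k h).obj (p', q'), fun a => (r' a).2.1)))
      ((P.gam s hN).map (f ×ₘ fun i => (P.gam (l i) (hs i)).map (g i ×ₘ fun j => (r i j).2.2 :
        (q i, fun j => (r i j).1) ⟶ (q' i, fun j => (r i j).2.1)) :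
        (p, fun i => (P.gam (l i) (hs i)).obj (q i, fun j => (r i j).1)) ⟶
          (p', fun i => (P.gam (l i) (hs i)).obj (q' i, fun j => (r i j).2.1)))) := by
  have e : l' = fun a : Fin m => l ((blocks k h).symm a).1 ((blocks k h).symm a).2 := by
    funext a
    obtain ⟨⟨i, j⟩, rfl⟩ := (blocks k h).surjective a
    rw [hl']
    exact congrArg (fun z : (i : Fin n) × Fin (k i) => l z.1 z.2)
      ((blocks k h).symm_apply_apply ⟨i, j⟩).symm
  subst e
  have e' : r' = fun a : Fin m => r ((blocks k h).symm a).1 ((blocks k h).symm a).2 := by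
    funext a
    obtain ⟨⟨i, j⟩, rfl⟩ := (blocks k h).surjective a
    refine eq_of_heq ((hr' i j).trans ?_)
    exact congr_arg_heq (fun z : (i : Fin n) × Fin (k i) => r z.1 z.2)
      ((blocks k h).symm_apply_apply ⟨i, j⟩).symm
  subst e'
  exact Same.of_pf (P.gam_assoc k h l s hs hN hN') ((f ×ₘ g) ×ₘ fun i j => (r i j).2.2)

theorem gam_gam {n : ℕ} (k : Fin n → ℕ) {m : ℕ} (h : ∑ i, k i = m) (l : Fin m → ℕ)
    (s : Fin n → ℕ) (hs : ∀ i, ∑ j, l (blocks k h ⟨i, j⟩) = s i) {N : ℕ} (hN : ∑ i, s i = N)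
    (hN' : ∑ a, l a = N) {p p' : P.obj n} (f : p ⟶ p') {q q' : ∀ i, P.obj (k i)} (g : q ⟶ q')
    {r r' : ∀ a, P.obj (l a)} (e : r ⟶ r') :
    Same ((P.gam l hN').map ((P.gam k h).map (f ×ₘ g) ×ₘ e))
      ((P.gam s hN).map (f ×ₘ fun i => (P.gam (fun j => l (blocks k h ⟨i, j⟩)) (hs i)).map
        (g i ×ₘ fun j => e (blocks k h ⟨i, j⟩) :
        (q i, fun j => r (blocks k h ⟨i, j⟩)) ⟶ (q' i, fun j => r' (blocks k h ⟨i, j⟩))) :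
        (p, fun i => (P.gam _ (hs i)).obj (q i, fun j => r (blocks k h ⟨i, j⟩))) ⟶
          (p', fun i => (P.gam _ (hs i)).obj (q' i, fun j => r' (blocks k h ⟨i, j⟩))))) :=
  gam_gam_aux k h (fun i j => l (blocks k h ⟨i, j⟩)) s hs hN f g
    (fun i j => ⟨_, _, e (blocks k h ⟨i, j⟩)⟩) l (fun _ _ => rfl) hN' (fun a => ⟨_, _, e a⟩)
    (fun _ _ => HEq.rfl)

theorem gam_one_same {k : Fin 1 → ℕ} {m : ℕ} (h : ∑ i, k i = m) (ρ : Fin m ≃ Fin (k 0))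
    (hρ : ∀ j, ρ (blocks k h ⟨0, j⟩) = j) {q q' : ∀ i, P.obj (k i)} (g : q ⟶ q') :
    Same ((P.gam k h).map (𝟙 P.one ×ₘ g)) ((P.re ρ).map (g 0)) := by
  obtain ⟨n, rfl⟩ : ∃ n, k = fun _ => n := ⟨k 0, funext fun i => by fin_cases i; rfl⟩
  obtain rfl : m = n := Fin.equiv_iff_eq.1 ⟨ρ⟩
  have e := Same.of_pf (P.one_gam h) (g 0)
  obtain rfl : ρ = Equiv.refl _ := Equiv.ext fun a => by
    obtain ⟨⟨i, j⟩, rfl⟩ := (blocks (fun _ : Fin 1 => m) h).surjective a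
    fin_cases i
    refine (hρ j).trans (Fin.ext ?_)
    exact ((blocks_val _ h 0 j).trans (by simp)).symm
  refine Same.trans ?_ (e.trans (Same.of_pf (P.re_refl m).symm (g 0)))
  refine Same.map ((Same.refl _).prod (Same.pi fun i => ?_)) _
  match i with
  | 0 => exact Same.refl _

end Operad

end SMTwo

namespace SMTwo

section

variable {Z : Type u₄} [Bicategory.{w₄, v₄} Z]

namespace PAlg

variable {P : Operad.{w, v, u}} (X : PAlg.{w, v, u, w₁, v₁, u₁} P)

theorem mu_re {n m : ℕ} (ρ : Fin n ≃ Fin m) (F : Z ⥤ᵖ P.obj m) (G : Fin n → (Z ⥤ᵖ X.carrier)) :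
    (pair (F.comp (P.re ρ)) (lift G)).comp (X.mu n) =
      (pair F (lift fun i => G (ρ.symm i))).comp (X.mu m) := by
  obtain rfl : n = m := Fin.equiv_iff_eq.1 ⟨ρ⟩
  have h := congrArg (fun K => (pair F (lift G)).comp K) (X.mu_act ρ)
  simp only [← pf_assoc, prodMap, comp_pair, comp_lift, pair_fst, pair_snd, lift_proj,
    pf_comp_id] at h
  exact h

theorem mu_gam_comp {n m : ℕ} (k : Fin n → ℕ) (h : ∑ i, k i = m) (F : Z ⥤ᵖ P.obj n)
    (Q : ∀ i, Z ⥤ᵖ P.obj (k i)) (G : Fin m → (Z ⥤ᵖ X.carrier)) :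
    (pair ((pair F (lift Q)).comp (P.gam k h)) (lift G)).comp (X.mu m) =
      (pair F (lift fun i => (pair (Q i) (lift fun j => G (blocks k h ⟨i, j⟩))).comp
        (X.mu (k i)))).comp (X.mu n) := by
  have e := congrArg (fun K => (pair (pair F (lift Q)) (lift G)).comp K) (X.mu_gam k h)
  simp only [← pf_assoc, comp_pair, comp_lift, pair_fst, pair_snd, lift_proj] at e
  exact e

end PAlg

/-- The underlying quiver of a bicategory, found before that of the category underlying a strict
one. -/
instance bicategoryQuiver (B : Type u) [h : Bicategory.{w, v} B] : Quiver B :=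
  h.toCategoryStruct.toQuiver

/-- A finite set with an enumeration. -/
structure Ctx where
  I : Type
  n : ℕ
  ν : I ≃ Fin n

section

variable (P : Operad.{w, v, u}) (X : PAlg.{w, v, u, w₁, v₁, u₁} P)

/-- Formal composites: an operation with a family of objects of an algebra. -/
abbrev Elem (c : Ctx) := P.obj c.n × (c.I → X.carrier)

variable {P}

/-- The value of a formal composite. -/
def Elem.val (c : Ctx) : Elem P X c ⥤ᵖ X.carrier :=
  (pair (fstP _ _) (lift fun j => (sndP (P.obj c.n) (c.I → X.carrier)).comp
    (proj (fun _ => X.carrier) (c.ν.symm j)))).comp (X.mu c.n)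

/-- Relabelling of formal composites. -/
def Elem.re {c d : Ctx} (e : c.I ≃ d.I) : Elem P X d ⥤ᵖ Elem P X c :=
  pair ((fstP _ _).comp (P.re (c.ν.symm.trans (e.trans d.ν)))) (lift fun i =>
    (sndP (P.obj d.n) (d.I → X.carrier)).comp (proj (fun _ => X.carrier) (e i)))

/-- Composition of formal composites. -/
def Elem.gam {n : ℕ} (c : Fin n → Ctx) (d : Ctx) (e : ((i : Fin n) × (c i).I) ≃ d.I) :
    (P.obj n × ∀ i, Elem P X (c i)) ⥤ᵖ Elem P X d :=
  pair (((pair (fstP _ _) (lift fun i => (sndP (P.obj n) (∀ i, Elem P X (c i))).comp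
      ((proj (fun i => Elem P X (c i)) i).comp (fstP _ _)))).comp
        (P.gam (fun i => (c i).n) rfl)).comp (P.re (d.ν.symm.trans (e.symm.trans
          ((Equiv.sigmaCongrRight fun i => (c i).ν).trans (blocks _ rfl))))))
    (lift fun b => (sndP (P.obj n) (∀ i, Elem P X (c i))).comp
      ((proj (fun i => Elem P X (c i)) (e.symm b).1).comp
        ((sndP _ _).comp (proj (fun _ => X.carrier) (e.symm b).2))))

theorem Elem.re_val {c d : Ctx} (e : c.I ≃ d.I) :
    (Elem.re X e).comp (Elem.val X c) = Elem.val X d := by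
  simp only [Elem.re, Elem.val, ← pf_assoc, comp_pair, comp_lift, pair_fst, pair_snd, lift_proj,
    X.mu_re]
  simp

theorem Elem.gam_val {n : ℕ} (c : Fin n → Ctx) (d : Ctx) (e : ((i : Fin n) × (c i).I) ≃ d.I) :
    (Elem.gam X c d e).comp (Elem.val X d) =
      (pair (fstP _ _) (lift fun i => (sndP (P.obj n) (∀ i, Elem P X (c i))).comp
        ((proj (fun i => Elem P X (c i)) i).comp (Elem.val X (c i))))).comp (X.mu n) := by
  simp only [Elem.gam, Elem.val, ← pf_assoc, comp_pair, comp_lift, pair_fst, pair_snd, lift_proj,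
    X.mu_re, X.mu_gam_comp]
  refine congrArg (fun K => (pair _ (lift K)).comp (X.mu n)) (funext fun i =>
    congrArg (fun K => (pair _ (lift K)).comp (X.mu (c i).n)) (funext fun j =>
      congrArg (fun z : (i : Fin n) × (c i).I =>
        (((sndP (P.obj n) (∀ i, Elem P X (c i))).comp (proj (fun i => Elem P X (c i)) z.1)).comp
          (sndP _ _)).comp (proj (fun _ => X.carrier) z.2)) (a₂ := ⟨i, (c i).ν.symm j⟩) ?_))
  simp only [Equiv.symm_trans_apply, Equiv.symm_symm, Equiv.symm_apply_apply]
  rfl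


variable {X}

theorem Elem.same {c : Ctx} {s t s' t' : Elem P X c} {h : s ⟶ t} {h' : s' ⟶ t'}
    (h₁ : Same h.1 h'.1) (h₂ : ∀ i, Same (h.2 i) (h'.2 i)) : Same h h' :=
  Same.prod (f := h.1) (f' := h'.1) (g := h.2) (g' := h'.2) h₁ (Same.pi h₂)

theorem Elem.same_fst {c : Ctx} {s t s' t' : Elem P X c} {h : s ⟶ t} {h' : s' ⟶ t'}
    (e : Same h h') : Same h.1 h'.1 := e.map (fstP _ _)

theorem Elem.same_of_eq {ι : Type} {A : ι → Type} {x y : ∀ i, A i → X.carrier}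
    (F : ∀ i j, x i j ⟶ y i j) {z z' : (i : ι) × A i} (h : z = z') :
    Same (F z.1 z.2) (F z'.1 z'.2) := by
  subst h
  exact Same.refl _

theorem _root_.SMTwo.Operad.re_congr {n m : ℕ} {ρ ρ' : Fin n ≃ Fin m} (h : ∀ i, ρ i = ρ' i)
    {p q p' q' : P.obj m} {f : p ⟶ q} {f' : p' ⟶ q'} (hf : Same f f') :
    Same ((P.re ρ).map f) ((P.re ρ').map f') := by
  obtain rfl : ρ = ρ' := Equiv.ext h
  exact hf.map _

theorem _root_.SMTwo.Operad.re_re {n m k : ℕ} (ρ : Fin n ≃ Fin m) (τ : Fin m ≃ Fin k)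
    {p q : P.obj k} (f : p ⟶ q) :
    Same ((P.re ρ).map ((P.re τ).map f)) ((P.re (ρ.trans τ)).map f) :=
  Same.of_pf (P.re_trans ρ τ) f

theorem Elem.re_refl_same {c : Ctx} {s t : Elem P X c} (h : s ⟶ t) :
    Same ((Elem.re X (Equiv.refl c.I)).map h) h := by
  refine Elem.same ?_ fun i => Same.refl _
  refine (Operad.re_congr (fun i => ?_) (Same.refl h.1)).trans
    (Same.of_pf (P.re_refl c.n) h.1)
  simp

theorem Elem.re_re_same {c d k : Ctx} (e : c.I ≃ d.I) (e' : d.I ≃ k.I) {s t : Elem P X k}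
    (h : s ⟶ t) :
    Same ((Elem.re X e).map ((Elem.re X e').map h)) ((Elem.re X (e.trans e')).map h) := by
  refine Elem.same ?_ fun i => Same.refl _
  refine (Operad.re_re _ _ h.1).trans (Operad.re_congr (fun i => ?_) (Same.refl h.1))
  simp

/-- Relabelling a composite. -/
theorem Elem.re_gam_same {n : ℕ} {c : Fin n → Ctx} {d d' : Ctx}
    (e : ((i : Fin n) × (c i).I) ≃ d.I) (e' : ((i : Fin n) × (c i).I) ≃ d'.I) (ρ : d'.I ≃ d.I)
    (hρ : ∀ i x, ρ (e' ⟨i, x⟩) = e ⟨i, x⟩) {p q : P.obj n} (κ : p ⟶ q)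
    {s t : ∀ i, Elem P X (c i)} (h : s ⟶ t) :
    Same ((Elem.re X ρ).map ((Elem.gam X c d e).map (κ ×ₘ h)))
      ((Elem.gam X c d' e').map (κ ×ₘ h)) := by
  have hρ' : ∀ y, e.symm (ρ y) = e'.symm y := fun y => by
    obtain ⟨z, rfl⟩ := e'.surjective y
    rw [hρ, Equiv.symm_apply_apply, Equiv.symm_apply_apply]
  refine Elem.same ?_ fun y => ?_
  · refine (Operad.re_re _ _ _).trans (Operad.re_congr (fun i => ?_) (Same.refl _))
    simp [hρ']
  · exact Elem.same_of_eq (fun i x => (h i).2 x) (hρ' y)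

/-- Composition commutes with relabelling. -/
theorem Elem.gam_re_same {n : ℕ} {c c' : Fin n → Ctx} {d : Ctx}
    (e : ((i : Fin n) × (c i).I) ≃ d.I) (e' : ((i : Fin n) × (c' i).I) ≃ d.I)
    (ρ : ∀ i, (c i).I ≃ (c' i).I) (hρ : ∀ i x, e' ⟨i, ρ i x⟩ = e ⟨i, x⟩) {p q : P.obj n}
    (κ : p ⟶ q) {s t : ∀ i, Elem P X (c' i)} (h : s ⟶ t) :
    Same ((Elem.gam X c d e).map (κ ×ₘ fun i => (Elem.re X (ρ i)).map (h i) :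
      (p, fun i => (Elem.re X (ρ i)).obj (s i)) ⟶ (q, fun i => (Elem.re X (ρ i)).obj (t i))))
      ((Elem.gam X c' d e').map (κ ×ₘ h)) := by
  refine Elem.same ?_ fun y => ?_
  · refine Same.trans (Same.map (Operad.gam_re rfl rfl
      (fun i => (c i).ν.symm.trans ((ρ i).trans (c' i).ν)) ((blocks _ rfl).symm.trans
        ((Equiv.sigmaCongrRight fun i => (c i).ν.symm.trans ((ρ i).trans (c' i).ν)).trans
          (blocks _ rfl))) (fun i j => ?_) κ fun i => (h i).1) _) ?_
    · simp
    · refine (Operad.re_re _ _ _).trans (Operad.re_congr (fun y => ?_) (Same.refl _))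
      obtain ⟨⟨i, x⟩, hy⟩ := e.surjective (d.ν.symm y)
      have h₁ : e.symm (d.ν.symm y) = ⟨i, x⟩ := by rw [← hy, Equiv.symm_apply_apply]
      have h₂ : e'.symm (d.ν.symm y) = ⟨i, ρ i x⟩ := by
        rw [← hy, ← hρ, Equiv.symm_apply_apply]
      simp only [Equiv.trans_apply, h₁, h₂, Equiv.sigmaCongrRight_apply,
        Equiv.symm_apply_apply]
  · obtain ⟨⟨i, x⟩, rfl⟩ := e.surjective y
    refine (Elem.same_of_eq (fun i x => (h i).2 (ρ i x)) (e.symm_apply_apply ⟨i, x⟩)).trans ?_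
    refine Elem.same_of_eq (fun i x => (h i).2 x) (z := ⟨i, ρ i x⟩) ?_
    rw [← hρ, Equiv.symm_apply_apply]

/-- Composition with a composite operation. -/
theorem Elem.gam_gam_same {n m : ℕ} (k : Fin n → ℕ) (hk : ∑ i, k i = m) {c : Fin m → Ctx}
    {d : Ctx} {c' : Fin n → Ctx} (e : ((a : Fin m) × (c a).I) ≃ d.I)
    (e' : ((i : Fin n) × (c' i).I) ≃ d.I)
    (e'' : ∀ i, ((j : Fin (k i)) × (c (blocks k hk ⟨i, j⟩)).I) ≃ (c' i).I)
    (he : ∀ i j x, e' ⟨i, e'' i ⟨j, x⟩⟩ = e ⟨blocks k hk ⟨i, j⟩, x⟩) {p q : P.obj n} (κ : p ⟶ q)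
    {r r' : ∀ i, P.obj (k i)} (g : r ⟶ r') {s t : ∀ a, Elem P X (c a)} (h : s ⟶ t) :
    Same ((Elem.gam X c d e).map ((P.gam k hk).map (κ ×ₘ g) ×ₘ h))
      ((Elem.gam X c' d e').map (κ ×ₘ fun i =>
        (Elem.gam X (fun j => c (blocks k hk ⟨i, j⟩)) (c' i) (e'' i)).map
          (g i ×ₘ fun j => h (blocks k hk ⟨i, j⟩) :
          (r i, fun j => s (blocks k hk ⟨i, j⟩)) ⟶ (r' i, fun j => t (blocks k hk ⟨i, j⟩))) :
        (p, fun i => (Elem.gam X _ (c' i) (e'' i)).obj (r i, fun j => s (blocks k hk ⟨i, j⟩))) ⟶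
          (q, fun i => (Elem.gam X _ (c' i) (e'' i)).obj
            (r' i, fun j => t (blocks k hk ⟨i, j⟩))))) := by
  have hN : ∑ i, ∑ j, (c (blocks k hk ⟨i, j⟩)).n = ∑ a, (c a).n :=
    (Fintype.sum_sigma fun z : (i : Fin n) × Fin (k i) => (c (blocks k hk z)).n).symm.trans
      ((blocks k hk).sum_comp fun a => (c a).n)
  refine Elem.same ?_ fun y => ?_
  · refine (Same.map (Operad.gam_gam k hk (fun a => (c a).n) _ (fun _ => rfl) hN rfl κ g
      fun a => (h a).1) _).trans (Same.symm ?_)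
    refine (Same.map (Operad.gam_re rfl hN
      (fun i => (c' i).ν.symm.trans ((e'' i).symm.trans ((Equiv.sigmaCongrRight fun j =>
        (c (blocks k hk ⟨i, j⟩)).ν).trans (blocks _ rfl)))) ((blocks _ rfl).symm.trans
        ((Equiv.sigmaCongrRight fun i => (c' i).ν.symm.trans ((e'' i).symm.trans
          ((Equiv.sigmaCongrRight fun j => (c (blocks k hk ⟨i, j⟩)).ν).trans (blocks _ rfl)))).trans
          (blocks _ hN))) (fun i j => ?_) κ fun i =>
          (P.gam _ rfl).map (g i ×ₘ fun j => (h (blocks k hk ⟨i, j⟩)).1)) _).trans ?_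
    · simp
    · refine (Operad.re_re _ _ _).trans (Operad.re_congr (fun y => ?_) (Same.refl _))
      obtain ⟨⟨a, x⟩, hy⟩ := e.surjective (d.ν.symm y)
      obtain ⟨⟨i, j⟩, rfl⟩ := (blocks k hk).surjective a
      have h₁ : e'.symm (d.ν.symm y) = ⟨i, e'' i ⟨j, x⟩⟩ := by
        rw [← hy, ← he, Equiv.symm_apply_apply]
      have h₂ : e.symm (d.ν.symm y) = ⟨blocks k hk ⟨i, j⟩, x⟩ := by
        rw [← hy, Equiv.symm_apply_apply]
      simp only [Equiv.trans_apply, h₁, h₂, Equiv.sigmaCongrRight_apply,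
        Equiv.symm_apply_apply]
      exact (blocks_blocks k hk (fun a => (c a).n) _ (fun _ => rfl) hN rfl i j _).symm
  · obtain ⟨⟨a, x⟩, rfl⟩ := e.surjective y
    obtain ⟨⟨i, j⟩, rfl⟩ := (blocks k hk).surjective a
    refine (Elem.same_of_eq (fun i x => (h i).2 x) (e.symm_apply_apply ⟨_, x⟩)).trans ?_
    refine Same.symm ?_
    have h₁ : e'.symm (e ⟨blocks k hk ⟨i, j⟩, x⟩) = ⟨i, e'' i ⟨j, x⟩⟩ := by
      rw [← he, Equiv.symm_apply_apply]
    refine (Elem.same_of_eq (fun i z => (h (blocks k hk ⟨i, ((e'' i).symm z).1⟩)).2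
      ((e'' i).symm z).2) h₁).trans ?_
    exact Elem.same_of_eq (fun j x => (h (blocks k hk ⟨i, j⟩)).2 x)
      ((e'' i).symm_apply_apply ⟨j, x⟩)

/-- Composition with the operadic unit. -/
theorem Elem.one_gam_same {c : Fin 1 → Ctx} {d : Ctx} (e : ((i : Fin 1) × (c i).I) ≃ d.I)
    (ρ : d.I ≃ (c 0).I) (hρ : ∀ x, ρ (e ⟨0, x⟩) = x) {s t : ∀ i, Elem P X (c i)} (h : s ⟶ t) :
    Same ((Elem.gam X c d e).map (𝟙 P.one ×ₘ h)) ((Elem.re X ρ).map (h 0)) := by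
  refine Elem.same ?_ fun y => ?_
  · refine (Same.map (Operad.gam_one_same rfl ((blocks _ rfl).symm.trans
      ((Equiv.uniqueSigma fun i => Fin (c i).n))) (fun j => ?_) fun i => (h i).1) _).trans ?_
    · simp [Equiv.uniqueSigma]
    · refine (Operad.re_re _ _ _).trans (Operad.re_congr (fun y => ?_) (Same.refl _))
      obtain ⟨⟨i, x⟩, hy⟩ := e.surjective (d.ν.symm y)
      obtain rfl : i = 0 := Subsingleton.elim _ _
      simp [← hy, hρ, Equiv.uniqueSigma]
  · obtain ⟨⟨i, x⟩, rfl⟩ := e.surjective y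
    refine (Elem.same_of_eq (fun i x => (h i).2 x) (e.symm_apply_apply ⟨i, x⟩)).trans ?_
    obtain rfl : i = 0 := Subsingleton.elim _ _
    exact Elem.same_of_eq (fun i x => (h i).2 x)
      (congrArg (fun x => (⟨0, x⟩ : (i : Fin 1) × (c i).I)) (hρ x).symm)

/-- The bijection between equal members of a family. -/
def Ctx.famCast {n : ℕ} (c : Fin n → Ctx) {i j : Fin n} (h : i = j) : (c i).I ≃ (c j).I :=
  Equiv.cast (congrArg (fun i => (c i).I) h)

theorem Ctx.famCast_eq {n : ℕ} {c : Fin n → Ctx} {i j : Fin n} (h : i = j) (x : (c i).I) :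
    (⟨j, Ctx.famCast c h x⟩ : (i : Fin n) × (c i).I) = ⟨i, x⟩ := by
  subst h
  rfl

theorem Elem.re_famCast {n : ℕ} {c : Fin n → Ctx} {s t : ∀ i, Elem P X (c i)} (h : s ⟶ t)
    {i j : Fin n} (e : i = j) : Same ((Elem.re X (Ctx.famCast c e)).map (h j)) (h i) := by
  subst e
  exact Elem.re_refl_same _

/-- Composition and the symmetric group actions. -/
theorem Elem.gam_act_same {n : ℕ} (σ : Equiv.Perm (Fin n)) {c : Fin n → Ctx} {d : Ctx}
    (e : ((i : Fin n) × (c i).I) ≃ d.I) (e' : ((i : Fin n) × (c (σ⁻¹ i)).I) ≃ d.I)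
    (he : ∀ i x, e' ⟨i, x⟩ = e ⟨σ⁻¹ i, x⟩) {p q : P.obj n} (κ : p ⟶ q)
    {s t : ∀ i, Elem P X (c i)} (h : s ⟶ t) :
    Same ((Elem.gam X c d e).map ((P.act σ).map κ ×ₘ h))
      ((Elem.gam X (fun i => c (σ⁻¹ i)) d e').map (κ ×ₘ fun i => h (σ⁻¹ i) :
        (p, fun i => s (σ⁻¹ i)) ⟶ (q, fun i => t (σ⁻¹ i)))) := by
  refine Elem.same ?_ fun y => ?_
  · have hσ : ∀ i, σ⁻¹ (σ i) = i := fun i => σ.symm_apply_apply i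
    let E : ((i : Fin n) × (c (σ⁻¹ (σ i))).I) ≃ d.I :=
      (Equiv.sigmaCongrRight fun i => Ctx.famCast c (hσ i)).trans e
    refine (Elem.same_fst (Elem.gam_re_same E e (fun i => Ctx.famCast c (hσ i))
      (fun i x => rfl) ((P.act σ).map κ) h).symm).trans ?_
    refine (Elem.same_fst (Same.map ((Same.refl _).prod (Same.pi fun i =>
      Elem.re_famCast h (hσ i))) (Elem.gam X (fun i => c (σ⁻¹ (σ i))) d E))).trans ?_
    refine (Same.map (Operad.gam_act_same σ (k := fun i => (c (σ⁻¹ i)).n) rfl rfl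
      ((blocks _ rfl).symm.trans ((Equiv.sigmaCongrLeft
        (β := fun i => Fin (c (σ⁻¹ i)).n) σ).trans (blocks _ rfl)))
        (fun i j => ?_) κ fun i => (h (σ⁻¹ i)).1) _).trans ?_
    · simp only [Equiv.trans_apply, Equiv.symm_apply_apply]
      rfl
    · refine (Operad.re_re _ _ _).trans (Operad.re_congr (fun y => ?_) (Same.refl _))
      obtain ⟨⟨i, x⟩, hy⟩ := E.surjective (d.ν.symm y)
      have h₁ : E.symm (d.ν.symm y) = ⟨i, x⟩ := by rw [← hy, Equiv.symm_apply_apply]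
      have h₂ : e'.symm (d.ν.symm y) = ⟨σ i, x⟩ := by
        rw [← hy, Equiv.symm_apply_eq, he]
        exact congrArg e (Ctx.famCast_eq (hσ i) x)
      simp only [Equiv.trans_apply, h₁, h₂, Equiv.sigmaCongrRight_apply,
        Equiv.symm_apply_apply]
      rfl
  · obtain ⟨⟨i, x⟩, rfl⟩ := e'.surjective y
    refine Same.trans ?_ (Elem.same_of_eq (fun i x => (h (σ⁻¹ i)).2 x)
      (e'.symm_apply_apply ⟨i, x⟩)).symm
    refine Elem.same_of_eq (fun i x => (h i).2 x) (z' := ⟨σ⁻¹ i, x⟩) ?_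
    rw [he, Equiv.symm_apply_apply]

end

end

section

variable {B : Type u₁} [Bicategory.{w₁, v₁} B] {C : Type u₂} [Bicategory.{w₂, v₂} C]
  {D : Type u₃} [Bicategory.{w₃, v₃} D]

theorem IsTwoFunctor.isEq_mapComp {F : B ⥤ᵖ C} (hF : IsTwoFunctor F) {a b c : B} (f : a ⟶ b)
    (g : b ⟶ c) : (Cmp.ofIso (F.mapComp f g)).IsEq := hF.2 f g

theorem IsTwoFunctor.isEq_mapId {F : B ⥤ᵖ C} (hF : IsTwoFunctor F) (a : B) :
    (Cmp.ofIso (F.mapId a)).IsEq := hF.1 a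

theorem isTwoFunctor_fst : IsTwoFunctor (fstP B C) := ⟨fun _ => ⟨rfl, rfl⟩, fun _ _ => ⟨rfl, rfl⟩⟩

theorem isTwoFunctor_snd : IsTwoFunctor (sndP B C) := ⟨fun _ => ⟨rfl, rfl⟩, fun _ _ => ⟨rfl, rfl⟩⟩

theorem isTwoFunctor_proj {ι : Type t} {A : ι → Type u₁} [∀ i, Bicategory.{w₁, v₁} (A i)] (i : ι) :
    IsTwoFunctor (proj A i) := ⟨fun _ => ⟨rfl, rfl⟩, fun _ _ => ⟨rfl, rfl⟩⟩

theorem IsTwoFunctor.pair {F : B ⥤ᵖ C} {G : B ⥤ᵖ D} (hF : IsTwoFunctor F) (hG : IsTwoFunctor G) :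
    IsTwoFunctor (pair F G) :=
  ⟨fun a => (Cmp.IsEq.pair (hF.isEq_mapId a) (hG.isEq_mapId a) :),
    fun f g => (Cmp.IsEq.pair (hF.isEq_mapComp f g) (hG.isEq_mapComp f g) :)⟩

theorem IsTwoFunctor.lift {ι : Type t} {A : ι → Type u₂} [∀ i, Bicategory.{w₂, v₂} (A i)]
    {F : ∀ i, B ⥤ᵖ A i} (hF : ∀ i, IsTwoFunctor (F i)) : IsTwoFunctor (lift F) :=
  ⟨fun a => (Cmp.IsEq.pi (φ := fun i => Cmp.ofIso ((F i).mapId a))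
      fun i => (hF i).isEq_mapId a :),
    fun f g => (Cmp.IsEq.pi (φ := fun i => Cmp.ofIso ((F i).mapComp f g))
      fun i => (hF i).isEq_mapComp f g :)⟩

theorem compCmp_pf_comp (F : B ⥤ᵖ C) (G : C ⥤ᵖ D) {a b c : B} {f : a ⟶ b} {g : b ⟶ c}
    {a' b' c' : D} {f' : a' ⟶ b'} {g' : b' ⟶ c'} (φ : Cmp (G.map (F.map f)) f')
    (ψ : Cmp (G.map (F.map g)) g') :
    compCmp (F.comp G) φ ψ = ((Cmp.ofIso (F.mapComp f g)).map G).trans (compCmp G φ ψ) := by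
  have h := compCmp_comp F G (Cmp.ofIso (Iso.refl _)) (Cmp.ofIso (Iso.refl _)) φ ψ
  have e : ∀ {a b : C} {f : a ⟶ b} {a' b' : D} {f' : a' ⟶ b'} (φ : Cmp (G.map f) f'),
      (Cmp.map G (Cmp.ofIso (Iso.refl f))).trans φ = φ := fun φ => Cmp.id_map_trans φ
  rw [e, e] at h
  refine h.trans ?_
  refine congrArg (Cmp.trans · _) (congrArg (Cmp.map _) ?_)
  refine congrArg (Cmp.mk rfl rfl) (Iso.ext ?_)
  simp

end

section

variable {P : Operad.{w, v, u}} {X : PAlg.{w, v, u, w₁, v₁, u₁} P}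

theorem Elem.re_isTwoFunctor {c d : Ctx} (e : c.I ≃ d.I) : IsTwoFunctor (Elem.re (P := P) X e) :=
  (isTwoFunctor_fst.comp (P.re_strict _)).pair
    (IsTwoFunctor.lift fun i => isTwoFunctor_snd.comp (isTwoFunctor_proj _))

theorem Elem.gam_isTwoFunctor {n : ℕ} (c : Fin n → Ctx) (d : Ctx)
    (e : ((i : Fin n) × (c i).I) ≃ d.I) : IsTwoFunctor (Elem.gam (P := P) X c d e) :=
  (((isTwoFunctor_fst.pair (IsTwoFunctor.lift fun i => isTwoFunctor_snd.comp
    ((isTwoFunctor_proj i).comp isTwoFunctor_fst))).comp (P.gam_strict _ _)).comp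
      (P.re_strict _)).pair (IsTwoFunctor.lift fun b => isTwoFunctor_snd.comp
        ((isTwoFunctor_proj _).comp (isTwoFunctor_snd.comp (isTwoFunctor_proj _))))

/-- A comparison of formal composites which is an identity on the objects of the algebra. -/
def Cmp.Flat {c : Ctx} {s t s' t' : Elem P X c} {h : s ⟶ t} {h' : s' ⟶ t'} (δ : Cmp h h') : Prop :=
  ∀ i, ((δ.map (sndP _ _)).map (proj (fun _ => X.carrier) i)).IsEq

namespace Cmp

variable {c : Ctx} {s t s' t' s'' t'' : Elem P X c} {h : s ⟶ t} {h' : s' ⟶ t'} {h'' : s'' ⟶ t''}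

theorem IsEq.flat {δ : Cmp h h'} (e : δ.IsEq) : δ.Flat := fun i => (e.map _).map _

theorem Flat.trans {δ : Cmp h h'} {δ' : Cmp h' h''} (e : δ.Flat) (e' : δ'.Flat) :
    (δ.trans δ').Flat := fun i => by
  rw [map_trans, map_trans]
  exact (e i).trans (e' i)

theorem Flat.symm {δ : Cmp h h'} (e : δ.Flat) : δ.symm.Flat := fun i => by
  rw [symm_map, symm_map]
  exact (e i).symm

theorem Flat.comp {r r' : Elem P X c} {k : t ⟶ r} {k' : t' ⟶ r'} {δ : Cmp h h'} {δ' : Cmp k k'}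
    (e : δ.Flat) (e' : δ'.Flat) : (δ.comp δ').Flat := fun i => by
  have : ((δ.comp δ').map (sndP _ _)).map (proj (fun _ => X.carrier) i) =
      ((δ.map (sndP _ _)).map (proj (fun _ => X.carrier) i)).comp
        ((δ'.map (sndP _ _)).map (proj (fun _ => X.carrier) i)) := by
    obtain ⟨rfl, rfl, _⟩ := δ
    obtain ⟨_, rfl, _⟩ := δ'
    rfl
  rw [this]
  exact (e i).comp (e' i)

theorem Flat.re {d : Ctx} (ρ : d.I ≃ c.I) {δ : Cmp h h'} (e : δ.Flat) :
    (δ.map (Elem.re X ρ)).Flat := fun i => by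
  have : ((δ.map (Elem.re X ρ)).map (sndP _ _)).map (proj (fun _ => X.carrier) i) =
      (δ.map (sndP _ _)).map (proj (fun _ => X.carrier) (ρ i)) := by
    obtain ⟨rfl, rfl, _⟩ := δ
    rfl
  rw [this]
  exact e (ρ i)

theorem Flat.gam {n : ℕ} {c : Fin n → Ctx} {d : Ctx} (e : ((i : Fin n) × (c i).I) ≃ d.I)
    {p q p' q' : P.obj n} {κ : p ⟶ q} {κ' : p' ⟶ q'} (θ : Cmp κ κ')
    {s t s' t' : ∀ i, Elem P X (c i)} {h : s ⟶ t} {h' : s' ⟶ t'} {δ : ∀ i, Cmp (h i) (h' i)}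
    (hδ : ∀ i, (δ i).Flat) : ((θ.pair (Cmp.pi δ)).map (Elem.gam X c d e)).Flat := fun y => by
  have : ∀ δ : Cmp h h', (((θ.pair δ).map (Elem.gam X c d e)).map (sndP _ _)).map
      (proj (fun _ => X.carrier) y) = ((δ.map (proj (fun i => Elem P X (c i)) (e.symm y).1)).map
        (sndP _ _)).map (proj (fun _ => X.carrier) (e.symm y).2) := fun δ => by
    obtain ⟨rfl, rfl, _⟩ := θ
    obtain ⟨rfl, rfl, _⟩ := δ
    rfl
  rw [this, pi_map_proj]
  exact hδ _ _

theorem flat_associator {r r' : Elem P X c} (h : s ⟶ t) (k : t ⟶ r) (l : r ⟶ r') :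
    (ofIso (α_ h k l)).Flat := fun i => associator_isEq (h.2 i) (k.2 i) (l.2 i)

theorem flat_leftUnitor (h : s ⟶ t) : (ofIso (λ_ h)).Flat := fun i => leftUnitor_isEq (h.2 i)

theorem flat_rightUnitor (h : s ⟶ t) : (ofIso (ρ_ h)).Flat := fun i => rightUnitor_isEq (h.2 i)

end Cmp

attribute [irreducible] Elem.val Elem.re Elem.gam

end

end SMTwo

namespace SMTwo

section

variable {P : Operad.{w, v, u}} {X : PAlg.{w, v, u, w₁, v₁, u₁} P}

namespace Cmp

/-- The comparison of values of `μ` induced by comparisons of objects of the algebra. -/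
def muMap (X : PAlg.{w, v, u, w₁, v₁, u₁} P) {n : ℕ} {p q p' q' : P.obj n} {κ : p ⟶ q}
    {κ' : p' ⟶ q'} (θ : Cmp κ κ') {x y x' y' : Fin n → X.carrier} {F : x ⟶ y} {F' : x' ⟶ y'}
    (φ : ∀ i, Cmp (F i) (F' i)) : Cmp (X.app κ F) (X.app κ' F') :=
  (θ.pair (Cmp.pi φ)).map (X.mu n)

variable {n : ℕ} {p q p' q' p'' q'' : P.obj n} {κ : p ⟶ q} {κ' : p' ⟶ q'} {κ'' : p'' ⟶ q''}
  {x y x' y' x'' y'' : Fin n → X.carrier} {F : x ⟶ y} {F' : x' ⟶ y'} {F'' : x'' ⟶ y''}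

theorem muMap_trans (θ : Cmp κ κ') (θ' : Cmp κ' κ'') (φ : ∀ i, Cmp (F i) (F' i))
    (ψ : ∀ i, Cmp (F' i) (F'' i)) :
    (muMap X θ φ).trans (muMap X θ' ψ) = muMap X (θ.trans θ') fun i => (φ i).trans (ψ i) :=
  (map_trans _ _ _).symm.trans (congrArg (Cmp.map (X.mu n)) ((pair_trans _ _ _ _).symm.trans
    (congrArg (Cmp.pair _) (pi_trans _ _))))

theorem muMap_isEq {θ : Cmp κ κ'} (hθ : θ.IsEq) {φ : ∀ i, Cmp (F i) (F' i)}
    (hφ : ∀ i, (φ i).IsEq) : (muMap X θ φ).IsEq :=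
  (hθ.pair (IsEq.pi hφ)).map (X.mu n)

theorem muMap_congr {θ θ' : Cmp κ κ'} (hθ : θ = θ') {φ ψ : ∀ i, Cmp (F i) (F' i)}
    (h : ∀ i, φ i = ψ i) : muMap X θ φ = muMap X θ' ψ := by
  obtain rfl := hθ
  obtain rfl : φ = ψ := funext h
  rfl

theorem muMap_refl : muMap X (ofIso (Iso.refl κ)) (fun i => ofIso (Iso.refl (F i))) =
    ofIso (Iso.refl (X.app κ F)) :=
  (muMap_isEq (IsEq.refl _) fun i => IsEq.refl _).unique (IsEq.refl _)

end Cmp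

namespace Elem

/-- The comparison of the values of a relabelled and of an original 1-cell. -/
def reC {c d : Ctx} (e : c.I ≃ d.I) {s t : Elem P X d} (h : s ⟶ t) :
    Cmp ((val X c).map ((re X e).map h)) ((val X d).map h) :=
  Cmp.ofPF (re_val X e) h

theorem reC_isEq {c d : Ctx} (e : c.I ≃ d.I) {s t : Elem P X d} (h : s ⟶ t) : (reC e h).IsEq :=
  Cmp.ofPF_isEq (re_val X e) h

/-- The composite of an operation with formal composites. -/
abbrev app {n : ℕ} (c : Fin n → Ctx) (d : Ctx) (e : ((i : Fin n) × (c i).I) ≃ d.I) {p q : P.obj n}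
    (κ : p ⟶ q) {s t : ∀ i, Elem P X (c i)} (h : ∀ i, s i ⟶ t i) :
    (gam X c d e).obj (p, s) ⟶ (gam X c d e).obj (q, t) :=
  (gam X c d e).map (κ ×ₘ (h : s ⟶ t))

/-- The values of a family. -/
abbrev vals {n : ℕ} {c : Fin n → Ctx} (s : ∀ i, Elem P X (c i)) : Fin n → X.carrier :=
  fun i => (val X (c i)).obj (s i)

/-- The values of a family. -/
abbrev valsMap {n : ℕ} {c : Fin n → Ctx} {s t : ∀ i, Elem P X (c i)} (h : ∀ i, s i ⟶ t i) :
    vals s ⟶ vals t :=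
  fun i => (val X (c i)).map (h i)

/-- The comparison of the value of a composite with the composite of the values. -/
def appC {n : ℕ} (c : Fin n → Ctx) (d : Ctx) (e : ((i : Fin n) × (c i).I) ≃ d.I) {p q : P.obj n}
    (κ : p ⟶ q) {s t : ∀ i, Elem P X (c i)} (h : ∀ i, s i ⟶ t i) :
    Cmp ((val X d).map (app c d e κ h)) (X.app κ (valsMap h)) :=
  Cmp.ofPF (gam_val X c d e) (κ ×ₘ (h : s ⟶ t))

theorem appC_isEq {n : ℕ} (c : Fin n → Ctx) (d : Ctx) (e : ((i : Fin n) × (c i).I) ≃ d.I)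
    {p q : P.obj n} (κ : p ⟶ q) {s t : ∀ i, Elem P X (c i)} (h : ∀ i, s i ⟶ t i) :
    (appC c d e κ h).IsEq :=
  Cmp.ofPF_isEq (gam_val X c d e) _

end Elem

/-- A presentation of a 1-cell as the value of a 1-cell between formal composites. -/
structure Raw (X : PAlg.{w, v, u, w₁, v₁, u₁} P) (c : Ctx) {a b : X.carrier} (g : a ⟶ b) where
  s : Elem P X c
  t : Elem P X c
  h : s ⟶ t
  φ : Cmp ((Elem.val X c).map h) g

/-- A comparison of 1-cells which is presented by a comparison of formal composites. -/
def Rel {c : Ctx} {a b a' b' : X.carrier} {g : a ⟶ b} {g' : a' ⟶ b'} (L : Raw X c g)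
    (L' : Raw X c g') (θ : Cmp g g') : Prop :=
  ∃ δ : Cmp L.h L'.h, δ.Flat ∧ (δ.map (Elem.val X c)).trans L'.φ = L.φ.trans θ

namespace Raw

variable {c d k : Ctx} {a₁ a₂ a₃ a₄ : X.carrier}

/-- Transport along a comparison. -/
def cast {g : a₁ ⟶ a₂} {g' : a₃ ⟶ a₄} (L : Raw X c g) (θ : Cmp g g') : Raw X c g' :=
  ⟨L.s, L.t, L.h, L.φ.trans θ⟩

/-- Relabelling. -/
def re (e : c.I ≃ d.I) {g : a₁ ⟶ a₂} (L : Raw X d g) : Raw X c g :=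
  ⟨_, _, (Elem.re X e).map L.h, (Elem.reC e L.h).trans L.φ⟩

/-- The identity. -/
def id (s : Elem P X c) (hs : (Elem.val X c).obj s = a₁) : Raw X c (𝟙 a₁) :=
  ⟨s, s, 𝟙 s, idCmp _ hs⟩

/-- Composition. -/
def comp {f : a₁ ⟶ a₂} {g : a₂ ⟶ a₃} (L : Raw X c f) (M : Raw X c g) (e : L.t = M.s) :
    Raw X c (f ≫ g) := by
  obtain ⟨s, t, h, φ⟩ := L
  obtain ⟨_, t', h', φ'⟩ := M
  cases e
  exact ⟨s, t', h ≫ h', compCmp _ φ φ'⟩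

theorem comp_s {f : a₁ ⟶ a₂} {g : a₂ ⟶ a₃} (L : Raw X c f) (M : Raw X c g) (e : L.t = M.s) :
    (L.comp M e).s = L.s := by
  obtain ⟨s, t, h, φ⟩ := L
  obtain ⟨_, t', h', φ'⟩ := M
  cases e
  rfl

theorem comp_t {f : a₁ ⟶ a₂} {g : a₂ ⟶ a₃} (L : Raw X c f) (M : Raw X c g) (e : L.t = M.s) :
    (L.comp M e).t = M.t := by
  obtain ⟨s, t, h, φ⟩ := L
  obtain ⟨_, t', h', φ'⟩ := M
  cases e
  rfl

/-- The action of the operad. -/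
def gam {n : ℕ} {p q : P.obj n} (κ : p ⟶ q) {c : Fin n → Ctx} {x y : Fin n → X.carrier}
    {F : x ⟶ y} (L : ∀ i, Raw X (c i) (F i)) (d : Ctx) (e : ((i : Fin n) × (c i).I) ≃ d.I) :
    Raw X d (X.app κ F) :=
  ⟨(Elem.gam X c d e).obj (p, fun i => (L i).s), (Elem.gam X c d e).obj (q, fun i => (L i).t),
    Elem.app c d e κ fun i => (L i).h, (Elem.appC c d e κ fun i => (L i).h).trans
      (Cmp.muMap X (Cmp.ofIso (Iso.refl κ)) fun i => (L i).φ)⟩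

end Raw

namespace Rel

variable {c d k : Ctx} {a₁ a₂ a₃ a₄ b₁ b₂ b₃ b₄ : X.carrier}

theorem refl {g : a₁ ⟶ a₂} (L : Raw X c g) : Rel L L (Cmp.ofIso (Iso.refl g)) :=
  ⟨Cmp.ofIso (Iso.refl _), (Cmp.IsEq.refl _).flat, by
    rw [Cmp.map_ofIso_refl, Cmp.ofIso_refl_trans, Cmp.trans_ofIso_refl]⟩

theorem trans {g : a₁ ⟶ a₂} {g' : b₁ ⟶ b₂} {g'' : a₃ ⟶ a₄} {L : Raw X c g} {L' : Raw X c g'}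
    {L'' : Raw X c g''} {θ : Cmp g g'} {θ' : Cmp g' g''} (h : Rel L L' θ) (h' : Rel L' L'' θ') :
    Rel L L'' (θ.trans θ') := by
  obtain ⟨δ, hδ, e⟩ := h
  obtain ⟨δ', hδ', e'⟩ := h'
  exact ⟨δ.trans δ', hδ.trans hδ', by
    rw [Cmp.map_trans, Cmp.trans_assoc, e', ← Cmp.trans_assoc, e, Cmp.trans_assoc]⟩

theorem symm {g : a₁ ⟶ a₂} {g' : b₁ ⟶ b₂} {L : Raw X c g} {L' : Raw X c g'} {θ : Cmp g g'}
    (h : Rel L L' θ) : Rel L' L θ.symm := by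
  obtain ⟨δ, hδ, e⟩ := h
  refine ⟨δ.symm, hδ.symm, ?_⟩
  rw [Cmp.trans_eq_iff] at e
  rw [e, Cmp.symm_map, Cmp.trans_assoc, Cmp.trans_assoc, Cmp.trans_symm, Cmp.trans_ofIso_refl]

theorem congr {g : a₁ ⟶ a₂} {g' : b₁ ⟶ b₂} {L : Raw X c g} {L' : Raw X c g'} {θ θ' : Cmp g g'}
    (h : Rel L L' θ) (e : θ = θ') : Rel L L' θ' := e ▸ h

/-- The composite of a presented comparison and an identity. -/
theorem trans_refl {g : a₁ ⟶ a₂} {g' : b₁ ⟶ b₂} {L : Raw X c g} {L' L'' : Raw X c g'}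
    {θ : Cmp g g'} (h : Rel L L' θ) (h' : Rel L' L'' (Cmp.ofIso (Iso.refl g'))) : Rel L L'' θ :=
  (h.trans h').congr (Cmp.trans_ofIso_refl θ)

theorem cast {g : a₁ ⟶ a₂} {g' : b₁ ⟶ b₂} (L : Raw X c g) (θ : Cmp g g') : Rel L (L.cast θ) θ :=
  ⟨Cmp.ofIso (Iso.refl _), (Cmp.IsEq.refl _).flat, by
    exact (congrArg (Cmp.trans · _) (Cmp.map_ofIso_refl _ _)).trans (Cmp.ofIso_refl_trans _)⟩

theorem re (e : c.I ≃ d.I) {g : a₁ ⟶ a₂} {g' : b₁ ⟶ b₂} {L : Raw X d g} {L' : Raw X d g'}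
    {θ : Cmp g g'} (h : Rel L L' θ) : Rel (L.re e) (L'.re e) θ := by
  obtain ⟨δ, hδ, h⟩ := h
  refine ⟨δ.map (Elem.re X e), hδ.re e, ?_⟩
  change _ = ((Cmp.ofPF (Elem.re_val X e) L.h).trans L.φ).trans θ
  rw [Cmp.trans_assoc, ← h]
  refine (Cmp.trans_assoc _ _ _).symm.trans (Eq.trans ?_ (Cmp.trans_assoc _ _ _))
  refine congrArg (Cmp.trans · L'.φ) ((congrArg (Cmp.trans · _) (Cmp.map_comp _ _ δ).symm).trans ?_)
  exact (Cmp.ofPF_trans_map (Elem.re_val X e) δ).symm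

theorem re_re (e : c.I ≃ d.I) (e' : d.I ≃ k.I) {g : a₁ ⟶ a₂} (L : Raw X k g) :
    Rel ((L.re e').re e) (L.re (e.trans e')) (Cmp.ofIso (Iso.refl g)) := by
  refine ⟨(Elem.re_re_same e e' L.h).cmp, (Same.isEq _).flat, ?_⟩
  refine ((Cmp.trans_assoc _ _ _).symm.trans (Eq.trans ?_ (Cmp.trans_assoc _ _ _))).trans
    (Cmp.trans_ofIso_refl _).symm
  refine congrArg (Cmp.trans · L.φ) (Cmp.IsEq.unique ?_ ?_)
  · exact ((Same.isEq _).map _).trans (Elem.reC_isEq (e.trans e') _)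
  · exact (Elem.reC_isEq e _).trans (Elem.reC_isEq e' _)

theorem re_refl {g : a₁ ⟶ a₂} (L : Raw X c g) :
    Rel (L.re (Equiv.refl c.I)) L (Cmp.ofIso (Iso.refl g)) := by
  refine ⟨(Elem.re_refl_same L.h).cmp, (Same.isEq _).flat, ?_⟩
  refine Eq.trans ?_ (Cmp.trans_ofIso_refl _).symm
  exact congrArg (Cmp.trans · L.φ) (((Same.isEq _).map _).unique (Elem.reC_isEq _ _))

theorem re_eq {e e' : c.I ≃ d.I} (h : ∀ x, e x = e' x) {g : a₁ ⟶ a₂} (L : Raw X d g) :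
    Rel (L.re e) (L.re e') (Cmp.ofIso (Iso.refl g)) := by
  obtain rfl : e = e' := Equiv.ext h
  exact refl _

theorem comp {f : a₁ ⟶ a₂} {g : a₂ ⟶ a₃} {f' : b₁ ⟶ b₂} {g' : b₂ ⟶ b₃} {L : Raw X c f}
    {M : Raw X c g} {L' : Raw X c f'} {M' : Raw X c g'} {θ : Cmp f f'} {θ' : Cmp g g'}
    (e : L.t = M.s) (e' : L'.t = M'.s) (h : Rel L L' θ) (h' : Rel M M' θ') :
    Rel (L.comp M e) (L'.comp M' e') (θ.comp θ') := by
  obtain ⟨s, t, l, φ⟩ := L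
  obtain ⟨_, t', m, φ'⟩ := M
  cases e
  obtain ⟨r, q, l', ψ⟩ := L'
  obtain ⟨_, q', m', ψ'⟩ := M'
  cases e'
  obtain ⟨δ, hδ, h⟩ := h
  obtain ⟨δ', hδ', h'⟩ := h'
  refine ⟨δ.comp δ', hδ.comp hδ', ?_⟩
  refine (compCmp_natural _ δ δ' ψ ψ').trans ((congrArg₂ (compCmp _) h h').trans ?_)
  exact compCmp_trans _ _ _ _ _

theorem assoc {f : a₁ ⟶ a₂} {g : a₂ ⟶ a₃} {h : a₃ ⟶ a₄} (L : Raw X c f) (M : Raw X c g)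
    (N : Raw X c h) (e : L.t = M.s) (e' : M.t = N.s) (e₁ : (L.comp M e).t = N.s)
    (e₂ : L.t = (M.comp N e').s) :
    Rel ((L.comp M e).comp N e₁) (L.comp (M.comp N e') e₂) (Cmp.ofIso (α_ f g h)) := by
  obtain ⟨s, t, l, φ⟩ := L
  obtain ⟨_, t', m, φ'⟩ := M
  cases e
  obtain ⟨_, t'', n, φ''⟩ := N
  cases e'
  exact ⟨Cmp.ofIso (α_ l m n), Cmp.flat_associator _ _ _, compCmp_assoc _ _ _ _⟩

theorem id_comp {f : a₁ ⟶ a₂} (s : Elem P X c) (hs : (Elem.val X c).obj s = a₁) (L : Raw X c f)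
    (e : s = L.s) : Rel ((Raw.id s hs).comp L e) L (Cmp.ofIso (λ_ f)) := by
  obtain ⟨r, t, l, φ⟩ := L
  cases e
  exact ⟨Cmp.ofIso (λ_ l), Cmp.flat_leftUnitor _, compCmp_id_left _ _ _⟩

theorem comp_id {f : a₁ ⟶ a₂} (s : Elem P X c) (hs : (Elem.val X c).obj s = a₂) (L : Raw X c f)
    (e : L.t = s) : Rel (L.comp (Raw.id s hs) e) L (Cmp.ofIso (ρ_ f)) := by
  obtain ⟨r, t, l, φ⟩ := L
  cases e
  exact ⟨Cmp.ofIso (ρ_ l), Cmp.flat_rightUnitor _, compCmp_id_right _ _ _⟩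

theorem id_congr (s s' : Elem P X c) (hs : (Elem.val X c).obj s = a₁)
    (hs' : (Elem.val X c).obj s' = a₁) (h : s = s') :
    Rel (Raw.id s hs) (Raw.id s' hs') (Cmp.ofIso (Iso.refl (𝟙 a₁))) := by
  subst h
  exact refl _

theorem re_id (e : c.I ≃ d.I) (s : Elem P X d) (hs : (Elem.val X d).obj s = a₁)
    (hs' : (Elem.val X c).obj ((Elem.re X e).obj s) = a₁) :
    Rel ((Raw.id s hs).re e) (Raw.id ((Elem.re X e).obj s) hs') (Cmp.ofIso (Iso.refl (𝟙 a₁))) := by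
  refine ⟨Cmp.ofIso ((Elem.re X e).mapId s),
    ((Elem.re_isTwoFunctor e).isEq_mapId s).flat, ?_⟩
  subst hs
  have h₁ := idCmp_ofPF _ (Elem.re_val X e) (a := s) rfl
  have h₂ := idCmp_comp (Elem.re X e) (Elem.val X c) (a := s) rfl hs'
  rw [Cmp.trans_ofIso_refl]
  refine Eq.trans ?_ (h₂.symm.trans h₁)
  exact congrArg (Cmp.trans · _) (congrArg (Cmp.map _) (Cmp.trans_ofIso_refl _).symm)

theorem re_comp (e : c.I ≃ d.I) {f : a₁ ⟶ a₂} {g : a₂ ⟶ a₃} (L : Raw X d f) (M : Raw X d g)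
    (h : L.t = M.s) (h' : (L.re e).t = (M.re e).s) :
    Rel ((L.comp M h).re e) ((L.re e).comp (M.re e) h') (Cmp.ofIso (Iso.refl (f ≫ g))) := by
  obtain ⟨s, t, l, φ⟩ := L
  obtain ⟨_, t', m, φ'⟩ := M
  cases h
  refine ⟨Cmp.ofIso ((Elem.re X e).mapComp l m),
    ((Elem.re_isTwoFunctor e).isEq_mapComp l m).flat, ?_⟩
  have h₁ := compCmp_ofPF _ (Elem.re_val X e) φ φ'
  have h₂ := compCmp_pf_comp (Elem.re X e) (Elem.val X c)
    ((Cmp.ofPF (Elem.re_val X e) l).trans φ) ((Cmp.ofPF (Elem.re_val X e) m).trans φ')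
  exact (h₂.symm.trans h₁).trans (Cmp.trans_ofIso_refl _).symm

end Rel

end

end SMTwo

namespace SMTwo

section

variable {P : Operad.{w, v, u}} {X : PAlg.{w, v, u, w₁, v₁, u₁} P}

theorem Elem.appC_natural {n : ℕ} {p q p' q' : P.obj n} {κ : p ⟶ q} {κ' : p' ⟶ q'}
    (θ : Cmp κ κ') {c : Fin n → Ctx} (d : Ctx) (e : ((i : Fin n) × (c i).I) ≃ d.I)
    {s t s' t' : ∀ i, Elem P X (c i)} {h : ∀ i, s i ⟶ t i} {h' : ∀ i, s' i ⟶ t' i}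
    (δ : ∀ i, Cmp (h i) (h' i)) :
    (((θ.pair (Cmp.pi δ : Cmp (show s ⟶ t from h) (show s' ⟶ t' from h'))).map
      (Elem.gam X c d e)).map (Elem.val X d)).trans (Elem.appC c d e κ' h') =
    (Elem.appC c d e κ h).trans (Cmp.muMap X θ fun i => (δ i).map (Elem.val X (c i))) := by
  refine ((congrArg (Cmp.trans · _) (Cmp.map_comp _ _ _).symm).trans
    (Cmp.ofPF_trans_map (Elem.gam_val X c d e) (θ.pair (Cmp.pi δ))).symm).trans ?_
  refine congrArg (Cmp.trans _) ?_
  have : ∀ δ : Cmp (show s ⟶ t from h) (show s' ⟶ t' from h'),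
      (θ.pair δ).map ((pair (fstP _ _) (lift fun i =>
      (sndP (P.obj n) (∀ i, Elem P X (c i))).comp
        ((proj (fun i => Elem P X (c i)) i).comp (Elem.val X (c i))))).comp (X.mu n)) =
      Cmp.muMap X (F := Elem.valsMap h) (F' := Elem.valsMap h') θ fun i =>
          (δ.map (proj (fun i => Elem P X (c i)) i)).map (Elem.val X (c i)) := fun δ => by
    obtain ⟨rfl, rfl, _⟩ := θ
    obtain ⟨rfl, rfl, _⟩ := δ
    rfl
  exact (this _).trans (Cmp.muMap_congr rfl fun i =>
    congrArg (Cmp.map _) (Cmp.pi_map_proj (A := fun i => Elem P X (c i)) δ i))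

theorem PAlg.gam_same_natural (X : PAlg.{w, v, u, w₁, v₁, u₁} P) {n m : ℕ} (k : Fin n → ℕ)
    (hk : ∑ i, k i = m) {p q : P.obj n} (κ : p ⟶ q) {r r' : ∀ i, P.obj (k i)} (g : r ⟶ r')
    {x y x' y' : Fin m → X.carrier} {F : x ⟶ y} {F' : x' ⟶ y'} (φ : ∀ a, Cmp (F a) (F' a)) :
    (X.gam_same k hk κ g F).cmp.trans
      (Cmp.muMap X (Cmp.ofIso (Iso.refl κ)) fun i => Cmp.muMap X
        (F := fun j => F (blocks k hk ⟨i, j⟩)) (F' := fun j => F' (blocks k hk ⟨i, j⟩))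
        (Cmp.ofIso (Iso.refl (g i))) fun j => φ (blocks k hk ⟨i, j⟩)) =
      (Cmp.muMap X (Cmp.ofIso (Iso.refl ((P.gam k hk).map (κ ×ₘ g)))) φ).trans
        (X.gam_same k hk κ g F').cmp := by
  have key : ∀ Φ : Cmp F F', (X.gam_same k hk κ g F).cmp.trans
      (Cmp.muMap X (Cmp.ofIso (Iso.refl κ)) fun i => Cmp.muMap X
        (F := fun j => F (blocks k hk ⟨i, j⟩)) (F' := fun j => F' (blocks k hk ⟨i, j⟩))
        (Cmp.ofIso (Iso.refl (g i))) fun j => Φ.map (proj (fun _ => X.carrier) _)) =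
      (Cmp.muMap X (Cmp.ofIso (Iso.refl ((P.gam k hk).map (κ ×ₘ g)))) fun a =>
        Φ.map (proj (fun _ => X.carrier) a)).trans (X.gam_same k hk κ g F').cmp := fun Φ => by
    obtain ⟨rfl, rfl, Φ⟩ := Φ
    have e := Cmp.ofPF_trans_map (X.mu_gam k hk)
      (((Cmp.ofIso (Iso.refl κ)).pair (Cmp.ofIso (Iso.refl g))).pair (Cmp.mk rfl rfl Φ))
    refine Eq.trans ?_ (e.symm.symm.trans ?_)
    · rfl
    · refine congrArg (Cmp.trans · _) ?_
      refine (Cmp.map_comp _ _ _).trans (congrArg (Cmp.map (X.mu m)) ?_)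
      refine (Cmp.map_pair _ _ _).trans (congrArg₂ Cmp.pair ?_ rfl)
      exact (((Cmp.IsEq.refl κ).pair (Cmp.IsEq.refl g)).map (P.gam k hk)).unique (Cmp.IsEq.refl _)
  refine Eq.trans ?_ ((key (Cmp.pi φ)).trans ?_)
  · exact congrArg (Cmp.trans _) (Cmp.muMap_congr rfl fun i => Cmp.muMap_congr rfl fun j =>
      (Cmp.pi_map_proj φ _).symm)
  · exact congrArg (Cmp.trans · _) (Cmp.muMap_congr rfl fun i => Cmp.pi_map_proj φ i)

namespace Rel

variable {c d k : Ctx}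

theorem gam_re {n : ℕ} {p q : P.obj n} (κ : p ⟶ q) {c : Fin n → Ctx} {x y : Fin n → X.carrier}
    {F : x ⟶ y} (L : ∀ i, Raw X (c i) (F i)) {d d' : Ctx} (e : ((i : Fin n) × (c i).I) ≃ d.I)
    (e' : ((i : Fin n) × (c i).I) ≃ d'.I) (ρ : d'.I ≃ d.I)
    (hρ : ∀ i x, ρ (e' ⟨i, x⟩) = e ⟨i, x⟩) :
    Rel ((Raw.gam κ L d e).re ρ) (Raw.gam κ L d' e') (Cmp.ofIso (Iso.refl (X.app κ F))) := by
  have h : Same ((Elem.re X ρ).map (Elem.app c d e κ fun i => (L i).h))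
      (Elem.app c d' e' κ fun i => (L i).h) := Elem.re_gam_same e e' ρ hρ κ _
  refine ⟨h.cmp, h.isEq.flat, ?_⟩
  refine Eq.trans ?_ (Cmp.trans_ofIso_refl _).symm
  refine ((Cmp.trans_assoc _ _ _).symm.trans (Eq.trans ?_ (Cmp.trans_assoc _ _ _)))
  refine congrArg (Cmp.trans · _) (Cmp.IsEq.unique ?_ ?_)
  · exact (h.isEq.map _).trans (Elem.appC_isEq _ _ _ _ _)
  · exact (Elem.reC_isEq _ _).trans (Elem.appC_isEq _ _ _ _ _)

/-- The action of comparisons on presented 1-cells, up to relabelling. -/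
theorem gam {n : ℕ} {p q p' q' : P.obj n} {κ : p ⟶ q} {κ' : p' ⟶ q'} (θ : Cmp κ κ')
    {c c' : Fin n → Ctx} {x y x' y' : Fin n → X.carrier} {F : x ⟶ y} {F' : x' ⟶ y'}
    {L : ∀ i, Raw X (c i) (F i)} {L' : ∀ i, Raw X (c' i) (F' i)} {φ : ∀ i, Cmp (F i) (F' i)}
    {d : Ctx} {e : ((i : Fin n) × (c i).I) ≃ d.I} {e' : ((i : Fin n) × (c' i).I) ≃ d.I}
    (ρ : ∀ i, (c i).I ≃ (c' i).I) (h : ∀ i, Rel (L i) ((L' i).re (ρ i)) (φ i))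
    (hρ : ∀ i x, e' ⟨i, ρ i x⟩ = e ⟨i, x⟩) :
    Rel (Raw.gam κ L d e) (Raw.gam κ' L' d e') (Cmp.muMap X θ φ) := by
  choose δ hδ hφ using h
  have hs : Same (Elem.app (X := X) c d e κ' fun i => (Elem.re X (ρ i)).map (L' i).h)
      (Elem.app c' d e' κ' fun i => (L' i).h) := Elem.gam_re_same e e' ρ hρ κ'
        (s := fun i => (L' i).s) (t := fun i => (L' i).t) fun i => (L' i).h
  have h₁ : (hs.cmp.map (Elem.val X d)).trans (Elem.appC c' d e' κ' _) =
      (Elem.appC c d e κ' _).trans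
        (Cmp.muMap X (Cmp.ofIso (Iso.refl κ')) fun i => Elem.reC (ρ i) (L' i).h) :=
    Cmp.IsEq.unique ((hs.isEq.map _).trans (Elem.appC_isEq _ _ _ _ _))
      ((Elem.appC_isEq _ _ _ _ _).trans (Cmp.muMap_isEq (Cmp.IsEq.refl _)
        fun i => Elem.reC_isEq _ _))
  let η : Cmp (Elem.app (X := X) c d e κ fun i => (L i).h)
      (Elem.app c d e κ' fun i => (Elem.re X (ρ i)).map (L' i).h) :=
    (θ.pair (Cmp.pi δ : Cmp (B := ∀ i, Elem P X (c i)) _ _)).map (Elem.gam X c d e)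
  refine ⟨η.trans hs.cmp, (Cmp.Flat.gam e θ hδ).trans hs.isEq.flat, ?_⟩
  refine Eq.trans (congrArg (Cmp.trans · _) (Cmp.map_trans _ _ _)) ?_
  refine (Cmp.trans_assoc _ _ _).trans ?_
  refine (congrArg (Cmp.trans _) ((Cmp.trans_assoc _ _ _).symm.trans
    ((congrArg (Cmp.trans · _) h₁).trans (Cmp.trans_assoc _ _ _)))).trans ?_
  refine ((Cmp.trans_assoc _ _ _).symm.trans ((congrArg (Cmp.trans · _)
    (Elem.appC_natural θ d e δ)).trans (Cmp.trans_assoc _ _ _))).trans ?_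
  refine (congrArg (Cmp.trans _) ?_).trans (Cmp.trans_assoc _ _ _).symm
  refine (congrArg (Cmp.trans _) (Cmp.muMap_trans _ _ _ _)).trans ?_
  refine (Cmp.muMap_trans _ _ _ _).trans (Eq.trans ?_ (Cmp.muMap_trans _ _ _ _).symm)
  refine Cmp.muMap_congr ?_ fun i => ?_
  · rw [Cmp.trans_ofIso_refl, Cmp.trans_ofIso_refl, Cmp.ofIso_refl_trans]
  · exact hφ i

/-- Composition with a composite operation. -/
theorem gam_gam {n m : ℕ} (k : Fin n → ℕ) (hk : ∑ i, k i = m) {c : Fin m → Ctx}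
    {d : Ctx} {c' : Fin n → Ctx} {e : ((a : Fin m) × (c a).I) ≃ d.I}
    {e' : ((i : Fin n) × (c' i).I) ≃ d.I}
    {e'' : ∀ i, ((j : Fin (k i)) × (c (blocks k hk ⟨i, j⟩)).I) ≃ (c' i).I}
    (he : ∀ i j x, e' ⟨i, e'' i ⟨j, x⟩⟩ = e ⟨blocks k hk ⟨i, j⟩, x⟩) {p q : P.obj n} (κ : p ⟶ q)
    {r r' : ∀ i, P.obj (k i)} (g : r ⟶ r') {x y : Fin m → X.carrier} {F : x ⟶ y}
    (L : ∀ a, Raw X (c a) (F a)) :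
    Rel (Raw.gam ((P.gam k hk).map (κ ×ₘ g)) L d e)
      (Raw.gam κ (F := fun i => X.app (g i) (fun j => F (blocks k hk ⟨i, j⟩) :
        PAlg.blk k hk x i ⟶ PAlg.blk k hk y i))
        (fun i => Raw.gam (g i) (F := (fun j => F (blocks k hk ⟨i, j⟩) :
          PAlg.blk k hk x i ⟶ PAlg.blk k hk y i)) (fun j => L (blocks k hk ⟨i, j⟩)) (c' i) (e'' i))
        d e') (X.gam_same k hk κ g F).cmp := by
  have hs : Same (Elem.app (X := X) c d e ((P.gam k hk).map (κ ×ₘ g)) fun i => (L i).h)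
      (Elem.app c' d e' κ fun i => Elem.app _ (c' i) (e'' i) (g i)
        fun j => (L (blocks k hk ⟨i, j⟩)).h) := Elem.gam_gam_same k hk e e' e''
          he κ g (s := fun i => (L i).s) (t := fun i => (L i).t) fun i => (L i).h
  refine ⟨hs.cmp, hs.isEq.flat, ?_⟩
  let G : Elem.vals (fun i => (L i).s) ⟶ Elem.vals (fun i => (L i).t) :=
    Elem.valsMap fun i => (L i).h
  have h₁ : (hs.cmp.map (Elem.val X d)).trans ((Elem.appC c' d e' κ _).trans
      (Cmp.muMap X (Cmp.ofIso (Iso.refl κ)) fun i => Elem.appC _ (c' i) (e'' i) (g i) _)) =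
      (Elem.appC c d e _ _).trans (X.gam_same k hk κ g G).cmp :=
    Cmp.IsEq.unique ((hs.isEq.map _).trans ((Elem.appC_isEq _ _ _ _ _).trans
        (Cmp.muMap_isEq (Cmp.IsEq.refl _) fun i => Elem.appC_isEq _ _ _ _ _)))
      ((Elem.appC_isEq _ _ _ _ _).trans (Same.isEq _))
  have h₂ : (X.gam_same k hk κ g G).cmp.trans
      (Cmp.muMap X (Cmp.ofIso (Iso.refl κ)) fun i => Cmp.muMap X
        (F := fun j => G (blocks k hk ⟨i, j⟩)) (F' := fun j => F (blocks k hk ⟨i, j⟩))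
        (Cmp.ofIso (Iso.refl (g i))) fun j => (L (blocks k hk ⟨i, j⟩)).φ) =
      (Cmp.muMap X (Cmp.ofIso (Iso.refl ((P.gam k hk).map (κ ×ₘ g)))) fun a =>
        (L a).φ).trans (X.gam_same k hk κ g F).cmp :=
    X.gam_same_natural k hk κ g fun a => (L a).φ
  refine Eq.trans ?_ (((congrArg (Cmp.trans · _) h₁).trans ((Cmp.trans_assoc _ _ _).trans
    (congrArg (Cmp.trans _) h₂))).trans (Cmp.trans_assoc _ _ _).symm)
  refine Eq.trans ?_ (Cmp.trans_assoc _ _ _).symm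
  refine congrArg (Cmp.trans _) (Eq.trans ?_ (Cmp.trans_assoc _ _ _).symm)
  refine congrArg (Cmp.trans _) (Eq.trans ?_ (Cmp.muMap_trans _ _ _ _).symm)
  exact Cmp.muMap_congr (Cmp.ofIso_refl_trans _).symm fun i => rfl

end Rel

end

end SMTwo

namespace SMTwo

section

variable {B : Type u₁} [Bicategory.{w₁, v₁} B] {C : Type u₂} [Bicategory.{w₂, v₂} C]

theorem Cmp.map_const (c : C) {a b a' b' : B} {f : a ⟶ b} {f' : a' ⟶ b'} (φ : Cmp f f') :
    φ.map (const B c) = Cmp.ofIso (Iso.refl (𝟙 c)) := by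
  obtain ⟨rfl, rfl, i⟩ := φ
  exact congrArg (Cmp.mk rfl rfl) (Iso.ext rfl)

theorem compCmp_refl (F : B ⥤ᵖ C) {a b c : B} (f : a ⟶ b) (g : b ⟶ c) :
    compCmp F (Cmp.ofIso (Iso.refl (F.map f))) (Cmp.ofIso (Iso.refl (F.map g))) =
      Cmp.ofIso (F.mapComp f g) := by
  refine congrArg (Cmp.mk rfl rfl) (Iso.ext ?_)
  simp

theorem idCmp_pair (F : B ⥤ᵖ C) {D : Type u₃} [Bicategory.{w₃, v₃} D] (G : B ⥤ᵖ D) (a : B) :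
    idCmp (pair F G) (a := a) rfl = (idCmp F rfl).pair (idCmp G rfl) := by
  refine congrArg (Cmp.mk rfl rfl) (Iso.ext (Prod.ext ?_ ?_)) <;> rfl

theorem compCmp_pair (F : B ⥤ᵖ C) {D : Type u₃} [Bicategory.{w₃, v₃} D] (G : B ⥤ᵖ D) {a b c : B}
    {f : a ⟶ b} {g : b ⟶ c} {x y z : C} {x' y' z' : D} {h : x ⟶ y} {k : y ⟶ z} {h' : x' ⟶ y'}
    {k' : y' ⟶ z'} (φ : Cmp (F.map f) h) (φ' : Cmp (G.map f) h') (ψ : Cmp (F.map g) k)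
    (ψ' : Cmp (G.map g) k') :
    compCmp (pair F G) (φ.pair φ' : Cmp ((pair F G).map f) (h ×ₘ h'))
      (ψ.pair ψ' : Cmp ((pair F G).map g) (k ×ₘ k')) =
      (compCmp F φ ψ).pair (compCmp G φ' ψ') := by
  obtain ⟨rfl, rfl, _⟩ := φ
  obtain ⟨rfl, rfl, _⟩ := φ'
  obtain ⟨_, rfl, _⟩ := ψ
  obtain ⟨_, rfl, _⟩ := ψ'
  rfl

theorem compCmp_lift {ι : Type t} {A : ι → Type u₃} [∀ i, Bicategory.{w₃, v₃} (A i)]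
    (F : ∀ i, B ⥤ᵖ A i) {a b c : B} {f : a ⟶ b} {g : b ⟶ c} {x y z : ∀ i, A i} {h : x ⟶ y}
    {k : y ⟶ z} (φ : ∀ i, Cmp ((F i).map f) (h i)) (ψ : ∀ i, Cmp ((F i).map g) (k i)) :
    compCmp (lift F) (Cmp.pi φ : Cmp ((lift F).map f) h) (Cmp.pi ψ : Cmp ((lift F).map g) k) =
      Cmp.pi fun i => compCmp (F i) (φ i) (ψ i) := by
  have key : ∀ (Φ : Cmp ((lift F).map f) h) (Ψ : Cmp ((lift F).map g) k) (i : ι),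
      (compCmp (lift F) Φ Ψ).map (proj A i) =
      compCmp (F i) (Φ.map (proj A i)) (Ψ.map (proj A i)) := fun Φ Ψ i => by
    obtain ⟨rfl, rfl, _⟩ := Φ
    obtain ⟨_, rfl, _⟩ := Ψ
    rfl
  exact Cmp.pi_ext fun i => (key _ _ i).trans ((congrArg₂ (compCmp (F i))
    (Cmp.pi_map_proj (A := A) φ i) (Cmp.pi_map_proj (A := A) ψ i)).trans
      (Cmp.pi_map_proj (A := A) (fun i => compCmp (F i) (φ i) (ψ i)) i).symm)

theorem idCmp_lift {ι : Type t} {A : ι → Type u₃} [∀ i, Bicategory.{w₃, v₃} (A i)]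
    (F : ∀ i, B ⥤ᵖ A i) (a : B) :
    idCmp (lift F) (a := a) rfl = Cmp.pi fun i => idCmp (F i) rfl := by
  refine Cmp.pi_ext fun i => Eq.trans ?_ (Cmp.pi_map_proj _ i).symm
  exact congrArg (Cmp.mk rfl rfl) (Iso.ext rfl)

end

section

variable {P : Operad.{w, v, u}} {X : PAlg.{w, v, u, w₁, v₁, u₁} P}

theorem PAlg.one_same_natural (X : PAlg.{w, v, u, w₁, v₁, u₁} P) {x y x' y' : Fin 1 → X.carrier}
    {F : x ⟶ y} {F' : x' ⟶ y'} (φ : ∀ a, Cmp (F a) (F' a)) :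
    (X.one_same F).cmp.trans (φ 0) =
      (Cmp.muMap X (Cmp.ofIso (Iso.refl (𝟙 P.one))) φ).trans (X.one_same F').cmp := by
  have key : ∀ Φ : Cmp F F', (X.one_same F).cmp.trans (Φ.map (proj (fun _ => X.carrier) 0)) =
      (Cmp.muMap X (Cmp.ofIso (Iso.refl (𝟙 P.one))) fun a =>
        Φ.map (proj (fun _ => X.carrier) a)).trans (X.one_same F').cmp := fun Φ => by
    obtain ⟨rfl, rfl, Φ⟩ := Φ
    obtain ⟨a, rfl⟩ : ∃ a, x = fun _ => a := ⟨x 0, funext fun i => congrArg x (Subsingleton.elim _ _)⟩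
    obtain ⟨b, rfl⟩ : ∃ b, y = fun _ => b := ⟨y 0, funext fun i => congrArg y (Subsingleton.elim _ _)⟩
    obtain ⟨f, rfl⟩ : ∃ f : a ⟶ b, F = fun _ => f :=
      ⟨F 0, funext fun i => by obtain rfl := Subsingleton.elim i 0; rfl⟩
    change (fun _ => f : (fun _ => a : Fin 1 → X.carrier) ⟶ fun _ => b) ≅ F' at Φ
    obtain ⟨f', rfl⟩ : ∃ f : a ⟶ b, F' = fun _ => f :=
      ⟨F' 0, funext fun i => by obtain rfl := Subsingleton.elim i 0; rfl⟩
    have e := Cmp.ofPF_trans_map X.mu_one (Cmp.ofIso (show f ≅ f' from ⟨Φ.hom 0, Φ.inv 0, congrFun Φ.hom_inv_id 0, congrFun Φ.inv_hom_id 0⟩))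
    have h : ∀ f : a ⟶ b, (X.one_same (fun _ => f :
      (fun _ => a : Fin 1 → X.carrier) ⟶ fun _ => b)).cmp = Cmp.ofPF X.mu_one f :=
        fun f => (Same.isEq _).unique (Cmp.ofPF_isEq X.mu_one f)
    rw [h, h]
    refine Eq.trans ?_ (e.trans (congrArg (Cmp.trans · _) ?_))
    · exact congrArg (Cmp.trans _) (Cmp.map_id _).symm
    · refine (Cmp.map_comp _ _ _).trans (congrArg (Cmp.map (X.mu 1)) ?_)
      refine (Cmp.map_pair _ _ _).trans (congrArg₂ Cmp.pair ?_ ?_)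
      · exact Cmp.map_const _ _
      · refine (Cmp.map_lift _ _).trans (congrArg Cmp.pi (funext fun i => ?_))
        obtain rfl := Subsingleton.elim i 0
        exact Cmp.map_id _
  exact Eq.trans (congrArg (Cmp.trans _) (Cmp.pi_map_proj φ 0).symm) ((key (Cmp.pi φ)).trans
    (congrArg (Cmp.trans · _) (Cmp.muMap_congr rfl fun i => Cmp.pi_map_proj φ i)))

theorem PAlg.act_same_natural (X : PAlg.{w, v, u, w₁, v₁, u₁} P) {n : ℕ} (σ : Equiv.Perm (Fin n))
    {p q : P.obj n} (κ : p ⟶ q) {x y x' y' : Fin n → X.carrier}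
    {F : x ⟶ y} {F' : x' ⟶ y'} (φ : ∀ a, Cmp (F a) (F' a)) :
    (X.act_same σ κ F).cmp.trans (Cmp.muMap X (F := fun i => F (σ⁻¹ i)) (F' := fun i => F' (σ⁻¹ i))
      (Cmp.ofIso (Iso.refl κ)) fun i => φ (σ⁻¹ i)) =
      (Cmp.muMap X (Cmp.ofIso (Iso.refl (P.dotMap κ σ))) φ).trans (X.act_same σ κ F').cmp := by
  have key : ∀ Φ : Cmp F F', (X.act_same σ κ F).cmp.trans
      (Cmp.muMap X (F := fun i => F (σ⁻¹ i)) (F' := fun i => F' (σ⁻¹ i))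
        (Cmp.ofIso (Iso.refl κ)) fun i => Φ.map (proj (fun _ => X.carrier) (σ⁻¹ i))) =
      (Cmp.muMap X (Cmp.ofIso (Iso.refl (P.dotMap κ σ))) fun a =>
        Φ.map (proj (fun _ => X.carrier) a)).trans (X.act_same σ κ F').cmp := fun Φ => by
    obtain ⟨rfl, rfl, Φ⟩ := Φ
    have e := Cmp.ofPF_trans_map (X.mu_act σ)
      ((Cmp.ofIso (Iso.refl κ)).pair (Cmp.mk rfl rfl Φ))
    refine Eq.trans ?_ (e.trans ?_)
    · rfl
    · refine congrArg (Cmp.trans · _) ?_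
      refine (Cmp.map_comp _ _ _).trans (congrArg (Cmp.map (X.mu n)) ?_)
      refine (Cmp.map_pair _ _ _).trans (congrArg₂ Cmp.pair ?_ rfl)
      exact ((Cmp.IsEq.refl κ).map (P.act σ)).unique (Cmp.IsEq.refl _)
  refine Eq.trans ?_ ((key (Cmp.pi φ)).trans ?_)
  · exact congrArg (Cmp.trans _) (Cmp.muMap_congr rfl fun i => (Cmp.pi_map_proj φ _).symm)
  · exact congrArg (Cmp.trans · _) (Cmp.muMap_congr rfl fun i => Cmp.pi_map_proj φ i)

namespace Rel

/-- Composition with the operadic unit. -/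
theorem gam_one {c : Fin 1 → Ctx} {d : Ctx} {e : ((i : Fin 1) × (c i).I) ≃ d.I}
    (ρ : d.I ≃ (c 0).I) (hρ : ∀ x, ρ (e ⟨0, x⟩) = x) {x y : Fin 1 → X.carrier} {F : x ⟶ y}
    (L : ∀ i, Raw X (c i) (F i)) :
    Rel (Raw.gam (𝟙 P.one) L d e) ((L 0).re ρ) (X.one_same F).cmp := by
  have hs : Same (Elem.app (X := X) c d e (𝟙 P.one) fun i => (L i).h)
      ((Elem.re X ρ).map (L 0).h) := Elem.one_gam_same e ρ hρ
        (s := fun i => (L i).s) (t := fun i => (L i).t) fun i => (L i).h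
  refine ⟨hs.cmp, hs.isEq.flat, ?_⟩
  let G : Elem.vals (fun i => (L i).s) ⟶ Elem.vals (fun i => (L i).t) :=
    Elem.valsMap fun i => (L i).h
  have h₁ : (hs.cmp.map (Elem.val X d)).trans (Elem.reC ρ (L 0).h) =
      (Elem.appC c d e _ _).trans (X.one_same G).cmp :=
    Cmp.IsEq.unique ((hs.isEq.map _).trans (Elem.reC_isEq _ _))
      ((Elem.appC_isEq _ _ _ _ _).trans (Same.isEq _))
  have h₂ := X.one_same_natural (F := G) fun a => (L a).φ
  refine (Cmp.trans_assoc _ _ _).symm.trans ((congrArg (Cmp.trans · _) h₁).trans ?_)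
  exact (Cmp.trans_assoc _ _ _).trans ((congrArg (Cmp.trans _) h₂).trans
    (Cmp.trans_assoc _ _ _).symm)

/-- Composition and the actions of the symmetric groups. -/
theorem gam_act {n : ℕ} (σ : Equiv.Perm (Fin n)) {c : Fin n → Ctx} {d : Ctx}
    {e : ((i : Fin n) × (c i).I) ≃ d.I} {e' : ((i : Fin n) × (c (σ⁻¹ i)).I) ≃ d.I}
    (he : ∀ i x, e' ⟨i, x⟩ = e ⟨σ⁻¹ i, x⟩) {p q : P.obj n} (κ : p ⟶ q)
    {x y : Fin n → X.carrier} {F : x ⟶ y} (L : ∀ i, Raw X (c i) (F i)) :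
    Rel (Raw.gam (P.dotMap κ σ) L d e)
      (Raw.gam κ (F := fun i => F (σ⁻¹ i)) (fun i => L (σ⁻¹ i)) d e') (X.act_same σ κ F).cmp := by
  have hs : Same (Elem.app (X := X) c d e (P.dotMap κ σ) fun i => (L i).h)
      (Elem.app (X := X) (fun i => c (σ⁻¹ i)) d e' κ fun i => (L (σ⁻¹ i)).h) :=
    Elem.gam_act_same σ e e' he κ (s := fun i => (L i).s) (t := fun i => (L i).t) fun i => (L i).h
  refine ⟨hs.cmp, hs.isEq.flat, ?_⟩
  let G : Elem.vals (fun i => (L i).s) ⟶ Elem.vals (fun i => (L i).t) :=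
    Elem.valsMap fun i => (L i).h
  have h₁ : (hs.cmp.map (Elem.val X d)).trans (Elem.appC (fun i => c (σ⁻¹ i)) d e' κ _) =
      (Elem.appC c d e _ _).trans (X.act_same σ κ G).cmp :=
    Cmp.IsEq.unique ((hs.isEq.map _).trans (Elem.appC_isEq _ _ _ _ _))
      ((Elem.appC_isEq _ _ _ _ _).trans (Same.isEq _))
  have h₂ := X.act_same_natural σ κ (F := G) fun a => (L a).φ
  refine (Cmp.trans_assoc _ _ _).symm.trans ((congrArg (Cmp.trans · _) h₁).trans ?_)
  exact (Cmp.trans_assoc _ _ _).trans ((congrArg (Cmp.trans _) h₂).trans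
    (Cmp.trans_assoc _ _ _).symm)

/-- Composition of formal composites preserves identities. -/
theorem gam_id {n : ℕ} (p : P.obj n) {c : Fin n → Ctx} {d : Ctx}
    {e : ((i : Fin n) × (c i).I) ≃ d.I} (s : ∀ i, Elem P X (c i)) {x : Fin n → X.carrier}
    (hs : ∀ i, (Elem.val X (c i)).obj (s i) = x i) {a : X.carrier}
    (h : (Elem.val X d).obj ((Elem.gam X c d e).obj (p, s)) = a) (h' : (X.mu n).obj (p, x) = a) :
    Rel (Raw.gam (𝟙 p) (F := 𝟙 x) (fun i => Raw.id (s i) (hs i)) d e)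
      (Raw.id ((Elem.gam X c d e).obj (p, s)) h) (idCmp (X.mu n) h') := by
  obtain rfl : (fun i => (Elem.val X (c i)).obj (s i)) = x := funext hs
  subst h'
  refine ⟨Cmp.ofIso ((Elem.gam X c d e).mapId (p, s)),
    ((Elem.gam_isTwoFunctor (P := P) (X := X) c d e).isEq_mapId (p, s)).flat, ?_⟩
  have h₁ := idCmp_ofPF _ (Elem.gam_val X c d e) (a := (p, s)) rfl
  have h₂ := idCmp_comp (Elem.gam X c d e) (Elem.val X d) (a := (p, s)) rfl h
  refine Eq.trans (congrArg (Cmp.trans · _) (congrArg (Cmp.map _)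
    (Cmp.trans_ofIso_refl (Cmp.ofIso ((Elem.gam X c d e).mapId (p, s)))).symm)) ?_
  refine (h₂.symm.trans h₁).trans ((congrArg (Cmp.trans _) ?_).trans (Cmp.trans_assoc _ _ _).symm)
  refine (idCmp_comp (pair (fstP _ _) (lift fun i => (sndP (P.obj n) (∀ i, Elem P X (c i))).comp
    ((proj (fun i => Elem P X (c i)) i).comp (Elem.val X (c i))))) (X.mu n)
      (a := (p, s)) rfl rfl).trans (congrArg (Cmp.trans · _) (congrArg (Cmp.map _) ?_))
  refine (idCmp_pair _ _ (p, s)).trans (congrArg₂ Cmp.pair ?_ ((idCmp_lift _ _).trans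
    (congrArg Cmp.pi (funext fun i => ?_))))
  · exact congrArg (Cmp.mk rfl rfl) (Iso.ext (Category.comp_id _))
  · refine (idCmp_comp (sndP (P.obj n) (∀ i, Elem P X (c i))) _ (a := (p, s)) rfl rfl).trans ?_
    refine (congrArg₂ Cmp.trans (((idCmp_isEq isTwoFunctor_snd (a := (p, s)) rfl).map _).unique
      (Cmp.IsEq.refl _)) rfl).trans ((Cmp.ofIso_refl_trans _).trans ?_)
    refine (idCmp_comp (proj (fun i => Elem P X (c i)) i) _ (a := s) rfl rfl).trans ?_
    exact (congrArg₂ Cmp.trans (((idCmp_isEq (isTwoFunctor_proj i) (a := s) rfl).map _).unique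
      (Cmp.IsEq.refl _)) rfl).trans (Cmp.ofIso_refl_trans _)

/-- Composition of formal composites preserves composition. -/
theorem gam_comp {n : ℕ} {p q r : P.obj n} (κ : p ⟶ q) (κ' : q ⟶ r) {c : Fin n → Ctx} {d : Ctx}
    {e : ((i : Fin n) × (c i).I) ≃ d.I} {x y z : Fin n → X.carrier} {F : x ⟶ y} {G : y ⟶ z}
    (L : ∀ i, Raw X (c i) (F i)) (M : ∀ i, Raw X (c i) (G i)) (h : ∀ i, (L i).t = (M i).s)
    (h' : (Raw.gam κ L d e).t = (Raw.gam κ' M d e).s) :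
    Rel (Raw.gam (κ ≫ κ') (F := F ≫ G) (fun i => (L i).comp (M i) (h i)) d e)
      ((Raw.gam κ L d e).comp (Raw.gam κ' M d e) h')
      (Cmp.ofIso ((X.mu n).mapComp (κ ×ₘ F) (κ' ×ₘ G))) := by
  obtain ⟨s, t, l, φ, rfl⟩ : ∃ (s t : ∀ i, Elem P X (c i)) (l : ∀ i, s i ⟶ t i)
      (φ : ∀ i, Cmp ((Elem.val X (c i)).map (l i)) (F i)), L = fun i => ⟨s i, t i, l i, φ i⟩ := ⟨_, _, _, _, rfl⟩
  obtain ⟨s', t', m, ψ, rfl⟩ : ∃ (s t : ∀ i, Elem P X (c i)) (l : ∀ i, s i ⟶ t i)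
      (φ : ∀ i, Cmp ((Elem.val X (c i)).map (l i)) (G i)), M = fun i => ⟨s i, t i, l i, φ i⟩ := ⟨_, _, _, _, rfl⟩
  obtain rfl : t = s' := funext h
  let l' : s ⟶ t := l
  let m' : t ⟶ t' := m
  refine ⟨Cmp.ofIso ((Elem.gam X c d e).mapComp (κ ×ₘ l') (κ' ×ₘ m')),
    ((Elem.gam_isTwoFunctor (P := P) (X := X) c d e).isEq_mapComp (κ ×ₘ l') (κ' ×ₘ m')).flat, ?_⟩
  let K := pair (fstP _ _) (lift fun i => (sndP (P.obj n) (∀ i, Elem P X (c i))).comp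
    ((proj (fun i => Elem P X (c i)) i).comp (Elem.val X (c i))))
  let Φ : Cmp (K.map (κ ×ₘ l')) (κ ×ₘ F) := (Cmp.ofIso (Iso.refl κ)).pair (Cmp.pi φ)
  let Ψ : Cmp (K.map (κ' ×ₘ m')) (κ' ×ₘ G) := (Cmp.ofIso (Iso.refl κ')).pair (Cmp.pi ψ)
  have h₁ := compCmp_pf_comp (Elem.gam X c d e) (Elem.val X d)
    ((Elem.appC c d e κ l).trans (Φ.map (X.mu n))) ((Elem.appC c d e κ' m).trans (Ψ.map (X.mu n)))
  have h₂ := compCmp_ofPF _ (Elem.gam_val X c d e) (f := κ ×ₘ l') (g := κ' ×ₘ m')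
    (Φ.map (X.mu n)) (Ψ.map (X.mu n))
  have h₃ := compCmp_comp K (X.mu n) Φ Ψ (Cmp.ofIso (Iso.refl _)) (Cmp.ofIso (Iso.refl _))
  refine (h₁.symm.trans h₂).trans ((congrArg (Cmp.trans _) ?_).trans (Cmp.trans_assoc _ _ _).symm)
  rw [Cmp.trans_ofIso_refl, Cmp.trans_ofIso_refl, compCmp_refl] at h₃
  refine h₃.trans (congrArg (Cmp.trans · _) (congrArg (Cmp.map _) ?_))
  refine (compCmp_pair _ _ (f := κ ×ₘ l') (g := κ' ×ₘ m') _ _ _ _).trans (congrArg₂ Cmp.pair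
    (compCmp_refl (fstP _ _) (f := κ ×ₘ l') (g := κ' ×ₘ m')) ?_)
  refine (compCmp_lift (fun i => (sndP (P.obj n) (∀ i, Elem P X (c i))).comp
    ((proj (fun i => Elem P X (c i)) i).comp (Elem.val X (c i)))) (f := κ ×ₘ l')
      (g := κ' ×ₘ m') (h := F) (k := G) φ ψ).trans (congrArg Cmp.pi (funext fun i => ?_))
  refine (compCmp_pf_comp (sndP (P.obj n) (∀ i, Elem P X (c i)))
    ((proj (fun i => Elem P X (c i)) i).comp (Elem.val X (c i))) (f := κ ×ₘ l')
    (g := κ' ×ₘ m') (φ i) (ψ i)).trans ?_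
  refine (congrArg₂ Cmp.trans (((Cmp.IsEq.refl _).map _).unique
      (Cmp.IsEq.refl _)) rfl).trans ((Cmp.ofIso_refl_trans _).trans ?_)
  refine (compCmp_pf_comp (proj (fun i => Elem P X (c i)) i)
    (Elem.val X (c i)) (f := l') (g := m') (φ i) (ψ i)).trans ?_
  exact (congrArg₂ Cmp.trans (((Cmp.IsEq.refl _).map _).unique
      (Cmp.IsEq.refl _)) rfl).trans (Cmp.ofIso_refl_trans _)

end Rel

end

end SMTwo

namespace SMTwo

section

variable {B : Type u₁} [Bicategory.{w₁, v₁} B]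

theorem whiskerLeft_faithful {a b c : B} {p : c ⟶ a} {q : a ⟶ c} (i : q ≫ p ≅ 𝟙 a) {f g : a ⟶ b}
    {η θ : f ⟶ g} (h : p ◁ η = p ◁ θ) : η = θ := by
  have h' : (q ≫ p) ◁ η = (q ≫ p) ◁ θ := by
    rw [comp_whiskerLeft, comp_whiskerLeft, h]
  have key : ∀ ζ : f ⟶ g, ζ = (λ_ f).inv ≫ i.inv ▷ f ≫ (q ≫ p) ◁ ζ ≫
      i.hom ▷ g ≫ (λ_ g).hom := fun ζ => by
    rw [whisker_exchange_assoc, ← comp_whiskerRight_assoc, i.inv_hom_id]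
    simp
  rw [key η, key θ, h']

theorem IsContractible.hom_ext (hB : IsContractible B) {a b : B} {f g : a ⟶ b} (η θ : f ⟶ g) :
    η = θ := by
  obtain ⟨G, ⟨e⟩, -⟩ := hB
  let p : G.obj ⟨⟨PUnit.unit⟩⟩ ⟶ a := e.hom.app a
  let q : a ⟶ G.obj ⟨⟨PUnit.unit⟩⟩ := e.inv.app a
  let i : q ≫ p ≅ 𝟙 a := ⟨(e.counit.hom.as.app a), (e.counit.inv.as.app a),
      congrArg (fun m => Pseudofunctor.StrongTrans.Modification.app m.as a) e.counit.hom_inv_id,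
      congrArg (fun m => Pseudofunctor.StrongTrans.Modification.app m.as a) e.counit.inv_hom_id⟩
  have h₁ := e.hom.naturality_naturality η
  have h₂ := e.hom.naturality_naturality θ
  exact whiskerLeft_faithful i ((Iso.cancel_iso_hom_left _ _ _).1 (h₁.symm.trans h₂))

end

variable {P : Operad.{w, v, u}} {X : PAlg.{w, v, u, w₁, v₁, u₁} P}

/-- Comparisons which are presented over a contractible 2-category of operations are unique. -/
theorem Rel.unique {c : Ctx} (hc : IsContractible (P.obj c.n)) {a b a' b' : X.carrier} {g : a ⟶ b}
    {g' : a' ⟶ b'} {L : Raw X c g} {L' : Raw X c g'} {θ θ' : Cmp g g'} (h : Rel L L' θ)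
    (h' : Rel L L' θ') : θ = θ' := by
  obtain ⟨δ, hδ, e⟩ := h
  obtain ⟨δ', hδ', e'⟩ := h'
  obtain rfl : δ = δ' := by
    rw [Cmp.eq_pair δ, Cmp.eq_pair δ']
    refine congrArg₂ Cmp.pair ?_ (Cmp.pi_ext fun i => (hδ i).unique (hδ' i))
    generalize δ.map (fstP _ _) = φ
    generalize δ'.map (fstP _ _) = ψ
    obtain ⟨_, _, i⟩ := φ
    obtain ⟨_, _, j⟩ := ψ
    obtain rfl : i = j := Iso.ext (hc.hom_ext _ _)
    rfl
  exact Cmp.trans_left_cancel (e.symm.trans e')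

end SMTwo

namespace SMTwo

section

variable {A : Type u₁} [Bicategory.{w₁, v₁} A] {B : Type u₂} [Bicategory.{w₂, v₂} B]
  {C : Type u₃} [Bicategory.{w₃, v₃} C]

/-- Pseudofunctors related by an icon of equalities are equal. -/
theorem Icon.eq_of_isEq {F G : A ⥤ᵖ B} (I : Icon F G)
    (h : ∀ {a b : A} (f : a ⟶ b), (I.cmp f).IsEq) : F = G := by
  obtain ⟨⟨⟨⟨obj, map⟩, map₂⟩, p₁, p₂⟩, mapId, mapComp, p₃, p₄, p₅, p₆, p₇⟩ := F
  obtain ⟨⟨⟨⟨obj', map'⟩, map₂'⟩, q₁, q₂⟩, mapId', mapComp', q₃, q₄, q₅, q₆, q₇⟩ := G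
  obtain rfl : obj = obj' := funext I.obj_eq
  obtain rfl : @map = @map' := by
    funext a b f
    exact eq_of_heq (h f).same.heq
  have e {a b : A} (f : a ⟶ b) : I.cmp f = Cmp.ofIso (Iso.refl (map f)) :=
    (h f).unique (Cmp.IsEq.refl _)
  have e₂ : @map₂ = @map₂' := by
    funext a b f g η
    have := I.natural η
    rw [e, e] at this
    have := eq_of_heq this
    change 𝟙 _ ≫ map₂ η ≫ 𝟙 _ = map₂' η at this
    simpa using this
  subst e₂
  have e₀ : @mapId = @mapId' := by
    funext a
    have := I.id a
    rw [e] at this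
    exact (Cmp.ofIso_injective (((Cmp.ofIso_refl_trans _).symm.trans this).trans
      (Cmp.trans_ofIso_refl _))).symm
  subst e₀
  have e₁ : @mapComp = @mapComp' := by
    funext a b c f g
    have := I.comp f g
    rw [e, e, e, compCmp_refl] at this
    exact (Cmp.ofIso_injective ((Cmp.ofIso_refl_trans _).symm.trans this)).symm
  subst e₁
  rfl

theorem const_comp_strict {K : B ⥤ᵖ C} (hK : IsTwoFunctor K) (b : B) :
    (const A b).comp K = const A (K.obj b) :=
  (Icon.ofConst K b rfl).eq_of_isEq fun f => idCmp_isEq hK rfl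

theorem comp_const (K : A ⥤ᵖ B) (c : C) : K.comp (const B c) = const A c := by
  refine pseudofunctor_ext rfl (heq_of_eq ?_) (heq_of_eq ?_)
  · funext a
    ext
    exact Category.comp_id _
  · funext a b c f g
    ext
    exact Category.id_comp _

theorem pair_const (b : B) (c : C) : pair (const A b) (const A c) = const A (b, c) := by
  refine pseudofunctor_ext rfl (heq_of_eq ?_) (heq_of_eq ?_)
  · funext a
    exact Iso.ext rfl
  · funext a b c f g
    exact Iso.ext rfl

theorem lift_const {ι : Type t} {D : ι → Type u₃} [∀ i, Bicategory.{w₃, v₃} (D i)]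
    (d : ∀ i, D i) : lift (fun i => const A (d i)) = const A d := by
  refine pseudofunctor_ext rfl (heq_of_eq ?_) (heq_of_eq ?_)
  · funext a
    ext
    rfl
  · funext a b c f g
    ext
    rfl

end

section

variable {P : Operad.{w, v, u}} (X : PAlg.{w, v, u, w₁, v₁, u₁} P) {A : Type u₂}
  [Bicategory.{w₂, v₂} A]

namespace PAlg

theorem sec_gam {n m : ℕ} (k : Fin n → ℕ) (h : ∑ i, k i = m) (p : P.obj n)
    (q : ∀ i, P.obj (k i)) (G : Fin m → (A ⥤ᵖ X.carrier)) :
    sec (X.mu m) ((P.gam k h).obj (p, q)) (lift G) =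
      sec (X.mu n) p (lift fun i => sec (X.mu (k i)) (q i) (lift fun j => G (blocks k h ⟨i, j⟩))) := by
  refine Eq.trans ?_ (X.mu_gam_comp k h (const A p) (fun i => const A (q i)) G)
  refine congrArg (fun K : A ⥤ᵖ _ => (pair K (lift G)).comp (X.mu m)) ?_
  rw [lift_const, pair_const]
  exact (const_comp_strict (P.gam_strict k h) _).symm

theorem sec_act {n : ℕ} (σ : Equiv.Perm (Fin n)) (p : P.obj n) (G : Fin n → (A ⥤ᵖ X.carrier)) :
    sec (X.mu n) (P.dot p σ) (lift G) = sec (X.mu n) p (lift fun i => G (σ⁻¹ i)) := by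
  refine Eq.trans ?_ (X.mu_re σ (const A p) G)
  exact congrArg (fun K : A ⥤ᵖ _ => (pair K (lift G)).comp (X.mu n))
    (const_comp_strict (P.act_strict σ) _).symm

theorem sec_one (G : Fin 1 → (A ⥤ᵖ X.carrier)) : sec (X.mu 1) P.one (lift G) = G 0 := by
  have h := congrArg (fun K => (G 0).comp K) X.mu_one
  refine Eq.trans ?_ (h.trans (pf_comp_id _))
  refine Eq.trans ?_ (pf_assoc _ _ _)
  refine congrArg (fun K : A ⥤ᵖ _ => K.comp (X.mu 1)) ?_
  rw [comp_pair, comp_const, comp_lift]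
  refine congrArg (pair _) (congrArg lift (funext fun i => ?_))
  obtain rfl := Subsingleton.elim i 0
  exact (pf_comp_id _).symm

theorem pair_tens (t : P.obj 2) (F G : A ⥤ᵖ X.carrier) :
    (pair F G).comp (X.tens t) = sec (X.mu 2) t (lift fun i : Fin 2 => match i with
      | 0 => F
      | 1 => G) := by
  refine (pf_assoc _ _ _).symm.trans (congrArg (fun K : A ⥤ᵖ _ => K.comp (X.mu 2)) ?_)
  rw [comp_pair, comp_const, comp_lift]
  refine congrArg (pair _) (congrArg lift (funext fun i => ?_))
  match i with
  | 0 => exact pair_fst F G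
  | 1 => exact pair_snd F G

theorem sec_g₂ {k₀ k₁ m : ℕ} (h : ∑ i, ![k₀, k₁] i = m) (t : P.obj 2) (q : P.obj k₀) (r : P.obj k₁)
    (G : Fin m → (A ⥤ᵖ X.carrier)) {F₀ F₁ : A ⥤ᵖ X.carrier}
    (h₀ : sec (X.mu k₀) q (lift fun j => G (blocks ![k₀, k₁] h ⟨0, j⟩)) = F₀)
    (h₁ : sec (X.mu k₁) r (lift fun j => G (blocks ![k₀, k₁] h ⟨1, j⟩)) = F₁) :
    sec (X.mu m) (P.g₂ h t q r) (lift G) = (pair F₀ F₁).comp (X.tens t) := by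
  subst h₀ h₁
  refine (X.sec_gam ![k₀, k₁] h t (Operad.fam₂ q r) G).trans (Eq.trans ?_ (X.pair_tens t _ _).symm)
  refine congrArg (sec (X.mu 2) t) (congrArg lift (funext fun i => ?_))
  match i with
  | 0 => rfl
  | 1 => rfl

theorem sec_tl (t : P.obj 2) (G : Fin 3 → (A ⥤ᵖ X.carrier)) :
    sec (X.mu 3) (P.tl t) (lift G) =
      (pair ((pair (G 0) (G 1)).comp (X.tens t)) (G 2)).comp (X.tens t) := by
  refine X.sec_g₂ (k₀ := 2) (k₁ := 1) rfl t t P.one G ?_ ?_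
  · refine Eq.trans ?_ (X.pair_tens t _ _).symm
    refine congrArg (sec (X.mu 2) t) (congrArg lift (funext fun i => ?_))
    match i with
    | 0 => rfl
    | 1 => rfl
  · exact X.sec_one _

theorem sec_tr (t : P.obj 2) (G : Fin 3 → (A ⥤ᵖ X.carrier)) :
    sec (X.mu 3) (P.tr t) (lift G) =
      (pair (G 0) ((pair (G 1) (G 2)).comp (X.tens t))).comp (X.tens t) := by
  refine X.sec_g₂ (k₀ := 1) (k₁ := 2) rfl t P.one t G ?_ ?_
  · exact X.sec_one _
  · refine Eq.trans ?_ (X.pair_tens t _ _).symm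
    refine congrArg (sec (X.mu 2) t) (congrArg lift (funext fun i => ?_))
    match i with
    | 0 => rfl
    | 1 => rfl

theorem sec_dot (t : P.obj 2) (G : Fin 2 → (A ⥤ᵖ X.carrier)) :
    sec (X.mu 2) (P.dot t Operad.σ₁₂) (lift G) = (pair (G 1) (G 0)).comp (X.tens t) := by
  refine (X.sec_act Operad.σ₁₂ t G).trans (Eq.trans ?_ (X.pair_tens t _ _).symm)
  refine congrArg (sec (X.mu 2) t) (congrArg lift (funext fun i => ?_))
  match i with
  | 0 => rfl
  | 1 => rfl

theorem sec_zero (i : P.obj 0) (G : Fin 0 → (A ⥤ᵖ X.carrier)) :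
    sec (X.mu 0) i (lift G) = (const A (i, Fin.elim0)).comp (X.mu 0) := by
  refine congrArg (fun K : A ⥤ᵖ _ => K.comp (X.mu 0)) (Eq.trans ?_ (pair_const i Fin.elim0))
  refine congrArg (pair _) (Eq.trans ?_ (lift_const _))
  exact congrArg lift (funext fun i => i.elim0)

end PAlg

end

end SMTwo

namespace SMTwo

section

variable {P : Operad.{w, v, u}} (X : PAlg.{w, v, u, w₁, v₁, u₁} P)

theorem Carries.trans {B : Type u₁} [Bicategory.{w₁, v₁} B] {a b a' b' a'' b'' : B} {f g : a ⟶ b}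
    {f' g' : a' ⟶ b'} {f'' g'' : a'' ⟶ b''} {φ : Cmp f f'} {ψ : Cmp g g'} {φ' : Cmp f' f''}
    {ψ' : Cmp g' g''} {θ : f ⟶ g} {θ' : f' ⟶ g'} {θ'' : f'' ⟶ g''} (h : Carries φ ψ θ θ')
    (h' : Carries φ' ψ' θ' θ'') : Carries (φ.trans φ') (ψ.trans ψ') θ θ'' :=
  Cmp.carries_trans h h'

theorem carries_ofIso {B : Type u₁} [Bicategory.{w₁, v₁} B] {a b : B} {f g f' g' : a ⟶ b}
    (i : f ≅ f') (j : g ≅ g') (θ : f ⟶ g) :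
    Carries (Cmp.ofIso i) (Cmp.ofIso j) θ (i.inv ≫ θ ≫ j.hom) := HEq.rfl

/-- The image of an equivalence of operations under the action, up to icons. -/
theorem PAlg.exists_image {A : Type u₂} [Bicategory.{w₂, v₂} A] {n : ℕ} {p q : P.obj n}
    (Q : A ⥤ᵖ (Fin n → X.carrier)) {F G : A ⥤ᵖ X.carrier} (I : Icon (sec (X.mu n) p Q) F)
    (J : Icon (sec (X.mu n) q Q) G) (e : Bicategory.Equivalence p q) :
    ∃ (e' : Bicategory.Equivalence F G)
      (h : ∀ a, Same ((X.ev (Q.obj a)).map e.hom) (e'.hom.app a))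
      (h' : ∀ a, Same ((X.ev (Q.obj a)).map e.inv) (e'.inv.app a)),
      (∀ {a b : A} (f : a ⟶ b), Carries ((I.cmp f).comp (h b).cmp) ((h a).cmp.comp (J.cmp f))
        (X.nat e.hom (Q.map f)).hom (e'.hom.naturality f).hom) ∧
      (∀ {a b : A} (f : a ⟶ b), Carries ((J.cmp f).comp (h' b).cmp) ((h' a).cmp.comp (I.cmp f))
        (X.nat e.inv (Q.map f)).hom (e'.inv.naturality f).hom) ∧
      (∀ a, Carries (idCmp (X.ev (Q.obj a)) (h a).src)
        (compCmp (X.ev (Q.obj a)) (h a).cmp (h' a).cmp)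
        ((X.ev (Q.obj a)).map₂ e.unit.hom) (e'.unit.hom.as.app a)) ∧
      ∀ a, Carries (compCmp (X.ev (Q.obj a)) (h' a).cmp (h a).cmp)
        (idCmp (X.ev (Q.obj a)) (h a).tgt)
        ((X.ev (Q.obj a)).map₂ e.counit.hom) (e'.counit.hom.as.app a) := by
  obtain ⟨e', h, h', h₁, h₂, h₃, h₄⟩ := Icon.exists_transfer I J (secEquiv (M := X.mu n) Q e)
  refine ⟨e', h, h', h₁, h₂, fun a => ?_, fun a => ?_⟩
  · have c := (carries_ofIso ((X.ev (Q.obj a)).mapId p) ((X.ev (Q.obj a)).mapComp e.hom e.inv)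
      ((X.ev (Q.obj a)).map₂ e.unit.hom))
    have : ((X.ev (Q.obj a)).mapId p).inv = ((X.mu n).mapId (p, Q.obj a)).inv :=
      congrArg Iso.inv (evalAt_mapId (X.mu n) p (Q.obj a))
    rw [this] at c
    exact c.trans (h₃ a)
  · have c := (carries_ofIso ((X.ev (Q.obj a)).mapComp e.inv e.hom) ((X.ev (Q.obj a)).mapId q)
      ((X.ev (Q.obj a)).map₂ e.counit.hom))
    have : ((X.ev (Q.obj a)).mapId q).hom = ((X.mu n).mapId (q, Q.obj a)).hom :=
      congrArg Iso.hom (evalAt_mapId (X.mu n) q (Q.obj a))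
    rw [this] at c
    exact c.trans (h₄ a)

variable {X}

/-- The naturality squares, units and counits of the structure equivalences are the images of
those of the choice of multiplication. -/
structure InducedCells.Squares {χ : ChoiceOfMult P} {s : MonCells X.carrier}
    (cells : InducedCells χ X s) : Prop where
  aSq {x y : Fin 3 → X.carrier} (F : x ⟶ y) :
    Carries ((cells.tlC F).comp (cells.a y).cmp) ((cells.a x).cmp.comp (cells.trC F))
      (X.nat χ.α.hom F).hom (s.aSq (F 0) (F 1) (F 2)).hom
  aiSq {x y : Fin 3 → X.carrier} (F : x ⟶ y) :
    Carries ((cells.trC F).comp (cells.ai y).cmp) ((cells.ai x).cmp.comp (cells.tlC F))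
      (X.nat χ.α.inv F).hom (s.aiSq (F 0) (F 1) (F 2)).hom
  lSq {x y : Fin 1 → X.carrier} (F : x ⟶ y) :
    Carries ((cells.ulC F).comp (cells.l y).cmp) ((cells.l x).cmp.comp (X.one_same F).cmp)
      (X.nat χ.l.hom F).hom (s.lSq (F 0)).hom
  liSq {x y : Fin 1 → X.carrier} (F : x ⟶ y) :
    Carries ((X.one_same F).cmp.comp (cells.li y).cmp) ((cells.li x).cmp.comp (cells.ulC F))
      (X.nat χ.l.inv F).hom (s.liSq (F 0)).hom
  rSq {x y : Fin 1 → X.carrier} (F : x ⟶ y) :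
    Carries ((X.one_same F).cmp.comp (cells.r y).cmp) ((cells.r x).cmp.comp (cells.urC F))
      (X.nat χ.r.hom F).hom (s.rSq (F 0)).hom
  riSq {x y : Fin 1 → X.carrier} (F : x ⟶ y) :
    Carries ((cells.urC F).comp (cells.ri y).cmp) ((cells.ri x).cmp.comp (X.one_same F).cmp)
      (X.nat χ.r.inv F).hom (s.riSq (F 0)).hom
  bSq {x y : Fin 2 → X.carrier} (F : x ⟶ y) :
    Carries ((cells.tens_same F).cmp.comp (cells.b y).cmp)
      ((cells.b x).cmp.comp (cells.dot_same F).cmp)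
      (X.nat χ.β.hom F).hom (s.bSq (F 0) (F 1)).hom
  biSq {x y : Fin 2 → X.carrier} (F : x ⟶ y) :
    Carries ((cells.dot_same F).cmp.comp (cells.bi y).cmp)
      ((cells.bi x).cmp.comp (cells.tens_same F).cmp)
      (X.nat χ.β.inv F).hom (s.biSq (F 0) (F 1)).hom
  aUnit (x : Fin 3 → X.carrier) :
    Carries (idCmp (X.ev x) (cells.a x).src) (compCmp (X.ev x) (cells.a x).cmp (cells.ai x).cmp)
      ((X.ev x).map₂ χ.α.unit.hom) (s.aUnit (x 0) (x 1) (x 2)).hom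
  aCounit (x : Fin 3 → X.carrier) :
    Carries (compCmp (X.ev x) (cells.ai x).cmp (cells.a x).cmp) (idCmp (X.ev x) (cells.a x).tgt)
      ((X.ev x).map₂ χ.α.counit.hom) (s.aCounit (x 0) (x 1) (x 2)).hom
  lUnit (x : Fin 1 → X.carrier) :
    Carries (idCmp (X.ev x) (cells.l x).src) (compCmp (X.ev x) (cells.l x).cmp (cells.li x).cmp)
      ((X.ev x).map₂ χ.l.unit.hom) (s.lUnit (x 0))
  lCounit (x : Fin 1 → X.carrier) :
    Carries (compCmp (X.ev x) (cells.li x).cmp (cells.l x).cmp) (idCmp (X.ev x) (cells.l x).tgt)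
      ((X.ev x).map₂ χ.l.counit.hom) (s.lCounit (x 0))
  rUnit (x : Fin 1 → X.carrier) :
    Carries (idCmp (X.ev x) (cells.r x).src) (compCmp (X.ev x) (cells.r x).cmp (cells.ri x).cmp)
      ((X.ev x).map₂ χ.r.unit.hom) (s.rUnit (x 0))
  rCounit (x : Fin 1 → X.carrier) :
    Carries (compCmp (X.ev x) (cells.ri x).cmp (cells.r x).cmp) (idCmp (X.ev x) (cells.r x).tgt)
      ((X.ev x).map₂ χ.r.counit.hom) (s.rCounit (x 0))
  bUnit (x : Fin 2 → X.carrier) :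
    Carries (idCmp (X.ev x) (cells.b x).src) (compCmp (X.ev x) (cells.b x).cmp (cells.bi x).cmp)
      ((X.ev x).map₂ χ.β.unit.hom) (s.bUnit (x 0) (x 1))
  bCounit (x : Fin 2 → X.carrier) :
    Carries (compCmp (X.ev x) (cells.bi x).cmp (cells.b x).cmp) (idCmp (X.ev x) (cells.b x).tgt)
      ((X.ev x).map₂ χ.β.counit.hom) (s.bCounit (x 0) (x 1))

namespace InducedCells

variable {χ : ChoiceOfMult P} {s : MonCells X.carrier} (H : InducedCells χ X s)

theorem tens_natural (H : InducedCells χ X s) {x y x' y' : Fin 2 → X.carrier} {F : x ⟶ y}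
    {F' : x' ⟶ y'} (φ : ∀ i, Cmp (F i) (F' i)) :
    (H.tens_same F).cmp.trans (((φ 0).pair (φ 1)).map s.tensor) =
      (Cmp.muMap X (Cmp.ofIso (Iso.refl (𝟙 χ.t))) φ).trans (H.tens_same F').cmp := by
  obtain ⟨tensor, e, a, l, r, b⟩ := s
  obtain rfl : tensor = X.tens χ.t := H.tensor
  let Q (i : Fin 2) : (X.carrier × X.carrier) ⥤ᵖ X.carrier := match i with
    | 0 => fstP X.carrier X.carrier
    | 1 => sndP X.carrier X.carrier
  let e {x y : Fin 2 → X.carrier} (F : x ⟶ y) (i : Fin 2) : Cmp (F i) ((Q i).map (F 0 ×ₘ F 1)) :=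
    match i with
    | 0 => Cmp.ofIso (Iso.refl _)
    | 1 => Cmp.ofIso (Iso.refl _)
  have h₁ : ((φ 0).pair (φ 1)).map (X.tens χ.t) =
      Cmp.muMap X (F := (lift Q).map (F 0 ×ₘ F 1)) (F' := (lift Q).map (F' 0 ×ₘ F' 1))
        (Cmp.ofIso (Iso.refl (𝟙 χ.t))) fun i => ((φ 0).pair (φ 1)).map (Q i) := by
    refine (Cmp.map_comp _ _ _).trans (congrArg (Cmp.map (X.mu 2)) ?_)
    refine (Cmp.map_pair _ _ _).trans (congrArg₂ Cmp.pair (Cmp.map_const _ _) ?_)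
    exact Cmp.map_lift Q _
  have h₂ {x y : Fin 2 → X.carrier} (F : x ⟶ y) : (H.tens_same F).cmp =
      Cmp.muMap X (F' := (lift Q).map (F 0 ×ₘ F 1)) (Cmp.ofIso (Iso.refl (𝟙 χ.t))) (e F) := by
    refine (Same.isEq _).unique (Cmp.muMap_isEq (Cmp.IsEq.refl _) fun i => ?_)
    match i with
    | 0 => exact Cmp.IsEq.refl _
    | 1 => exact Cmp.IsEq.refl _
  refine (congrArg₂ Cmp.trans (h₂ F) h₁).trans (Eq.trans ?_ (congrArg (Cmp.trans _) (h₂ F')).symm)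
  refine (Cmp.muMap_trans _ _ _ _).trans (Eq.trans ?_ (Cmp.muMap_trans _ _ _ _).symm)
  refine Cmp.muMap_congr rfl fun i => ?_
  match i with
  | 0 =>
    exact (Cmp.ofIso_refl_trans _).trans
      ((Cmp.pair_map_fst _ _).trans (Cmp.trans_ofIso_refl _).symm)
  | 1 =>
    exact (Cmp.ofIso_refl_trans _).trans
      ((Cmp.pair_map_snd _ _).trans (Cmp.trans_ofIso_refl _).symm)

theorem tenC_trans (H : InducedCells χ X s) {k₀ k₁ m : ℕ} (h : ∑ i, ![k₀, k₁] i = m) {q q' : P.obj k₀}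
    {r r' : P.obj k₁} (g : q ⟶ q') (g' : r ⟶ r') {x y : Fin m → X.carrier} (F : x ⟶ y)
    {a b a' b' : X.carrier} {G : a ⟶ b} {G' : a' ⟶ b'}
    (φ : Cmp (X.app g (fun j => F (blocks ![k₀, k₁] h ⟨0, j⟩) :
      PAlg.blk ![k₀, k₁] h x 0 ⟶ PAlg.blk ![k₀, k₁] h y 0)) G)
    (ψ : Cmp (X.app g' (fun j => F (blocks ![k₀, k₁] h ⟨1, j⟩) :
      PAlg.blk ![k₀, k₁] h x 1 ⟶ PAlg.blk ![k₀, k₁] h y 1)) G') {c d c' d' : X.carrier}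
    {K : c ⟶ d} {K' : c' ⟶ d'} (φ' : Cmp G K) (ψ' : Cmp G' K') :
    (H.tenC h g g' F φ ψ).trans ((φ'.pair ψ').map s.tensor) =
      H.tenC h g g' F (φ.trans φ') (ψ.trans ψ') := by
  let fam {a b a' b' : X.carrier} (G : a ⟶ b) (G' : a' ⟶ b') : (![a, a'] : Fin 2 → X.carrier) ⟶ ![b, b'] :=
    fun i => match i with
      | 0 => G
      | 1 => G'
  let famC {a b a' b' c d c' d' : X.carrier} {G : a ⟶ b} {G' : a' ⟶ b'} {K : c ⟶ d} {K' : c' ⟶ d'}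
    (φ' : Cmp G K) (ψ' : Cmp G' K') (i : Fin 2) : Cmp (fam G G' i) (fam K K' i) :=
      match i with
      | 0 => φ'
      | 1 => ψ'
  have h := H.tens_natural (F := fam G G') (F' := fam K K') (famC φ' ψ')
  refine (Cmp.trans_assoc _ _ _).trans ((congrArg (Cmp.trans _) h).trans ?_)
  refine (Cmp.trans_assoc _ _ _).symm.trans (congrArg (Cmp.trans · _) ?_)
  refine (Cmp.trans_assoc _ _ _).trans (congrArg (Cmp.trans _) ?_)
  refine (Cmp.muMap_trans _ _ _ _).trans (Cmp.muMap_congr (Cmp.ofIso_refl_trans _) fun i => ?_)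
  match i with
  | 0 => rfl
  | 1 => rfl

theorem tenC_isEq (H : InducedCells χ X s) {k₀ k₁ m : ℕ} (h : ∑ i, ![k₀, k₁] i = m)
    {q q' : P.obj k₀} {r r' : P.obj k₁} (g : q ⟶ q') (g' : r ⟶ r') {x y : Fin m → X.carrier}
    (F : x ⟶ y) {a b a' b' : X.carrier} {G : a ⟶ b} {G' : a' ⟶ b'}
    {φ : Cmp (X.app g (fun j => F (blocks ![k₀, k₁] h ⟨0, j⟩) :
      PAlg.blk ![k₀, k₁] h x 0 ⟶ PAlg.blk ![k₀, k₁] h y 0)) G} (hφ : φ.IsEq)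
    {ψ : Cmp (X.app g' (fun j => F (blocks ![k₀, k₁] h ⟨1, j⟩) :
      PAlg.blk ![k₀, k₁] h x 1 ⟶ PAlg.blk ![k₀, k₁] h y 1)) G'} (hψ : ψ.IsEq) :
    (H.tenC h g g' F φ ψ).IsEq := by
  refine ((Same.isEq _).trans (Cmp.muMap_isEq (Cmp.IsEq.refl _) fun i => ?_)).trans (Same.isEq _)
  match i with
  | 0 => exact hφ
  | 1 => exact hψ

theorem tlC_isEq (H : InducedCells χ X s) {x y : Fin 3 → X.carrier} (F : x ⟶ y) :
    (H.tlC F).IsEq :=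
  (Cmp.ofHEq_isEq _ _ _).trans (H.tenC_isEq _ _ _ _ (Same.isEq _) (Same.isEq _))

theorem trC_isEq (H : InducedCells χ X s) {x y : Fin 3 → X.carrier} (F : x ⟶ y) :
    (H.trC F).IsEq :=
  (Cmp.ofHEq_isEq _ _ _).trans (H.tenC_isEq _ _ _ _ (Same.isEq _) (Same.isEq _))

end InducedCells

theorem idCmp_ev {n : ℕ} (x : Fin n → X.carrier) (p : P.obj n) {a : X.carrier}
    (h : (X.mu n).obj (p, x) = a) : ∃ φ : Cmp ((X.ev x).map (𝟙 p)) ((X.mu n).map (𝟙 (p, x))),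
      φ.IsEq ∧ idCmp (X.ev x) h = φ.trans (idCmp (X.mu n) h) := by
  have e := idCmp_comp (pair (Pseudofunctor.id (P.obj n)) (const (P.obj n) x)) (X.mu n)
    (a := p) rfl h
  exact ⟨_, (Cmp.IsEq.trans ⟨rfl, rfl⟩ (Cmp.ofHEq_isEq _ _ _)).map (X.mu n), e⟩

namespace InducedCells

variable {χ : ChoiceOfMult P} {s : MonCells X.carrier} (H : InducedCells χ X s)

theorem unitC_eq (H : InducedCells χ X s) {x y : Fin 0 → X.carrier} (F : x ⟶ y)
    (z : Fin 0 → X.carrier) :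
    ∃ φ : Cmp (X.app (𝟙 χ.i) F) ((X.mu 0).map (𝟙 (χ.i, z))),
      φ.IsEq ∧ H.unitC F = φ.trans (idCmp (X.mu 0) (H.unit z)) := by
  obtain rfl : x = z := funext fun i => i.elim0
  obtain ⟨φ, hφ, e⟩ := idCmp_ev x χ.i (H.unit x)
  exact ⟨_, (Cmp.ofHEq_isEq _ _ _).trans hφ,
    (congrArg (Cmp.trans _) e).trans (Cmp.trans_assoc _ _ _).symm⟩

theorem tenIdC_eq (H : InducedCells χ X s) {k₀ k₁ m : ℕ} (h : ∑ i, ![k₀, k₁] i = m)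
    (q : P.obj k₀) (r : P.obj k₁) {x y : Fin m → X.carrier} (F : x ⟶ y)
    {a b a' b' : X.carrier} {G : a ⟶ b} {G' : a' ⟶ b'}
    {φ : Cmp (X.app (𝟙 q) (fun j => F (blocks ![k₀, k₁] h ⟨0, j⟩) :
      PAlg.blk ![k₀, k₁] h x 0 ⟶ PAlg.blk ![k₀, k₁] h y 0)) G} (hφ : φ.IsEq)
    {ψ : Cmp (X.app (𝟙 r) (fun j => F (blocks ![k₀, k₁] h ⟨1, j⟩) :
      PAlg.blk ![k₀, k₁] h x 1 ⟶ PAlg.blk ![k₀, k₁] h y 1)) G'} (hψ : ψ.IsEq) {c d c' d' : X.carrier}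
    {K : c ⟶ d} {K' : c' ⟶ d'} (φ' : Cmp G K) (ψ' : Cmp G' K')
    {δ : Cmp (X.app (𝟙 (P.g₂ h χ.t q r)) F) (s.tensor.map (G ×ₘ G'))} (hδ : δ.IsEq) :
    H.tenIdC h q r F (φ.trans φ') (ψ.trans ψ') = δ.trans ((φ'.pair ψ').map s.tensor) := by
  refine (congrArg (Cmp.trans _) (H.tenC_trans h _ _ F φ ψ φ' ψ').symm).trans ?_
  refine (Cmp.trans_assoc _ _ _).symm.trans (congrArg (Cmp.trans · _) ?_)
  exact ((Cmp.ofHEq_isEq _ _ _).trans (H.tenC_isEq h _ _ F hφ hψ)).unique hδ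

end InducedCells

variable (X)

theorem exists_inducedCells (χ : ChoiceOfMult P) :
    ∃ (s : MonCells X.carrier) (H : InducedCells χ X s), H.Squares := by
  let Q₁ : ∀ i : Fin 1, X.carrier ⥤ᵖ X.carrier := fun _ => Pseudofunctor.id X.carrier
  let Q₂ : ∀ i : Fin 2, (X.carrier × X.carrier) ⥤ᵖ X.carrier := fun i => match i with
    | 0 => fstP X.carrier X.carrier
    | 1 => sndP X.carrier X.carrier
  let Q₃ : ∀ i : Fin 3, (X.carrier × (X.carrier × X.carrier)) ⥤ᵖ X.carrier := fun i => match i with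
    | 0 => fstP X.carrier (X.carrier × X.carrier)
    | 1 => (sndP X.carrier (X.carrier × X.carrier)).comp (fstP X.carrier X.carrier)
    | 2 => (sndP X.carrier (X.carrier × X.carrier)).comp (sndP X.carrier X.carrier)
  let J₁ : Icon (sec (X.mu 1) P.one (lift Q₁)) (Pseudofunctor.id _) := Icon.ofEq (X.sec_one Q₁)
  let K : Icon ((const X.carrier (χ.i, Fin.elim0)).comp (X.mu 0))
      (const X.carrier ((X.mu 0).obj (χ.i, Fin.elim0))) := Icon.ofConst _ _ rfl
  have h_left : sec (X.mu 1) (P.g₂ rfl χ.t χ.i P.one) (lift Q₁) =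
      (pair ((const X.carrier (χ.i, Fin.elim0)).comp (X.mu 0)) (Pseudofunctor.id _)).comp
        (X.tens χ.t) := X.sec_g₂ (k₀ := 0) (k₁ := 1) rfl χ.t χ.i P.one Q₁ (X.sec_zero _ _) (X.sec_one _)
  have h_right : sec (X.mu 1) (P.g₂ rfl χ.t P.one χ.i) (lift Q₁) =
      (pair (Pseudofunctor.id _) ((const X.carrier (χ.i, Fin.elim0)).comp (X.mu 0))).comp
        (X.tens χ.t) := X.sec_g₂ (k₀ := 1) (k₁ := 0) rfl χ.t P.one χ.i Q₁ (X.sec_one _) (X.sec_zero _ _)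
  obtain ⟨a, ha, hai, a₁, a₂, a₃, a₄⟩ := X.exists_image (lift Q₃) (Icon.ofEq (X.sec_tl χ.t Q₃))
    (Icon.ofEq (X.sec_tr χ.t Q₃)) χ.α
  obtain ⟨b, hb, hbi, b₁, b₂, b₃, b₄⟩ := X.exists_image (lift Q₂)
    (Icon.ofEq (X.pair_tens χ.t (Q₂ 0) (Q₂ 1)).symm) (Icon.ofEq (X.sec_dot χ.t Q₂)) χ.β
  obtain ⟨l, hl, hli, l₁, l₂, l₃, l₄⟩ := X.exists_image (lift Q₁)
    ((Icon.ofEq h_left).trans ((K.pair (Icon.ofEq rfl)).whisker (X.tens χ.t))) J₁ χ.l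
  obtain ⟨r, hr, hri, r₁, r₂, r₃, r₄⟩ := X.exists_image (lift Q₁) J₁
    ((Icon.ofEq h_right).trans (((Icon.ofEq rfl).pair K).whisker (X.tens χ.t))) χ.r
  let s : MonCells X.carrier := ⟨X.tens χ.t, (X.mu 0).obj (χ.i, Fin.elim0), a, l, r, b⟩
  have s₁ (x : Fin 1 → X.carrier) : ∃ a, x = (lift Q₁).obj a := ⟨x 0, funext fun i => by
    obtain rfl := Subsingleton.elim i 0; rfl⟩
  have s₂ (x : Fin 2 → X.carrier) : ∃ a, x = (lift Q₂).obj a := ⟨(x 0, x 1), funext fun i => by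
    match i with
    | 0 => rfl
    | 1 => rfl⟩
  have s₃ (x : Fin 3 → X.carrier) : ∃ a, x = (lift Q₃).obj a := ⟨(x 0, x 1, x 2), funext fun i => by
    match i with
    | 0 => rfl
    | 1 => rfl
    | 2 => rfl⟩
  have H : InducedCells χ X s :=
    { tensor := rfl
      unit x := congrArg (fun x => (X.mu 0).obj (χ.i, x)) (funext fun i => i.elim0)
      a x := by obtain ⟨x, rfl⟩ := s₃ x; exact ha x
      ai x := by obtain ⟨x, rfl⟩ := s₃ x; exact hai x
      l x := by obtain ⟨x, rfl⟩ := s₁ x; exact hl x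
      li x := by obtain ⟨x, rfl⟩ := s₁ x; exact hli x
      r x := by obtain ⟨x, rfl⟩ := s₁ x; exact hr x
      ri x := by obtain ⟨x, rfl⟩ := s₁ x; exact hri x
      b x := by obtain ⟨x, rfl⟩ := s₂ x; exact hb x
      bi x := by obtain ⟨x, rfl⟩ := s₂ x; exact hbi x }
  have eq₁ {x y : X.carrier} (f : x ⟶ y) :
      (J₁.cmp f) = (X.one_same ((lift Q₁).map f)).cmp :=
    (Cmp.ofPF_isEq (X.sec_one Q₁) f).unique (Same.isEq _)
  have eqt {x y : X.carrier × (X.carrier × X.carrier)} (f : x ⟶ y) :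
      (Icon.ofEq (X.sec_tl χ.t Q₃)).cmp f = H.tlC ((lift Q₃).map f) :=
    (Cmp.ofPF_isEq (X.sec_tl χ.t Q₃) f).unique (H.tlC_isEq _)
  have eqt' {x y : X.carrier × (X.carrier × X.carrier)} (f : x ⟶ y) :
      (Icon.ofEq (X.sec_tr χ.t Q₃)).cmp f = H.trC ((lift Q₃).map f) :=
    (Cmp.ofPF_isEq (X.sec_tr χ.t Q₃) f).unique (H.trC_isEq _)
  have eqb {x y : X.carrier × X.carrier} (f : x ⟶ y) :
      (Icon.ofEq (X.pair_tens χ.t (Q₂ 0) (Q₂ 1)).symm).cmp f =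
        (H.tens_same ((lift Q₂).map f)).cmp :=
    (Cmp.ofPF_isEq (X.pair_tens χ.t (Q₂ 0) (Q₂ 1)).symm f).unique (Same.isEq _)
  have eqb' {x y : X.carrier × X.carrier} (f : x ⟶ y) :
      (Icon.ofEq (X.sec_dot χ.t Q₂)).cmp f = (H.dot_same ((lift Q₂).map f)).cmp :=
    (Cmp.ofPF_isEq (X.sec_dot χ.t Q₂) f).unique (Same.isEq _)
  have eql {x y : X.carrier} (f : x ⟶ y) :
      ((Icon.ofEq h_left).trans ((K.pair (Icon.ofEq rfl)).whisker (X.tens χ.t))).cmp f =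
        H.ulC ((lift Q₁).map f) := by
    obtain ⟨φ, hφ, e⟩ := H.unitC_eq (x := fun j => (lift Q₁).obj x (blocks ![0, 1] rfl ⟨0, j⟩))
      (y := fun j => (lift Q₁).obj y (blocks ![0, 1] rfl ⟨0, j⟩))
      (fun j => (lift Q₁).map f (blocks ![0, 1] rfl ⟨0, j⟩)) Fin.elim0
    have e' := H.tenIdC_eq (k₀ := 0) (k₁ := 1) rfl χ.i P.one ((lift Q₁).map f) hφ
      (X.one_same (fun j => (lift Q₁).map f (blocks ![0, 1] rfl ⟨1, j⟩))).isEq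
      (idCmp (X.mu 0) (H.unit Fin.elim0)) (Cmp.ofIso (Iso.refl f))
      (δ := Cmp.ofPF h_left f) (Cmp.ofPF_isEq _ _)
    refine e'.symm.trans (congrArg₂ (H.tenIdC rfl χ.i P.one ((lift Q₁).map f)) e.symm ?_)
    exact Cmp.trans_ofIso_refl _
  have eqr {x y : X.carrier} (f : x ⟶ y) :
      ((Icon.ofEq h_right).trans (((Icon.ofEq rfl).pair K).whisker (X.tens χ.t))).cmp f =
        H.urC ((lift Q₁).map f) := by
    obtain ⟨φ, hφ, e⟩ := H.unitC_eq (x := fun j => (lift Q₁).obj x (blocks ![1, 0] rfl ⟨1, j⟩))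
      (y := fun j => (lift Q₁).obj y (blocks ![1, 0] rfl ⟨1, j⟩))
      (fun j => (lift Q₁).map f (blocks ![1, 0] rfl ⟨1, j⟩)) Fin.elim0
    have e' := H.tenIdC_eq (k₀ := 1) (k₁ := 0) rfl P.one χ.i ((lift Q₁).map f)
      (X.one_same (fun j => (lift Q₁).map f (blocks ![1, 0] rfl ⟨0, j⟩))).isEq hφ
      (Cmp.ofIso (Iso.refl f)) (idCmp (X.mu 0) (H.unit Fin.elim0))
      (δ := Cmp.ofPF h_right f) (Cmp.ofPF_isEq _ _)
    refine e'.symm.trans (congrArg₂ (H.tenIdC rfl P.one χ.i ((lift Q₁).map f)) ?_ e.symm)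
    exact Cmp.trans_ofIso_refl _
  have m₁ {x y : X.carrier} (F : (lift Q₁).obj x ⟶ (lift Q₁).obj y) :
      ∃ f : x ⟶ y, F = (lift Q₁).map f := ⟨F 0, funext fun i => by
    obtain rfl := Subsingleton.elim i 0; rfl⟩
  have m₂ {x y : X.carrier × X.carrier} (F : (lift Q₂).obj x ⟶ (lift Q₂).obj y) :
      ∃ f : x ⟶ y, F = (lift Q₂).map f := ⟨F 0 ×ₘ F 1, funext fun i => by
    match i with
    | 0 => rfl
    | 1 => rfl⟩
  have m₃ {x y : X.carrier × (X.carrier × X.carrier)} (F : (lift Q₃).obj x ⟶ (lift Q₃).obj y) :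
      ∃ f : x ⟶ y, F = (lift Q₃).map f := ⟨F 0 ×ₘ (F 1 ×ₘ F 2), funext fun i => by
    match i with
    | 0 => rfl
    | 1 => rfl
    | 2 => rfl⟩
  refine ⟨s, H, ?_⟩
  constructor
  · intro x y F
    obtain ⟨x, rfl⟩ := s₃ x
    obtain ⟨y, rfl⟩ := s₃ y
    obtain ⟨f, rfl⟩ := m₃ F
    have := a₁ f
    rw [eqt, eqt'] at this
    exact this
  · intro x y F
    obtain ⟨x, rfl⟩ := s₃ x
    obtain ⟨y, rfl⟩ := s₃ y
    obtain ⟨f, rfl⟩ := m₃ F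
    have := a₂ f
    rw [eqt, eqt'] at this
    exact this
  · intro x y F
    obtain ⟨x, rfl⟩ := s₁ x
    obtain ⟨y, rfl⟩ := s₁ y
    obtain ⟨f, rfl⟩ := m₁ F
    have := l₁ f
    rw [eql, eq₁] at this
    exact this
  · intro x y F
    obtain ⟨x, rfl⟩ := s₁ x
    obtain ⟨y, rfl⟩ := s₁ y
    obtain ⟨f, rfl⟩ := m₁ F
    have := l₂ f
    rw [eql, eq₁] at this
    exact this
  · intro x y F
    obtain ⟨x, rfl⟩ := s₁ x
    obtain ⟨y, rfl⟩ := s₁ y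
    obtain ⟨f, rfl⟩ := m₁ F
    have := r₁ f
    rw [eqr, eq₁] at this
    exact this
  · intro x y F
    obtain ⟨x, rfl⟩ := s₁ x
    obtain ⟨y, rfl⟩ := s₁ y
    obtain ⟨f, rfl⟩ := m₁ F
    have := r₂ f
    rw [eqr, eq₁] at this
    exact this
  · intro x y F
    obtain ⟨x, rfl⟩ := s₂ x
    obtain ⟨y, rfl⟩ := s₂ y
    obtain ⟨f, rfl⟩ := m₂ F
    have := b₁ f
    rw [eqb, eqb'] at this
    exact this
  · intro x y F
    obtain ⟨x, rfl⟩ := s₂ x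
    obtain ⟨y, rfl⟩ := s₂ y
    obtain ⟨f, rfl⟩ := m₂ F
    have := b₂ f
    rw [eqb, eqb'] at this
    exact this
  · intro x
    obtain ⟨x, rfl⟩ := s₃ x
    exact a₃ x
  · intro x
    obtain ⟨x, rfl⟩ := s₃ x
    exact a₄ x
  · intro x
    obtain ⟨x, rfl⟩ := s₁ x
    exact l₃ x
  · intro x
    obtain ⟨x, rfl⟩ := s₁ x
    exact l₄ x
  · intro x
    obtain ⟨x, rfl⟩ := s₁ x
    exact r₃ x
  · intro x
    obtain ⟨x, rfl⟩ := s₁ x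
    exact r₄ x
  · intro x
    obtain ⟨x, rfl⟩ := s₂ x
    exact b₃ x
  · intro x
    obtain ⟨x, rfl⟩ := s₂ x
    exact b₄ x

end

end SMTwo

namespace SMTwo

section

variable {P : Operad.{w, v, u}} {X : PAlg.{w, v, u, w₁, v₁, u₁} P}

variable (X) in
/-- An object of an algebra which is presented by a formal composite. -/
structure Pt where
  a : X.carrier
  c : Ctx
  s : Elem P X c
  hs : (Elem.val X c).obj s = a

namespace Pt

/-- A 1-cell which is presented by a 1-cell between formal composites. -/
structure Hom (A B : Pt X) where
  g : A.a ⟶ B.a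
  σ : A.c.I ≃ B.c.I
  raw : Raw X A.c g
  hs : raw.s = A.s
  ht : raw.t = (Elem.re X σ).obj B.s

variable {A B C D : Pt X}

/-- An invertible 2-cell which is presented by a comparison of formal composites. -/
structure Hom₂ (f g : Hom A B) where
  θ : f.g ≅ g.g
  hσ : f.σ = g.σ
  rel : Rel f.raw g.raw (Cmp.ofIso θ)

theorem Hom₂.ext {f g : Hom A B} {η θ : Hom₂ f g} (h : η.θ.hom = θ.θ.hom) : η = θ := by
  obtain ⟨η, _, _⟩ := η
  obtain ⟨θ, _, _⟩ := θ
  obtain rfl : η = θ := Iso.ext h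
  rfl

instance homCategory : Category (Hom A B) where
  Hom := Hom₂
  id f := ⟨Iso.refl f.g, rfl, Rel.refl f.raw⟩
  comp η θ := ⟨η.θ ≪≫ θ.θ, η.hσ.trans θ.hσ, (η.rel.trans θ.rel).congr (Cmp.ofIso_trans _ _)⟩
  id_comp η := Hom₂.ext (Category.id_comp _)
  comp_id η := Hom₂.ext (Category.comp_id _)
  assoc η θ ζ := Hom₂.ext (Category.assoc _ _ _)

/-- A 2-cell of the algebra which is presented by a comparison of formal composites. -/
def mkIso {f g : Hom A B} (θ : f.g ≅ g.g) (hσ : f.σ = g.σ)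
    (rel : Rel f.raw g.raw (Cmp.ofIso θ)) : f ≅ g where
  hom := ⟨θ, hσ, rel⟩
  inv := ⟨θ.symm, hσ.symm, rel.symm⟩
  hom_inv_id := Hom₂.ext θ.hom_inv_id
  inv_hom_id := Hom₂.ext θ.inv_hom_id

theorem Hom.comp_aux (f : Hom A B) (g : Hom B C) : f.raw.t = (g.raw.re f.σ).s :=
  f.ht.trans (congrArg _ g.hs.symm)

theorem _root_.SMTwo.Elem.re_re_obj {c d k : Ctx} (e : c.I ≃ d.I) (e' : d.I ≃ k.I)
    (s : Elem P X k) :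
    (Elem.re X e).obj ((Elem.re X e').obj s) = (Elem.re X (e.trans e')).obj s :=
  (Elem.re_re_same e e' (𝟙 s)).src

theorem _root_.SMTwo.Elem.val_re {c d : Ctx} (e : c.I ≃ d.I) (s : Elem P X d) {a : X.carrier}
    (h : (Elem.val X d).obj s = a) : (Elem.val X c).obj ((Elem.re X e).obj s) = a :=
  (Elem.reC_isEq e (𝟙 s)).same.src.trans h

theorem _root_.SMTwo.Elem.re_refl_obj {c : Ctx} (s : Elem P X c) :
    (Elem.re X (Equiv.refl c.I)).obj s = s :=
  (Elem.re_refl_same (𝟙 s)).src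

/-- The identity. -/
def Hom.id (A : Pt X) : Hom A A :=
  ⟨𝟙 A.a, Equiv.refl _, Raw.id A.s A.hs, rfl, (Elem.re_refl_obj _).symm⟩

/-- Composition. -/
def Hom.comp (f : Hom A B) (g : Hom B C) : Hom A C where
  g := f.g ≫ g.g
  σ := f.σ.trans g.σ
  raw := f.raw.comp (g.raw.re f.σ) (f.comp_aux g)
  hs := (Raw.comp_s _ _ _).trans f.hs
  ht := (Raw.comp_t _ _ _).trans ((congrArg _ g.ht).trans (Elem.re_re_obj _ _ _))

instance : Bicategory (Pt X) where
  Hom := Hom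
  id := Hom.id
  comp := Hom.comp
  homCategory _ _ := homCategory
  whiskerLeft f g h η :=
    ⟨whiskerLeftIso f.g η.θ, congrArg (Equiv.trans f.σ) η.hσ,
      ((Rel.refl f.raw).comp _ _ (η.rel.re f.σ)).congr (congrArg Cmp.ofIso (Iso.ext (by simp)))⟩
  whiskerRight {_ _ _ f g} η h :=
    ⟨whiskerRightIso η.θ h.g, congrArg (Equiv.trans · h.σ) η.hσ,
      (η.rel.comp _ _ (Rel.re_eq (fun x => DFunLike.congr_fun η.hσ x) h.raw)).congr
        (congrArg Cmp.ofIso (Iso.ext (by simp)))⟩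
  associator f g h := mkIso (α_ f.g g.g h.g) rfl
    ((Rel.assoc _ _ ((h.raw.re g.σ).re f.σ) _ (congrArg _ (g.comp_aux h))
      ((Raw.comp_t _ _ _).trans (congrArg _ (g.comp_aux h)))
      ((f.comp_aux g).trans (Raw.comp_s _ _ _).symm) |> fun r =>
        (((Rel.refl _).comp _ _ (Rel.re_re f.σ g.σ h.raw).symm).trans r).trans
        ((Rel.refl _).comp _ _ (Rel.re_comp f.σ g.raw (h.raw.re g.σ) (g.comp_aux h) _).symm)).congr
          (congrArg Cmp.ofIso (Iso.ext (by simp))))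
  leftUnitor f := mkIso (λ_ f.g) rfl
    (((Rel.id_comp _ _ _ _).trans (Rel.re_refl _)).congr (Cmp.trans_ofIso_refl _))
  rightUnitor {A B} f := mkIso (ρ_ f.g) rfl
    ((((Rel.refl f.raw).comp _ (f.ht : f.raw.t = _) (Rel.re_id f.σ B.s B.hs (Elem.val_re _ _ B.hs))).trans
      (Rel.comp_id _ _ _ _)).congr (congrArg Cmp.ofIso (Iso.ext (by simp))))
  whiskerLeft_id _ _ := Hom₂.ext (Bicategory.whiskerLeft_id _ _)
  whiskerLeft_comp _ _ _ _ _ _ := Hom₂.ext (Bicategory.whiskerLeft_comp _ _ _)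
  id_whiskerLeft _ := Hom₂.ext (Bicategory.id_whiskerLeft _)
  comp_whiskerLeft _ _ _ _ _ := Hom₂.ext (Bicategory.comp_whiskerLeft _ _ _)
  id_whiskerRight _ _ := Hom₂.ext (Bicategory.id_whiskerRight _ _)
  comp_whiskerRight _ _ _ := Hom₂.ext (Bicategory.comp_whiskerRight _ _ _)
  whiskerRight_id _ := Hom₂.ext (Bicategory.whiskerRight_id _)
  whiskerRight_comp _ _ _ := Hom₂.ext (Bicategory.whiskerRight_comp _ _ _)
  whisker_assoc _ _ _ _ _ := Hom₂.ext (Bicategory.whisker_assoc _ _ _)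
  whisker_exchange _ _ := Hom₂.ext (Bicategory.whisker_exchange _ _)
  pentagon _ _ _ _ := Hom₂.ext (Bicategory.pentagon _ _ _ _)
  triangle _ _ := Hom₂.ext (Bicategory.triangle _ _)

end Pt

end

end SMTwo

namespace SMTwo

/-- Sums over consecutive blocks. -/
def sigmaBlocks {n m : ℕ} (k : Fin n → ℕ) (hk : ∑ i, k i = m) (I : Fin m → Type) :
    ((a : Fin m) × I a) ≃ ((i : Fin n) × (j : Fin (k i)) × I (blocks k hk ⟨i, j⟩)) :=
  (Equiv.sigmaCongrLeft (β := I) (blocks k hk)).symm.trans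
    (Equiv.sigmaAssoc fun i j => I (blocks k hk ⟨i, j⟩))

theorem sigmaBlocks_apply {n m : ℕ} (k : Fin n → ℕ) (hk : ∑ i, k i = m) (I : Fin m → Type) (i : Fin n)
    (j : Fin (k i)) (x : I (blocks k hk ⟨i, j⟩)) :
    sigmaBlocks k hk I ⟨blocks k hk ⟨i, j⟩, x⟩ = ⟨i, j, x⟩ :=
  (Equiv.eq_symm_apply _).1 rfl

section

variable {P : Operad.{w, v, u}} {X : PAlg.{w, v, u, w₁, v₁, u₁} P}

namespace Pt

variable {n : ℕ}

/-- The values of a family. -/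
abbrev as (A : Fin n → Pt X) : Fin n → X.carrier := fun i => (A i).a

/-- The values of a family. -/
abbrev gs {A B : Fin n → Pt X} (F : ∀ i, A i ⟶ B i) : as A ⟶ as B := fun i => (F i).g

/-- The presentation of the image of a family. -/
abbrev rawApp {p q : P.obj n} {A B : Fin n → Pt X} (κ : p ⟶ q) (F : ∀ i, A i ⟶ B i) {c : Ctx}
    (e : ((i : Fin n) × (A i).c.I) ≃ c.I) : Raw X c (X.app κ (gs F)) :=
  Raw.gam κ (F := gs F) (fun i => (F i).raw) c e

/-- A presentation of an object as the value of an operation. -/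
structure Pres (p : P.obj n) (A : Fin n → Pt X) (Y : Pt X) where
  e : ((i : Fin n) × (A i).c.I) ≃ Y.c.I
  hs : (Elem.gam X (fun i => (A i).c) Y.c e).obj (p, fun i => (A i).s) = Y.s

theorem Pres.ext {p : P.obj n} {A : Fin n → Pt X} {Y : Pt X} {h h' : Pres p A Y}
    (e : ∀ i x, h.e ⟨i, x⟩ = h'.e ⟨i, x⟩) : h = h' := by
  obtain ⟨e₁, _⟩ := h
  obtain ⟨e₂, _⟩ := h'
  obtain rfl : e₁ = e₂ := Equiv.ext fun ⟨i, x⟩ => e i x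
  rfl

theorem Pres.val {p : P.obj n} {A : Fin n → Pt X} {Y : Pt X} (h : Pres p A Y) :
    (X.mu n).obj (p, as A) = Y.a :=
  (rawApp (𝟙 p) (fun i => 𝟙 (A i)) h.e).φ.src.symm.trans
    ((congrArg (Elem.val X Y.c).obj h.hs).trans Y.hs)

/-- A presentation of a 1-cell as the value of a 1-cell of operations on 1-cells. -/
structure HomPres {p q : P.obj n} {A B : Fin n → Pt X} {Y Z : Pt X} (hY : Pres p A Y)
    (hZ : Pres q B Z) (κ : p ⟶ q) (F : ∀ i, A i ⟶ B i) (f : Y ⟶ Z)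
    (φ : Cmp (X.app κ (gs F)) f.g) : Prop where
  hσ : ∀ i x, f.σ (hY.e ⟨i, x⟩) = hZ.e ⟨i, (F i).σ x⟩
  rel : Rel (rawApp κ F hY.e) f.raw φ

section

variable {p q r : P.obj n} {A B C : Fin n → Pt X} {Y Z W : Pt X} {hY : Pres p A Y}
  {hZ : Pres q B Z} {hW : Pres r C W} {κ κ' : p ⟶ q} {κ₂ : q ⟶ r} {F F' : ∀ i, A i ⟶ B i}
  {G : ∀ i, B i ⟶ C i} {f f' : Y ⟶ Z} {g : Z ⟶ W} {φ : Cmp (X.app κ (gs F)) f.g}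
  {φ' : Cmp (X.app κ' (gs F')) f'.g} {ψ : Cmp (X.app κ₂ (gs G)) g.g}

theorem gam_re_obj (hZ : Pres q B Z) (e : ((i : Fin n) × (A i).c.I) ≃ Y.c.I)
    (ρ : ∀ i, (A i).c.I ≃ (B i).c.I) (σ : Y.c.I ≃ Z.c.I)
    (hσ : ∀ i x, σ (e ⟨i, x⟩) = hZ.e ⟨i, ρ i x⟩) :
    (Elem.gam X (fun i => (A i).c) Y.c e).obj (q, fun i => (Elem.re X (ρ i)).obj (B i).s) =
      (Elem.re X σ).obj Z.s := by
  rw [← hZ.hs]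
  refine (Elem.gam_re_same e (hZ.e.trans σ.symm) ρ (fun i x => ?_) (𝟙 q)
    (s := fun i => (B i).s) (t := fun i => (B i).s) (fun i => 𝟙 (B i).s)).src.trans
      (Elem.re_gam_same hZ.e (hZ.e.trans σ.symm) σ (fun i x => ?_) (𝟙 q)
    (s := fun i => (B i).s) (t := fun i => (B i).s) (fun i => 𝟙 (B i).s)).src.symm
  · exact (Equiv.symm_apply_eq _).2 (hσ i x).symm
  · exact Equiv.apply_symm_apply _ _

/-- The 1-cell with a given presentation. -/
def Hom.ofPres (hY : Pres p A Y) (hZ : Pres q B Z) (κ : p ⟶ q) (F : ∀ i, A i ⟶ B i)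
    (g : Y.a ⟶ Z.a) (φ : Cmp (X.app κ (gs F)) g) (σ : Y.c.I ≃ Z.c.I)
    (hσ : ∀ i x, σ (hY.e ⟨i, x⟩) = hZ.e ⟨i, (F i).σ x⟩) : Y ⟶ Z where
  g := g
  σ := σ
  raw := (rawApp κ F hY.e).cast φ
  hs := (congrArg (fun s => (Elem.gam X (fun i => (A i).c) Y.c hY.e).obj (p, s))
    (funext fun i => (F i).hs)).trans hY.hs
  ht := (congrArg (fun s => (Elem.gam X (fun i => (A i).c) Y.c hY.e).obj (q, s))
    (funext fun i => (F i).ht)).trans (gam_re_obj hZ hY.e _ σ hσ)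

theorem Hom.ofPres_pres (hY : Pres p A Y) (hZ : Pres q B Z) (κ : p ⟶ q) (F : ∀ i, A i ⟶ B i)
    (g : Y.a ⟶ Z.a) (φ : Cmp (X.app κ (gs F)) g) (σ : Y.c.I ≃ Z.c.I)
    (hσ : ∀ i x, σ (hY.e ⟨i, x⟩) = hZ.e ⟨i, (F i).σ x⟩) :
    HomPres hY hZ κ F (Hom.ofPres hY hZ κ F g φ σ hσ) φ :=
  ⟨hσ, Rel.cast _ _⟩

namespace HomPres

theorem congr {ψ : Cmp (X.app κ (gs F)) f.g} (h : HomPres hY hZ κ F f φ) (e : φ = ψ) :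
    HomPres hY hZ κ F f ψ := e ▸ h

/-- Change of presentation. -/
theorem of_rel (h : HomPres hY hZ κ' F' f' φ') (hF : ∀ i x, (F i).σ x = (F' i).σ x)
    {ζ : Cmp (X.app κ (gs F)) (X.app κ' (gs F'))}
    (hζ : Rel (rawApp κ F hY.e) (rawApp κ' F' hY.e) ζ) :
    HomPres hY hZ κ F f' (ζ.trans φ') :=
  ⟨fun i x => (h.hσ i x).trans (congrArg (fun y => hZ.e ⟨i, y⟩) (hF i x).symm), hζ.trans h.rel⟩

theorem rel_of (h : HomPres hY hZ κ F f φ) (h' : HomPres hY hZ κ' F' f' φ')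
    {ζ : Cmp (X.app κ (gs F)) (X.app κ' (gs F'))}
    (hζ : Rel (rawApp κ F hY.e) (rawApp κ' F' hY.e) ζ) {θ : Cmp f.g f'.g}
    (e : ζ.trans φ' = φ.trans θ) : Rel f.raw f'.raw θ :=
  ((h.rel.symm.trans hζ).trans h'.rel).congr
    ((Cmp.trans_assoc _ _ _).trans ((congrArg (Cmp.trans _) e).trans (Cmp.trans_symm_trans _ _)))

theorem σ_eq (h : HomPres hY hZ κ F f φ) (h' : HomPres hY hZ κ' F' f' φ')
    (hF : ∀ i x, (F i).σ x = (F' i).σ x) : f.σ = f'.σ :=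
  Equiv.ext fun y => by
    obtain ⟨⟨i, x⟩, rfl⟩ := hY.e.surjective y
    exact (h.hσ i x).trans ((congrArg (fun y => hZ.e ⟨i, y⟩) (hF i x)).trans (h'.hσ i x).symm)

end HomPres

theorem rawApp_natural {c : Ctx} (e : ((i : Fin n) × (A i).c.I) ≃ c.I) (θ : Cmp κ κ')
    {η : ∀ i, Cmp (F i).g (F' i).g} (hη : ∀ i, Rel (F i).raw (F' i).raw (η i)) :
    Rel (rawApp κ F e) (rawApp κ' F' e) (Cmp.muMap X (F := gs F) (F' := gs F') θ η) :=
  Rel.gam θ (fun i => Equiv.refl _)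
    (fun i => (hη i).trans_refl (Rel.re_refl _).symm) fun _ _ => rfl

namespace HomPres

theorem comp (h : HomPres hY hZ κ F f φ) (h' : HomPres hZ hW κ₂ G g ψ) :
    HomPres hY hW (κ ≫ κ₂) (fun i => F i ≫ G i) (f ≫ g)
      (compCmp (X.mu n) φ ψ : Cmp (X.app (κ ≫ κ₂) (gs F ≫ gs G)) (f.g ≫ g.g)) := by
  refine ⟨fun i x => (congrArg g.σ (h.hσ i x)).trans (h'.hσ i _), ?_⟩
  have e₀ : (rawApp κ F hY.e).t =
      (Raw.gam κ₂ (F := gs G) (fun i => (G i).raw.re (F i).σ) Y.c hY.e).s :=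
    congrArg (fun s => (Elem.gam X (fun i => (A i).c) Y.c hY.e).obj (q, s))
      (funext fun i => (F i).comp_aux (G i))
  have r₁ := Rel.gam_comp κ κ₂ (F := gs F) (G := gs G) (e := hY.e) (fun i => (F i).raw)
    (fun i => (G i).raw.re (F i).σ) (fun i => (F i).comp_aux (G i)) e₀
  have r₂ : Rel (Raw.gam κ₂ (F := gs G) (fun i => (G i).raw.re (F i).σ) Y.c hY.e)
      (g.raw.re f.σ) ψ := by
    have r₃ := Rel.gam (Cmp.ofIso (Iso.refl κ₂)) (F := gs G) (F' := gs G) (d := Y.c)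
      (e := hY.e) (e' := hZ.e.trans f.σ.symm) (fun i => (F i).σ)
      (fun i => Rel.refl ((G i).raw.re (F i).σ)) (fun i x =>
        (Equiv.symm_apply_eq _).2 (h.hσ i x).symm)
    have r₄ := Rel.gam_re κ₂ (F := gs G) (fun i => (G i).raw) hZ.e (hZ.e.trans f.σ.symm) f.σ
      (fun i x => Equiv.apply_symm_apply _ _)
    exact ((r₃.trans_refl r₄.symm).trans (h'.rel.re f.σ)).congr
      ((congrArg (Cmp.trans · ψ) Cmp.muMap_refl).trans (Cmp.ofIso_refl_trans ψ))
  exact r₁.trans (h.rel.comp e₀ (f.comp_aux g) r₂)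

/-- Composition of presentations on fixed objects. -/
theorem comp_ev {A : Fin n → Pt X} {hY : Pres p A Y} {hZ : Pres q A Z} {hW : Pres r A W}
    {φ : Cmp ((X.ev (as A)).map κ) f.g} {ψ : Cmp ((X.ev (as A)).map κ₂) g.g}
    (h : HomPres hY hZ κ (fun i => 𝟙 (A i)) f φ) (h' : HomPres hZ hW κ₂ (fun i => 𝟙 (A i)) g ψ) :
    HomPres hY hW (κ ≫ κ₂) (fun i => 𝟙 (A i)) (f ≫ g) (compCmp (X.ev (as A)) φ ψ) := by
  refine ((h.comp h').of_rel (F := fun i => 𝟙 (A i)) (fun i x => rfl)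
    (rawApp_natural hY.e (Cmp.ofIso (Iso.refl (κ ≫ κ₂))) fun i => (λ_ (𝟙 (A i))).symm.hom.rel)).congr ?_
  refine Eq.trans ?_ (compCmp_pf_comp (pair (Pseudofunctor.id (P.obj n)) (const (P.obj n) (as A)))
    (X.mu n) φ ψ).symm
  refine congrArg (Cmp.trans · _) (congrArg (Cmp.map (X.mu n)) ?_)
  exact congrArg (Cmp.mk rfl rfl) (Iso.ext rfl)

end HomPres

theorem idCmp_ev_eq {n : ℕ} (x : Fin n → X.carrier) (p : P.obj n) {a : X.carrier}
    (h : (X.mu n).obj (p, x) = a) :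
    idCmp (X.ev x) h = (idCmp (X.mu n) h : Cmp ((X.mu n).map (𝟙 (p, x))) (𝟙 a)) := by
  obtain ⟨φ, hφ, e⟩ := idCmp_ev x p h
  refine e.trans ((congrArg (Cmp.trans · _) (hφ.unique (Cmp.IsEq.refl _))).trans
    (Cmp.ofIso_refl_trans _))

theorem HomPres.id (hY : Pres p A Y) :
    HomPres hY hY (𝟙 p) (fun i => 𝟙 (A i)) (𝟙 Y) (idCmp (X.ev (as A)) hY.val) := by
  refine ⟨fun i x => rfl, ?_⟩
  rw [idCmp_ev_eq]
  have h := (congrArg (Elem.val X Y.c).obj hY.hs).trans Y.hs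
  have r := Rel.gam_id p (d := Y.c) (e := hY.e) (fun i => (A i).s) (fun i => (A i).hs) h hY.val
  exact (r.trans (Rel.id_congr _ _ h Y.hs hY.hs)).congr (Cmp.trans_ofIso_refl _)

end

section

/-- A sum over one index. -/
def sigmaOne (I : Fin 1 → Type) : ((i : Fin 1) × I i) ≃ I 0 where
  toFun := fun
    | ⟨0, x⟩ => x
  invFun x := ⟨0, x⟩
  left_inv := fun
    | ⟨0, _⟩ => rfl
  right_inv _ := rfl

/-- The presentation by the operadic unit. -/
def Pres.one (A : Fin 1 → Pt X) : Pres P.one A (A 0) where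
  e := sigmaOne fun i => (A i).c.I
  hs := (Elem.one_gam_same _ (Equiv.refl _) (fun _ => rfl) (s := fun i => (A i).s)
    (t := fun i => (A i).s) (fun i => 𝟙 (A i).s)).src.trans (Elem.re_refl_obj _)

theorem HomPres.one {A B : Fin 1 → Pt X} (F : ∀ i, A i ⟶ B i) :
    HomPres (Pres.one A) (Pres.one B) (𝟙 P.one) F (F 0) (X.one_same (gs F)).cmp :=
  ⟨fun i x => by obtain rfl := Subsingleton.elim i 0; rfl,
    (Rel.gam_one (Equiv.refl _) (fun _ => rfl) fun i => (F i).raw).trans_refl (Rel.re_refl _)⟩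

/-- The presentation by a composite operation. -/
def Pres.gam {m : ℕ} (k : Fin n → ℕ) (hk : ∑ i, k i = m) {A : Fin m → Pt X} {p : P.obj n}
    {q : ∀ i, P.obj (k i)} {Y : Fin n → Pt X} {Z : Pt X} (hZ : Pres p Y Z)
    (hY : ∀ i, Pres (q i) (fun j => A (blocks k hk ⟨i, j⟩)) (Y i)) :
    Pres ((P.gam k hk).obj (p, q)) A Z where
  e := (sigmaBlocks k hk fun a => (A a).c.I).trans
    ((Equiv.sigmaCongrRight fun i => (hY i).e).trans hZ.e)
  hs := by
    refine (Elem.gam_gam_same k hk _ hZ.e (fun i => (hY i).e) (fun i j x => ?_) (𝟙 p)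
      (fun i => 𝟙 (q i)) (s := fun i => (A i).s) (t := fun i => (A i).s)
      fun i => 𝟙 (A i).s).src.trans (Eq.trans ?_ hZ.hs)
    · simp only [Equiv.trans_apply, sigmaBlocks_apply]
      rfl
    · exact congrArg (fun s => (Elem.gam X (fun i => (Y i).c) Z.c hZ.e).obj (p, s))
        (funext fun i => (hY i).hs)

theorem Pres.gam_e {m : ℕ} (k : Fin n → ℕ) (hk : ∑ i, k i = m) {A : Fin m → Pt X} {p : P.obj n}
    {q : ∀ i, P.obj (k i)} {Y : Fin n → Pt X} {Z : Pt X} (hZ : Pres p Y Z)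
    (hY : ∀ i, Pres (q i) (fun j => A (blocks k hk ⟨i, j⟩)) (Y i)) (i : Fin n) (j : Fin (k i))
    (x : (A (blocks k hk ⟨i, j⟩)).c.I) :
    (Pres.gam k hk hZ hY).e ⟨blocks k hk ⟨i, j⟩, x⟩ = hZ.e ⟨i, (hY i).e ⟨j, x⟩⟩ := by
  simp only [Pres.gam, Equiv.trans_apply, sigmaBlocks_apply]
  rfl

theorem HomPres.gam {m : ℕ} (k : Fin n → ℕ) (hk : ∑ i, k i = m) {A A' : Fin m → Pt X}
    {p p' : P.obj n} {q q' : ∀ i, P.obj (k i)} {Y Y' : Fin n → Pt X} {Z Z' : Pt X}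
    {hZ : Pres p Y Z} {hY : ∀ i, Pres (q i) (fun j => A (blocks k hk ⟨i, j⟩)) (Y i)}
    {hZ' : Pres p' Y' Z'} {hY' : ∀ i, Pres (q' i) (fun j => A' (blocks k hk ⟨i, j⟩)) (Y' i)}
    {κ : p ⟶ p'} {κ' : q ⟶ q'} {F : ∀ i, A i ⟶ A' i} {f : ∀ i, Y i ⟶ Y' i} {g : Z ⟶ Z'}
    {φ : ∀ i, Cmp (X.app (κ' i) (gs fun j => F (blocks k hk ⟨i, j⟩))) (f i).g}
    {ψ : Cmp (X.app κ (gs f)) g.g} (h : HomPres hZ hZ' κ f g ψ)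
    (h' : ∀ i, HomPres (hY i) (hY' i) (κ' i) (fun j => F (blocks k hk ⟨i, j⟩)) (f i) (φ i)) :
    HomPres (Pres.gam k hk hZ hY) (Pres.gam k hk hZ' hY') ((P.gam k hk).map (κ ×ₘ κ')) F g
      ((X.gamC k hk κ κ' (gs F) (G := gs f) φ).trans ψ) := by
  refine ⟨fun a x => ?_, ?_⟩
  · obtain ⟨⟨i, j⟩, rfl⟩ := (blocks k hk).surjective a
    refine (congrArg g.σ (Pres.gam_e k hk hZ hY i j x)).trans ((h.hσ i _).trans ?_)
    exact (congrArg (fun y => hZ'.e ⟨i, y⟩) ((h' i).hσ j x)).trans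
      (Pres.gam_e k hk hZ' hY' i j _).symm
  · refine Rel.trans ?_ h.rel
    exact (Rel.gam_gam k hk (fun i j x => (Pres.gam_e k hk hZ hY i j x).symm) κ κ' (F := gs F)
      fun a => (F a).raw).trans (Rel.gam (Cmp.ofIso (Iso.refl κ)) (F' := gs f) (φ := φ)
        (fun i => Equiv.refl _) (fun i => (h' i).rel.trans_refl (Rel.re_refl _).symm)
        fun i x => rfl)

/-- The presentation by a permuted operation. -/
def Pres.act (σ : Equiv.Perm (Fin n)) {A : Fin n → Pt X} {p : P.obj n} {Y : Pt X}
    (hY : Pres p (fun i => A (σ⁻¹ i)) Y) : Pres (P.dot p σ) A Y where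
  e := (Equiv.sigmaCongrLeft (β := fun i => (A i).c.I) σ⁻¹).symm.trans hY.e
  hs := by
    refine (Elem.gam_act_same σ _ hY.e (fun i x => ?_) (𝟙 p) (s := fun i => (A i).s)
      (t := fun i => (A i).s) fun i => 𝟙 (A i).s).src.trans hY.hs
    exact congrArg hY.e ((Equiv.eq_symm_apply _).2 rfl)

theorem Pres.act_e (σ : Equiv.Perm (Fin n)) {A : Fin n → Pt X} {p : P.obj n} {Y : Pt X}
    (hY : Pres p (fun i => A (σ⁻¹ i)) Y) (i : Fin n) (x : (A (σ⁻¹ i)).c.I) :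
    (Pres.act σ hY).e ⟨σ⁻¹ i, x⟩ = hY.e ⟨i, x⟩ :=
  congrArg hY.e ((Equiv.sigmaCongrLeft (β := fun i => (A i).c.I) σ⁻¹).symm_apply_apply ⟨i, x⟩)

theorem HomPres.act (σ : Equiv.Perm (Fin n)) {A B : Fin n → Pt X} {p q : P.obj n} {Y Z : Pt X}
    {hY : Pres p (fun i => A (σ⁻¹ i)) Y} {hZ : Pres q (fun i => B (σ⁻¹ i)) Z} {κ : p ⟶ q}
    {F : ∀ i, A i ⟶ B i} {f : Y ⟶ Z} {φ : Cmp (X.app κ (gs fun i => F (σ⁻¹ i))) f.g}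
    (h : HomPres hY hZ κ (fun i => F (σ⁻¹ i)) f φ) :
    HomPres (Pres.act σ hY) (Pres.act σ hZ) (P.dotMap κ σ) F f
      ((X.act_same σ κ (gs F)).cmp.trans φ) := by
  refine ⟨fun a x => ?_, ?_⟩
  · obtain ⟨i, rfl⟩ := (σ⁻¹).surjective a
    exact (congrArg f.σ (Pres.act_e σ hY i x)).trans ((h.hσ i x).trans
      (Pres.act_e σ hZ i _).symm)
  · exact (Rel.gam_act σ (fun i x => (Pres.act_e σ hY i x).symm) κ (F := gs F)
      fun i => (F i).raw).trans h.rel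

/-- Transport of a presentation along an equality of operations. -/
def Pres.cast {p p' : P.obj n} {A : Fin n → Pt X} {Y : Pt X} (h : Pres p A Y) (e : p = p') :
    Pres p' A Y :=
  ⟨h.e, e ▸ h.hs⟩

theorem HomPres.cast {p q p' q' : P.obj n} {A B : Fin n → Pt X} {Y Z : Pt X} {hY : Pres p A Y}
    {hZ : Pres q B Z} {κ : p ⟶ q} {F : ∀ i, A i ⟶ B i} {f : Y ⟶ Z} {φ : Cmp (X.app κ (gs F)) f.g}
    (h : HomPres hY hZ κ F f φ) (e : p = p') (e' : q = q') {θ : Cmp (κ.cast e e') κ}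
    (hθ : θ.IsEq) :
    HomPres (hY.cast e) (hZ.cast e') (κ.cast e e') F f
      ((Cmp.muMap X (F := gs F) (F' := gs F) θ fun i => Cmp.ofIso (Iso.refl _)).trans φ) := by
  subst e e'
  obtain rfl := hθ.unique (Cmp.IsEq.refl _)
  exact h.congr ((congrArg (Cmp.trans · φ) Cmp.muMap_refl).trans (Cmp.ofIso_refl_trans φ)).symm

end

end Pt

end

end SMTwo

namespace SMTwo

/-- A sum over two indices. -/
def sigmaTwo (I : Fin 2 → Type) : ((i : Fin 2) × I i) ≃ I 0 ⊕ I 1 where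
  toFun := fun
    | ⟨0, x⟩ => Sum.inl x
    | ⟨1, x⟩ => Sum.inr x
  invFun := fun
    | Sum.inl x => ⟨0, x⟩
    | Sum.inr x => ⟨1, x⟩
  left_inv := fun
    | ⟨0, _⟩ => rfl
    | ⟨1, _⟩ => rfl
  right_inv := fun
    | Sum.inl _ => rfl
    | Sum.inr _ => rfl

/-- The sum of two finite sets. -/
def Ctx.sum (c d : Ctx) : Ctx :=
  ⟨c.I ⊕ d.I, c.n + d.n, (Equiv.sumCongr c.ν d.ν).trans finSumFinEquiv⟩

/-- The empty set. -/
def Ctx.empty : Ctx := ⟨Empty, 0, Equiv.equivOfIsEmpty _ _⟩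

section

variable {P : Operad.{w, v, u}} {X : PAlg.{w, v, u, w₁, v₁, u₁} P}

theorem Cmp.square_aux {B : Type u₁} [Bicategory.{w₁, v₁} B] {a b a' b' a'' b'' : B}
    {f₁ f₂ g₁ g₂ : a ⟶ b} (i : f₁ ≅ f₂) (m : f₁ ≅ g₁) (j : g₁ ≅ g₂) {h : a' ⟶ b'} {k : a'' ⟶ b''}
    {φ : Cmp f₂ h} {ψ : Cmp g₂ k} {θ : Cmp h k}
    (e : (ofIso (i.symm ≪≫ m ≪≫ j)).trans ψ = φ.trans θ) :
    (ofIso m).trans ((ofIso j).trans ψ) = ((ofIso i).trans φ).trans θ := by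
  rw [trans_assoc, ← e]
  obtain ⟨rfl, rfl, l⟩ := ψ
  refine congrArg (Cmp.mk rfl rfl) (Iso.ext ?_)
  change m.hom ≫ j.hom ≫ l.hom = i.hom ≫ (i.inv ≫ m.hom ≫ j.hom) ≫ l.hom
  simp

namespace Pt

variable {n : ℕ} {p q : P.obj n} {Y Z Y' Z' : Pt X}

/-- The 2-cell between presented 1-cells which is the image of a 2-cell of operations. -/
def iso {A : Fin n → Pt X} {hY : Pres p A Y} {hZ : Pres q A Z} {κ κ' : p ⟶ q} {f f' : Y ⟶ Z}
    {φ : Cmp ((X.ev (as A)).map κ) f.g} {φ' : Cmp ((X.ev (as A)).map κ') f'.g}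
    (h : HomPres hY hZ κ (fun i => 𝟙 (A i)) f φ) (h' : HomPres hY hZ κ' (fun i => 𝟙 (A i)) f' φ')
    {ζ : κ ≅ κ'} (θ : f.g ≅ f'.g) (hθ : Carries φ φ' ((X.ev (as A)).map₂ ζ.hom) θ.hom) : f ≅ f' :=
  mkIso θ (h.σ_eq h' fun _ _ => rfl)
    (h.rel_of h' (rawApp_natural hY.e (Cmp.ofIso ζ) fun i => Rel.refl _)
      ((carries_iff (θ := (X.ev (as A)).map₂Iso ζ)).1 hθ))

/-- The naturality square of a 1-cell of operations. -/
def sq {A B : Fin n → Pt X} {hY : Pres p A Y} {hZ : Pres q A Z} {hY' : Pres p B Y'}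
    {hZ' : Pres q B Z'} {κ : p ⟶ q} {F : ∀ i, A i ⟶ B i} {f : Y ⟶ Y'} {g : Z ⟶ Z'} {a : Y ⟶ Z}
    {a' : Y' ⟶ Z'} {φ : Cmp (X.app (𝟙 p) (gs F)) f.g} {ψ : Cmp (X.app (𝟙 q) (gs F)) g.g}
    {α : Cmp ((X.ev (as A)).map κ) a.g} {α' : Cmp ((X.ev (as B)).map κ) a'.g}
    (hf : HomPres hY hY' (𝟙 p) F f φ) (ha' : HomPres hY' hZ' κ (fun i => 𝟙 (B i)) a' α')
    (ha : HomPres hY hZ κ (fun i => 𝟙 (A i)) a α) (hg : HomPres hZ hZ' (𝟙 q) F g ψ)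
    (θ : f.g ≫ a'.g ≅ a.g ≫ g.g)
    (hθ : Carries (φ.comp α') (α.comp ψ) (X.nat κ (gs F)).hom θ.hom) : f ≫ a' ≅ a ≫ g :=
  mkIso θ ((hf.comp ha').σ_eq (ha.comp hg) fun _ _ => rfl)
    ((hf.comp ha').rel_of (ha.comp hg)
      (ζ := Cmp.ofIso ((X.mu n).map₂Iso
        (Iso.prod (λ_ κ ≪≫ (ρ_ κ).symm) (ρ_ (gs F) ≪≫ (λ_ (gs F)).symm))))
      (rawApp_natural hY.e (Cmp.ofIso (λ_ κ ≪≫ (ρ_ κ).symm))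
        fun i => ((ρ_ (F i)) ≪≫ (λ_ (F i)).symm).hom.rel) (by
        have h := carries_iff.1 hθ
        exact Cmp.square_aux _ _ _ h))

/-- A family of two objects. -/
def fam (A B : Pt X) : Fin 2 → Pt X := fun i => match i with
  | 0 => A
  | 1 => B

/-- A family of two 1-cells. -/
def famMap {A B A' B' : Pt X} (f : A ⟶ A') (g : B ⟶ B') : ∀ i, fam A B i ⟶ fam A' B' i :=
  fun i => match i with
    | 0 => f
    | 1 => g

theorem exists_fam (Y : Fin 2 → Pt X) : ∃ A B, Y = fam A B :=
  ⟨Y 0, Y 1, funext fun i => match i with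
    | 0 => rfl
    | 1 => rfl⟩

theorem exists_famMap {A B A' B' : Pt X} (F : ∀ i, fam A B i ⟶ fam A' B' i) :
    ∃ f g, F = famMap f g :=
  ⟨F 0, F 1, funext fun i => match i with
    | 0 => rfl
    | 1 => rfl⟩

end Pt

namespace InducedCells

open Pt

variable {χ : ChoiceOfMult P} {s : MonCells X.carrier} (H : InducedCells χ X s)

theorem tens_id (H : InducedCells χ X s) (x : Fin 2 → X.carrier)
    (h : (X.mu 2).obj (χ.t, x) = s.o (x 0) (x 1)) :
    idCmp (X.ev x) h = (H.tens_same (𝟙 x)).cmp.trans (Cmp.ofIso (s.mId (x 0) (x 1))) := by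
  rw [idCmp_ev_eq]
  obtain ⟨tensor, e, a, l, r, b⟩ := s
  obtain rfl : tensor = X.tens χ.t := H.tensor
  let Q (i : Fin 2) : (X.carrier × X.carrier) ⥤ᵖ X.carrier := match i with
    | 0 => fstP X.carrier X.carrier
    | 1 => sndP X.carrier X.carrier
  obtain ⟨z, rfl⟩ : ∃ z, x = (lift Q).obj z := ⟨(x 0, x 1), funext fun i => match i with
    | 0 => rfl
    | 1 => rfl⟩
  have hQ : (idCmp (pair (const (X.carrier × X.carrier) χ.t) (lift Q)) (a := z) rfl).IsEq := by
    rw [idCmp_pair]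
    exact ((Cmp.IsEq.refl _).trans (Cmp.ofHEq_isEq _ _ _)).pair
      (idCmp_isEq (IsTwoFunctor.lift fun i => match i with
        | 0 => isTwoFunctor_fst
        | 1 => isTwoFunctor_snd) rfl)
  have e₁ : Cmp.ofIso ((X.tens χ.t).mapId z) = idCmp (X.tens χ.t) rfl :=
    (Cmp.trans_ofIso_refl _).symm
  have e₂ := idCmp_comp (pair (const (X.carrier × X.carrier) χ.t) (lift Q)) (X.mu 2) (a := z) rfl h
  refine Eq.trans ?_ (congrArg (Cmp.trans _) (e₁.trans e₂)).symm
  refine Eq.trans ?_ (Cmp.trans_assoc _ _ _)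
  refine (Cmp.ofIso_refl_trans _).symm.trans (congrArg (Cmp.trans · _) ?_)
  exact (Cmp.IsEq.refl _).unique ((Same.isEq _).trans (hQ.map (X.mu 2)))

theorem tens_comp (H : InducedCells χ X s) {x y z : Fin 2 → X.carrier} (F : x ⟶ y) (G : y ⟶ z) :
    (Cmp.muMap X (Cmp.ofIso (λ_ (𝟙 χ.t)).symm) fun i => Cmp.ofIso (Iso.refl (F i ≫ G i))).trans
      (compCmp (X.mu 2) (H.tens_same F).cmp (H.tens_same G).cmp :
        Cmp (X.app (𝟙 χ.t ≫ 𝟙 χ.t) (F ≫ G)) _) =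
      (H.tens_same (F ≫ G)).cmp.trans (Cmp.ofIso (s.mComp (F 0) (G 0) (F 1) (G 1))) := by
  obtain ⟨tensor, e, a, l, r, b⟩ := s
  obtain rfl : tensor = X.tens χ.t := H.tensor
  let Q (i : Fin 2) : (X.carrier × X.carrier) ⥤ᵖ X.carrier := match i with
    | 0 => fstP X.carrier X.carrier
    | 1 => sndP X.carrier X.carrier
  have hQ (x : Fin 2 → X.carrier) : ∃ z, x = (lift Q).obj z :=
    ⟨(x 0, x 1), funext fun i => match i with
    | 0 => rfl
    | 1 => rfl⟩
  have mQ {x y : X.carrier × X.carrier} (F : (lift Q).obj x ⟶ (lift Q).obj y) :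
      ∃ f : x ⟶ y, F = (lift Q).map f := ⟨F 0 ×ₘ F 1, funext fun i => by
    match i with
    | 0 => rfl
    | 1 => rfl⟩
  obtain ⟨x, rfl⟩ := hQ x
  obtain ⟨y, rfl⟩ := hQ y
  obtain ⟨z, rfl⟩ := hQ z
  obtain ⟨F, rfl⟩ := mQ F
  obtain ⟨G, rfl⟩ := mQ G
  have e₁ {x y : X.carrier × X.carrier} (F : x ⟶ y) : (H.tens_same ((lift Q).map F)).cmp =
      Cmp.ofIso (Iso.refl (X.app (𝟙 χ.t) ((lift Q).map F))) :=
    (Same.isEq _).unique (Cmp.IsEq.refl _)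
  have e₂ : (H.tens_same ((lift Q).map F ≫ (lift Q).map G)).cmp =
      Cmp.muMap X (F' := (lift Q).map (F ≫ G)) (Cmp.ofIso (Iso.refl (𝟙 χ.t)))
        (fun i => (Cmp.ofIso ((Q i).mapComp F G)).symm) := by
    refine (Same.isEq _).unique (Cmp.muMap_isEq (Cmp.IsEq.refl _) fun i => ?_)
    match i with
    | 0 => exact Cmp.IsEq.refl _
    | 1 => exact Cmp.IsEq.refl _
  have e₃ := compCmp_pf_comp (pair (const (X.carrier × X.carrier) χ.t) (lift Q)) (X.mu 2)
    (f := F) (g := G) (Cmp.ofIso (Iso.refl _)) (Cmp.ofIso (Iso.refl _))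
  have e₄ := (compCmp_refl (X.tens χ.t) F G).symm.trans e₃
  refine Eq.trans ?_ (congrArg₂ Cmp.trans e₂ e₄).symm
  refine Eq.trans ?_ (Cmp.trans_assoc _ _ _)
  refine congrArg₂ Cmp.trans ?_ (congrArg₂ (compCmp (X.mu 2)) (e₁ F) (e₁ G))
  have e₅ : (Cmp.ofIso ((pair (const (X.carrier × X.carrier) χ.t) (lift Q)).mapComp F G)).map (X.mu 2)
    = Cmp.muMap X (Cmp.ofIso (λ_ (𝟙 χ.t)).symm) (F := (lift Q).map (F ≫ G))
      (F' := (lift Q).map F ≫ (lift Q).map G) fun i => Cmp.ofIso ((Q i).mapComp F G) :=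
    congrArg (Cmp.map (X.mu 2)) (congrArg (Cmp.mk rfl rfl) (Iso.ext rfl))
  refine Eq.trans ?_ ((congrArg (Cmp.trans _) e₅).trans (Cmp.muMap_trans _ _ _ _)).symm
  exact Cmp.muMap_congr (Cmp.ofIso_refl_trans _).symm fun i => (Cmp.symm_trans _).symm

end InducedCells

end

end SMTwo

namespace SMTwo

section

variable {P : Operad.{w, v, u}} {X : PAlg.{w, v, u, w₁, v₁, u₁} P}

instance : IsEmpty Ctx.empty.I := inferInstanceAs (IsEmpty Empty)

/-- The empty family. -/
def Pt.noPt : Fin 0 → Pt X := fun i => i.elim0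

/-- A family of two 2-cells. -/
def Pt.famMap₂ {A B A' B' : Pt X} {f f' : A ⟶ A'} {g g' : B ⟶ B'} (η : f ⟶ f') (θ : g ⟶ g') :
    ∀ i, famMap f g i ⟶ famMap f' g' i :=
  fun i => match i with
    | 0 => η
    | 1 => θ

/-- The value of a pair of 1-cells. -/
def Pt.valMap {A B : Pt X × Pt X} (f : A ⟶ B) : (A.1.a, A.2.a) ⟶ (B.1.a, B.2.a) :=
  f.1.g ×ₘ f.2.g

/-- The value of a pair of 2-cells. -/
def Pt.valMap₂ {A B : Pt X × Pt X} {f g : A ⟶ B} (η : f ⟶ g) : valMap f ⟶ valMap g :=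
  (η.1.θ.hom, η.2.θ.hom)

namespace InducedCells

open Pt

section

variable {χ : ChoiceOfMult P} {s : MonCells X.carrier} (H : InducedCells χ X s)

/-- The tensor product of presented objects. -/
def o (A B : Pt X) : Pt X where
  a := s.o A.a B.a
  c := A.c.sum B.c
  s := (Elem.gam X (fun i => (fam A B i).c) (A.c.sum B.c)
    (sigmaTwo fun i => (fam A B i).c.I)).obj (χ.t, fun i => (fam A B i).s)
  hs := (rawApp (c := A.c.sum B.c) (𝟙 χ.t) (fun i => 𝟙 (fam A B i))
    (sigmaTwo fun i => (fam A B i).c.I)).φ.src.trans (H.tens_obj _)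

/-- The unit object. -/
def pe (H : InducedCells χ X s) : Pt X where
  a := s.e
  c := Ctx.empty
  s := (Elem.gam X (fun i => (noPt i).c) Ctx.empty (Equiv.equivOfIsEmpty _ _)).obj
    (χ.i, fun i => (noPt i).s)
  hs := (rawApp (X := X) (c := Ctx.empty) (𝟙 χ.i) (fun i => 𝟙 (noPt i))
    (Equiv.equivOfIsEmpty _ _)).φ.src.trans (H.unit _)

/-- The presentation of a tensor product. -/
def ten (Y : Fin 2 → Pt X) : Pres χ.t Y (H.o (Y 0) (Y 1)) where
  e := sigmaTwo fun i => (Y i).c.I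
  hs := by
    obtain ⟨A, B, rfl⟩ := exists_fam Y
    rfl

/-- The presentation of the unit. -/
def zero (Y : Fin 0 → Pt X) : Pres χ.i Y H.pe where
  e := haveI : IsEmpty H.pe.c.I := inferInstanceAs (IsEmpty Empty); Equiv.equivOfIsEmpty _ _
  hs := by
    obtain rfl : Y = noPt := funext fun i => i.elim0
    rfl

/-- The tensor product of presented 1-cells. -/
def m {A A' B B' : Pt X} (f : A ⟶ A') (g : B ⟶ B') : H.o A B ⟶ H.o A' B' :=
  Hom.ofPres (H.ten (fam A B)) (H.ten (fam A' B')) (𝟙 χ.t) (famMap f g) (s.m f.g g.g)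
    (H.tens_same (gs (famMap f g))).cmp (Equiv.sumCongr f.σ g.σ) fun i x => by
      match i with
      | 0 => rfl
      | 1 => rfl

theorem m_pres {Y Y' : Fin 2 → Pt X} (F : ∀ i, Y i ⟶ Y' i) :
    HomPres (H.ten Y) (H.ten Y') (𝟙 χ.t) F (H.m (F 0) (F 1)) (H.tens_same (gs F)).cmp := by
  obtain ⟨A, B, rfl⟩ := exists_fam Y
  obtain ⟨A', B', rfl⟩ := exists_fam Y'
  obtain ⟨f, g, rfl⟩ := exists_famMap F
  exact Hom.ofPres_pres _ _ _ _ _ _ _ _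

/-- The tensor product of presented objects as a pseudofunctor. -/
def tensorPt : (Pt X × Pt X) ⥤ᵖ Pt X where
  obj A := H.o A.1 A.2
  map f := H.m f.1 f.2
  map₂ {A B f f'} η := ⟨s.mIso η.1.θ η.2.θ, congrArg₂ Equiv.sumCongr η.1.hσ η.2.hσ,
    (H.m_pres (famMap f.1 f.2)).rel_of (H.m_pres (famMap f'.1 f'.2))
      (rawApp_natural _ (Cmp.ofIso (Iso.refl _)) (η := fun i => Cmp.ofIso (famMap₂ η.1 η.2 i).θ)
        fun i => (famMap₂ η.1 η.2 i).rel) (H.tens_natural _).symm⟩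
  mapId A := mkIso (s.mId A.1.a A.2.a) (Equiv.ext fun x => by rcases x with x | x <;> rfl)
    ((H.m_pres fun i => 𝟙 (fam A.1 A.2 i)).rel_of (HomPres.id (H.ten (fam A.1 A.2)))
      (Rel.refl _) ((Cmp.ofIso_refl_trans _).trans (H.tens_id _ _)))
  mapComp {A B C} f g := mkIso (s.mComp f.1.g g.1.g f.2.g g.2.g)
    (Equiv.ext fun x => by rcases x with x | x <;> rfl)
    ((H.m_pres fun i => famMap f.1 f.2 i ≫ famMap g.1 g.2 i).rel_of
      ((H.m_pres (famMap f.1 f.2)).comp (H.m_pres (famMap g.1 g.2)))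
      (rawApp_natural _ (Cmp.ofIso (λ_ (𝟙 χ.t)).symm) fun i => Rel.refl _) (H.tens_comp _ _))
  map₂_id f := Hom₂.ext (s.tensor.map₂_id (valMap f))
  map₂_comp η θ := Hom₂.ext (s.tensor.map₂_comp (valMap₂ η) (valMap₂ θ))
  map₂_whisker_left f _ _ η := Hom₂.ext (s.tensor.map₂_whisker_left (valMap f) (valMap₂ η))
  map₂_whisker_right η h := Hom₂.ext (s.tensor.map₂_whisker_right (valMap₂ η) (valMap h))
  map₂_associator f g h :=
    Hom₂.ext (s.tensor.map₂_associator (valMap f) (valMap g) (valMap h))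
  map₂_left_unitor f := Hom₂.ext (s.tensor.map₂_left_unitor (valMap f))
  map₂_right_unitor f := Hom₂.ext (s.tensor.map₂_right_unitor (valMap f))

theorem tenC_eq (H : InducedCells χ X s) {k₀ k₁ m : ℕ} (h : ∑ i, ![k₀, k₁] i = m) {q q' : P.obj k₀}
    {r r' : P.obj k₁} (g : q ⟶ q') (g' : r ⟶ r') {x y : Fin m → X.carrier} (F : x ⟶ y)
    {z z' : Fin 2 → X.carrier} (G : z ⟶ z')
    (φ : ∀ i, Cmp (X.app (Operad.fam₂Map g g' i) (fun j => F (blocks ![k₀, k₁] h ⟨i, j⟩) :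
      PAlg.blk ![k₀, k₁] h x i ⟶ PAlg.blk ![k₀, k₁] h y i)) (G i)) :
    (X.gamC ![k₀, k₁] h (𝟙 χ.t) (Operad.fam₂Map g g') F φ).trans (H.tens_same G).cmp =
      H.tenC h g g' F (φ 0) (φ 1) := by
  obtain ⟨a, a', rfl⟩ : ∃ a a', z = ![a, a'] := ⟨z 0, z 1, funext fun i => match i with
    | 0 => rfl
    | 1 => rfl⟩
  obtain ⟨b, b', rfl⟩ : ∃ a a', z' = ![a, a'] := ⟨z' 0, z' 1, funext fun i => match i with
    | 0 => rfl
    | 1 => rfl⟩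
  obtain ⟨f, f', rfl⟩ : ∃ (f : a ⟶ b) (f' : a' ⟶ b'), G = (fun i => match i with
      | 0 => f
      | 1 => f' : ![a, a'] ⟶ ![b, b']) := ⟨G 0, G 1, funext fun i => match i with
    | 0 => rfl
    | 1 => rfl⟩
  refine congrArg (fun φ => (X.gamC ![k₀, k₁] h (𝟙 χ.t) (Operad.fam₂Map g g') F φ).trans _)
    (funext fun i => ?_)
  match i with
  | 0 => rfl
  | 1 => rfl

end

end InducedCells

namespace Pt

open InducedCells

variable {χ : ChoiceOfMult P} {s : MonCells X.carrier} (H : InducedCells χ X s)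

/-- The presentation of a tensor product of presented objects. -/
def Pres.g₂ {k₀ k₁ m : ℕ} (h : ∑ i, ![k₀, k₁] i = m) {A : Fin m → Pt X} {q : P.obj k₀}
    {r : P.obj k₁} {Y₀ Y₁ : Pt X} (h₀ : Pres q (fun j => A (blocks ![k₀, k₁] h ⟨0, j⟩)) Y₀)
    (h₁ : Pres r (fun j => A (blocks ![k₀, k₁] h ⟨1, j⟩)) Y₁) :
    Pres (P.g₂ h χ.t q r) A (H.o Y₀ Y₁) :=
  Pres.gam ![k₀, k₁] h (H.ten (fam Y₀ Y₁)) fun i => match i with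
    | 0 => h₀
    | 1 => h₁

theorem HomPres.tenC {k₀ k₁ m : ℕ} (h : ∑ i, ![k₀, k₁] i = m) {A A' : Fin m → Pt X}
    {q q' : P.obj k₀} {r r' : P.obj k₁} {Y₀ Y₁ Z₀ Z₁ : Pt X}
    {h₀ : Pres q (fun j => A (blocks ![k₀, k₁] h ⟨0, j⟩)) Y₀}
    {h₁ : Pres r (fun j => A (blocks ![k₀, k₁] h ⟨1, j⟩)) Y₁}
    {h₀' : Pres q' (fun j => A' (blocks ![k₀, k₁] h ⟨0, j⟩)) Z₀}
    {h₁' : Pres r' (fun j => A' (blocks ![k₀, k₁] h ⟨1, j⟩)) Z₁} {g : q ⟶ q'} {g' : r ⟶ r'}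
    {F : ∀ i, A i ⟶ A' i} {f₀ : Y₀ ⟶ Z₀} {f₁ : Y₁ ⟶ Z₁}
    {φ : Cmp (X.app g (gs fun j => F (blocks ![k₀, k₁] h ⟨0, j⟩))) f₀.g}
    {ψ : Cmp (X.app g' (gs fun j => F (blocks ![k₀, k₁] h ⟨1, j⟩))) f₁.g}
    (hf : HomPres h₀ h₀' g (fun j => F (blocks ![k₀, k₁] h ⟨0, j⟩)) f₀ φ)
    (hg : HomPres h₁ h₁' g' (fun j => F (blocks ![k₀, k₁] h ⟨1, j⟩)) f₁ ψ) :
    HomPres (Pres.g₂ H h h₀ h₁) (Pres.g₂ H h h₀' h₁') (P.g₂Map h (𝟙 χ.t) g g') F (H.m f₀ f₁)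
      (H.tenC h g g' (gs F) φ ψ) :=
  ((H.m_pres (famMap f₀ f₁)).gam ![k₀, k₁] h (κ' := Operad.fam₂Map g g') (F := F)
    (f := famMap f₀ f₁) (φ := fun i => match i with
      | 0 => φ
      | 1 => ψ) fun i => match i with
        | 0 => hf
        | 1 => hg).congr (H.tenC_eq h g g' (gs F) (gs (famMap f₀ f₁)) _)

end Pt

end

end SMTwo

namespace SMTwo

section

variable {P : Operad.{w, v, u}} {X : PAlg.{w, v, u, w₁, v₁, u₁} P}

namespace Pt

/-- A family of three objects. -/
def fam₃ (A B C : Pt X) : Fin 3 → Pt X := fun i => match i with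
  | 0 => A
  | 1 => B
  | 2 => C

/-- A family of three 1-cells. -/
def famMap₃ {A B C A' B' C' : Pt X} (f : A ⟶ A') (g : B ⟶ B') (h : C ⟶ C') :
    ∀ i, fam₃ A B C i ⟶ fam₃ A' B' C' i :=
  fun i => match i with
    | 0 => f
    | 1 => g
    | 2 => h

/-- A family of one object. -/
def fam₁ (A : Pt X) : Fin 1 → Pt X := fun i => match i with
  | 0 => A

/-- A family of one 1-cell. -/
def famMap₁ {A A' : Pt X} (f : A ⟶ A') : ∀ i, fam₁ A i ⟶ fam₁ A' i :=
  fun i => match i with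
    | 0 => f

theorem exists_fam₃ (Y : Fin 3 → Pt X) : ∃ A B C, Y = fam₃ A B C :=
  ⟨Y 0, Y 1, Y 2, funext fun i => match i with
    | 0 => rfl
    | 1 => rfl
    | 2 => rfl⟩

theorem exists_fam₁ (Y : Fin 1 → Pt X) : ∃ A, Y = fam₁ A :=
  ⟨Y 0, funext fun i => match i with
    | 0 => rfl⟩

end Pt

namespace InducedCells

open Pt

variable {χ : ChoiceOfMult P} {s : MonCells X.carrier} (H : InducedCells χ X s)

theorem _root_.SMTwo.Pt.HomPres.tenIdC {k₀ k₁ m : ℕ} (h : ∑ i, ![k₀, k₁] i = m)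
    {A A' : Fin m → Pt X} {q : P.obj k₀} {r : P.obj k₁} {Y₀ Y₁ Z₀ Z₁ : Pt X}
    {h₀ : Pres q (fun j => A (blocks ![k₀, k₁] h ⟨0, j⟩)) Y₀}
    {h₁ : Pres r (fun j => A (blocks ![k₀, k₁] h ⟨1, j⟩)) Y₁}
    {h₀' : Pres q (fun j => A' (blocks ![k₀, k₁] h ⟨0, j⟩)) Z₀}
    {h₁' : Pres r (fun j => A' (blocks ![k₀, k₁] h ⟨1, j⟩)) Z₁}
    {F : ∀ i, A i ⟶ A' i} {f₀ : Y₀ ⟶ Z₀} {f₁ : Y₁ ⟶ Z₁}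
    {φ : Cmp (X.app (𝟙 q) (gs fun j => F (blocks ![k₀, k₁] h ⟨0, j⟩))) f₀.g}
    {ψ : Cmp (X.app (𝟙 r) (gs fun j => F (blocks ![k₀, k₁] h ⟨1, j⟩))) f₁.g}
    (hf : HomPres h₀ h₀' (𝟙 q) (fun j => F (blocks ![k₀, k₁] h ⟨0, j⟩)) f₀ φ)
    (hg : HomPres h₁ h₁' (𝟙 r) (fun j => F (blocks ![k₀, k₁] h ⟨1, j⟩)) f₁ ψ) :
    HomPres (Pres.g₂ H h h₀ h₁) (Pres.g₂ H h h₀' h₁') (𝟙 (P.g₂ h χ.t q r)) F (H.m f₀ f₁)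
      (H.tenIdC h q r (gs F) φ ψ) :=
  ((HomPres.tenC H h hf hg).of_rel (fun _ _ => rfl)
    (rawApp_natural _ (Cmp.ofIso (eqToIso (id_g₂ h χ.t q r))) fun i => Rel.refl _)).congr
      (congrArg (Cmp.trans · _) ((Cmp.muMap_isEq (Cmp.IsEq.of_eq _) fun i => Cmp.IsEq.refl _).unique
        (Cmp.ofHEq_isEq _ _ _)))

/-- The presentation of `(xy)z`. -/
def tlP (A : Fin 3 → Pt X) : Pres (P.tl χ.t) A (H.o (H.o (A 0) (A 1)) (A 2)) :=
  Pres.g₂ H (k₀ := 2) (k₁ := 1) rfl (H.ten fun j => A (blocks ![2, 1] rfl ⟨0, j⟩))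
    (Pres.one fun j => A (blocks ![2, 1] rfl ⟨1, j⟩))

/-- The presentation of `x(yz)`. -/
def trP (A : Fin 3 → Pt X) : Pres (P.tr χ.t) A (H.o (A 0) (H.o (A 1) (A 2))) :=
  Pres.g₂ H (k₀ := 1) (k₁ := 2) rfl (Pres.one fun j => A (blocks ![1, 2] rfl ⟨0, j⟩))
    (H.ten fun j => A (blocks ![1, 2] rfl ⟨1, j⟩))

/-- The presentation of `ex`. -/
def ulP (A : Fin 1 → Pt X) : Pres (P.g₂ (m := 1) rfl χ.t χ.i P.one) A (H.o H.pe (A 0)) :=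
  Pres.g₂ H (k₀ := 0) (k₁ := 1) rfl (H.zero _) (Pres.one fun j => A (blocks ![0, 1] rfl ⟨1, j⟩))

/-- The presentation of `xe`. -/
def urP (A : Fin 1 → Pt X) : Pres (P.g₂ (m := 1) rfl χ.t P.one χ.i) A (H.o (A 0) H.pe) :=
  Pres.g₂ H (k₀ := 1) (k₁ := 0) rfl (Pres.one fun j => A (blocks ![1, 0] rfl ⟨0, j⟩)) (H.zero _)

/-- The presentation of `yx`. -/
def dotP (A : Fin 2 → Pt X) : Pres (P.dot χ.t Operad.σ₁₂) A (H.o (A 1) (A 0)) :=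
  Pres.act Operad.σ₁₂ (H.ten fun i => A (Operad.σ₁₂⁻¹ i))

theorem tl_pres {A B : Fin 3 → Pt X} (F : ∀ i, A i ⟶ B i) :
    HomPres (H.tlP A) (H.tlP B) (𝟙 (P.tl χ.t)) F (H.m (H.m (F 0) (F 1)) (F 2)) (H.tlC (gs F)) :=
  HomPres.tenIdC H rfl (H.m_pres _) (HomPres.one _)

theorem tr_pres {A B : Fin 3 → Pt X} (F : ∀ i, A i ⟶ B i) :
    HomPres (H.trP A) (H.trP B) (𝟙 (P.tr χ.t)) F (H.m (F 0) (H.m (F 1) (F 2))) (H.trC (gs F)) :=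
  HomPres.tenIdC H rfl (HomPres.one _) (H.m_pres _)

theorem zero_pres {A B : Fin 0 → Pt X} (F : ∀ i, A i ⟶ B i) :
    HomPres (H.zero A) (H.zero B) (𝟙 χ.i) F (𝟙 H.pe) (H.unitC (gs F)) := by
  obtain rfl : A = noPt := funext fun i => i.elim0
  obtain rfl : B = noPt := funext fun i => i.elim0
  obtain rfl : F = fun i => 𝟙 (noPt i) := funext fun i => i.elim0
  refine (HomPres.id (H.zero noPt)).congr ?_
  refine (Cmp.ofIso_refl_trans _).symm.trans (congrArg (Cmp.trans · _) ?_)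
  exact (Cmp.IsEq.refl _).unique (Cmp.ofHEq_isEq _ _ _)

theorem ul_pres {A B : Fin 1 → Pt X} (F : ∀ i, A i ⟶ B i) :
    HomPres (H.ulP A) (H.ulP B) (𝟙 _) F (H.m (𝟙 H.pe) (F 0)) (H.ulC (gs F)) :=
  HomPres.tenIdC H rfl (H.zero_pres _) (HomPres.one _)

theorem ur_pres {A B : Fin 1 → Pt X} (F : ∀ i, A i ⟶ B i) :
    HomPres (H.urP A) (H.urP B) (𝟙 _) F (H.m (F 0) (𝟙 H.pe)) (H.urC (gs F)) :=
  HomPres.tenIdC H rfl (HomPres.one _) (H.zero_pres _)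

theorem dot_pres {A B : Fin 2 → Pt X} (F : ∀ i, A i ⟶ B i) :
    HomPres (H.dotP A) (H.dotP B) (𝟙 _) F (H.m (F 1) (F 0)) (H.dot_same (gs F)).cmp :=
  ((HomPres.act Operad.σ₁₂ (H.m_pres fun i => F (Operad.σ₁₂⁻¹ i))).of_rel (fun _ _ => rfl)
    (rawApp_natural _ (Cmp.ofIso (eqToIso
      ((P.act_strict (Operad.σ₁₂ (n := 0))).1 χ.t).choose.symm)) fun i => Rel.refl _)).congr
      (((Cmp.muMap_isEq (Cmp.IsEq.of_eq _) fun i => Cmp.IsEq.refl _).trans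
        ((Same.isEq _).trans (Same.isEq _))).unique (Same.isEq _))

/-- The associativity 1-cell. -/
def pa (A B C : Pt X) : H.o (H.o A B) C ⟶ H.o A (H.o B C) :=
  Hom.ofPres (H.tlP (fam₃ A B C)) (H.trP (fam₃ A B C)) χ.α.hom (fun i => 𝟙 _) (s.a A.a B.a C.a)
    (H.a (as (fam₃ A B C))).cmp (Equiv.sumAssoc _ _ _) fun i x => by
      match i with
      | 0 => rfl
      | 1 => rfl
      | 2 => rfl

theorem pa_pres (A : Fin 3 → Pt X) :
    HomPres (H.tlP A) (H.trP A) χ.α.hom (fun i => 𝟙 (A i)) (H.pa (A 0) (A 1) (A 2))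
      (H.a (as A)).cmp := by
  obtain ⟨A, B, C, rfl⟩ := exists_fam₃ A
  exact Hom.ofPres_pres _ _ _ _ _ _ _ _

/-- The inverse of the associativity 1-cell. -/
def pai (A B C : Pt X) : H.o A (H.o B C) ⟶ H.o (H.o A B) C :=
  Hom.ofPres (H.trP (fam₃ A B C)) (H.tlP (fam₃ A B C)) χ.α.inv (fun i => 𝟙 _) (s.ai A.a B.a C.a)
    (H.ai (as (fam₃ A B C))).cmp (Equiv.sumAssoc _ _ _).symm fun i x => by
      match i with
      | 0 => rfl
      | 1 => rfl
      | 2 => rfl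

theorem pai_pres (A : Fin 3 → Pt X) :
    HomPres (H.trP A) (H.tlP A) χ.α.inv (fun i => 𝟙 (A i)) (H.pai (A 0) (A 1) (A 2))
      (H.ai (as A)).cmp := by
  obtain ⟨A, B, C, rfl⟩ := exists_fam₃ A
  exact Hom.ofPres_pres _ _ _ _ _ _ _ _

/-- The left unit 1-cell. -/
def pl (A : Pt X) : H.o H.pe A ⟶ A :=
  Hom.ofPres (H.ulP (fam₁ A)) (Pres.one (fam₁ A)) χ.l.hom (fun i => 𝟙 _) (s.l A.a)
    (H.l (as (fam₁ A))).cmp (Equiv.emptySum Empty A.c.I) fun i x => by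
      match i with
      | 0 => rfl

theorem pl_pres (A : Fin 1 → Pt X) :
    HomPres (H.ulP A) (Pres.one A) χ.l.hom (fun i => 𝟙 (A i)) (H.pl (A 0))
      (H.l (as A)).cmp := by
  obtain ⟨A, rfl⟩ := exists_fam₁ A
  exact Hom.ofPres_pres _ _ _ _ _ _ _ _

/-- The inverse of the left unit 1-cell. -/
def pli (A : Pt X) : A ⟶ H.o H.pe A :=
  Hom.ofPres (Pres.one (fam₁ A)) (H.ulP (fam₁ A)) χ.l.inv (fun i => 𝟙 _) (s.li A.a)
    (H.li (as (fam₁ A))).cmp (Equiv.emptySum Empty A.c.I).symm fun i x => by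
      match i with
      | 0 => rfl

theorem pli_pres (A : Fin 1 → Pt X) :
    HomPres (Pres.one A) (H.ulP A) χ.l.inv (fun i => 𝟙 (A i)) (H.pli (A 0))
      (H.li (as A)).cmp := by
  obtain ⟨A, rfl⟩ := exists_fam₁ A
  exact Hom.ofPres_pres _ _ _ _ _ _ _ _

/-- The right unit 1-cell. -/
def pr (A : Pt X) : A ⟶ H.o A H.pe :=
  Hom.ofPres (Pres.one (fam₁ A)) (H.urP (fam₁ A)) χ.r.hom (fun i => 𝟙 _) (s.r A.a)
    (H.r (as (fam₁ A))).cmp (Equiv.sumEmpty A.c.I Empty).symm fun i x => by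
      match i with
      | 0 => rfl

theorem pr_pres (A : Fin 1 → Pt X) :
    HomPres (Pres.one A) (H.urP A) χ.r.hom (fun i => 𝟙 (A i)) (H.pr (A 0))
      (H.r (as A)).cmp := by
  obtain ⟨A, rfl⟩ := exists_fam₁ A
  exact Hom.ofPres_pres _ _ _ _ _ _ _ _

/-- The inverse of the right unit 1-cell. -/
def pri (A : Pt X) : H.o A H.pe ⟶ A :=
  Hom.ofPres (H.urP (fam₁ A)) (Pres.one (fam₁ A)) χ.r.inv (fun i => 𝟙 _) (s.ri A.a)
    (H.ri (as (fam₁ A))).cmp (Equiv.sumEmpty A.c.I Empty) fun i x => by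
      match i with
      | 0 => rfl

theorem pri_pres (A : Fin 1 → Pt X) :
    HomPres (H.urP A) (Pres.one A) χ.r.inv (fun i => 𝟙 (A i)) (H.pri (A 0))
      (H.ri (as A)).cmp := by
  obtain ⟨A, rfl⟩ := exists_fam₁ A
  exact Hom.ofPres_pres _ _ _ _ _ _ _ _

/-- The braiding 1-cell. -/
def pb (A B : Pt X) : H.o A B ⟶ H.o B A :=
  Hom.ofPres (H.ten (fam A B)) (H.dotP (fam A B)) χ.β.hom (fun i => 𝟙 _) (s.b A.a B.a)
    (H.b (as (fam A B))).cmp (Equiv.sumComm _ _) fun i x => by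
      match i with
      | 0 => rfl
      | 1 => rfl

theorem pb_pres (A : Fin 2 → Pt X) :
    HomPres (H.ten A) (H.dotP A) χ.β.hom (fun i => 𝟙 (A i)) (H.pb (A 0) (A 1))
      (H.b (as A)).cmp := by
  obtain ⟨A, B, rfl⟩ := exists_fam A
  exact Hom.ofPres_pres _ _ _ _ _ _ _ _

/-- The inverse of the braiding 1-cell. -/
def pbi (A B : Pt X) : H.o B A ⟶ H.o A B :=
  Hom.ofPres (H.dotP (fam A B)) (H.ten (fam A B)) χ.β.inv (fun i => 𝟙 _) (s.bi A.a B.a)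
    (H.bi (as (fam A B))).cmp (Equiv.sumComm _ _) fun i x => by
      match i with
      | 0 => rfl
      | 1 => rfl

theorem pbi_pres (A : Fin 2 → Pt X) :
    HomPres (H.dotP A) (H.ten A) χ.β.inv (fun i => 𝟙 (A i)) (H.pbi (A 0) (A 1))
      (H.bi (as A)).cmp := by
  obtain ⟨A, B, rfl⟩ := exists_fam A
  exact Hom.ofPres_pres _ _ _ _ _ _ _ _

end InducedCells

end

end SMTwo

namespace SMTwo

/-- The components of an invertible modification. -/
def modIso {B : Type u₁} [Bicategory.{w₁, v₁} B] {C : Type u₂} [Bicategory.{w₂, v₂} C]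
    {F G : B ⥤ᵖ C} {η θ : F ⟶ G} (m : η ≅ θ) (a : B) : η.app a ≅ θ.app a where
  hom := m.hom.as.app a
  inv := m.inv.as.app a
  hom_inv_id := congrArg (fun t => t.as.app a) m.hom_inv_id
  inv_hom_id := congrArg (fun t => t.as.app a) m.inv_hom_id

section

variable {P : Operad.{w, v, u}} {X : PAlg.{w, v, u, w₁, v₁, u₁} P}

/-- The value of a triple of 1-cells. -/
def Pt.valMap₃ {A B : Pt X × (Pt X × Pt X)} (f : A ⟶ B) :
    (A.1.a, (A.2.1.a, A.2.2.a)) ⟶ (B.1.a, (B.2.1.a, B.2.2.a)) :=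
  f.1.g ×ₘ (f.2.1.g ×ₘ f.2.2.g)

/-- The value of a triple of 2-cells. -/
def Pt.valMap₂₃ {A B : Pt X × (Pt X × Pt X)} {f g : A ⟶ B} (η : f ⟶ g) :
    valMap₃ f ⟶ valMap₃ g :=
  (η.1.θ.hom, (η.2.1.θ.hom, η.2.2.θ.hom))

/-- The value of a 1-cell. -/
def Pt.valMap₁ {A B : Pt X} (f : A ⟶ B) : A.a ⟶ B.a := Hom.g f

/-- The value of a 2-cell. -/
def Pt.valMap₂₁ {A B : Pt X} {f g : A ⟶ B} (η : f ⟶ g) : valMap₁ f ⟶ valMap₁ g := η.θ.hom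

namespace InducedCells

open Pt

variable {χ : ChoiceOfMult P} {s : MonCells X.carrier} (H : InducedCells χ X s)

/-- The structure 1-cells of `MonCells.assoc` on presented objects. -/
def assocHomPt (S : H.Squares) : Pseudofunctor.StrongTrans ((pair ((pair (fstP (Pt X) (Pt X × Pt X)) ((sndP (Pt X) (Pt X × Pt X)).comp (fstP (Pt X) (Pt X)))).comp H.tensorPt)
      ((sndP (Pt X) (Pt X × Pt X)).comp (sndP (Pt X) (Pt X)))).comp H.tensorPt) ((pair (fstP (Pt X) (Pt X × Pt X)) ((pair ((sndP (Pt X) (Pt X × Pt X)).comp (fstP (Pt X) (Pt X)))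
      ((sndP (Pt X) (Pt X × Pt X)).comp (sndP (Pt X) (Pt X)))).comp H.tensorPt)).comp H.tensorPt) where
  app A := H.pa A.1 A.2.1 A.2.2
  naturality {A B} f := sq (H.tl_pres (famMap₃ f.1 f.2.1 f.2.2)) (H.pa_pres (fam₃ B.1 B.2.1 B.2.2))
    (H.pa_pres (fam₃ A.1 A.2.1 A.2.2)) (H.tr_pres (famMap₃ f.1 f.2.1 f.2.2)) (s.aSq f.1.g f.2.1.g f.2.2.g) (S.aSq (gs (famMap₃ f.1 f.2.1 f.2.2)))
  naturality_naturality η := Hom₂.ext (s.assoc.hom.naturality_naturality (valMap₂₃ η))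
  naturality_id A := Hom₂.ext (s.assoc.hom.naturality_id ((A.1.a, (A.2.1.a, A.2.2.a))))
  naturality_comp f g := Hom₂.ext (s.assoc.hom.naturality_comp (valMap₃ f) (valMap₃ g))

/-- The inverse structure 1-cells of `MonCells.assoc` on presented objects. -/
def assocInvPt (S : H.Squares) : Pseudofunctor.StrongTrans ((pair (fstP (Pt X) (Pt X × Pt X)) ((pair ((sndP (Pt X) (Pt X × Pt X)).comp (fstP (Pt X) (Pt X)))
      ((sndP (Pt X) (Pt X × Pt X)).comp (sndP (Pt X) (Pt X)))).comp H.tensorPt)).comp H.tensorPt) ((pair ((pair (fstP (Pt X) (Pt X × Pt X)) ((sndP (Pt X) (Pt X × Pt X)).comp (fstP (Pt X) (Pt X)))).comp H.tensorPt)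
      ((sndP (Pt X) (Pt X × Pt X)).comp (sndP (Pt X) (Pt X)))).comp H.tensorPt) where
  app A := H.pai A.1 A.2.1 A.2.2
  naturality {A B} f := sq (H.tr_pres (famMap₃ f.1 f.2.1 f.2.2)) (H.pai_pres (fam₃ B.1 B.2.1 B.2.2))
    (H.pai_pres (fam₃ A.1 A.2.1 A.2.2)) (H.tl_pres (famMap₃ f.1 f.2.1 f.2.2)) (s.aiSq f.1.g f.2.1.g f.2.2.g) (S.aiSq (gs (famMap₃ f.1 f.2.1 f.2.2)))
  naturality_naturality η := Hom₂.ext (s.assoc.inv.naturality_naturality (valMap₂₃ η))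
  naturality_id A := Hom₂.ext (s.assoc.inv.naturality_id ((A.1.a, (A.2.1.a, A.2.2.a))))
  naturality_comp f g := Hom₂.ext (s.assoc.inv.naturality_comp (valMap₃ f) (valMap₃ g))

/-- The equivalence `MonCells.assoc` on presented objects. -/
def assocPt (S : H.Squares) : Bicategory.Equivalence ((pair ((pair (fstP (Pt X) (Pt X × Pt X)) ((sndP (Pt X) (Pt X × Pt X)).comp (fstP (Pt X) (Pt X)))).comp H.tensorPt)
      ((sndP (Pt X) (Pt X × Pt X)).comp (sndP (Pt X) (Pt X)))).comp H.tensorPt)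
    ((pair (fstP (Pt X) (Pt X × Pt X)) ((pair ((sndP (Pt X) (Pt X × Pt X)).comp (fstP (Pt X) (Pt X)))
      ((sndP (Pt X) (Pt X × Pt X)).comp (sndP (Pt X) (Pt X)))).comp H.tensorPt)).comp H.tensorPt) where
  hom := H.assocHomPt S
  inv := H.assocInvPt S
  unit := Pseudofunctor.StrongTrans.isoMk (fun A => Pt.iso (HomPres.id (H.tlP (fam₃ A.1 A.2.1 A.2.2)))
    ((H.pa_pres (fam₃ A.1 A.2.1 A.2.2)).comp_ev (H.pai_pres (fam₃ A.1 A.2.1 A.2.2))) (ζ := χ.α.unit)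
    (modIso s.assoc.unit ((A.1.a, (A.2.1.a, A.2.2.a)))) (S.aUnit _))
    fun f => Hom₂.ext (s.assoc.unit.hom.as.naturality (valMap₃ f))
  counit := Pseudofunctor.StrongTrans.isoMk (fun A => Pt.iso
    ((H.pai_pres (fam₃ A.1 A.2.1 A.2.2)).comp_ev (H.pa_pres (fam₃ A.1 A.2.1 A.2.2))) (HomPres.id (H.trP (fam₃ A.1 A.2.1 A.2.2)))
    (ζ := χ.α.counit) (modIso s.assoc.counit ((A.1.a, (A.2.1.a, A.2.2.a)))) (S.aCounit _))
    fun f => Hom₂.ext (s.assoc.counit.hom.as.naturality (valMap₃ f))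
  left_triangle := (left_triangle_iff _ _).2 (Pseudofunctor.StrongTrans.homCategory.ext fun A =>
    Hom₂.ext (congrArg (·.as.app ((A.1.a, (A.2.1.a, A.2.2.a))))
      ((left_triangle_iff _ _).1 s.assoc.left_triangle)))

/-- The structure 1-cells of `MonCells.left` on presented objects. -/
def leftHomPt (S : H.Squares) : Pseudofunctor.StrongTrans ((pair (const (Pt X) H.pe) (Pseudofunctor.id (Pt X))).comp H.tensorPt) (Pseudofunctor.id (Pt X)) where
  app A := H.pl A
  naturality {A B} f := sq (H.ul_pres (famMap₁ f)) (H.pl_pres (fam₁ B))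
    (H.pl_pres (fam₁ A)) (HomPres.one (famMap₁ f)) (s.lSq f.g) (S.lSq (gs (famMap₁ f)))
  naturality_naturality η := Hom₂.ext (s.left.hom.naturality_naturality (valMap₂₁ η))
  naturality_id A := Hom₂.ext (s.left.hom.naturality_id (A.a))
  naturality_comp f g := Hom₂.ext (s.left.hom.naturality_comp (valMap₁ f) (valMap₁ g))

/-- The inverse structure 1-cells of `MonCells.left` on presented objects. -/
def leftInvPt (S : H.Squares) : Pseudofunctor.StrongTrans (Pseudofunctor.id (Pt X)) ((pair (const (Pt X) H.pe) (Pseudofunctor.id (Pt X))).comp H.tensorPt) where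
  app A := H.pli A
  naturality {A B} f := sq (HomPres.one (famMap₁ f)) (H.pli_pres (fam₁ B))
    (H.pli_pres (fam₁ A)) (H.ul_pres (famMap₁ f)) (s.liSq f.g) (S.liSq (gs (famMap₁ f)))
  naturality_naturality η := Hom₂.ext (s.left.inv.naturality_naturality (valMap₂₁ η))
  naturality_id A := Hom₂.ext (s.left.inv.naturality_id (A.a))
  naturality_comp f g := Hom₂.ext (s.left.inv.naturality_comp (valMap₁ f) (valMap₁ g))

/-- The equivalence `MonCells.left` on presented objects. -/
def leftPt (S : H.Squares) : Bicategory.Equivalence ((pair (const (Pt X) H.pe) (Pseudofunctor.id (Pt X))).comp H.tensorPt)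
    (Pseudofunctor.id (Pt X)) where
  hom := H.leftHomPt S
  inv := H.leftInvPt S
  unit := Pseudofunctor.StrongTrans.isoMk (fun A => Pt.iso (HomPres.id (H.ulP (fam₁ A)))
    ((H.pl_pres (fam₁ A)).comp_ev (H.pli_pres (fam₁ A))) (ζ := χ.l.unit)
    (modIso s.left.unit (A.a)) (S.lUnit _))
    fun f => Hom₂.ext (s.left.unit.hom.as.naturality (valMap₁ f))
  counit := Pseudofunctor.StrongTrans.isoMk (fun A => Pt.iso
    ((H.pli_pres (fam₁ A)).comp_ev (H.pl_pres (fam₁ A))) (HomPres.id (Pres.one (fam₁ A)))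
    (ζ := χ.l.counit) (modIso s.left.counit (A.a)) (S.lCounit _))
    fun f => Hom₂.ext (s.left.counit.hom.as.naturality (valMap₁ f))
  left_triangle := (left_triangle_iff _ _).2 (Pseudofunctor.StrongTrans.homCategory.ext fun A =>
    Hom₂.ext (congrArg (·.as.app (A.a))
      ((left_triangle_iff _ _).1 s.left.left_triangle)))

/-- The structure 1-cells of `MonCells.right` on presented objects. -/
def rightHomPt (S : H.Squares) : Pseudofunctor.StrongTrans (Pseudofunctor.id (Pt X)) ((pair (Pseudofunctor.id (Pt X)) (const (Pt X) H.pe)).comp H.tensorPt) where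
  app A := H.pr A
  naturality {A B} f := sq (HomPres.one (famMap₁ f)) (H.pr_pres (fam₁ B))
    (H.pr_pres (fam₁ A)) (H.ur_pres (famMap₁ f)) (s.rSq f.g) (S.rSq (gs (famMap₁ f)))
  naturality_naturality η := Hom₂.ext (s.right.hom.naturality_naturality (valMap₂₁ η))
  naturality_id A := Hom₂.ext (s.right.hom.naturality_id (A.a))
  naturality_comp f g := Hom₂.ext (s.right.hom.naturality_comp (valMap₁ f) (valMap₁ g))

/-- The inverse structure 1-cells of `MonCells.right` on presented objects. -/
def rightInvPt (S : H.Squares) : Pseudofunctor.StrongTrans ((pair (Pseudofunctor.id (Pt X)) (const (Pt X) H.pe)).comp H.tensorPt) (Pseudofunctor.id (Pt X)) where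
  app A := H.pri A
  naturality {A B} f := sq (H.ur_pres (famMap₁ f)) (H.pri_pres (fam₁ B))
    (H.pri_pres (fam₁ A)) (HomPres.one (famMap₁ f)) (s.riSq f.g) (S.riSq (gs (famMap₁ f)))
  naturality_naturality η := Hom₂.ext (s.right.inv.naturality_naturality (valMap₂₁ η))
  naturality_id A := Hom₂.ext (s.right.inv.naturality_id (A.a))
  naturality_comp f g := Hom₂.ext (s.right.inv.naturality_comp (valMap₁ f) (valMap₁ g))

/-- The equivalence `MonCells.right` on presented objects. -/
def rightPt (S : H.Squares) : Bicategory.Equivalence (Pseudofunctor.id (Pt X))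
    ((pair (Pseudofunctor.id (Pt X)) (const (Pt X) H.pe)).comp H.tensorPt) where
  hom := H.rightHomPt S
  inv := H.rightInvPt S
  unit := Pseudofunctor.StrongTrans.isoMk (fun A => Pt.iso (HomPres.id (Pres.one (fam₁ A)))
    ((H.pr_pres (fam₁ A)).comp_ev (H.pri_pres (fam₁ A))) (ζ := χ.r.unit)
    (modIso s.right.unit (A.a)) (S.rUnit _))
    fun f => Hom₂.ext (s.right.unit.hom.as.naturality (valMap₁ f))
  counit := Pseudofunctor.StrongTrans.isoMk (fun A => Pt.iso
    ((H.pri_pres (fam₁ A)).comp_ev (H.pr_pres (fam₁ A))) (HomPres.id (H.urP (fam₁ A)))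
    (ζ := χ.r.counit) (modIso s.right.counit (A.a)) (S.rCounit _))
    fun f => Hom₂.ext (s.right.counit.hom.as.naturality (valMap₁ f))
  left_triangle := (left_triangle_iff _ _).2 (Pseudofunctor.StrongTrans.homCategory.ext fun A =>
    Hom₂.ext (congrArg (·.as.app (A.a))
      ((left_triangle_iff _ _).1 s.right.left_triangle)))

/-- The structure 1-cells of `MonCells.braid` on presented objects. -/
def braidHomPt (S : H.Squares) : Pseudofunctor.StrongTrans ((pair (fstP (Pt X) (Pt X)) (sndP (Pt X) (Pt X))).comp H.tensorPt) ((pair (sndP (Pt X) (Pt X)) (fstP (Pt X) (Pt X))).comp H.tensorPt) where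
  app A := H.pb A.1 A.2
  naturality {A B} f := sq (H.m_pres (famMap f.1 f.2)) (H.pb_pres (fam B.1 B.2))
    (H.pb_pres (fam A.1 A.2)) (H.dot_pres (famMap f.1 f.2)) (s.bSq f.1.g f.2.g) (S.bSq (gs (famMap f.1 f.2)))
  naturality_naturality η := Hom₂.ext (s.braid.hom.naturality_naturality (valMap₂ η))
  naturality_id A := Hom₂.ext (s.braid.hom.naturality_id ((A.1.a, A.2.a)))
  naturality_comp f g := Hom₂.ext (s.braid.hom.naturality_comp (valMap f) (valMap g))

/-- The inverse structure 1-cells of `MonCells.braid` on presented objects. -/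
def braidInvPt (S : H.Squares) : Pseudofunctor.StrongTrans ((pair (sndP (Pt X) (Pt X)) (fstP (Pt X) (Pt X))).comp H.tensorPt) ((pair (fstP (Pt X) (Pt X)) (sndP (Pt X) (Pt X))).comp H.tensorPt) where
  app A := H.pbi A.1 A.2
  naturality {A B} f := sq (H.dot_pres (famMap f.1 f.2)) (H.pbi_pres (fam B.1 B.2))
    (H.pbi_pres (fam A.1 A.2)) (H.m_pres (famMap f.1 f.2)) (s.biSq f.1.g f.2.g) (S.biSq (gs (famMap f.1 f.2)))
  naturality_naturality η := Hom₂.ext (s.braid.inv.naturality_naturality (valMap₂ η))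
  naturality_id A := Hom₂.ext (s.braid.inv.naturality_id ((A.1.a, A.2.a)))
  naturality_comp f g := Hom₂.ext (s.braid.inv.naturality_comp (valMap f) (valMap g))

/-- The equivalence `MonCells.braid` on presented objects. -/
def braidPt (S : H.Squares) : Bicategory.Equivalence ((pair (fstP (Pt X) (Pt X)) (sndP (Pt X) (Pt X))).comp H.tensorPt)
    ((pair (sndP (Pt X) (Pt X)) (fstP (Pt X) (Pt X))).comp H.tensorPt) where
  hom := H.braidHomPt S
  inv := H.braidInvPt S
  unit := Pseudofunctor.StrongTrans.isoMk (fun A => Pt.iso (HomPres.id (H.ten (fam A.1 A.2)))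
    ((H.pb_pres (fam A.1 A.2)).comp_ev (H.pbi_pres (fam A.1 A.2))) (ζ := χ.β.unit)
    (modIso s.braid.unit ((A.1.a, A.2.a))) (S.bUnit _))
    fun f => Hom₂.ext (s.braid.unit.hom.as.naturality (valMap f))
  counit := Pseudofunctor.StrongTrans.isoMk (fun A => Pt.iso
    ((H.pbi_pres (fam A.1 A.2)).comp_ev (H.pb_pres (fam A.1 A.2))) (HomPres.id (H.dotP (fam A.1 A.2)))
    (ζ := χ.β.counit) (modIso s.braid.counit ((A.1.a, A.2.a))) (S.bCounit _))
    fun f => Hom₂.ext (s.braid.counit.hom.as.naturality (valMap f))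
  left_triangle := (left_triangle_iff _ _).2 (Pseudofunctor.StrongTrans.homCategory.ext fun A =>
    Hom₂.ext (congrArg (·.as.app ((A.1.a, A.2.a)))
      ((left_triangle_iff _ _).1 s.braid.left_triangle)))

/-- The monoidal structure on presented objects. -/
def cellsPt (S : H.Squares) : MonCells (Pt X) where
  tensor := H.tensorPt
  e := H.pe
  assoc := H.assocPt S
  left := H.leftPt S
  right := H.rightPt S
  braid := H.braidPt S

end InducedCells

end

end SMTwo

namespace SMTwo

section

variable {P : Operad.{w, v, u}} {X : PAlg.{w, v, u, w₁, v₁, u₁} P}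

namespace Pt

open InducedCells

section

variable {n : ℕ} {p q r : P.obj n} {A : Fin n → Pt X} {Y Z W : Pt X}

theorem Pres.ext_symm {h h' : Pres p A Y} (e : ∀ y, h.e.symm y = h'.e.symm y) : h = h' :=
  Pres.ext fun i x => congrArg (fun e : Y.c.I ≃ _ => e.symm ⟨i, x⟩)
    (Equiv.ext e : h.e.symm = h'.e.symm)

theorem HomPres.comp_ev' {hY : Pres p A Y} {hZ hZ' : Pres q A Z} {hW : Pres r A W} {κ : p ⟶ q}
    {κ₂ : q ⟶ r} {f : Y ⟶ Z} {g : Z ⟶ W}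
    {φ : Cmp ((X.ev (as A)).map κ) f.g} {ψ : Cmp ((X.ev (as A)).map κ₂) g.g}
    (h : HomPres hY hZ κ (fun i => 𝟙 (A i)) f φ) (h' : HomPres hZ' hW κ₂ (fun i => 𝟙 (A i)) g ψ)
    (e : ∀ y, hZ.e.symm y = hZ'.e.symm y) :
    HomPres hY hW (κ ≫ κ₂) (fun i => 𝟙 (A i)) (f ≫ g) (compCmp (X.ev (as A)) φ ψ) := by
  obtain rfl := Pres.ext_symm e
  exact h.comp_ev h'

theorem HomPres.of_ext {hY hY' : Pres p A Y} {hZ hZ' : Pres q A Z} {κ : p ⟶ q} {f : Y ⟶ Z}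
    {φ : Cmp ((X.ev (as A)).map κ) f.g} (h : HomPres hY hZ κ (fun i => 𝟙 (A i)) f φ)
    (e : ∀ y, hY.e.symm y = hY'.e.symm y) (e' : ∀ y, hZ.e.symm y = hZ'.e.symm y) :
    HomPres hY' hZ' κ (fun i => 𝟙 (A i)) f φ := by
  obtain rfl := Pres.ext_symm e
  obtain rfl := Pres.ext_symm e'
  exact h

/-- The 2-cell between presented 1-cells which is the image of a 2-cell of operations. -/
def iso' {hY hY' : Pres p A Y} {hZ hZ' : Pres q A Z} {κ κ' : p ⟶ q} {f f' : Y ⟶ Z}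
    {φ : Cmp ((X.ev (as A)).map κ) f.g} {φ' : Cmp ((X.ev (as A)).map κ') f'.g}
    (h : HomPres hY hZ κ (fun i => 𝟙 (A i)) f φ) (h' : HomPres hY' hZ' κ' (fun i => 𝟙 (A i)) f' φ')
    {ζ : κ ≅ κ'} (θ : f.g ≅ f'.g) (hθ : Carries φ φ' ((X.ev (as A)).map₂ ζ.hom) θ.hom)
    (e : ∀ y, hY.e.symm y = hY'.e.symm y) (e' : ∀ y, hZ.e.symm y = hZ'.e.symm y) : f ≅ f' :=
  iso (hY := hY) (hZ := hZ) h (by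
    obtain rfl := Pres.ext_symm e
    obtain rfl := Pres.ext_symm e'
    exact h') θ hθ

theorem HomPres.castC {p' q' : P.obj n} {hY : Pres p A Y} {hZ : Pres q A Z} {κ : p ⟶ q}
    {f : Y ⟶ Z} {φ : Cmp ((X.ev (as A)).map κ) f.g}
    (h : HomPres hY hZ κ (fun i => 𝟙 (A i)) f φ) (e : p = p') (e' : q = q') :
    HomPres (hY.cast e) (hZ.cast e') (κ.cast e e') (fun i => 𝟙 (A i)) f
      (InducedCells.castC κ e e' (as A) φ) :=
  (h.cast e e' (θ := (Same.of_cast κ e e').cmp) (Same.isEq _)).congr (congrArg (Cmp.trans · φ)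
    ((Cmp.muMap_isEq (Same.isEq _) fun i => Cmp.IsEq.refl _).unique (Same.isEq _)))

end

variable {χ : ChoiceOfMult P} {s : MonCells X.carrier} (H : InducedCells χ X s)

/-- The presentation of a composite with a ternary operation. -/
def Pres.g₃ {k₀ k₁ k₂ m : ℕ} (h : ∑ i, ![k₀, k₁, k₂] i = m) {A : Fin m → Pt X} {p : P.obj 3}
    {q : P.obj k₀} {q' : P.obj k₁} {q'' : P.obj k₂} {Y₀ Y₁ Y₂ Z : Pt X}
    (hZ : Pres p (fam₃ Y₀ Y₁ Y₂) Z)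
    (h₀ : Pres q (fun j => A (blocks ![k₀, k₁, k₂] h ⟨0, j⟩)) Y₀)
    (h₁ : Pres q' (fun j => A (blocks ![k₀, k₁, k₂] h ⟨1, j⟩)) Y₁)
    (h₂ : Pres q'' (fun j => A (blocks ![k₀, k₁, k₂] h ⟨2, j⟩)) Y₂) :
    Pres (P.g₃ h p q q' q'') A Z :=
  Pres.gam ![k₀, k₁, k₂] h hZ fun i => match i with
    | 0 => h₀
    | 1 => h₁
    | 2 => h₂

/-- The presentation of a composite with a binary operation. -/
def Pres.h₂ {k₀ k₁ m : ℕ} (h : ∑ i, ![k₀, k₁] i = m) {A : Fin m → Pt X} {p : P.obj 2}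
    {q : P.obj k₀} {q' : P.obj k₁} {Y₀ Y₁ Z : Pt X} (hZ : Pres p (fam Y₀ Y₁) Z)
    (h₀ : Pres q (fun j => A (blocks ![k₀, k₁] h ⟨0, j⟩)) Y₀)
    (h₁ : Pres q' (fun j => A (blocks ![k₀, k₁] h ⟨1, j⟩)) Y₁) :
    Pres (P.g₂ h p q q') A Z :=
  Pres.gam ![k₀, k₁] h hZ fun i => match i with
    | 0 => h₀
    | 1 => h₁

/-- The presentation of a composite with a unary operation. -/
def Pres.g₁ {k m : ℕ} (h : ∑ i, ![k] i = m) {A : Fin m → Pt X} {p : P.obj 1}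
    {q : P.obj k} {Y₀ Z : Pt X} (hZ : Pres p (fam₁ Y₀) Z)
    (h₀ : Pres q (fun j => A (blocks ![k] h ⟨0, j⟩)) Y₀) :
    Pres (P.g₁ h p q) A Z :=
  Pres.gam ![k] h hZ fun i => match i with
    | 0 => h₀

theorem _root_.SMTwo.InducedCells.aC_eq {k₀ k₁ k₂ m : ℕ} (h : ∑ i, ![k₀, k₁, k₂] i = m)
    (q : P.obj k₀)
    (q' : P.obj k₁)
    (q'' : P.obj k₂) (x : Fin m → X.carrier)
    {z : Fin 3 → X.carrier} (φ : ∀ i, Cmp (X.app (Operad.fam₃Map (𝟙 q) (𝟙 q') (𝟙 q'') i)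
      (fun j => 𝟙 (x (blocks ![k₀, k₁, k₂] h ⟨i, j⟩)) : PAlg.blk ![k₀, k₁, k₂] h x i ⟶ PAlg.blk ![k₀, k₁, k₂] h x i))
        (𝟙 (z i)))
    (h₀ : (X.ev (PAlg.blk ![k₀, k₁, k₂] h x 0)).obj q = z 0) (h₁ : (X.ev (PAlg.blk ![k₀, k₁, k₂] h x 1)).obj q' = z 1) (h₂ : (X.ev (PAlg.blk ![k₀, k₁, k₂] h x 2)).obj q'' = z 2)
    (e₀ : φ 0 = idCmp (X.ev (PAlg.blk ![k₀, k₁, k₂] h x 0)) h₀)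
    (e₁ : φ 1 = idCmp (X.ev (PAlg.blk ![k₀, k₁, k₂] h x 1)) h₁)
    (e₂ : φ 2 = idCmp (X.ev (PAlg.blk ![k₀, k₁, k₂] h x 2)) h₂) :
    (X.gamC ![k₀, k₁, k₂] h χ.α.hom (Operad.fam₃Map (𝟙 q) (𝟙 q') (𝟙 q'')) (𝟙 x) (G := 𝟙 z) φ).trans (H.a z).cmp =
      H.aC h q q' q'' x h₀ h₁ h₂ := by
  obtain ⟨a, b, c, rfl⟩ : ∃ a b c, z = ![a, b, c] := ⟨z 0, z 1, z 2, funext fun i => match i with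
    | 0 => rfl
    | 1 => rfl
    | 2 => rfl⟩
  refine congrArg (fun φ => (X.gamC ![k₀, k₁, k₂] h χ.α.hom (Operad.fam₃Map (𝟙 q) (𝟙 q') (𝟙 q'')) (𝟙 x)
    (G := 𝟙 ![a, b, c]) φ).trans (H.a ![a, b, c]).cmp) (funext fun i => ?_)
  match i with
  | 0 => exact e₀
  | 1 => exact e₁
  | 2 => exact e₂

theorem HomPres.aC {k₀ k₁ k₂ m : ℕ} (h : ∑ i, ![k₀, k₁, k₂] i = m) {A : Fin m → Pt X}
    {q : P.obj k₀}
    {q' : P.obj k₁}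
    {q'' : P.obj k₂} {Y₀ Y₁ Y₂ : Pt X}
    (h₀ : Pres q (fun j => A (blocks ![k₀, k₁, k₂] h ⟨0, j⟩)) Y₀)
    (h₁ : Pres q' (fun j => A (blocks ![k₀, k₁, k₂] h ⟨1, j⟩)) Y₁)
    (h₂ : Pres q'' (fun j => A (blocks ![k₀, k₁, k₂] h ⟨2, j⟩)) Y₂) :
    HomPres (Pres.g₃ h (H.tlP (fam₃ Y₀ Y₁ Y₂)) h₀ h₁ h₂)
      (Pres.g₃ h (H.trP (fam₃ Y₀ Y₁ Y₂)) h₀ h₁ h₂) (P.g₃Map h χ.α.hom (𝟙 q) (𝟙 q') (𝟙 q''))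
      (fun i => 𝟙 (A i)) (H.pa Y₀ Y₁ Y₂) (H.aC h q q' q'' (as A) h₀.val h₁.val h₂.val) :=
  ((H.pa_pres (fam₃ Y₀ Y₁ Y₂)).gam ![k₀, k₁, k₂] h (F := fun i => 𝟙 (A i))
    (κ' := Operad.fam₃Map (𝟙 q) (𝟙 q') (𝟙 q'')) (f := fun i => 𝟙 (fam₃ Y₀ Y₁ Y₂ i))
    (hY := fun i => match i with
      | 0 => h₀
      | 1 => h₁
      | 2 => h₂) (hY' := fun i => match i with
      | 0 => h₀
      | 1 => h₁
      | 2 => h₂) (φ := fun i => match i with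
        | 0 => idCmp (X.ev (PAlg.blk ![k₀, k₁, k₂] h (as A) 0)) h₀.val
        | 1 => idCmp (X.ev (PAlg.blk ![k₀, k₁, k₂] h (as A) 1)) h₁.val
        | 2 => idCmp (X.ev (PAlg.blk ![k₀, k₁, k₂] h (as A) 2)) h₂.val) fun i => match i with
          | 0 => HomPres.id h₀
          | 1 => HomPres.id h₁
          | 2 => HomPres.id h₂).congr
      (H.aC_eq (z := as (fam₃ Y₀ Y₁ Y₂)) h q q' q'' (as A) _ h₀.val h₁.val h₂.val rfl rfl rfl)

theorem _root_.SMTwo.InducedCells.bC_eq {k₀ k₁ m : ℕ} (h : ∑ i, ![k₀, k₁] i = m)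
    (q : P.obj k₀)
    (q' : P.obj k₁) (x : Fin m → X.carrier)
    {z : Fin 2 → X.carrier} (φ : ∀ i, Cmp (X.app (Operad.fam₂Map (𝟙 q) (𝟙 q') i)
      (fun j => 𝟙 (x (blocks ![k₀, k₁] h ⟨i, j⟩)) : PAlg.blk ![k₀, k₁] h x i ⟶ PAlg.blk ![k₀, k₁] h x i))
        (𝟙 (z i)))
    (h₀ : (X.ev (PAlg.blk ![k₀, k₁] h x 0)).obj q = z 0) (h₁ : (X.ev (PAlg.blk ![k₀, k₁] h x 1)).obj q' = z 1)
    (e₀ : φ 0 = idCmp (X.ev (PAlg.blk ![k₀, k₁] h x 0)) h₀)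
    (e₁ : φ 1 = idCmp (X.ev (PAlg.blk ![k₀, k₁] h x 1)) h₁) :
    (X.gamC ![k₀, k₁] h χ.β.hom (Operad.fam₂Map (𝟙 q) (𝟙 q')) (𝟙 x) (G := 𝟙 z) φ).trans (H.b z).cmp =
      H.bC h q q' x h₀ h₁ := by
  obtain ⟨a, b, rfl⟩ : ∃ a b, z = ![a, b] := ⟨z 0, z 1, funext fun i => match i with
    | 0 => rfl
    | 1 => rfl⟩
  refine congrArg (fun φ => (X.gamC ![k₀, k₁] h χ.β.hom (Operad.fam₂Map (𝟙 q) (𝟙 q')) (𝟙 x)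
    (G := 𝟙 ![a, b]) φ).trans (H.b ![a, b]).cmp) (funext fun i => ?_)
  match i with
  | 0 => exact e₀
  | 1 => exact e₁

theorem HomPres.bC {k₀ k₁ m : ℕ} (h : ∑ i, ![k₀, k₁] i = m) {A : Fin m → Pt X}
    {q : P.obj k₀}
    {q' : P.obj k₁} {Y₀ Y₁ : Pt X}
    (h₀ : Pres q (fun j => A (blocks ![k₀, k₁] h ⟨0, j⟩)) Y₀)
    (h₁ : Pres q' (fun j => A (blocks ![k₀, k₁] h ⟨1, j⟩)) Y₁) :
    HomPres (Pres.h₂ h (H.ten (fam Y₀ Y₁)) h₀ h₁)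
      (Pres.h₂ h (H.dotP (fam Y₀ Y₁)) h₀ h₁) (P.g₂Map h χ.β.hom (𝟙 q) (𝟙 q'))
      (fun i => 𝟙 (A i)) (H.pb Y₀ Y₁) (H.bC h q q' (as A) h₀.val h₁.val) :=
  ((H.pb_pres (fam Y₀ Y₁)).gam ![k₀, k₁] h (F := fun i => 𝟙 (A i))
    (κ' := Operad.fam₂Map (𝟙 q) (𝟙 q')) (f := fun i => 𝟙 (fam Y₀ Y₁ i))
    (hY := fun i => match i with
      | 0 => h₀
      | 1 => h₁) (hY' := fun i => match i with
      | 0 => h₀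
      | 1 => h₁) (φ := fun i => match i with
        | 0 => idCmp (X.ev (PAlg.blk ![k₀, k₁] h (as A) 0)) h₀.val
        | 1 => idCmp (X.ev (PAlg.blk ![k₀, k₁] h (as A) 1)) h₁.val) fun i => match i with
          | 0 => HomPres.id h₀
          | 1 => HomPres.id h₁).congr
      (H.bC_eq (z := as (fam Y₀ Y₁)) h q q' (as A) _ h₀.val h₁.val rfl rfl)

theorem _root_.SMTwo.InducedCells.lC_eq {k m : ℕ} (h : ∑ i, ![k] i = m)
    (q : P.obj k) (x : Fin m → X.carrier)
    {z : Fin 1 → X.carrier} (φ : ∀ i, Cmp (X.app (Operad.fam₁Map (𝟙 q) i)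
      (fun j => 𝟙 (x (blocks ![k] h ⟨i, j⟩)) : PAlg.blk ![k] h x i ⟶ PAlg.blk ![k] h x i))
        (𝟙 (z i)))
    (h₀ : (X.ev (PAlg.blk ![k] h x 0)).obj q = z 0)
    (e₀ : φ 0 = idCmp (X.ev (PAlg.blk ![k] h x 0)) h₀) :
    (X.gamC ![k] h χ.l.hom (Operad.fam₁Map (𝟙 q)) (𝟙 x) (G := 𝟙 z) φ).trans (H.l z).cmp =
      H.lC h q x h₀ := by
  obtain ⟨a, rfl⟩ : ∃ a, z = ![a] := ⟨z 0, funext fun i => match i with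
    | 0 => rfl⟩
  refine congrArg (fun φ => (X.gamC ![k] h χ.l.hom (Operad.fam₁Map (𝟙 q)) (𝟙 x)
    (G := 𝟙 ![a]) φ).trans (H.l ![a]).cmp) (funext fun i => ?_)
  match i with
  | 0 => exact e₀

theorem HomPres.lC {k m : ℕ} (h : ∑ i, ![k] i = m) {A : Fin m → Pt X}
    {q : P.obj k} {Y₀ : Pt X}
    (h₀ : Pres q (fun j => A (blocks ![k] h ⟨0, j⟩)) Y₀) :
    HomPres (Pres.g₁ h (H.ulP (fam₁ Y₀)) h₀)
      (Pres.g₁ h (Pres.one (fam₁ Y₀)) h₀) (P.g₁Map h χ.l.hom (𝟙 q))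
      (fun i => 𝟙 (A i)) (H.pl Y₀) (H.lC h q (as A) h₀.val) :=
  ((H.pl_pres (fam₁ Y₀)).gam ![k] h (F := fun i => 𝟙 (A i))
    (κ' := Operad.fam₁Map (𝟙 q)) (f := fun i => 𝟙 (fam₁ Y₀ i))
    (hY := fun i => match i with
      | 0 => h₀) (hY' := fun i => match i with
      | 0 => h₀) (φ := fun i => match i with
        | 0 => idCmp (X.ev (PAlg.blk ![k] h (as A) 0)) h₀.val) fun i => match i with
          | 0 => HomPres.id h₀).congr
      (H.lC_eq (z := as (fam₁ Y₀)) h q (as A) _ h₀.val rfl)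

theorem _root_.SMTwo.InducedCells.rC_eq {k m : ℕ} (h : ∑ i, ![k] i = m)
    (q : P.obj k) (x : Fin m → X.carrier)
    {z : Fin 1 → X.carrier} (φ : ∀ i, Cmp (X.app (Operad.fam₁Map (𝟙 q) i)
      (fun j => 𝟙 (x (blocks ![k] h ⟨i, j⟩)) : PAlg.blk ![k] h x i ⟶ PAlg.blk ![k] h x i))
        (𝟙 (z i)))
    (h₀ : (X.ev (PAlg.blk ![k] h x 0)).obj q = z 0)
    (e₀ : φ 0 = idCmp (X.ev (PAlg.blk ![k] h x 0)) h₀) :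
    (X.gamC ![k] h χ.r.hom (Operad.fam₁Map (𝟙 q)) (𝟙 x) (G := 𝟙 z) φ).trans (H.r z).cmp =
      H.rC h q x h₀ := by
  obtain ⟨a, rfl⟩ : ∃ a, z = ![a] := ⟨z 0, funext fun i => match i with
    | 0 => rfl⟩
  refine congrArg (fun φ => (X.gamC ![k] h χ.r.hom (Operad.fam₁Map (𝟙 q)) (𝟙 x)
    (G := 𝟙 ![a]) φ).trans (H.r ![a]).cmp) (funext fun i => ?_)
  match i with
  | 0 => exact e₀

theorem HomPres.rC {k m : ℕ} (h : ∑ i, ![k] i = m) {A : Fin m → Pt X}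
    {q : P.obj k} {Y₀ : Pt X}
    (h₀ : Pres q (fun j => A (blocks ![k] h ⟨0, j⟩)) Y₀) :
    HomPres (Pres.g₁ h (Pres.one (fam₁ Y₀)) h₀)
      (Pres.g₁ h (H.urP (fam₁ Y₀)) h₀) (P.g₁Map h χ.r.hom (𝟙 q))
      (fun i => 𝟙 (A i)) (H.pr Y₀) (H.rC h q (as A) h₀.val) :=
  ((H.pr_pres (fam₁ Y₀)).gam ![k] h (F := fun i => 𝟙 (A i))
    (κ' := Operad.fam₁Map (𝟙 q)) (f := fun i => 𝟙 (fam₁ Y₀ i))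
    (hY := fun i => match i with
      | 0 => h₀) (hY' := fun i => match i with
      | 0 => h₀) (φ := fun i => match i with
        | 0 => idCmp (X.ev (PAlg.blk ![k] h (as A) 0)) h₀.val) fun i => match i with
          | 0 => HomPres.id h₀).congr
      (H.rC_eq (z := as (fam₁ Y₀)) h q (as A) _ h₀.val rfl)

theorem HomPres.actC {n : ℕ} (σ : Equiv.Perm (Fin n)) {A : Fin n → Pt X} {p q : P.obj n}
    {Y Z : Pt X} {hY : Pres p (fun i => A (σ⁻¹ i)) Y} {hZ : Pres q (fun i => A (σ⁻¹ i)) Z}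
    {κ : p ⟶ q} {f : Y ⟶ Z} {φ : Cmp ((X.ev fun i => as A (σ⁻¹ i)).map κ) f.g}
    (h : HomPres hY hZ κ (fun i => 𝟙 (A (σ⁻¹ i))) f φ) :
    HomPres (Pres.act σ hY) (Pres.act σ hZ) (P.dotMap κ σ) (fun i => 𝟙 (A i)) f
      (InducedCells.actC σ κ (as A) φ) :=
  h.act σ (F := fun i => 𝟙 (A i))

theorem HomPres.oneC (A : Fin 1 → Pt X) :
    HomPres (Pres.one A) (Pres.one A) (𝟙 P.one) (fun i => 𝟙 (A i)) (𝟙 (A 0))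
      (InducedCells.oneC X (as A)) :=
  HomPres.one fun i => 𝟙 (A i)

theorem HomPres.evC {k₀ k₁ m : ℕ} (h : ∑ i, ![k₀, k₁] i = m) {A : Fin m → Pt X}
    {q q' : P.obj k₀} {r r' : P.obj k₁} {Y₀ Y₁ Z₀ Z₁ : Pt X}
    {h₀ : Pres q (fun j => A (blocks ![k₀, k₁] h ⟨0, j⟩)) Y₀}
    {h₁ : Pres r (fun j => A (blocks ![k₀, k₁] h ⟨1, j⟩)) Y₁}
    {h₀' : Pres q' (fun j => A (blocks ![k₀, k₁] h ⟨0, j⟩)) Z₀}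
    {h₁' : Pres r' (fun j => A (blocks ![k₀, k₁] h ⟨1, j⟩)) Z₁} {g : q ⟶ q'} {g' : r ⟶ r'}
    {f₀ : Y₀ ⟶ Z₀} {f₁ : Y₁ ⟶ Z₁}
    {φ : Cmp ((X.ev (PAlg.blk ![k₀, k₁] h (as A) 0)).map g) f₀.g}
    {ψ : Cmp ((X.ev (PAlg.blk ![k₀, k₁] h (as A) 1)).map g') f₁.g}
    (hf : HomPres h₀ h₀' g (fun j => 𝟙 (A (blocks ![k₀, k₁] h ⟨0, j⟩))) f₀ φ)
    (hg : HomPres h₁ h₁' g' (fun j => 𝟙 (A (blocks ![k₀, k₁] h ⟨1, j⟩))) f₁ ψ) :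
    HomPres (Pres.g₂ H h h₀ h₁) (Pres.g₂ H h h₀' h₁') (P.g₂Map h (𝟙 χ.t) g g')
      (fun i => 𝟙 (A i)) (H.m f₀ f₁) (H.evC h g g' (as A) φ ψ) :=
  HomPres.tenC H h (F := fun i => 𝟙 (A i)) hf hg

end Pt

end

end SMTwo

namespace SMTwo

section

variable {P : Operad.{w, v, u}} {X : PAlg.{w, v, u, w₁, v₁, u₁} P}

/-- A family of four objects. -/
def Pt.fam₄ (A B C D : Pt X) : Fin 4 → Pt X := fun i => match i with
  | 0 => A
  | 1 => B
  | 2 => C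
  | 3 => D

namespace InducedCells

open Pt

variable {χ : ChoiceOfMult P} {s : MonCells X.carrier} (H : InducedCells χ X s)

/-- The comparison for the source of the pentagonator. -/
def piSrc (x : Fin 4 → X.carrier) :
    Cmp ((X.ev x).map (P.g₂Map (m := 4) rfl (𝟙 χ.t) χ.α.hom (𝟙 P.one) ≫
      (P.g₃Map (m := 4) rfl χ.α.hom (𝟙 P.one) (𝟙 χ.t) (𝟙 P.one)).cast (P.pi_obj₁ χ.t) (P.pi_obj₂ χ.t) ≫
        P.g₂Map (m := 4) rfl (𝟙 χ.t) (𝟙 P.one) χ.α.hom))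
      (s.rw (s.a (x 0) (x 1) (x 2)) (x 3) ≫ s.a (x 0) (s.o (x 1) (x 2)) (x 3) ≫
      s.lw (x 0) (s.a (x 1) (x 2) (x 3))) :=
  compCmp (X.ev x)
    (H.evC rfl χ.α.hom (𝟙 P.one) x (H.a _).cmp (oneC X _))
    (compCmp (X.ev x)
      (castC _ (P.pi_obj₁ χ.t) (P.pi_obj₂ χ.t) x
        (H.aC rfl P.one χ.t P.one x (X.one_obj _) (H.tens_obj _) (X.one_obj _)))
      (H.evC rfl (𝟙 P.one) χ.α.hom x (oneC X _) (H.a _).cmp))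

/-- The comparison for the target of the pentagonator. -/
def piTgt (x : Fin 4 → X.carrier) :
    Cmp ((X.ev x).map ((P.g₃Map (m := 4) rfl χ.α.hom (𝟙 χ.t) (𝟙 P.one) (𝟙 P.one)).cast (P.pi_obj₃ χ.t) (P.pi_obj₅ χ.t) ≫
      (P.g₃Map (m := 4) rfl χ.α.hom (𝟙 P.one) (𝟙 P.one) (𝟙 χ.t)).cast rfl (P.pi_obj₄ χ.t)))
      (s.a (s.o (x 0) (x 1)) (x 2) (x 3) ≫ s.a (x 0) (x 1) (s.o (x 2) (x 3))) :=
  compCmp (X.ev x)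
    (castC _ (P.pi_obj₃ χ.t) (P.pi_obj₅ χ.t) x
      (H.aC rfl χ.t P.one P.one x (H.tens_obj _) (X.one_obj _) (X.one_obj _)))
    (castC _ rfl (P.pi_obj₄ χ.t) x
      (H.aC rfl P.one P.one χ.t x (X.one_obj _) (X.one_obj _) (H.tens_obj _)))

/-- The comparison for the source of the middle unit modification. -/
def muSrc (x : Fin 2 → X.carrier) :
    Cmp ((X.ev x).map (P.g₂Map (m := 2) rfl (𝟙 χ.t) χ.r.hom (𝟙 P.one) ≫
      (P.g₃Map (m := 2) rfl χ.α.hom (𝟙 P.one) (𝟙 χ.i) (𝟙 P.one)).cast (P.mu_obj₁ χ.t χ.i) (P.mu_obj₂ χ.t χ.i) ≫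
        P.g₂Map (m := 2) rfl (𝟙 χ.t) (𝟙 P.one) χ.l.hom))
      (s.rw (s.r (x 0)) (x 1) ≫ s.a (x 0) s.e (x 1) ≫ s.lw (x 0) (s.l (x 1))) :=
  compCmp (X.ev x)
    (H.evC rfl χ.r.hom (𝟙 P.one) x (H.r _).cmp (oneC X _))
    (compCmp (X.ev x)
      (castC _ (P.mu_obj₁ χ.t χ.i) (P.mu_obj₂ χ.t χ.i) x
        (H.aC rfl P.one χ.i P.one x (X.one_obj _) (H.unit_obj₁ _) (X.one_obj _)))
      (H.evC rfl (𝟙 P.one) χ.l.hom x (oneC X _) (H.l _).cmp))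

/-- The comparison for the target of the middle unit modification. -/
def muTgt (x : Fin 2 → X.carrier) :
    Cmp ((X.ev x).map (𝟙 (P.g₂ (m := 2) rfl χ.t P.one P.one)))
      (𝟙 (s.o (x 0) (x 1))) :=
  idCmp (X.ev x)
    (H.evC (m := 2) rfl (𝟙 P.one) (𝟙 P.one) x (oneC X _) (oneC X _)).src

/-- The comparison for the source of the left unit modification. -/
def lamSrc (x : Fin 2 → X.carrier) :
    Cmp ((X.ev x).map (P.g₂Map (m := 2) rfl (𝟙 χ.t) χ.l.hom (𝟙 P.one)))
      (s.rw (s.l (x 0)) (x 1)) :=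
  H.evC rfl χ.l.hom (𝟙 P.one) x (H.l _).cmp (oneC X _)

/-- The comparison for the target of the left unit modification. -/
def lamTgt (x : Fin 2 → X.carrier) :
    Cmp ((X.ev x).map ((P.g₃Map (m := 2) rfl χ.α.hom (𝟙 χ.i) (𝟙 P.one) (𝟙 P.one)).cast (P.lam_obj₁ χ.t χ.i) (P.lam_obj₂ χ.t χ.i) ≫
      (P.g₁Map (m := 2) rfl χ.l.hom (𝟙 χ.t)).cast rfl (P.lam_obj₃ χ.t)))
      (s.a s.e (x 0) (x 1) ≫ s.l (s.o (x 0) (x 1))) :=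
  compCmp (X.ev x)
    (castC _ (P.lam_obj₁ χ.t χ.i) (P.lam_obj₂ χ.t χ.i) x
      (H.aC rfl χ.i P.one P.one x (H.unit_obj₁ _) (X.one_obj _) (X.one_obj _)))
    (castC _ rfl (P.lam_obj₃ χ.t) x (H.lC rfl χ.t x (H.tens_obj _)))

/-- The comparison for the source of the right unit modification. -/
def rhoSrc (x : Fin 2 → X.carrier) :
    Cmp ((X.ev x).map (P.g₂Map (m := 2) rfl (𝟙 χ.t) (𝟙 P.one) χ.r.hom))
      (s.lw (x 0) (s.r (x 1))) :=
  H.evC rfl (𝟙 P.one) χ.r.hom x (oneC X _) (H.r _).cmp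

/-- The comparison for the target of the right unit modification. -/
def rhoTgt (x : Fin 2 → X.carrier) :
    Cmp ((X.ev x).map ((P.g₁Map (m := 2) rfl χ.r.hom (𝟙 χ.t)).cast (P.lam_obj₃ χ.t) (P.rho_obj₂ χ.t χ.i) ≫
      (P.g₃Map (m := 2) rfl χ.α.hom (𝟙 P.one) (𝟙 P.one) (𝟙 χ.i)).cast rfl (P.rho_obj₁ χ.t χ.i)))
      (s.r (s.o (x 0) (x 1)) ≫ s.a (x 0) (x 1) s.e) :=
  compCmp (X.ev x)
    (castC _ (P.lam_obj₃ χ.t) (P.rho_obj₂ χ.t χ.i) x (H.rC rfl χ.t x (H.tens_obj _)))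
    (castC _ rfl (P.rho_obj₁ χ.t χ.i) x
      (H.aC rfl P.one P.one χ.i x (X.one_obj _) (X.one_obj _) (H.unit_obj₁ _)))

/-- The comparison for the source of the first hexagon modification. -/
def RSrc (x : Fin 3 → X.carrier) :
    Cmp ((X.ev x).map (Operad.braidLeft χ.β.hom ≫ P.dotMap χ.α.hom Operad.σ₁₂ ≫
      (P.dotMap (Operad.braidRight χ.β.hom) Operad.σ₁₂).cast rfl (P.R_obj χ.t)))
      (s.rw (s.b (x 0) (x 1)) (x 2) ≫ s.a (x 1) (x 0) (x 2) ≫ s.lw (x 1) (s.b (x 0) (x 2))) :=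
  compCmp (X.ev x) (H.blC x)
    (compCmp (X.ev x) (actC Operad.σ₁₂ _ x (H.a _).cmp)
      (castC _ rfl (P.R_obj χ.t) x (actC Operad.σ₁₂ _ x (H.brC _))))

/-- The comparison for the target of the first hexagon modification. -/
def RTgt (x : Fin 3 → X.carrier) :
    Cmp ((X.ev x).map (χ.α.hom ≫ Operad.dotLeft χ.β.hom ≫ P.dotMap χ.α.hom Operad.σ₁₃₂))
      (s.a (x 0) (x 1) (x 2) ≫ s.b (x 0) (s.o (x 1) (x 2)) ≫ s.a (x 1) (x 2) (x 0)) :=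
  compCmp (X.ev x) (H.a x).cmp
    (compCmp (X.ev x)
      (castC (p' := P.tr χ.t) _ rfl (P.dot_obj_left χ.t) x
        (H.bC rfl P.one χ.t x (X.one_obj _) (H.tens_obj _)))
      (actC Operad.σ₁₃₂ _ x (H.a _).cmp))

/-- The comparison for the source of the second hexagon modification. -/
def SSrc (x : Fin 3 → X.carrier) :
    Cmp ((X.ev x).map (Operad.braidRight χ.β.hom ≫ P.dotMap χ.α.inv Operad.σ₂₃ ≫
      (P.dotMap (Operad.braidLeft χ.β.hom) Operad.σ₂₃).cast rfl (P.S_obj χ.t)))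
      (s.lw (x 0) (s.b (x 1) (x 2)) ≫ s.ai (x 0) (x 2) (x 1) ≫ s.rw (s.b (x 0) (x 2)) (x 1)) :=
  compCmp (X.ev x) (H.brC x)
    (compCmp (X.ev x) (actC Operad.σ₂₃ _ x (H.ai _).cmp)
      (castC _ rfl (P.S_obj χ.t) x (actC Operad.σ₂₃ _ x (H.blC _))))

/-- The comparison for the target of the second hexagon modification. -/
def STgt (x : Fin 3 → X.carrier) :
    Cmp ((X.ev x).map (χ.α.inv ≫ Operad.dotRight χ.β.hom ≫ P.dotMap χ.α.inv Operad.σ₁₂₃))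
      (s.ai (x 0) (x 1) (x 2) ≫ s.b (s.o (x 0) (x 1)) (x 2) ≫ s.ai (x 2) (x 0) (x 1)) :=
  compCmp (X.ev x) (H.ai x).cmp
    (compCmp (X.ev x)
      (castC (p' := P.tl χ.t) _ rfl (P.dot_obj_right χ.t) x
        (H.bC rfl χ.t P.one x (H.tens_obj _) (X.one_obj _)))
      (actC Operad.σ₁₂₃ _ x (H.ai _).cmp))

/-- The comparison for the source of the syllepsis. -/
def sylSrc (x : Fin 2 → X.carrier) :
    Cmp ((X.ev x).map (χ.β.hom ≫ (P.dotMap χ.β.hom Operad.σ₁₂).cast rfl (P.v_obj χ.t)))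
      (s.b (x 0) (x 1) ≫ s.b (x 1) (x 0)) :=
  compCmp (X.ev x) (H.b x).cmp
    (castC _ rfl (P.v_obj χ.t) x (actC Operad.σ₁₂ _ x (H.b _).cmp))

/-- The comparison for the target of the syllepsis. -/
def sylTgt (x : Fin 2 → X.carrier) :
    Cmp ((X.ev x).map (𝟙 χ.t))
      (𝟙 (s.o (x 0) (x 1))) :=
  idCmp (X.ev x) (H.tens_obj x)

/-- The invertible modifications of a symmetric monoidal structure, given as the images of those of
the choice of multiplication. -/
structure Mods (H : InducedCells χ X s) where
  pi (x y z w : X.carrier) : s.rw (s.a x y z) w ≫ s.a x (s.o y z) w ≫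
      s.lw x (s.a y z w) ≅
    s.a (s.o x y) z w ≫ s.a x y (s.o z w)
  mu (x y : X.carrier) : s.rw (s.r x) y ≫ s.a x s.e y ≫ s.lw x (s.l y) ≅
    𝟙 (s.o x y)
  lam (x y : X.carrier) : s.rw (s.l x) y ≅
    s.a s.e x y ≫ s.l (s.o x y)
  rho (x y : X.carrier) : s.lw x (s.r y) ≅
    s.r (s.o x y) ≫ s.a x y s.e
  R (x y z : X.carrier) : s.rw (s.b x y) z ≫ s.a y x z ≫ s.lw y (s.b x z) ≅
    s.a x y z ≫ s.b x (s.o y z) ≫ s.a y z x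
  S (x y z : X.carrier) : s.lw x (s.b y z) ≫ s.ai x z y ≫ s.rw (s.b x z) y ≅
    s.ai x y z ≫ s.b (s.o x y) z ≫ s.ai z x y
  syl (x y : X.carrier) : s.b x y ≫ s.b y x ≅
    𝟙 (s.o x y)
  pi_carries (x : Fin 4 → X.carrier) : Carries (H.piSrc x) (H.piTgt x)
    ((X.ev x).map₂ χ.π.hom) (pi (x 0) (x 1) (x 2) (x 3)).hom
  mu_carries (x : Fin 2 → X.carrier) : Carries (H.muSrc x) (H.muTgt x)
    ((X.ev x).map₂ χ.μ.hom) (mu (x 0) (x 1)).hom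
  lam_carries (x : Fin 2 → X.carrier) : Carries (H.lamSrc x) (H.lamTgt x)
    ((X.ev x).map₂ χ.lam.hom) (lam (x 0) (x 1)).hom
  rho_carries (x : Fin 2 → X.carrier) : Carries (H.rhoSrc x) (H.rhoTgt x)
    ((X.ev x).map₂ χ.ρ.hom) (rho (x 0) (x 1)).hom
  R_carries (x : Fin 3 → X.carrier) : Carries (H.RSrc x) (H.RTgt x)
    ((X.ev x).map₂ χ.R.hom) (R (x 0) (x 1) (x 2)).hom
  S_carries (x : Fin 3 → X.carrier) : Carries (H.SSrc x) (H.STgt x)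
    ((X.ev x).map₂ χ.S.hom) (S (x 0) (x 1) (x 2)).hom
  syl_carries (x : Fin 2 → X.carrier) : Carries (H.sylSrc x) (H.sylTgt x)
    ((X.ev x).map₂ χ.v.hom) (syl (x 0) (x 1)).hom

/-- The modifications determined by a choice of multiplication. -/
def mods : H.Mods where
  pi x y z w := Cmp.conj (H.piSrc ![x, y, z, w]) (H.piTgt ![x, y, z, w]) ((X.ev ![x, y, z, w]).map₂Iso χ.π)
  mu x y := Cmp.conj (H.muSrc ![x, y]) (H.muTgt ![x, y]) ((X.ev ![x, y]).map₂Iso χ.μ)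
  lam x y := Cmp.conj (H.lamSrc ![x, y]) (H.lamTgt ![x, y]) ((X.ev ![x, y]).map₂Iso χ.lam)
  rho x y := Cmp.conj (H.rhoSrc ![x, y]) (H.rhoTgt ![x, y]) ((X.ev ![x, y]).map₂Iso χ.ρ)
  R x y z := Cmp.conj (H.RSrc ![x, y, z]) (H.RTgt ![x, y, z]) ((X.ev ![x, y, z]).map₂Iso χ.R)
  S x y z := Cmp.conj (H.SSrc ![x, y, z]) (H.STgt ![x, y, z]) ((X.ev ![x, y, z]).map₂Iso χ.S)
  syl x y := Cmp.conj (H.sylSrc ![x, y]) (H.sylTgt ![x, y]) ((X.ev ![x, y]).map₂Iso χ.v)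
  pi_carries x := by
    obtain ⟨x, y, z, w, rfl⟩ : ∃ a b c d, x = ![a, b, c, d] :=
      ⟨x 0, x 1, x 2, x 3, funext fun i => match i with
        | 0 => rfl
        | 1 => rfl
        | 2 => rfl
        | 3 => rfl⟩
    exact Cmp.carries_conj (H.piSrc ![x, y, z, w]) (H.piTgt ![x, y, z, w]) ((X.ev ![x, y, z, w]).map₂Iso χ.π)
  mu_carries x := by
    obtain ⟨x, y, rfl⟩ : ∃ a b, x = ![a, b] :=
      ⟨x 0, x 1, funext fun i => match i with
        | 0 => rfl
        | 1 => rfl⟩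
    exact Cmp.carries_conj (H.muSrc ![x, y]) (H.muTgt ![x, y]) ((X.ev ![x, y]).map₂Iso χ.μ)
  lam_carries x := by
    obtain ⟨x, y, rfl⟩ : ∃ a b, x = ![a, b] :=
      ⟨x 0, x 1, funext fun i => match i with
        | 0 => rfl
        | 1 => rfl⟩
    exact Cmp.carries_conj (H.lamSrc ![x, y]) (H.lamTgt ![x, y]) ((X.ev ![x, y]).map₂Iso χ.lam)
  rho_carries x := by
    obtain ⟨x, y, rfl⟩ : ∃ a b, x = ![a, b] :=
      ⟨x 0, x 1, funext fun i => match i with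
        | 0 => rfl
        | 1 => rfl⟩
    exact Cmp.carries_conj (H.rhoSrc ![x, y]) (H.rhoTgt ![x, y]) ((X.ev ![x, y]).map₂Iso χ.ρ)
  R_carries x := by
    obtain ⟨x, y, z, rfl⟩ : ∃ a b c, x = ![a, b, c] :=
      ⟨x 0, x 1, x 2, funext fun i => match i with
        | 0 => rfl
        | 1 => rfl
        | 2 => rfl⟩
    exact Cmp.carries_conj (H.RSrc ![x, y, z]) (H.RTgt ![x, y, z]) ((X.ev ![x, y, z]).map₂Iso χ.R)
  S_carries x := by
    obtain ⟨x, y, z, rfl⟩ : ∃ a b c, x = ![a, b, c] :=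
      ⟨x 0, x 1, x 2, funext fun i => match i with
        | 0 => rfl
        | 1 => rfl
        | 2 => rfl⟩
    exact Cmp.carries_conj (H.SSrc ![x, y, z]) (H.STgt ![x, y, z]) ((X.ev ![x, y, z]).map₂Iso χ.S)
  syl_carries x := by
    obtain ⟨x, y, rfl⟩ : ∃ a b, x = ![a, b] :=
      ⟨x 0, x 1, funext fun i => match i with
        | 0 => rfl
        | 1 => rfl⟩
    exact Cmp.carries_conj (H.sylSrc ![x, y]) (H.sylTgt ![x, y]) ((X.ev ![x, y]).map₂Iso χ.v)

theorem bl_pres (A : Fin 3 → Pt X) :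
    HomPres (H.tlP A) (Pres.act Operad.σ₁₂ (H.tlP fun i => A (Operad.σ₁₂⁻¹ i)))
      (Operad.braidLeft χ.β.hom) (fun i => 𝟙 (A i)) (H.m (H.pb (A 0) (A 1)) (𝟙 (A 2)))
      (H.blC (as A)) := by
  have h := HomPres.castC (p' := P.tl χ.t)
    (HomPres.evC H rfl (H.pb_pres fun j => A (blocks ![2, 1] rfl ⟨0, j⟩))
    (HomPres.oneC fun j => A (blocks ![2, 1] rfl ⟨1, j⟩))) rfl (P.braid_left_obj χ.t)
  exact h.of_ext (fun y => match y with
        | .inl (.inl x) => rfl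
        | .inl (.inr x) => rfl
        | .inr x => rfl) (fun y => match y with
        | .inl (.inl x) => rfl
        | .inl (.inr x) => rfl
        | .inr x => rfl)

theorem br_pres (A : Fin 3 → Pt X) :
    HomPres (H.trP A) (Pres.act Operad.σ₂₃ (H.trP fun i => A (Operad.σ₂₃⁻¹ i)))
      (Operad.braidRight χ.β.hom) (fun i => 𝟙 (A i)) (H.m (𝟙 (A 0)) (H.pb (A 1) (A 2)))
      (H.brC (as A)) := by
  have h := HomPres.castC (p' := P.tr χ.t)
    (HomPres.evC H rfl (HomPres.oneC fun j => A (blocks ![1, 2] rfl ⟨0, j⟩))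
    (H.pb_pres fun j => A (blocks ![1, 2] rfl ⟨1, j⟩))) rfl (P.braid_right_obj χ.t)
  exact h.of_ext (fun y => match y with
        | .inl x => rfl
        | .inr (.inl x) => rfl
        | .inr (.inr x) => rfl) (fun y => match y with
        | .inl x => rfl
        | .inr (.inl x) => rfl
        | .inr (.inr x) => rfl)

theorem _root_.SMTwo.Pt.Pres.gam_symm {n m : ℕ} (k : Fin n → ℕ) (hk : ∑ i, k i = m)
    {A : Fin m → Pt X} {p : P.obj n} {q : ∀ i, P.obj (k i)} {Y : Fin n → Pt X} {Z : Pt X}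
    (hZ : Pres p Y Z) (hY : ∀ i, Pres (q i) (fun j => A (blocks k hk ⟨i, j⟩)) (Y i)) (y : Z.c.I)
    (i : Fin n) (z : (Y i).c.I) (hz : hZ.e.symm y = ⟨i, z⟩) (j : Fin (k i))
    (x : (A (blocks k hk ⟨i, j⟩)).c.I) (hx : (hY i).e.symm z = ⟨j, x⟩) :
    (Pres.gam k hk hZ hY).e.symm y = ⟨blocks k hk ⟨i, j⟩, x⟩ :=
  (Equiv.symm_apply_eq _).2 (((congrArg hZ.e ((congrArg (Sigma.mk i)
    ((Equiv.symm_apply_eq _).1 hx).symm).trans hz.symm)).trans (Equiv.apply_symm_apply _ _)).symm.trans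
      (Pres.gam_e k hk hZ hY i j x).symm)

theorem _root_.SMTwo.Pt.Pres.cast_gam_symm {n m : ℕ} (k : Fin n → ℕ) (hk : ∑ i, k i = m)
    {A : Fin m → Pt X} {p : P.obj n} {q : ∀ i, P.obj (k i)} {Y : Fin n → Pt X} {Z : Pt X}
    (hZ : Pres p Y Z) (hY : ∀ i, Pres (q i) (fun j => A (blocks k hk ⟨i, j⟩)) (Y i)) (y : Z.c.I)
    (i : Fin n) (z : (Y i).c.I) (hz : hZ.e.symm y = ⟨i, z⟩) (j : Fin (k i))
    (x : (A (blocks k hk ⟨i, j⟩)).c.I) (hx : (hY i).e.symm z = ⟨j, x⟩) {p' : P.obj m}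
    {e : (P.gam k hk).obj (p, q) = p'} :
    ((Pres.gam k hk hZ hY).cast e).e.symm y = ⟨blocks k hk ⟨i, j⟩, x⟩ :=
  Pres.gam_symm k hk hZ hY y i z hz j x hx

theorem pi_symm₁ (A : Fin 4 → Pt X) (y) :
    (Pres.g₂ H (k₀ := 3) (k₁ := 1) rfl (H.tlP _) (Pres.one _) : Pres (P.g₂ (m := 4) rfl χ.t (P.tl χ.t) P.one) A ((H.o (H.o (H.o (A 0) (A 1)) (A 2)) (A 3)))).e.symm y =
      ((Pres.g₃ (k₀ := 2) (k₁ := 1) (k₂ := 1) rfl (H.tlP (fam₃ (H.o (A 0) (A 1)) (A 2) (A 3))) (H.ten _) (Pres.one _) (Pres.one _)).cast (P.pi_obj₃ χ.t) : Pres (P.g₂ (m := 4) rfl χ.t (P.tl χ.t) P.one) A ((H.o (H.o (H.o (A 0) (A 1)) (A 2)) (A 3)))).e.symm y :=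
  match y with
  | .inl (.inl (.inl x)) => (Pres.gam_symm ![3, 1] rfl (H.ten (fam (H.o (H.o (A 0) (A 1)) (A 2)) (A 3))) _ (.inl (.inl (.inl x))) 0 _ rfl (0 : Fin 3) _ rfl).trans
      (Pres.cast_gam_symm ![2, 1, 1] rfl (H.tlP (fam₃ (H.o (A 0) (A 1)) (A 2) (A 3))) _ (.inl (.inl (.inl x))) 0 _ rfl (0 : Fin 2) _ rfl).symm
  | .inl (.inl (.inr x)) => (Pres.gam_symm ![3, 1] rfl (H.ten (fam (H.o (H.o (A 0) (A 1)) (A 2)) (A 3))) _ (.inl (.inl (.inr x))) 0 _ rfl (1 : Fin 3) _ rfl).trans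
      (Pres.cast_gam_symm ![2, 1, 1] rfl (H.tlP (fam₃ (H.o (A 0) (A 1)) (A 2) (A 3))) _ (.inl (.inl (.inr x))) 0 _ rfl (1 : Fin 2) _ rfl).symm
  | .inl (.inr x) => (Pres.gam_symm ![3, 1] rfl (H.ten (fam (H.o (H.o (A 0) (A 1)) (A 2)) (A 3))) _ (.inl (.inr x)) 0 _ rfl (2 : Fin 3) _ rfl).trans
      (Pres.cast_gam_symm ![2, 1, 1] rfl (H.tlP (fam₃ (H.o (A 0) (A 1)) (A 2) (A 3))) _ (.inl (.inr x)) 1 _ rfl (0 : Fin 1) _ rfl).symm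
  | .inr x => (Pres.gam_symm ![3, 1] rfl (H.ten (fam (H.o (H.o (A 0) (A 1)) (A 2)) (A 3))) _ (.inr x) 1 _ rfl (0 : Fin 1) _ rfl).trans
      (Pres.cast_gam_symm ![2, 1, 1] rfl (H.tlP (fam₃ (H.o (A 0) (A 1)) (A 2) (A 3))) _ (.inr x) 2 _ rfl (0 : Fin 1) _ rfl).symm

theorem pi_symm₂ (A : Fin 4 → Pt X) (y) :
    (Pres.g₂ H (k₀ := 3) (k₁ := 1) rfl (H.trP _) (Pres.one _) : Pres (P.g₂ (m := 4) rfl χ.t (P.tr χ.t) P.one) A ((H.o (H.o (A 0) (H.o (A 1) (A 2))) (A 3)))).e.symm y =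
      ((Pres.g₃ (k₀ := 1) (k₁ := 2) (k₂ := 1) rfl (H.tlP (fam₃ (A 0) (H.o (A 1) (A 2)) (A 3))) (Pres.one _) (H.ten _) (Pres.one _)).cast (P.pi_obj₁ χ.t) : Pres (P.g₂ (m := 4) rfl χ.t (P.tr χ.t) P.one) A ((H.o (H.o (A 0) (H.o (A 1) (A 2))) (A 3)))).e.symm y :=
  match y with
  | .inl (.inl x) => (Pres.gam_symm ![3, 1] rfl (H.ten (fam (H.o (A 0) (H.o (A 1) (A 2))) (A 3))) _ (.inl (.inl x)) 0 _ rfl (0 : Fin 3) _ rfl).trans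
      (Pres.cast_gam_symm ![1, 2, 1] rfl (H.tlP (fam₃ (A 0) (H.o (A 1) (A 2)) (A 3))) _ (.inl (.inl x)) 0 _ rfl (0 : Fin 1) _ rfl).symm
  | .inl (.inr (.inl x)) => (Pres.gam_symm ![3, 1] rfl (H.ten (fam (H.o (A 0) (H.o (A 1) (A 2))) (A 3))) _ (.inl (.inr (.inl x))) 0 _ rfl (1 : Fin 3) _ rfl).trans
      (Pres.cast_gam_symm ![1, 2, 1] rfl (H.tlP (fam₃ (A 0) (H.o (A 1) (A 2)) (A 3))) _ (.inl (.inr (.inl x))) 1 _ rfl (0 : Fin 2) _ rfl).symm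
  | .inl (.inr (.inr x)) => (Pres.gam_symm ![3, 1] rfl (H.ten (fam (H.o (A 0) (H.o (A 1) (A 2))) (A 3))) _ (.inl (.inr (.inr x))) 0 _ rfl (2 : Fin 3) _ rfl).trans
      (Pres.cast_gam_symm ![1, 2, 1] rfl (H.tlP (fam₃ (A 0) (H.o (A 1) (A 2)) (A 3))) _ (.inl (.inr (.inr x))) 1 _ rfl (1 : Fin 2) _ rfl).symm
  | .inr x => (Pres.gam_symm ![3, 1] rfl (H.ten (fam (H.o (A 0) (H.o (A 1) (A 2))) (A 3))) _ (.inr x) 1 _ rfl (0 : Fin 1) _ rfl).trans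
      (Pres.cast_gam_symm ![1, 2, 1] rfl (H.tlP (fam₃ (A 0) (H.o (A 1) (A 2)) (A 3))) _ (.inr x) 2 _ rfl (0 : Fin 1) _ rfl).symm

theorem pi_symm₃ (A : Fin 4 → Pt X) (y) :
    ((Pres.g₃ (k₀ := 1) (k₁ := 2) (k₂ := 1) rfl (H.trP (fam₃ (A 0) (H.o (A 1) (A 2)) (A 3))) (Pres.one _) (H.ten _) (Pres.one _)).cast (P.pi_obj₂ χ.t) : Pres (P.g₂ (m := 4) rfl χ.t P.one (P.tl χ.t)) A ((H.o (A 0) (H.o (H.o (A 1) (A 2)) (A 3))))).e.symm y =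
      (Pres.g₂ H (k₀ := 1) (k₁ := 3) rfl (Pres.one _) (H.tlP _) : Pres (P.g₂ (m := 4) rfl χ.t P.one (P.tl χ.t)) A ((H.o (A 0) (H.o (H.o (A 1) (A 2)) (A 3))))).e.symm y :=
  match y with
  | .inl x => (Pres.cast_gam_symm ![1, 2, 1] rfl (H.trP (fam₃ (A 0) (H.o (A 1) (A 2)) (A 3))) _ (.inl x) 0 _ rfl (0 : Fin 1) _ rfl).trans
      (Pres.gam_symm ![1, 3] rfl (H.ten (fam (A 0) (H.o (H.o (A 1) (A 2)) (A 3)))) _ (.inl x) 0 _ rfl (0 : Fin 1) _ rfl).symm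
  | .inr (.inl (.inl x)) => (Pres.cast_gam_symm ![1, 2, 1] rfl (H.trP (fam₃ (A 0) (H.o (A 1) (A 2)) (A 3))) _ (.inr (.inl (.inl x))) 1 _ rfl (0 : Fin 2) _ rfl).trans
      (Pres.gam_symm ![1, 3] rfl (H.ten (fam (A 0) (H.o (H.o (A 1) (A 2)) (A 3)))) _ (.inr (.inl (.inl x))) 1 _ rfl (0 : Fin 3) _ rfl).symm
  | .inr (.inl (.inr x)) => (Pres.cast_gam_symm ![1, 2, 1] rfl (H.trP (fam₃ (A 0) (H.o (A 1) (A 2)) (A 3))) _ (.inr (.inl (.inr x))) 1 _ rfl (1 : Fin 2) _ rfl).trans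
      (Pres.gam_symm ![1, 3] rfl (H.ten (fam (A 0) (H.o (H.o (A 1) (A 2)) (A 3)))) _ (.inr (.inl (.inr x))) 1 _ rfl (1 : Fin 3) _ rfl).symm
  | .inr (.inr x) => (Pres.cast_gam_symm ![1, 2, 1] rfl (H.trP (fam₃ (A 0) (H.o (A 1) (A 2)) (A 3))) _ (.inr (.inr x)) 2 _ rfl (0 : Fin 1) _ rfl).trans
      (Pres.gam_symm ![1, 3] rfl (H.ten (fam (A 0) (H.o (H.o (A 1) (A 2)) (A 3)))) _ (.inr (.inr x)) 1 _ rfl (2 : Fin 3) _ rfl).symm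

theorem pi_symm₄ (A : Fin 4 → Pt X) (y) :
    (Pres.g₂ H (k₀ := 1) (k₁ := 3) rfl (Pres.one _) (H.trP _) : Pres (P.g₂ (m := 4) rfl χ.t P.one (P.tr χ.t)) A ((H.o (A 0) (H.o (A 1) (H.o (A 2) (A 3)))))).e.symm y =
      ((Pres.g₃ (k₀ := 1) (k₁ := 1) (k₂ := 2) rfl (H.trP (fam₃ (A 0) (A 1) (H.o (A 2) (A 3)))) (Pres.one _) (Pres.one _) (H.ten _)).cast (P.pi_obj₄ χ.t) : Pres (P.g₂ (m := 4) rfl χ.t P.one (P.tr χ.t)) A ((H.o (A 0) (H.o (A 1) (H.o (A 2) (A 3)))))).e.symm y :=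
  match y with
  | .inl x => (Pres.gam_symm ![1, 3] rfl (H.ten (fam (A 0) (H.o (A 1) (H.o (A 2) (A 3))))) _ (.inl x) 0 _ rfl (0 : Fin 1) _ rfl).trans
      (Pres.cast_gam_symm ![1, 1, 2] rfl (H.trP (fam₃ (A 0) (A 1) (H.o (A 2) (A 3)))) _ (.inl x) 0 _ rfl (0 : Fin 1) _ rfl).symm
  | .inr (.inl x) => (Pres.gam_symm ![1, 3] rfl (H.ten (fam (A 0) (H.o (A 1) (H.o (A 2) (A 3))))) _ (.inr (.inl x)) 1 _ rfl (0 : Fin 3) _ rfl).trans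
      (Pres.cast_gam_symm ![1, 1, 2] rfl (H.trP (fam₃ (A 0) (A 1) (H.o (A 2) (A 3)))) _ (.inr (.inl x)) 1 _ rfl (0 : Fin 1) _ rfl).symm
  | .inr (.inr (.inl x)) => (Pres.gam_symm ![1, 3] rfl (H.ten (fam (A 0) (H.o (A 1) (H.o (A 2) (A 3))))) _ (.inr (.inr (.inl x))) 1 _ rfl (1 : Fin 3) _ rfl).trans
      (Pres.cast_gam_symm ![1, 1, 2] rfl (H.trP (fam₃ (A 0) (A 1) (H.o (A 2) (A 3)))) _ (.inr (.inr (.inl x))) 2 _ rfl (0 : Fin 2) _ rfl).symm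
  | .inr (.inr (.inr x)) => (Pres.gam_symm ![1, 3] rfl (H.ten (fam (A 0) (H.o (A 1) (H.o (A 2) (A 3))))) _ (.inr (.inr (.inr x))) 1 _ rfl (2 : Fin 3) _ rfl).trans
      (Pres.cast_gam_symm ![1, 1, 2] rfl (H.trP (fam₃ (A 0) (A 1) (H.o (A 2) (A 3)))) _ (.inr (.inr (.inr x))) 2 _ rfl (1 : Fin 2) _ rfl).symm

theorem pi_symm₅ (A : Fin 4 → Pt X) (y) :
    ((Pres.g₃ (k₀ := 2) (k₁ := 1) (k₂ := 1) rfl (H.trP (fam₃ (H.o (A 0) (A 1)) (A 2) (A 3))) (H.ten _) (Pres.one _) (Pres.one _)).cast (P.pi_obj₅ χ.t) : Pres (P.g₃ (m := 4) rfl (P.tl χ.t) P.one P.one χ.t) A ((H.o (H.o (A 0) (A 1)) (H.o (A 2) (A 3))))).e.symm y =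
      ((Pres.g₃ (k₀ := 1) (k₁ := 1) (k₂ := 2) rfl (H.tlP (fam₃ (A 0) (A 1) (H.o (A 2) (A 3)))) (Pres.one _) (Pres.one _) (H.ten _)).cast rfl : Pres (P.g₃ (m := 4) rfl (P.tl χ.t) P.one P.one χ.t) A ((H.o (H.o (A 0) (A 1)) (H.o (A 2) (A 3))))).e.symm y :=
  match y with
  | .inl (.inl x) => (Pres.cast_gam_symm ![2, 1, 1] rfl (H.trP (fam₃ (H.o (A 0) (A 1)) (A 2) (A 3))) _ (.inl (.inl x)) 0 _ rfl (0 : Fin 2) _ rfl).trans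
      (Pres.cast_gam_symm ![1, 1, 2] rfl (H.tlP (fam₃ (A 0) (A 1) (H.o (A 2) (A 3)))) _ (.inl (.inl x)) 0 _ rfl (0 : Fin 1) _ rfl).symm
  | .inl (.inr x) => (Pres.cast_gam_symm ![2, 1, 1] rfl (H.trP (fam₃ (H.o (A 0) (A 1)) (A 2) (A 3))) _ (.inl (.inr x)) 0 _ rfl (1 : Fin 2) _ rfl).trans
      (Pres.cast_gam_symm ![1, 1, 2] rfl (H.tlP (fam₃ (A 0) (A 1) (H.o (A 2) (A 3)))) _ (.inl (.inr x)) 1 _ rfl (0 : Fin 1) _ rfl).symm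
  | .inr (.inl x) => (Pres.cast_gam_symm ![2, 1, 1] rfl (H.trP (fam₃ (H.o (A 0) (A 1)) (A 2) (A 3))) _ (.inr (.inl x)) 1 _ rfl (0 : Fin 1) _ rfl).trans
      (Pres.cast_gam_symm ![1, 1, 2] rfl (H.tlP (fam₃ (A 0) (A 1) (H.o (A 2) (A 3)))) _ (.inr (.inl x)) 2 _ rfl (0 : Fin 2) _ rfl).symm
  | .inr (.inr x) => (Pres.cast_gam_symm ![2, 1, 1] rfl (H.trP (fam₃ (H.o (A 0) (A 1)) (A 2) (A 3))) _ (.inr (.inr x)) 2 _ rfl (0 : Fin 1) _ rfl).trans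
      (Pres.cast_gam_symm ![1, 1, 2] rfl (H.tlP (fam₃ (A 0) (A 1) (H.o (A 2) (A 3)))) _ (.inr (.inr x)) 2 _ rfl (1 : Fin 2) _ rfl).symm

theorem pi_pres₁ (A : Fin 4 → Pt X) :
    HomPres (A := A) (Pres.g₂ H (k₀ := 3) (k₁ := 1) rfl (H.tlP _) (Pres.one _)) (Pres.g₂ H (k₀ := 3) (k₁ := 1) rfl (H.trP _) (Pres.one _))
      (P.g₂Map (m := 4) rfl (𝟙 χ.t) χ.α.hom (𝟙 P.one)) (fun i => 𝟙 (A i)) (H.m (H.pa (A 0) (A 1) (A 2)) (𝟙 (A 3)))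
      (H.evC rfl χ.α.hom (𝟙 P.one) (as A) (H.a _).cmp (oneC X _)) :=
  HomPres.evC H rfl (H.pa_pres _) (HomPres.oneC _)

theorem pi_pres₂ (A : Fin 4 → Pt X) :
    HomPres (A := A) ((Pres.g₃ (k₀ := 1) (k₁ := 2) (k₂ := 1) rfl (H.tlP (fam₃ (A 0) (H.o (A 1) (A 2)) (A 3))) (Pres.one _) (H.ten _) (Pres.one _)).cast (P.pi_obj₁ χ.t)) ((Pres.g₃ (k₀ := 1) (k₁ := 2) (k₂ := 1) rfl (H.trP (fam₃ (A 0) (H.o (A 1) (A 2)) (A 3))) (Pres.one _) (H.ten _) (Pres.one _)).cast (P.pi_obj₂ χ.t))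
      ((P.g₃Map (m := 4) rfl χ.α.hom (𝟙 P.one) (𝟙 χ.t) (𝟙 P.one)).cast (P.pi_obj₁ χ.t) (P.pi_obj₂ χ.t)) (fun i => 𝟙 (A i)) (H.pa (A 0) (H.o (A 1) (A 2)) (A 3))
      (castC _ (P.pi_obj₁ χ.t) (P.pi_obj₂ χ.t) (as A)
        (H.aC rfl P.one χ.t P.one (as A) (X.one_obj _) (H.tens_obj _) (X.one_obj _))) :=
  (HomPres.aC H rfl (Pres.one _) (H.ten _) (Pres.one _)).castC (P.pi_obj₁ χ.t) (P.pi_obj₂ χ.t)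

theorem pi_pres₃ (A : Fin 4 → Pt X) :
    HomPres (A := A) (Pres.g₂ H (k₀ := 1) (k₁ := 3) rfl (Pres.one _) (H.tlP _)) (Pres.g₂ H (k₀ := 1) (k₁ := 3) rfl (Pres.one _) (H.trP _))
      (P.g₂Map (m := 4) rfl (𝟙 χ.t) (𝟙 P.one) χ.α.hom) (fun i => 𝟙 (A i)) (H.m (𝟙 (A 0)) (H.pa (A 1) (A 2) (A 3)))
      (H.evC rfl (𝟙 P.one) χ.α.hom (as A) (oneC X _) (H.a _).cmp) :=
  HomPres.evC H rfl (HomPres.oneC _) (H.pa_pres _)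

theorem pi_pres₄ (A : Fin 4 → Pt X) :
    HomPres (A := A) ((Pres.g₃ (k₀ := 2) (k₁ := 1) (k₂ := 1) rfl (H.tlP (fam₃ (H.o (A 0) (A 1)) (A 2) (A 3))) (H.ten _) (Pres.one _) (Pres.one _)).cast (P.pi_obj₃ χ.t)) ((Pres.g₃ (k₀ := 2) (k₁ := 1) (k₂ := 1) rfl (H.trP (fam₃ (H.o (A 0) (A 1)) (A 2) (A 3))) (H.ten _) (Pres.one _) (Pres.one _)).cast (P.pi_obj₅ χ.t))
      ((P.g₃Map (m := 4) rfl χ.α.hom (𝟙 χ.t) (𝟙 P.one) (𝟙 P.one)).cast (P.pi_obj₃ χ.t) (P.pi_obj₅ χ.t)) (fun i => 𝟙 (A i)) (H.pa (H.o (A 0) (A 1)) (A 2) (A 3))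
      (castC _ (P.pi_obj₃ χ.t) (P.pi_obj₅ χ.t) (as A)
        (H.aC rfl χ.t P.one P.one (as A) (H.tens_obj _) (X.one_obj _) (X.one_obj _))) :=
  (HomPres.aC H rfl (H.ten _) (Pres.one _) (Pres.one _)).castC (P.pi_obj₃ χ.t) (P.pi_obj₅ χ.t)

theorem pi_pres₅ (A : Fin 4 → Pt X) :
    HomPres (A := A) ((Pres.g₃ (k₀ := 1) (k₁ := 1) (k₂ := 2) rfl (H.tlP (fam₃ (A 0) (A 1) (H.o (A 2) (A 3)))) (Pres.one _) (Pres.one _) (H.ten _)).cast rfl) ((Pres.g₃ (k₀ := 1) (k₁ := 1) (k₂ := 2) rfl (H.trP (fam₃ (A 0) (A 1) (H.o (A 2) (A 3)))) (Pres.one _) (Pres.one _) (H.ten _)).cast (P.pi_obj₄ χ.t))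
      ((P.g₃Map (m := 4) rfl χ.α.hom (𝟙 P.one) (𝟙 P.one) (𝟙 χ.t)).cast rfl (P.pi_obj₄ χ.t)) (fun i => 𝟙 (A i)) (H.pa (A 0) (A 1) (H.o (A 2) (A 3)))
      (castC _ rfl (P.pi_obj₄ χ.t) (as A)
        (H.aC rfl P.one P.one χ.t (as A) (X.one_obj _) (X.one_obj _) (H.tens_obj _))) :=
  (HomPres.aC H rfl (Pres.one _) (Pres.one _) (H.ten _)).castC rfl (P.pi_obj₄ χ.t)

theorem piSrc_pres (A : Fin 4 → Pt X) :
    HomPres (Pres.g₂ H (k₀ := 3) (k₁ := 1) rfl (H.tlP _) (Pres.one _)) (Pres.g₂ H (k₀ := 1) (k₁ := 3) rfl (Pres.one _) (H.trP _))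
      (P.g₂Map (m := 4) rfl (𝟙 χ.t) χ.α.hom (𝟙 P.one) ≫
      (P.g₃Map (m := 4) rfl χ.α.hom (𝟙 P.one) (𝟙 χ.t) (𝟙 P.one)).cast (P.pi_obj₁ χ.t) (P.pi_obj₂ χ.t) ≫
        P.g₂Map (m := 4) rfl (𝟙 χ.t) (𝟙 P.one) χ.α.hom)
      (fun i => 𝟙 (A i)) (H.m (H.pa (A 0) (A 1) (A 2)) (𝟙 (A 3)) ≫ H.pa (A 0) (H.o (A 1) (A 2)) (A 3) ≫
      H.m (𝟙 (A 0)) (H.pa (A 1) (A 2) (A 3))) (H.piSrc (as A)) :=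
  (H.pi_pres₁ A).comp_ev' ((H.pi_pres₂ A).comp_ev' (H.pi_pres₃ A) (H.pi_symm₃ A)) (H.pi_symm₂ A)

theorem piTgt_pres (A : Fin 4 → Pt X) :
    HomPres ((Pres.g₃ (k₀ := 2) (k₁ := 1) (k₂ := 1) rfl (H.tlP (fam₃ (H.o (A 0) (A 1)) (A 2) (A 3))) (H.ten _) (Pres.one _) (Pres.one _)).cast (P.pi_obj₃ χ.t)) ((Pres.g₃ (k₀ := 1) (k₁ := 1) (k₂ := 2) rfl (H.trP (fam₃ (A 0) (A 1) (H.o (A 2) (A 3)))) (Pres.one _) (Pres.one _) (H.ten _)).cast (P.pi_obj₄ χ.t))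
      ((P.g₃Map (m := 4) rfl χ.α.hom (𝟙 χ.t) (𝟙 P.one) (𝟙 P.one)).cast (P.pi_obj₃ χ.t) (P.pi_obj₅ χ.t) ≫
      (P.g₃Map (m := 4) rfl χ.α.hom (𝟙 P.one) (𝟙 P.one) (𝟙 χ.t)).cast rfl (P.pi_obj₄ χ.t))
      (fun i => 𝟙 (A i)) (H.pa (H.o (A 0) (A 1)) (A 2) (A 3) ≫ H.pa (A 0) (A 1) (H.o (A 2) (A 3))) (H.piTgt (as A)) :=
  (H.pi_pres₄ A).comp_ev' (H.pi_pres₅ A) (H.pi_symm₅ A)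

theorem muSrc_pres (A : Fin 2 → Pt X) :
    HomPres (Pres.g₂ H (k₀ := 1) (k₁ := 1) rfl (Pres.one _) (Pres.one _)) (Pres.g₂ H (k₀ := 1) (k₁ := 1) rfl (Pres.one _) (Pres.one _))
      (P.g₂Map (m := 2) rfl (𝟙 χ.t) χ.r.hom (𝟙 P.one) ≫
      (P.g₃Map (m := 2) rfl χ.α.hom (𝟙 P.one) (𝟙 χ.i) (𝟙 P.one)).cast (P.mu_obj₁ χ.t χ.i) (P.mu_obj₂ χ.t χ.i) ≫
        P.g₂Map (m := 2) rfl (𝟙 χ.t) (𝟙 P.one) χ.l.hom)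
      (fun i => 𝟙 (A i)) (H.m (H.pr (A 0)) (𝟙 (A 1)) ≫ H.pa (A 0) H.pe (A 1) ≫ H.m (𝟙 (A 0)) (H.pl (A 1))) (H.muSrc (as A)) :=
  (HomPres.evC H rfl (H.pr_pres _) (HomPres.oneC _)).comp_ev'
    (((HomPres.aC H rfl (Pres.one _) (H.zero _) (Pres.one _)).castC (P.mu_obj₁ χ.t χ.i) (P.mu_obj₂ χ.t χ.i)).comp_ev'
      (HomPres.evC H rfl (HomPres.oneC _) (H.pl_pres _)) (fun y => match y with
        | .inl x => rfl
        | .inr (.inl x) => Empty.elim x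
        | .inr (.inr x) => rfl)) (fun y => match y with
        | .inl (.inl x) => rfl
        | .inl (.inr x) => Empty.elim x
        | .inr x => rfl)

theorem muTgt_pres (A : Fin 2 → Pt X) :
    HomPres (Pres.g₂ H (k₀ := 1) (k₁ := 1) rfl (Pres.one _) (Pres.one _)) (Pres.g₂ H (k₀ := 1) (k₁ := 1) rfl (Pres.one _) (Pres.one _))
      (𝟙 (P.g₂ (m := 2) rfl χ.t P.one P.one))
      (fun i => 𝟙 (A i)) (𝟙 (H.o (A 0) (A 1))) (H.muTgt (as A)) :=
  HomPres.id (Pres.g₂ H (k₀ := 1) (k₁ := 1) rfl (Pres.one _) (Pres.one _))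

theorem lamSrc_pres (A : Fin 2 → Pt X) :
    HomPres (Pres.g₂ H (k₀ := 1) (k₁ := 1) rfl (H.ulP _) (Pres.one _)) (Pres.g₂ H (k₀ := 1) (k₁ := 1) rfl (Pres.one _) (Pres.one _))
      (P.g₂Map (m := 2) rfl (𝟙 χ.t) χ.l.hom (𝟙 P.one))
      (fun i => 𝟙 (A i)) (H.m (H.pl (A 0)) (𝟙 (A 1))) (H.lamSrc (as A)) :=
  HomPres.evC H rfl (H.pl_pres _) (HomPres.oneC _)

theorem lamTgt_pres (A : Fin 2 → Pt X) :
    HomPres ((Pres.g₃ (k₀ := 0) (k₁ := 1) (k₂ := 1) rfl (H.tlP (fam₃ _ _ _)) (H.zero _) (Pres.one _) (Pres.one _)).cast (P.lam_obj₁ χ.t χ.i)) ((Pres.g₁ (k := 2) rfl (Pres.one (fam₁ _)) (H.ten _)).cast (P.lam_obj₃ χ.t))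
      ((P.g₃Map (m := 2) rfl χ.α.hom (𝟙 χ.i) (𝟙 P.one) (𝟙 P.one)).cast (P.lam_obj₁ χ.t χ.i) (P.lam_obj₂ χ.t χ.i) ≫
      (P.g₁Map (m := 2) rfl χ.l.hom (𝟙 χ.t)).cast rfl (P.lam_obj₃ χ.t))
      (fun i => 𝟙 (A i)) (H.pa H.pe (A 0) (A 1) ≫ H.pl (H.o (A 0) (A 1))) (H.lamTgt (as A)) :=
  ((HomPres.aC H rfl (H.zero _) (Pres.one _) (Pres.one _)).castC (P.lam_obj₁ χ.t χ.i) (P.lam_obj₂ χ.t χ.i)).comp_ev'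
    ((HomPres.lC H rfl (H.ten _)).castC rfl (P.lam_obj₃ χ.t)) (fun y => match y with
        | .inl x => Empty.elim x
        | .inr (.inl x) => rfl
        | .inr (.inr x) => rfl)

theorem rhoSrc_pres (A : Fin 2 → Pt X) :
    HomPres (Pres.g₂ H (k₀ := 1) (k₁ := 1) rfl (Pres.one _) (Pres.one _)) (Pres.g₂ H (k₀ := 1) (k₁ := 1) rfl (Pres.one _) (H.urP _))
      (P.g₂Map (m := 2) rfl (𝟙 χ.t) (𝟙 P.one) χ.r.hom)
      (fun i => 𝟙 (A i)) (H.m (𝟙 (A 0)) (H.pr (A 1))) (H.rhoSrc (as A)) :=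
  HomPres.evC H rfl (HomPres.oneC _) (H.pr_pres _)

theorem rhoTgt_pres (A : Fin 2 → Pt X) :
    HomPres ((Pres.g₁ (k := 2) rfl (Pres.one (fam₁ _)) (H.ten _)).cast (P.lam_obj₃ χ.t)) ((Pres.g₃ (k₀ := 1) (k₁ := 1) (k₂ := 0) rfl (H.trP (fam₃ _ _ _)) (Pres.one _) (Pres.one _) (H.zero _)).cast (P.rho_obj₁ χ.t χ.i))
      ((P.g₁Map (m := 2) rfl χ.r.hom (𝟙 χ.t)).cast (P.lam_obj₃ χ.t) (P.rho_obj₂ χ.t χ.i) ≫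
      (P.g₃Map (m := 2) rfl χ.α.hom (𝟙 P.one) (𝟙 P.one) (𝟙 χ.i)).cast rfl (P.rho_obj₁ χ.t χ.i))
      (fun i => 𝟙 (A i)) (H.pr (H.o (A 0) (A 1)) ≫ H.pa (A 0) (A 1) H.pe) (H.rhoTgt (as A)) :=
  ((HomPres.rC H rfl (H.ten _)).castC (P.lam_obj₃ χ.t) (P.rho_obj₂ χ.t χ.i)).comp_ev'
    ((HomPres.aC H rfl (Pres.one _) (Pres.one _) (H.zero _)).castC rfl (P.rho_obj₁ χ.t χ.i)) (fun y => match y with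
        | .inl (.inl x) => rfl
        | .inl (.inr x) => rfl
        | .inr x => Empty.elim x)

theorem RSrc_pres (A : Fin 3 → Pt X) :
    HomPres (H.tlP A) ((Pres.act Operad.σ₁₂ (Pres.act Operad.σ₂₃ (H.trP _))).cast (P.R_obj χ.t))
      (Operad.braidLeft χ.β.hom ≫ P.dotMap χ.α.hom Operad.σ₁₂ ≫
      (P.dotMap (Operad.braidRight χ.β.hom) Operad.σ₁₂).cast rfl (P.R_obj χ.t))
      (fun i => 𝟙 (A i)) (H.m (H.pb (A 0) (A 1)) (𝟙 (A 2)) ≫ H.pa (A 1) (A 0) (A 2) ≫ H.m (𝟙 (A 1)) (H.pb (A 0) (A 2))) (H.RSrc (as A)) :=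
  (H.bl_pres A).comp_ev' ((HomPres.actC Operad.σ₁₂ (H.pa_pres fun i => A (Operad.σ₁₂⁻¹ i))).comp_ev'
    ((HomPres.actC Operad.σ₁₂ (H.br_pres fun i => A (Operad.σ₁₂⁻¹ i))).castC rfl (P.R_obj χ.t)) (fun y => match y with
        | .inl x => rfl
        | .inr (.inl x) => rfl
        | .inr (.inr x) => rfl)) (fun y => match y with
        | .inl (.inl x) => rfl
        | .inl (.inr x) => rfl
        | .inr x => rfl)

theorem RTgt_pres (A : Fin 3 → Pt X) :
    HomPres (H.tlP A) (Pres.act Operad.σ₁₃₂ (H.trP _))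
      (χ.α.hom ≫ Operad.dotLeft χ.β.hom ≫ P.dotMap χ.α.hom Operad.σ₁₃₂)
      (fun i => 𝟙 (A i)) (H.pa (A 0) (A 1) (A 2) ≫ H.pb (A 0) (H.o (A 1) (A 2)) ≫ H.pa (A 1) (A 2) (A 0)) (H.RTgt (as A)) :=
  (H.pa_pres A).comp_ev' (HomPres.comp_ev' (HomPres.castC (p' := P.tr χ.t)
    (HomPres.bC H rfl (Pres.one _) (H.ten _)) rfl (P.dot_obj_left χ.t))
      (HomPres.actC Operad.σ₁₃₂ (H.pa_pres fun i => A (Operad.σ₁₃₂⁻¹ i))) (fun y => match y with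
        | .inl (.inl x) => rfl
        | .inl (.inr x) => rfl
        | .inr x => rfl)) (fun y => match y with
        | .inl x => rfl
        | .inr (.inl x) => rfl
        | .inr (.inr x) => rfl)

theorem SSrc_pres (A : Fin 3 → Pt X) :
    HomPres (H.trP A) ((Pres.act Operad.σ₂₃ (Pres.act Operad.σ₁₂ (H.tlP _))).cast (P.S_obj χ.t))
      (Operad.braidRight χ.β.hom ≫ P.dotMap χ.α.inv Operad.σ₂₃ ≫
      (P.dotMap (Operad.braidLeft χ.β.hom) Operad.σ₂₃).cast rfl (P.S_obj χ.t))
      (fun i => 𝟙 (A i)) (H.m (𝟙 (A 0)) (H.pb (A 1) (A 2)) ≫ H.pai (A 0) (A 2) (A 1) ≫ H.m (H.pb (A 0) (A 2)) (𝟙 (A 1))) (H.SSrc (as A)) :=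
  (H.br_pres A).comp_ev' ((HomPres.actC Operad.σ₂₃ (H.pai_pres fun i => A (Operad.σ₂₃⁻¹ i))).comp_ev'
    ((HomPres.actC Operad.σ₂₃ (H.bl_pres fun i => A (Operad.σ₂₃⁻¹ i))).castC rfl (P.S_obj χ.t)) (fun y => match y with
        | .inl (.inl x) => rfl
        | .inl (.inr x) => rfl
        | .inr x => rfl)) (fun y => match y with
        | .inl x => rfl
        | .inr (.inl x) => rfl
        | .inr (.inr x) => rfl)

theorem STgt_pres (A : Fin 3 → Pt X) :
    HomPres (H.trP A) (Pres.act Operad.σ₁₂₃ (H.tlP _))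
      (χ.α.inv ≫ Operad.dotRight χ.β.hom ≫ P.dotMap χ.α.inv Operad.σ₁₂₃)
      (fun i => 𝟙 (A i)) (H.pai (A 0) (A 1) (A 2) ≫ H.pb (H.o (A 0) (A 1)) (A 2) ≫ H.pai (A 2) (A 0) (A 1)) (H.STgt (as A)) :=
  (H.pai_pres A).comp_ev' (HomPres.comp_ev' (HomPres.castC (p' := P.tl χ.t)
    (HomPres.bC H rfl (H.ten _) (Pres.one _)) rfl (P.dot_obj_right χ.t))
      (HomPres.actC Operad.σ₁₂₃ (H.pai_pres fun i => A (Operad.σ₁₂₃⁻¹ i))) (fun y => match y with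
        | .inl x => rfl
        | .inr (.inl x) => rfl
        | .inr (.inr x) => rfl)) (fun y => match y with
        | .inl (.inl x) => rfl
        | .inl (.inr x) => rfl
        | .inr x => rfl)

theorem sylSrc_pres (A : Fin 2 → Pt X) :
    HomPres (H.ten A) ((Pres.act Operad.σ₁₂ (Pres.act Operad.σ₁₂ (H.ten _))).cast (P.v_obj χ.t))
      (χ.β.hom ≫ (P.dotMap χ.β.hom Operad.σ₁₂).cast rfl (P.v_obj χ.t))
      (fun i => 𝟙 (A i)) (H.pb (A 0) (A 1) ≫ H.pb (A 1) (A 0)) (H.sylSrc (as A)) :=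
  (H.pb_pres A).comp_ev' ((HomPres.actC Operad.σ₁₂ (H.pb_pres fun i => A (Operad.σ₁₂⁻¹ i))).castC rfl (P.v_obj χ.t)) (fun y => match y with
        | .inl x => rfl
        | .inr x => rfl)

theorem sylTgt_pres (A : Fin 2 → Pt X) :
    HomPres (H.ten A) (H.ten A)
      (𝟙 χ.t)
      (fun i => 𝟙 (A i)) (𝟙 (H.o (A 0) (A 1))) (H.sylTgt (as A)) :=
  HomPres.id (H.ten A)

/-- The pentagonator on presented objects. -/
def piPt (K : H.Mods) (A B C D : Pt X) :
    H.m (H.pa A B C) (𝟙 D) ≫ H.pa A (H.o B C) D ≫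
      H.m (𝟙 A) (H.pa B C D) ≅
      H.pa (H.o A B) C D ≫ H.pa A B (H.o C D) :=
  Pt.iso' (H.piSrc_pres (fam₄ A B C D)) (H.piTgt_pres (fam₄ A B C D)) (ζ := χ.π)
    (K.pi A.a B.a C.a D.a) (K.pi_carries (as (fam₄ A B C D)))
    (H.pi_symm₁ (fam₄ A B C D)) (H.pi_symm₄ (fam₄ A B C D))

/-- The middle unit modification on presented objects. -/
def muPt (K : H.Mods) (A B : Pt X) :
    H.m (H.pr A) (𝟙 B) ≫ H.pa A H.pe B ≫ H.m (𝟙 A) (H.pl B) ≅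
      𝟙 (H.o A B) :=
  Pt.iso' (H.muSrc_pres (fam A B)) (H.muTgt_pres (fam A B)) (ζ := χ.μ)
    (K.mu A.a B.a) (K.mu_carries (as (fam A B)))
    (fun y => match y with
        | .inl x => rfl
        | .inr x => rfl) (fun y => match y with
        | .inl x => rfl
        | .inr x => rfl)

/-- The left unit modification on presented objects. -/
def lamPt (K : H.Mods) (A B : Pt X) :
    H.m (H.pl A) (𝟙 B) ≅
      H.pa H.pe A B ≫ H.pl (H.o A B) :=
  Pt.iso' (H.lamSrc_pres (fam A B)) (H.lamTgt_pres (fam A B)) (ζ := χ.lam)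
    (K.lam A.a B.a) (K.lam_carries (as (fam A B)))
    (fun y => match y with
        | .inl (.inl x) => Empty.elim x
        | .inl (.inr x) => rfl
        | .inr x => rfl) (fun y => match y with
        | .inl x => rfl
        | .inr x => rfl)

/-- The right unit modification on presented objects. -/
def rhoPt (K : H.Mods) (A B : Pt X) :
    H.m (𝟙 A) (H.pr B) ≅
      H.pr (H.o A B) ≫ H.pa A B H.pe :=
  Pt.iso' (H.rhoSrc_pres (fam A B)) (H.rhoTgt_pres (fam A B)) (ζ := χ.ρ)
    (K.rho A.a B.a) (K.rho_carries (as (fam A B)))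
    (fun y => match y with
        | .inl x => rfl
        | .inr x => rfl) (fun y => match y with
        | .inl x => rfl
        | .inr (.inl x) => rfl
        | .inr (.inr x) => Empty.elim x)

/-- The first hexagon modification on presented objects. -/
def RPt (K : H.Mods) (A B C : Pt X) :
    H.m (H.pb A B) (𝟙 C) ≫ H.pa B A C ≫ H.m (𝟙 B) (H.pb A C) ≅
      H.pa A B C ≫ H.pb A (H.o B C) ≫ H.pa B C A :=
  Pt.iso' (H.RSrc_pres (fam₃ A B C)) (H.RTgt_pres (fam₃ A B C)) (ζ := χ.R)
    (K.R A.a B.a C.a) (K.R_carries (as (fam₃ A B C)))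
    (fun y => match y with
        | .inl (.inl x) => rfl
        | .inl (.inr x) => rfl
        | .inr x => rfl) (fun y => match y with
        | .inl x => rfl
        | .inr (.inl x) => rfl
        | .inr (.inr x) => rfl)

/-- The second hexagon modification on presented objects. -/
def SPt (K : H.Mods) (A B C : Pt X) :
    H.m (𝟙 A) (H.pb B C) ≫ H.pai A C B ≫ H.m (H.pb A C) (𝟙 B) ≅
      H.pai A B C ≫ H.pb (H.o A B) C ≫ H.pai C A B :=
  Pt.iso' (H.SSrc_pres (fam₃ A B C)) (H.STgt_pres (fam₃ A B C)) (ζ := χ.S)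
    (K.S A.a B.a C.a) (K.S_carries (as (fam₃ A B C)))
    (fun y => match y with
        | .inl x => rfl
        | .inr (.inl x) => rfl
        | .inr (.inr x) => rfl) (fun y => match y with
        | .inl (.inl x) => rfl
        | .inl (.inr x) => rfl
        | .inr x => rfl)

/-- The syllepsis on presented objects. -/
def sylPt (K : H.Mods) (A B : Pt X) :
    H.pb A B ≫ H.pb B A ≅
      𝟙 (H.o A B) :=
  Pt.iso' (H.sylSrc_pres (fam A B)) (H.sylTgt_pres (fam A B)) (ζ := χ.v)
    (K.syl A.a B.a) (K.syl_carries (as (fam A B)))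
    (fun y => match y with
        | .inl x => rfl
        | .inr x => rfl) (fun y => match y with
        | .inl x => rfl
        | .inr x => rfl)

end InducedCells

end

end SMTwo

namespace SMTwo

section

variable {P : Operad.{w, v, u}} {X : PAlg.{w, v, u, w₁, v₁, u₁} P}

/-- A set with one element. -/
def Ctx.one : Ctx := ⟨Unit, 1, Equiv.ofUnique _ _⟩

theorem Elem.val_letter {x y : X.carrier} (f : x ⟶ y) :
    Same ((Elem.val X Ctx.one).map ((𝟙 P.one ×ₘ fun _ => f) :
      ((P.one, fun _ => x) : Elem P X Ctx.one) ⟶ (P.one, fun _ => y))) f := by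
  unfold Elem.val
  exact X.one_same fun _ => f

namespace Pt

/-- An object presented by itself. -/
def letter (x : X.carrier) : Pt X where
  a := x
  c := Ctx.one
  s := (P.one, fun _ => x)
  hs := (Elem.val_letter (𝟙 x)).src

/-- A 1-cell presented by itself. -/
def letterMap {x y : X.carrier} (f : x ⟶ y) : letter x ⟶ letter y :=
  show Hom _ _ from
  { g := f
    σ := Equiv.refl _
    raw := ⟨(P.one, fun _ => x), (P.one, fun _ => y), 𝟙 P.one ×ₘ fun _ => f,
      (Elem.val_letter f).cmp⟩
    hs := rfl
    ht := (Elem.re_refl_obj _).symm }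

/-- Parallel presented 2-cells are equal. -/
theorem hom_ext {A B : Pt X} {f g : A ⟶ B} (hc : IsContractible (P.obj A.c.n)) (η θ : f ⟶ g) :
    η = θ :=
  Hom₂.ext (congrArg Iso.hom (Cmp.ofIso_injective (Rel.unique hc (Hom₂.rel η) (Hom₂.rel θ))))

end Pt

namespace InducedCells

open Pt

variable {χ : ChoiceOfMult P} {s : MonCells X.carrier} (H : InducedCells χ X s)

theorem pi_natural (hP : ∀ n ≤ 5, IsContractible (P.obj n)) (S : H.Squares) (K : H.Mods)
    {x y z w x' y' z' w' : X.carrier} (f : x ⟶ x') (g : y ⟶ y') (h : z ⟶ z') (k : w ⟶ w') :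
    s.m (s.m (s.m f g) h) k ◁ (K.pi x' y' z' w').hom ≫
      (Sq.comp (s.aSq (s.m f g) h k)
        (s.aSq f g (s.m h k))).hom =
    (Sq.comp (s.mSq (s.aSq f g h) (Sq.id k))
      (Sq.comp (s.aSq f (s.m g h) k)
        (s.mSq (Sq.id f) (s.aSq g h k)))).hom ≫
      (K.pi x y z w).hom ▷ s.m f (s.m g (s.m h k)) := by
  have h : (H.cellsPt S).m ((H.cellsPt S).m ((H.cellsPt S).m (letterMap f) (letterMap g)) (letterMap h)) (letterMap k) ◁ (H.piPt K (letter x') (letter y') (letter z') (letter w')).hom ≫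
      (Sq.comp ((H.cellsPt S).aSq ((H.cellsPt S).m (letterMap f) (letterMap g)) (letterMap h) (letterMap k))
        ((H.cellsPt S).aSq (letterMap f) (letterMap g) ((H.cellsPt S).m (letterMap h) (letterMap k)))).hom =
    (Sq.comp ((H.cellsPt S).mSq ((H.cellsPt S).aSq (letterMap f) (letterMap g) (letterMap h)) (Sq.id (letterMap k)))
      (Sq.comp ((H.cellsPt S).aSq (letterMap f) ((H.cellsPt S).m (letterMap g) (letterMap h)) (letterMap k))
        ((H.cellsPt S).mSq (Sq.id (letterMap f)) ((H.cellsPt S).aSq (letterMap g) (letterMap h) (letterMap k))))).hom ≫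
      (H.piPt K (letter x) (letter y) (letter z) (letter w)).hom ▷ (H.cellsPt S).m (letterMap f) ((H.cellsPt S).m (letterMap g) ((H.cellsPt S).m (letterMap h) (letterMap k))) :=
    Pt.hom_ext (hP 4 (by decide)) _ _
  exact congrArg (fun η : Hom₂ _ _ => η.θ.hom) h

theorem mu_natural (hP : ∀ n ≤ 5, IsContractible (P.obj n)) (S : H.Squares) (K : H.Mods)
    {x y x' y' : X.carrier} (f : x ⟶ x') (g : y ⟶ y') :
    s.m f g ◁ (K.mu x' y').hom ≫ (Sq.id (s.m f g)).hom =
    (Sq.comp (s.mSq (s.rSq f) (Sq.id g))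
      (Sq.comp (s.aSq f (𝟙 s.e) g)
        (s.mSq (Sq.id f) (s.lSq g)))).hom ≫
      (K.mu x y).hom ▷ s.m f g := by
  have h : (H.cellsPt S).m (letterMap f) (letterMap g) ◁ (H.muPt K (letter x') (letter y')).hom ≫ (Sq.id ((H.cellsPt S).m (letterMap f) (letterMap g))).hom =
    (Sq.comp ((H.cellsPt S).mSq ((H.cellsPt S).rSq (letterMap f)) (Sq.id (letterMap g)))
      (Sq.comp ((H.cellsPt S).aSq (letterMap f) (𝟙 (H.cellsPt S).e) (letterMap g))
        ((H.cellsPt S).mSq (Sq.id (letterMap f)) ((H.cellsPt S).lSq (letterMap g))))).hom ≫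
      (H.muPt K (letter x) (letter y)).hom ▷ (H.cellsPt S).m (letterMap f) (letterMap g) :=
    Pt.hom_ext (hP 2 (by decide)) _ _
  exact congrArg (fun η : Hom₂ _ _ => η.θ.hom) h

theorem lam_natural (hP : ∀ n ≤ 5, IsContractible (P.obj n)) (S : H.Squares) (K : H.Mods)
    {x y x' y' : X.carrier} (f : x ⟶ x') (g : y ⟶ y') :
    s.m (s.m (𝟙 s.e) f) g ◁ (K.lam x' y').hom ≫
      (Sq.comp (s.aSq (𝟙 s.e) f g) (s.lSq (s.m f g))).hom =
    (s.mSq (s.lSq f) (Sq.id g)).hom ≫ (K.lam x y).hom ▷ s.m f g := by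
  have h : (H.cellsPt S).m ((H.cellsPt S).m (𝟙 (H.cellsPt S).e) (letterMap f)) (letterMap g) ◁ (H.lamPt K (letter x') (letter y')).hom ≫
      (Sq.comp ((H.cellsPt S).aSq (𝟙 (H.cellsPt S).e) (letterMap f) (letterMap g)) ((H.cellsPt S).lSq ((H.cellsPt S).m (letterMap f) (letterMap g)))).hom =
    ((H.cellsPt S).mSq ((H.cellsPt S).lSq (letterMap f)) (Sq.id (letterMap g))).hom ≫ (H.lamPt K (letter x) (letter y)).hom ▷ (H.cellsPt S).m (letterMap f) (letterMap g) :=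
    Pt.hom_ext (hP 2 (by decide)) _ _
  exact congrArg (fun η : Hom₂ _ _ => η.θ.hom) h

theorem rho_natural (hP : ∀ n ≤ 5, IsContractible (P.obj n)) (S : H.Squares) (K : H.Mods)
    {x y x' y' : X.carrier} (f : x ⟶ x') (g : y ⟶ y') :
    s.m f g ◁ (K.rho x' y').hom ≫
      (Sq.comp (s.rSq (s.m f g)) (s.aSq f g (𝟙 s.e))).hom =
    (s.mSq (Sq.id f) (s.rSq g)).hom ≫
      (K.rho x y).hom ▷ s.m f (s.m g (𝟙 s.e)) := by
  have h : (H.cellsPt S).m (letterMap f) (letterMap g) ◁ (H.rhoPt K (letter x') (letter y')).hom ≫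
      (Sq.comp ((H.cellsPt S).rSq ((H.cellsPt S).m (letterMap f) (letterMap g))) ((H.cellsPt S).aSq (letterMap f) (letterMap g) (𝟙 (H.cellsPt S).e))).hom =
    ((H.cellsPt S).mSq (Sq.id (letterMap f)) ((H.cellsPt S).rSq (letterMap g))).hom ≫
      (H.rhoPt K (letter x) (letter y)).hom ▷ (H.cellsPt S).m (letterMap f) ((H.cellsPt S).m (letterMap g) (𝟙 (H.cellsPt S).e)) :=
    Pt.hom_ext (hP 2 (by decide)) _ _
  exact congrArg (fun η : Hom₂ _ _ => η.θ.hom) h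

theorem R_natural (hP : ∀ n ≤ 5, IsContractible (P.obj n)) (S : H.Squares) (K : H.Mods)
    {x y z x' y' z' : X.carrier} (f : x ⟶ x') (g : y ⟶ y') (h : z ⟶ z') :
    s.m (s.m f g) h ◁ (K.R x' y' z').hom ≫
      (Sq.comp (s.aSq f g h)
        (Sq.comp (s.bSq f (s.m g h)) (s.aSq g h f))).hom =
    (Sq.comp (s.mSq (s.bSq f g) (Sq.id h))
      (Sq.comp (s.aSq g f h)
        (s.mSq (Sq.id g) (s.bSq f h)))).hom ≫
      (K.R x y z).hom ▷ s.m g (s.m h f) := by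
  have h : (H.cellsPt S).m ((H.cellsPt S).m (letterMap f) (letterMap g)) (letterMap h) ◁ (H.RPt K (letter x') (letter y') (letter z')).hom ≫
      (Sq.comp ((H.cellsPt S).aSq (letterMap f) (letterMap g) (letterMap h))
        (Sq.comp ((H.cellsPt S).bSq (letterMap f) ((H.cellsPt S).m (letterMap g) (letterMap h))) ((H.cellsPt S).aSq (letterMap g) (letterMap h) (letterMap f)))).hom =
    (Sq.comp ((H.cellsPt S).mSq ((H.cellsPt S).bSq (letterMap f) (letterMap g)) (Sq.id (letterMap h)))
      (Sq.comp ((H.cellsPt S).aSq (letterMap g) (letterMap f) (letterMap h))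
        ((H.cellsPt S).mSq (Sq.id (letterMap g)) ((H.cellsPt S).bSq (letterMap f) (letterMap h))))).hom ≫
      (H.RPt K (letter x) (letter y) (letter z)).hom ▷ (H.cellsPt S).m (letterMap g) ((H.cellsPt S).m (letterMap h) (letterMap f)) :=
    Pt.hom_ext (hP 3 (by decide)) _ _
  exact congrArg (fun η : Hom₂ _ _ => η.θ.hom) h

theorem S_natural (hP : ∀ n ≤ 5, IsContractible (P.obj n)) (S : H.Squares) (K : H.Mods)
    {x y z x' y' z' : X.carrier} (f : x ⟶ x') (g : y ⟶ y') (h : z ⟶ z') :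
    s.m f (s.m g h) ◁ (K.S x' y' z').hom ≫
      (Sq.comp (s.aiSq f g h)
        (Sq.comp (s.bSq (s.m f g) h) (s.aiSq h f g))).hom =
    (Sq.comp (s.mSq (Sq.id f) (s.bSq g h))
      (Sq.comp (s.aiSq f h g)
        (s.mSq (s.bSq f h) (Sq.id g)))).hom ≫
      (K.S x y z).hom ▷ s.m (s.m h f) g := by
  have h : (H.cellsPt S).m (letterMap f) ((H.cellsPt S).m (letterMap g) (letterMap h)) ◁ (H.SPt K (letter x') (letter y') (letter z')).hom ≫
      (Sq.comp ((H.cellsPt S).aiSq (letterMap f) (letterMap g) (letterMap h))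
        (Sq.comp ((H.cellsPt S).bSq ((H.cellsPt S).m (letterMap f) (letterMap g)) (letterMap h)) ((H.cellsPt S).aiSq (letterMap h) (letterMap f) (letterMap g)))).hom =
    (Sq.comp ((H.cellsPt S).mSq (Sq.id (letterMap f)) ((H.cellsPt S).bSq (letterMap g) (letterMap h)))
      (Sq.comp ((H.cellsPt S).aiSq (letterMap f) (letterMap h) (letterMap g))
        ((H.cellsPt S).mSq ((H.cellsPt S).bSq (letterMap f) (letterMap h)) (Sq.id (letterMap g))))).hom ≫
      (H.SPt K (letter x) (letter y) (letter z)).hom ▷ (H.cellsPt S).m ((H.cellsPt S).m (letterMap h) (letterMap f)) (letterMap g) :=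
    Pt.hom_ext (hP 3 (by decide)) _ _
  exact congrArg (fun η : Hom₂ _ _ => η.θ.hom) h

theorem syl_natural (hP : ∀ n ≤ 5, IsContractible (P.obj n)) (S : H.Squares) (K : H.Mods)
    {x y x' y' : X.carrier} (f : x ⟶ x') (g : y ⟶ y') :
    s.m f g ◁ (K.syl x' y').hom ≫ (Sq.id (s.m f g)).hom =
    (Sq.comp (s.bSq f g) (s.bSq g f)).hom ≫
      (K.syl x y).hom ▷ s.m f g := by
  have h : (H.cellsPt S).m (letterMap f) (letterMap g) ◁ (H.sylPt K (letter x') (letter y')).hom ≫ (Sq.id ((H.cellsPt S).m (letterMap f) (letterMap g))).hom =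
    (Sq.comp ((H.cellsPt S).bSq (letterMap f) (letterMap g)) ((H.cellsPt S).bSq (letterMap g) (letterMap f))).hom ≫
      (H.sylPt K (letter x) (letter y)).hom ▷ (H.cellsPt S).m (letterMap f) (letterMap g) :=
    Pt.hom_ext (hP 2 (by decide)) _ _
  exact congrArg (fun η : Hom₂ _ _ => η.θ.hom) h

end InducedCells

end

end SMTwo

namespace SMTwo

section

variable {P : Operad.{w, v, u}} {X : PAlg.{w, v, u, w₁, v₁, u₁} P}

namespace Pt

theorem hom_eq_of {A B : Pt X} {f g : A ⟶ B} {η θ : f ⟶ g} (hc : IsContractible (P.obj A.c.n))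
    {p : Prop} (_ : p → η = θ) : η.θ.hom = θ.θ.hom :=
  congrArg (fun η : Hom₂ _ _ => η.θ.hom) (hom_ext hc η θ)

theorem iso_eq_of {A B : Pt X} {f g : A ⟶ B} {η θ : f ≅ g} (hc : IsContractible (P.obj A.c.n))
    {p : Prop} (_ : p → η = θ) : η.hom.θ.hom = θ.hom.θ.hom :=
  congrArg (fun η : Hom₂ _ _ => η.θ.hom) (hom_ext hc η.hom θ.hom)

end Pt

namespace InducedCells

open Pt

variable {χ : ChoiceOfMult P} {s : MonCells X.carrier} (H : InducedCells χ X s)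
  (hP : ∀ n ≤ 5, IsContractible (P.obj n)) (S : H.Squares) (K : H.Mods)

/-- The data of the symmetric monoidal structure determined by a choice of multiplication. -/
def symMonData : SymMonData X.carrier where
  toMonCells := s
  pi := K.pi
  pi_natural := H.pi_natural hP S K
  mu := K.mu
  mu_natural := H.mu_natural hP S K
  lam := K.lam
  lam_natural := H.lam_natural hP S K
  rho := K.rho
  rho_natural := H.rho_natural hP S K
  R := K.R
  R_natural := H.R_natural hP S K
  S := K.S
  S_natural := H.S_natural hP S K
  syl := K.syl
  syl_natural := H.syl_natural hP S K

/-- The data of the symmetric monoidal structure on presented objects. -/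
def symMonDataPt : SymMonData (Pt X) where
  toMonCells := H.cellsPt S
  pi := H.piPt K
  pi_natural f g h k := Hom₂.ext (H.pi_natural hP S K (valMap₁ f) (valMap₁ g) (valMap₁ h) (valMap₁ k))
  mu := H.muPt K
  mu_natural f g := Hom₂.ext (H.mu_natural hP S K (valMap₁ f) (valMap₁ g))
  lam := H.lamPt K
  lam_natural f g := Hom₂.ext (H.lam_natural hP S K (valMap₁ f) (valMap₁ g))
  rho := H.rhoPt K
  rho_natural f g := Hom₂.ext (H.rho_natural hP S K (valMap₁ f) (valMap₁ g))
  R := H.RPt K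
  R_natural f g h := Hom₂.ext (H.R_natural hP S K (valMap₁ f) (valMap₁ g) (valMap₁ h))
  S := H.SPt K
  S_natural f g h := Hom₂.ext (H.S_natural hP S K (valMap₁ f) (valMap₁ g) (valMap₁ h))
  syl := H.sylPt K
  syl_natural f g := Hom₂.ext (H.syl_natural hP S K (valMap₁ f) (valMap₁ g))

theorem assoc_law : (H.symMonData hP S K).AssocAxiom := fun x y z w u =>
  hom_eq_of (hP 5 (by decide))
    fun h : (H.symMonDataPt hP S K).AssocAxiom => h (letter x) (letter y) (letter z) (letter w) (letter u)

theorem left_normalization : (H.symMonData hP S K).LeftNormalization := fun x y z =>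
  hom_eq_of (hP 3 (by decide))
    fun h : (H.symMonDataPt hP S K).LeftNormalization => h (letter x) (letter y) (letter z)

theorem right_normalization : (H.symMonData hP S K).RightNormalization := fun x y z =>
  hom_eq_of (hP 3 (by decide))
    fun h : (H.symMonDataPt hP S K).RightNormalization => h (letter x) (letter y) (letter z)

theorem braid_law₁ : (H.symMonData hP S K).BraidAxiom₁ := fun x y z w =>
  hom_eq_of (hP 4 (by decide))
    fun h : (H.symMonDataPt hP S K).BraidAxiom₁ => h (letter x) (letter y) (letter z) (letter w)

theorem braid_law₂ : (H.symMonData hP S K).BraidAxiom₂ := fun x y z w =>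
  Iso.ext (iso_eq_of (hP 4 (by decide))
    fun h : (H.symMonDataPt hP S K).BraidAxiom₂ => h (letter x) (letter y) (letter z) (letter w))

theorem braid_law₃ : (H.symMonData hP S K).BraidAxiom₃ := fun x y z w =>
  Iso.ext (iso_eq_of (hP 4 (by decide))
    fun h : (H.symMonDataPt hP S K).BraidAxiom₃ => h (letter x) (letter y) (letter z) (letter w))

theorem braid_law₄ : (H.symMonData hP S K).BraidAxiom₄ := fun x y z =>
  Iso.ext (iso_eq_of (hP 3 (by decide))
    fun h : (H.symMonDataPt hP S K).BraidAxiom₄ => h (letter x) (letter y) (letter z))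

theorem sylleptic_law₁ : (H.symMonData hP S K).SyllepticAxiom₁ := fun x y z =>
  Iso.ext (iso_eq_of (hP 3 (by decide))
    fun h : (H.symMonDataPt hP S K).SyllepticAxiom₁ => h (letter x) (letter y) (letter z))

theorem sylleptic_law₂ : (H.symMonData hP S K).SyllepticAxiom₂ := fun x y z =>
  Iso.ext (iso_eq_of (hP 3 (by decide))
    fun h : (H.symMonDataPt hP S K).SyllepticAxiom₂ => h (letter x) (letter y) (letter z))

theorem symmetry_law : (H.symMonData hP S K).SymmetryAxiom := fun x y =>
  Iso.ext (iso_eq_of (hP 2 (by decide))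
    fun h : (H.symMonDataPt hP S K).SymmetryAxiom => h (letter x) (letter y))

/-- The symmetric monoidal structure determined by a choice of multiplication. -/
def symMon : SymMon X.carrier :=
  ⟨H.symMonData hP S K, H.assoc_law hP S K, H.left_normalization hP S K,
    H.right_normalization hP S K, H.braid_law₁ hP S K, H.braid_law₂ hP S K, H.braid_law₃ hP S K,
    H.braid_law₄ hP S K, H.sylleptic_law₁ hP S K, H.sylleptic_law₂ hP S K,
    H.symmetry_law hP S K⟩

theorem induced : Induced χ X (H.symMon hP S K) where
  cells := H
  aSq F := S.aSq F
  aiSq F := S.aiSq F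
  lSq F := S.lSq F
  liSq F := S.liSq F
  rSq F := S.rSq F
  riSq F := S.riSq F
  bSq F := S.bSq F
  biSq F := S.biSq F
  aUnit x := S.aUnit x
  aCounit x := S.aCounit x
  lUnit x := S.lUnit x
  lCounit x := S.lCounit x
  rUnit x := S.rUnit x
  rCounit x := S.rCounit x
  bUnit x := S.bUnit x
  bCounit x := S.bCounit x
  pi x := K.pi_carries x
  mu x := K.mu_carries x
  lam x := K.lam_carries x
  rho x := K.rho_carries x
  R x := K.R_carries x
  S x := K.S_carries x
  syl x := K.syl_carries x

end InducedCells

/-- A symmetric monoidal structure on an algebra is determined by a choice of multiplication. -/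
theorem exists_induced (X : PAlg.{w, v, u, w₁, v₁, u₁} P)
    (hP : ∀ n ≤ 5, IsContractible (P.obj n)) (χ : ChoiceOfMult P) :
    ∃ s : SymMon X.carrier, Induced χ X s :=
  have ⟨_, H, S⟩ := exists_inducedCells X χ
  ⟨H.symMon hP S H.mods, H.induced hP S H.mods⟩

end

end SMTwo

namespace SMTwo

section

variable {B : Type u₁} [Bicategory.{w₁, v₁} B] {C : Type u₂} [Bicategory.{w₂, v₂} C]

/-- Comparisons in the source and in the target of a pseudofunctor which correspond under
comparisons of their ends. -/
def Compat (F : B ⥤ᵖ C) {a b a' b' : B} {f : a ⟶ b} {g : a' ⟶ b'} {c d c' d' : C} {f₁ : c ⟶ d}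
    {g₁ : c' ⟶ d'} (ψ : Cmp f g) (ψ' : Cmp f₁ g₁) (ω : Cmp (F.map f) f₁)
    (ω' : Cmp (F.map g) g₁) : Prop :=
  (ψ.map F).trans ω' = ω.trans ψ'

namespace Compat

variable {F : B ⥤ᵖ C} {a b a' b' a'' b'' : B} {f : a ⟶ b} {g : a' ⟶ b'} {h : a'' ⟶ b''}
  {c d c' d' c'' d'' : C} {f₁ : c ⟶ d} {g₁ : c' ⟶ d'} {h₁ : c'' ⟶ d''}

theorem refl (ω : Cmp (F.map f) f₁) :
    Compat F (Cmp.ofIso (Iso.refl f)) (Cmp.ofIso (Iso.refl f₁)) ω ω :=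
  Cmp.id_map_trans ω |>.trans (Cmp.trans_ofIso_refl ω).symm

theorem trans {ψ : Cmp f g} {ψ' : Cmp f₁ g₁} {φ : Cmp g h} {φ' : Cmp g₁ h₁}
    {ω : Cmp (F.map f) f₁} {ω' : Cmp (F.map g) g₁} {ω'' : Cmp (F.map h) h₁}
    (e : Compat F ψ ψ' ω ω') (e' : Compat F φ φ' ω' ω'') :
    Compat F (ψ.trans φ) (ψ'.trans φ') ω ω'' :=
  (congrArg (Cmp.trans · _) (Cmp.map_trans F ψ φ)).trans ((Cmp.trans_assoc _ _ _).trans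
    ((congrArg (Cmp.trans _) e').trans ((Cmp.trans_assoc _ _ _).symm.trans
      ((congrArg (Cmp.trans · _) e).trans (Cmp.trans_assoc _ _ _)))))

theorem symm {ψ : Cmp f g} {ψ' : Cmp f₁ g₁} {ω : Cmp (F.map f) f₁} {ω' : Cmp (F.map g) g₁}
    (e : Compat F ψ ψ' ω ω') : Compat F ψ.symm ψ'.symm ω' ω := by
  have e : (ψ.map F).trans ω' = ω.trans ψ' := e
  refine (congrArg (Cmp.trans · _) (Cmp.symm_map F ψ)).trans ?_
  refine Cmp.trans_left_cancel (φ := ψ.map F) ?_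
  rw [Cmp.symm_trans_trans, ← Cmp.trans_assoc, e, Cmp.trans_assoc, Cmp.trans_symm,
    Cmp.trans_ofIso_refl]

theorem comp {k : b ⟶ a''} {k' : b' ⟶ b''} {k₁ : d ⟶ c''} {k₁' : d' ⟶ d''} {ψ : Cmp f g}
    {ψ' : Cmp f₁ g₁} {φ : Cmp k k'} {φ' : Cmp k₁ k₁'} {ω : Cmp (F.map f) f₁}
    {ω' : Cmp (F.map g) g₁} {σ : Cmp (F.map k) k₁} {σ' : Cmp (F.map k') k₁'}
    (e : Compat F ψ ψ' ω ω') (e' : Compat F φ φ' σ σ') :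
    Compat F (ψ.comp φ) (ψ'.comp φ') (compCmp F ω σ) (compCmp F ω' σ') :=
  (compCmp_natural F ψ φ ω' σ').trans ((congrArg₂ (compCmp F) e e').trans
    (compCmp_trans F ω σ ψ' φ'))

theorem congr {ψ : Cmp f g} {ψ' : Cmp f₁ g₁} {φ : Cmp f g} {φ' : Cmp f₁ g₁}
    {ω σ : Cmp (F.map f) f₁} {ω' σ' : Cmp (F.map g) g₁} (e : Compat F ψ ψ' ω ω') (h₁ : ψ = φ)
    (h₂ : ψ' = φ') (h₃ : ω = σ) (h₄ : ω' = σ') : Compat F φ φ' σ σ' := by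
  subst h₁ h₂ h₃ h₄
  exact e

theorem leftUnitor {e : F.obj a = c} (ω : Cmp (F.map f) f₁) :
    Compat F (Cmp.ofIso (λ_ f)) (Cmp.ofIso (λ_ f₁)) (compCmp F (idCmp F e) ω) ω :=
  compCmp_id_left F e ω

theorem rightUnitor {e : F.obj b = d} (ω : Cmp (F.map f) f₁) :
    Compat F (Cmp.ofIso (ρ_ f)) (Cmp.ofIso (ρ_ f₁)) (compCmp F ω (idCmp F e)) ω :=
  compCmp_id_right F e ω

end Compat

theorem idCmp_refl (F : B ⥤ᵖ C) (a : B) : idCmp F (a := a) rfl = Cmp.ofIso (F.mapId a) :=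
  Cmp.trans_ofIso_refl _

theorem Carries.symm {a b a' b' : B} {f g : a ⟶ b} {f' g' : a' ⟶ b'} {φ : Cmp f f'}
    {ψ : Cmp g g'} {θ : f ⟶ g} {θ' : f' ⟶ g'} (h : Carries φ ψ θ θ') :
    Carries φ.symm ψ.symm θ' θ := by
  obtain ⟨rfl, rfl, i⟩ := φ
  obtain ⟨_, _, j⟩ := ψ
  obtain rfl := eq_of_heq h
  change f ≅ f' at i
  change g ≅ g' at j
  refine heq_of_eq ?_
  change i.hom ≫ (i.inv ≫ θ ≫ j.hom) ≫ j.inv = θ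
  simp

theorem Carries.congr {a b a' b' : B} {f g : a ⟶ b} {f' g' : a' ⟶ b'} {φ φ' : Cmp f f'}
    {ψ ψ' : Cmp g g'} {θ : f ⟶ g} {θ' : f' ⟶ g'} (h : Carries φ ψ θ θ') (e : φ = φ')
    (e' : ψ = ψ') : Carries φ' ψ' θ θ' := by
  subst e e'
  exact h

theorem Carries.transfer {F : B ⥤ᵖ C} {a b a' b' : B} {f g : a ⟶ b} {k l : a' ⟶ b'}
    {c d c' d' : C} {f₁ g₁ : c ⟶ d} {k₁ l₁ : c' ⟶ d'} {ψ : Cmp f k} {φ : Cmp g l}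
    {ψ' : Cmp f₁ k₁} {φ' : Cmp g₁ l₁} {ω : Cmp (F.map f) f₁} {σ : Cmp (F.map g) g₁}
    {ω' : Cmp (F.map k) k₁} {σ' : Cmp (F.map l) l₁} {θ : f ⟶ g} {κ : k ⟶ l} {θ₁ : f₁ ⟶ g₁}
    {κ₁ : k₁ ⟶ l₁} (hX : Carries ψ φ θ κ) (hY : Carries ψ' φ' θ₁ κ₁)
    (hω : Carries ω σ (F.map₂ θ) θ₁) (h : Compat F ψ ψ' ω ω') (h' : Compat F φ φ' σ σ') :
    Carries ω' σ' (F.map₂ κ) κ₁ := by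
  refine ((Cmp.carries_map F hX).symm.trans (hω.trans hY)).congr ?_ ?_
  · exact (congrArg (Cmp.trans _) (Eq.symm h)).trans (Cmp.trans_symm_trans _ _)
  · exact (congrArg (Cmp.trans _) (Eq.symm h')).trans (Cmp.trans_symm_trans _ _)

theorem Carries.ofPF {F G : B ⥤ᵖ C} (h : F = G) {a b : B} {f g : a ⟶ b} (θ : f ⟶ g) :
    Carries (Cmp.ofPF h f) (Cmp.ofPF h g) (F.map₂ θ) (G.map₂ θ) := by
  subst h
  exact Cmp.carries_refl _

theorem Carries.pair_id {p q : B} {κ κ' : p ⟶ q} (θ : κ ⟶ κ') {x y x' y' : C} {F : x ⟶ y}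
    {F' : x' ⟶ y'} (φ : Cmp F F') :
    Carries ((Cmp.ofIso (Iso.refl κ)).pair φ) ((Cmp.ofIso (Iso.refl κ')).pair φ)
      ((θ, 𝟙 F) : (κ ×ₘ F) ⟶ (κ' ×ₘ F)) ((θ, 𝟙 F') : (κ ×ₘ F') ⟶ (κ' ×ₘ F')) := by
  obtain ⟨rfl, rfl, i⟩ := φ
  change F ≅ F' at i
  refine heq_of_eq (Prod.ext ?_ ?_)
  · exact (Category.id_comp _).trans (Category.comp_id _)
  · exact (congrArg (i.inv ≫ ·) (Category.id_comp _)).trans i.inv_hom_id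

end

section

variable {P : Operad.{w, v, u}} {X Y : PAlg.{w, v, u, w₁, v₁, u₁} P} (F : X ⟶ Y)

namespace PAlg

/-- The comparison of `F(μ(κ; G))` with `μ(κ; G')` induced by comparisons of `F(Gᵢ)` with
`G'ᵢ`. -/
def appC {n : ℕ} {p q : P.obj n} (κ : p ⟶ q) {x y : Fin n → X.carrier} {x' y' : Fin n → Y.carrier}
    {G : x ⟶ y} {G' : x' ⟶ y'} (ω : ∀ i, Cmp (F.toPF.map (G i)) (G' i)) :
    Cmp (F.toPF.map (X.app κ G)) (Y.app κ G') :=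
  (Cmp.ofPF (F.comm n) (κ ×ₘ G)).trans
    (Cmp.muMap Y (F := fun i => F.toPF.map (G i)) (Cmp.ofIso (Iso.refl κ)) ω)

variable {n : ℕ} {p q r p' q' : P.obj n} {κ : p ⟶ q} {x y z w a b : Fin n → X.carrier}
  {x' y' z' w' a' b' : Fin n → Y.carrier} {G : x ⟶ y} {G' : x' ⟶ y'} {K : z ⟶ w} {K' : z' ⟶ w'}

theorem appC_congr {ω ω' : ∀ i, Cmp (F.toPF.map (G i)) (G' i)} (h : ∀ i, ω i = ω' i) :
    appC F κ ω = appC F κ ω' := by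
  obtain rfl : ω = ω' := funext h
  rfl

theorem appC_muMap (ω : ∀ i, Cmp (F.toPF.map (G i)) (G' i)) (φ : ∀ i, Cmp (G' i) (K' i)) :
    (appC F κ ω).trans (Cmp.muMap Y (Cmp.ofIso (Iso.refl κ)) φ) =
      appC F κ fun i => (ω i).trans (φ i) :=
  (Cmp.trans_assoc _ _ _).trans (congrArg (Cmp.trans _) ((Cmp.muMap_trans _ _ _ _).trans
    (Cmp.muMap_congr (Cmp.trans_ofIso_refl _) fun i => rfl)))

theorem map_muMap_appC {κ' : p' ⟶ q'} (θ : Cmp κ κ') (φ : ∀ i, Cmp (G i) (K i))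
    (ω : ∀ i, Cmp (F.toPF.map (K i)) (K' i)) :
    ((Cmp.muMap X θ φ).map F.toPF).trans (appC F κ' ω) =
      (Cmp.ofPF (F.comm n) (κ ×ₘ G)).trans (Cmp.muMap Y (F := fun i => F.toPF.map (G i)) θ
        fun i => ((φ i).map F.toPF).trans (ω i)) := by
  have key : ∀ Φ : Cmp G K, (θ.pair Φ).map
      ((prodMap (Pseudofunctor.id (P.obj n)) (powMap (Fin n) F.toPF)).comp (Y.mu n)) =
      Cmp.muMap Y (F := fun i => F.toPF.map (G i)) (F' := fun i => F.toPF.map (K i)) θ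
        fun i => (Φ.map (proj (fun _ => X.carrier) i)).map F.toPF := fun Φ => by
    obtain ⟨rfl, rfl, _⟩ := θ
    obtain ⟨rfl, rfl, _⟩ := Φ
    rfl
  refine (Cmp.trans_assoc _ _ _).symm.trans ((congrArg (Cmp.trans · _)
    ((congrArg (Cmp.trans · _) (Cmp.map_comp _ _ _).symm).trans
      (Cmp.ofPF_trans_map (F.comm n) (θ.pair (Cmp.pi φ))).symm)).trans ?_)
  refine (Cmp.trans_assoc _ _ _).trans (congrArg (Cmp.trans _) ?_)
  refine (congrArg (Cmp.trans · _) (key _)).trans ((Cmp.muMap_trans _ _ _ _).trans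
    (Cmp.muMap_congr (Cmp.trans_ofIso_refl _) fun i => ?_))
  exact congrArg (fun ψ => (Cmp.map F.toPF ψ).trans (ω i)) (Cmp.pi_map_proj φ i)

theorem compat_muMap {κ' : p' ⟶ q'} (θ : Cmp κ κ') {φ : ∀ i, Cmp (G i) (K i)}
    {φ' : ∀ i, Cmp (G' i) (K' i)} {ω : ∀ i, Cmp (F.toPF.map (G i)) (G' i)}
    {ω' : ∀ i, Cmp (F.toPF.map (K i)) (K' i)}
    (h : ∀ i, Compat F.toPF (φ i) (φ' i) (ω i) (ω' i)) :
    Compat F.toPF (Cmp.muMap X θ φ) (Cmp.muMap Y θ φ') (appC F κ ω) (appC F κ' ω') :=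
  (map_muMap_appC F θ φ ω').trans (Eq.trans (congrArg (Cmp.trans _)
    ((Cmp.muMap_congr (Cmp.ofIso_refl_trans θ).symm h).trans (Cmp.muMap_trans _ _ _ _).symm))
      (Cmp.trans_assoc _ _ _).symm)

theorem compat_mapComp {κ' : q ⟶ r} {L : y ⟶ z} {L' : y' ⟶ z'}
    (ω : ∀ i, Cmp (F.toPF.map (G i)) (G' i)) (σ : ∀ i, Cmp (F.toPF.map (L i)) (L' i)) :
    Compat F.toPF (Cmp.ofIso ((X.mu n).mapComp (κ ×ₘ G) (κ' ×ₘ L)))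
      (Cmp.ofIso ((Y.mu n).mapComp (κ ×ₘ G') (κ' ×ₘ L')))
      (appC F (κ ≫ κ') (G := G ≫ L) (G' := G' ≫ L') fun i => compCmp F.toPF (ω i) (σ i))
      (compCmp F.toPF (appC F κ ω) (appC F κ' σ)) := by
  let N := prodMap (Pseudofunctor.id (P.obj n)) (powMap (Fin n) F.toPF)
  let Ω : Cmp (N.map (κ ×ₘ G)) (κ ×ₘ G') := (Cmp.ofIso (Iso.refl κ)).pair (Cmp.pi ω)
  let S : Cmp (N.map (κ' ×ₘ L)) (κ' ×ₘ L') := (Cmp.ofIso (Iso.refl κ')).pair (Cmp.pi σ)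
  have e₁ := compCmp_pf_comp (X.mu n) F.toPF (f := κ ×ₘ G) (g := κ' ×ₘ L) (appC F κ ω)
    (appC F κ' σ)
  have e₂ := compCmp_ofPF _ (F.comm n) (Ω.map (Y.mu n)) (S.map (Y.mu n))
  have e₄ : compCmp N Ω S = (Cmp.ofIso (Iso.refl (κ ≫ κ'))).pair
      (Cmp.pi fun i => compCmp F.toPF (ω i) (σ i)) := by
    refine (compCmp_pair _ _ _ _ _ _).trans (congrArg₂ Cmp.pair ?_ ?_)
    · exact (compCmp_refl _ _ _).trans (congrArg (Cmp.mk rfl rfl) (Iso.ext (Category.id_comp _)))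
    · refine (compCmp_pf_comp (sndP (P.obj n) (Fin n → X.carrier)) (powMap (Fin n) F.toPF)
        (f := κ ×ₘ G) (g := κ' ×ₘ L) (Cmp.pi ω) (Cmp.pi σ)).trans ((Cmp.id_map_trans _).trans ?_)
      refine (compCmp_lift (fun i => (proj (fun _ => X.carrier) i).comp F.toPF) ω σ).trans
        (congrArg Cmp.pi (funext fun i => ?_))
      exact (compCmp_pf_comp (proj (fun _ => X.carrier) i) F.toPF (f := G) (g := L) (ω i)
        (σ i)).trans (Cmp.id_map_trans _)
  refine e₁.symm.trans (e₂.trans (Eq.trans (congrArg (Cmp.trans _) ?_)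
    (Cmp.trans_assoc _ _ _).symm))
  refine (StrictCells.compCmp_comp' (F := N) (G := Y.mu n) (φ := Ω) (ψ := S)
    (Cmp.trans_ofIso_refl _).symm (Cmp.trans_ofIso_refl _).symm).trans ?_
  exact congrArg₂ Cmp.trans (congrArg (Cmp.map (Y.mu n)) e₄) (compCmp_refl _ _ _)

theorem compat_nat (κ : p ⟶ q) (ω : ∀ i, Cmp (F.toPF.map (G i)) (G' i)) (hx : ∀ i, F.toPF.obj (x i) = x' i)
    (hy : ∀ i, F.toPF.obj (y i) = y' i) :
    Compat F.toPF (Cmp.ofIso (X.nat κ G)) (Cmp.ofIso (Y.nat κ G'))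
      (compCmp F.toPF (appC F (𝟙 p) ω)
        (appC F κ (G := 𝟙 y) (G' := 𝟙 y') fun i => idCmp F.toPF (hy i)))
      (compCmp F.toPF (appC F κ (G := 𝟙 x) (G' := 𝟙 x') fun i => idCmp F.toPF (hx i))
        (appC F (𝟙 q) ω)) := by
  have e := compat_muMap F (κ := 𝟙 p ≫ κ) (G := G ≫ 𝟙 y) (G' := G' ≫ 𝟙 y') (K := 𝟙 x ≫ G)
    (K' := 𝟙 x' ≫ G') (κ' := κ ≫ 𝟙 q) (Cmp.ofIso (λ_ κ ≪≫ (ρ_ κ).symm)) fun i =>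
      (Compat.rightUnitor (e := hy i) (ω i)).trans (Compat.leftUnitor (e := hx i) (ω i)).symm
  exact (compat_mapComp F ω fun i => idCmp F.toPF (hy i)).symm.trans (e.trans
    (compat_mapComp F (fun i => idCmp F.toPF (hx i)) ω))

theorem compat_mapId (p : P.obj n) (x : Fin n → X.carrier)
    (h : F.toPF.obj ((X.mu n).obj (p, x)) = (Y.mu n).obj (p, fun i => F.toPF.obj (x i))) :
    Compat F.toPF (idCmp (X.mu n) (a := (p, x)) rfl)
      (idCmp (Y.mu n) (a := (p, fun i => F.toPF.obj (x i))) rfl) (homC F (𝟙 p) x)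
      (idCmp F.toPF h) := by
  let N := prodMap (Pseudofunctor.id (P.obj n)) (powMap (Fin n) F.toPF)
  have e₁ := idCmp_comp (X.mu n) F.toPF (a := (p, x)) rfl h
  have e₂ := idCmp_ofPF _ (F.comm n) (a := (p, x)) rfl
  have e₃ := idCmp_comp N (Y.mu n) (a := (p, x)) rfl rfl
  have e₄ : idCmp N (a := (p, x)) rfl = (Cmp.ofIso (Iso.refl (𝟙 p))).pair
      (Cmp.pi fun i => Cmp.ofIso (F.toPF.mapId (x i))) := by
    refine (idCmp_pair _ _ _).trans (congrArg₂ Cmp.pair ?_ ?_)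
    · exact (idCmp_refl _ _).trans (congrArg (Cmp.mk rfl rfl) (Iso.ext (Category.id_comp _)))
    · refine (idCmp_refl _ _).trans (congrArg (Cmp.mk rfl rfl) (Iso.ext (funext fun i => ?_)))
      change F.toPF.map₂ (𝟙 _) ≫ F.toPF.map₂ (𝟙 _) ≫ (F.toPF.mapId (x i)).hom = _
      exact (congrArg₂ (fun a b => a ≫ b ≫ _) (F.toPF.map₂_id _) (F.toPF.map₂_id _)).trans
        ((Category.id_comp _).trans (Category.id_comp _))
  refine e₁.symm.trans (e₂.trans (Eq.trans (congrArg (Cmp.trans _) ?_) (Cmp.trans_assoc _ _ _).symm))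
  exact e₃.trans (congrArg (fun ψ => (Cmp.map (Y.mu n) ψ).trans _) e₄)

end PAlg

end

end SMTwo

namespace SMTwo

section

variable {B : Type u₁} [Bicategory.{w₁, v₁} B] {C : Type u₂} [Bicategory.{w₂, v₂} C]

/-- Comparisons which are identities are compatible as soon as they are so up to a naturality
square. -/
theorem Compat.of_natural {F : B ⥤ᵖ C} {a b a' b' : B} {f : a ⟶ b} {g : a' ⟶ b'} {c d c' d' : C}
    {f₁ : c ⟶ d} {g₁ : c' ⟶ d'} {e k e' k' : C} {l : e ⟶ k} {l' : e' ⟶ k'} {ψ : Cmp f g}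
    {ψ' : Cmp f₁ g₁} (hψ : ψ.IsEq) {ι : Cmp (F.map f) l} {ι' : Cmp (F.map g) l'} (hι : ι.IsEq)
    (hι' : ι'.IsEq) {σ : Cmp l l'} (hσ : σ.IsEq) {ω : Cmp l f₁} {ω' : Cmp l' g₁}
    (h : σ.trans ω' = ω.trans ψ') : Compat F ψ ψ' (ι.trans ω) (ι'.trans ω') := by
  refine (Cmp.trans_assoc _ _ _).symm.trans (Eq.trans ?_ (Cmp.trans_assoc _ _ _).symm)
  rw [← h, ← Cmp.trans_assoc]
  exact congrArg (Cmp.trans · _) (((hψ.map F).trans hι').unique (hι.trans hσ))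

theorem Compat.idCmp_cast {F : B ⥤ᵖ C} {a a' : B} {c c' : C} (h : a = a') (h' : c = c')
    (e : F.obj a = c) (e' : F.obj a' = c') :
    Compat F (Cmp.ofHEq h h (by rw [h]) : Cmp (𝟙 a) (𝟙 a'))
      (Cmp.ofHEq h' h' (by rw [h']) : Cmp (𝟙 c) (𝟙 c')) (idCmp F e) (idCmp F e') := by
  subst h h'
  exact Compat.refl _

end

section

variable {P : Operad.{w, v, u}} {X Y : PAlg.{w, v, u, w₁, v₁, u₁} P} (F : X ⟶ Y)

namespace PAlg

variable {n : ℕ} {p q r p' q' : P.obj n} {κ κ' : p ⟶ q} {x y z w a b : Fin n → X.carrier}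
  {x' y' z' w' a' b' : Fin n → Y.carrier} {G : x ⟶ y} {G' : x' ⟶ y'} {K : z ⟶ w} {K' : z' ⟶ w'}

theorem carries_appC (θ : κ ⟶ κ') (ω : ∀ i, Cmp (F.toPF.map (G i)) (G' i)) :
    Carries (appC F κ ω) (appC F κ' ω) (F.toPF.map₂ ((X.mu n).map₂ (θ, 𝟙 G)))
      ((Y.mu n).map₂ (θ, 𝟙 G')) := by
  refine (Carries.ofPF (F.comm n) (f := κ ×ₘ G) (g := κ' ×ₘ G) (θ, 𝟙 G)).trans ?_
  have h := Cmp.carries_map (Y.mu n) (Carries.pair_id θ (F := fun i => F.toPF.map (G i)) (F' := G')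
    (Cmp.pi ω))
  have e : ((prodMap (Pseudofunctor.id (P.obj n)) (powMap (Fin n) F.toPF)).map₂
      ((θ, 𝟙 G) : (κ ×ₘ G) ⟶ (κ' ×ₘ G))) = (θ, 𝟙 fun i => F.toPF.map (G i)) :=
    Prod.ext rfl (funext fun i => F.toPF.map₂_id _)
  exact (congrArg (fun η => Carries _ _ ((Y.mu n).map₂ η) _) e).mpr h

/-- `F(μ(κ; 𝟙)) = μ(κ; F(𝟙)) ≅ μ(κ; 𝟙)` -/
def evC {n : ℕ} {p q : P.obj n} (κ : p ⟶ q) {x : Fin n → X.carrier} {x' : Fin n → Y.carrier}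
    (h : ∀ i, F.toPF.obj (x i) = x' i) : Cmp (F.toPF.map ((X.ev x).map κ)) ((Y.ev x').map κ) :=
  appC F κ (G := 𝟙 x) (G' := 𝟙 x') fun i => idCmp F.toPF (h i)

theorem evC_rfl (κ : p ⟶ q) (x : Fin n → X.carrier) :
    evC F κ (x := x) (fun i => rfl) = homC F κ x :=
  appC_congr F fun i => idCmp_refl _ _

theorem compat_one {x y : Fin 1 → X.carrier} {x' y' : Fin 1 → Y.carrier} {G : x ⟶ y}
    {G' : x' ⟶ y'} (ω : ∀ i, Cmp (F.toPF.map (G i)) (G' i)) :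
    Compat F.toPF (X.one_same G).cmp (Y.one_same G').cmp (appC F (𝟙 P.one) ω) (ω 0) := by
  have h := Y.one_same_natural (F := fun i => F.toPF.map (G i)) ω
  refine Eq.trans (congrArg (Cmp.trans _) (Cmp.ofIso_refl_trans (ω 0)).symm)
    (Compat.of_natural (F := F.toPF) (Same.isEq _) (ι := Cmp.ofPF (F.comm 1) _)
      (Cmp.ofPF_isEq _ _) (Cmp.IsEq.refl _) (Same.isEq _) h)

theorem compat_act (σ : Equiv.Perm (Fin n)) (κ : p ⟶ q)
    (ω : ∀ i, Cmp (F.toPF.map (G i)) (G' i)) :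
    Compat F.toPF (X.act_same σ κ G).cmp (Y.act_same σ κ G').cmp (appC F (P.dotMap κ σ) ω)
      (appC F κ (G := fun i => G (σ⁻¹ i)) (G' := fun i => G' (σ⁻¹ i)) fun i => ω (σ⁻¹ i)) :=
  Compat.of_natural (F := F.toPF) (Same.isEq _) (ι := Cmp.ofPF (F.comm n) _)
    (ι' := Cmp.ofPF (F.comm n) _) (Cmp.ofPF_isEq _ _) (Cmp.ofPF_isEq _ _) (Same.isEq _)
    (Y.act_same_natural σ κ (F := fun i => F.toPF.map (G i)) ω)

theorem compat_gam {n m : ℕ} (k : Fin n → ℕ) (h : ∑ i, k i = m) {p p' : P.obj n} (κ : p ⟶ p')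
    {q q' : ∀ i, P.obj (k i)} (g : q ⟶ q') {x y : Fin m → X.carrier} {x' y' : Fin m → Y.carrier}
    {G : x ⟶ y} {G' : x' ⟶ y'} (ω : ∀ i, Cmp (F.toPF.map (G i)) (G' i)) :
    Compat F.toPF (X.gam_same k h κ g G).cmp (Y.gam_same k h κ g G').cmp
      (appC F ((P.gam k h).map (κ ×ₘ g)) ω)
      (appC F κ (G := fun i => X.app (g i) fun j => G (blocks k h ⟨i, j⟩))
        (G' := fun i => Y.app (g i) fun j => G' (blocks k h ⟨i, j⟩)) fun i =>
        appC F (g i) (G := fun j => G (blocks k h ⟨i, j⟩)) (G' := fun j => G' (blocks k h ⟨i, j⟩))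
          fun j => ω (blocks k h ⟨i, j⟩)) := by
  have e := Y.gam_same_natural k h κ g (F := fun i => F.toPF.map (G i)) ω
  have e' := appC_muMap F (κ := κ) (G := fun i => X.app (g i) fun j => G (blocks k h ⟨i, j⟩))
    (fun i => Cmp.ofPF (F.comm (k i)) (g i ×ₘ fun j => G (blocks k h ⟨i, j⟩)))
    fun i => Cmp.muMap Y (F := fun j => F.toPF.map (G (blocks k h ⟨i, j⟩)))
      (F' := fun j => G' (blocks k h ⟨i, j⟩)) (Cmp.ofIso (Iso.refl (g i)))
      fun j => ω (blocks k h ⟨i, j⟩)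
  refine Eq.trans (congrArg (Cmp.trans _) e'.symm) (Compat.of_natural (F := F.toPF) (Same.isEq _)
    (ι := Cmp.ofPF (F.comm m) _) (Cmp.ofPF_isEq (F.comm m) _) ?_ (Same.isEq _) e)
  exact (Cmp.ofPF_isEq _ _).trans (Cmp.muMap_isEq (Cmp.IsEq.refl _) fun i => Cmp.ofPF_isEq _ _)

theorem compat_gamC {n m : ℕ} (k : Fin n → ℕ) (h : ∑ i, k i = m) {p p' : P.obj n} (κ : p ⟶ p')
    {q q' : ∀ i, P.obj (k i)} (g : q ⟶ q') {x y : Fin m → X.carrier} {x' y' : Fin m → Y.carrier}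
    {G : x ⟶ y} {G' : x' ⟶ y'} (ω : ∀ i, Cmp (F.toPF.map (G i)) (G' i))
    {a b : Fin n → X.carrier} {a' b' : Fin n → Y.carrier} {K : a ⟶ b} {K' : a' ⟶ b'}
    {φ : ∀ i, Cmp (X.app (g i) (fun j => G (blocks k h ⟨i, j⟩) : blk k h x i ⟶ blk k h y i)) (K i)}
    {φ' : ∀ i, Cmp (Y.app (g i) (fun j => G' (blocks k h ⟨i, j⟩) :
      blk k h x' i ⟶ blk k h y' i)) (K' i)} {σ : ∀ i, Cmp (F.toPF.map (K i)) (K' i)}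
    (e : ∀ i, Compat F.toPF (φ i) (φ' i) (appC F (g i) fun j => ω (blocks k h ⟨i, j⟩)) (σ i)) :
    Compat F.toPF (X.gamC k h κ g G φ) (Y.gamC k h κ g G' φ')
      (appC F ((P.gam k h).map (κ ×ₘ g)) ω) (appC F κ σ) :=
  (compat_gam F k h κ g ω).trans (compat_muMap F (Cmp.ofIso (Iso.refl κ)) e)

theorem compat_compCmp {κ : p ⟶ q} {κ' : q ⟶ r} (h : ∀ i, F.toPF.obj (x i) = x' i)
    {a b c : X.carrier} {f : a ⟶ b} {g : b ⟶ c} {a' b' c' : Y.carrier} {f' : a' ⟶ b'}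
    {g' : b' ⟶ c'} {φ : Cmp ((X.ev x).map κ) f} {ψ : Cmp ((X.ev x).map κ') g}
    {φ' : Cmp ((Y.ev x').map κ) f'} {ψ' : Cmp ((Y.ev x').map κ') g'} {ω : Cmp (F.toPF.map f) f'}
    {σ : Cmp (F.toPF.map g) g'} (e : Compat F.toPF φ φ' (evC F κ h) ω)
    (e' : Compat F.toPF ψ ψ' (evC F κ' h) σ) :
    Compat F.toPF (compCmp (X.ev x) φ ψ) (compCmp (Y.ev x') φ' ψ') (evC F (κ ≫ κ') h)
      (compCmp F.toPF ω σ) := by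
  have key (Z : PAlg.{w, v, u, w₁, v₁, u₁} P) (z : Fin n → Z.carrier) {a b c : Z.carrier}
      {f : a ⟶ b} {g : b ⟶ c} (φ : Cmp ((Z.ev z).map κ) f) (ψ : Cmp ((Z.ev z).map κ') g) :
      (Cmp.muMap Z (Cmp.ofIso (Iso.refl (κ ≫ κ'))) (F := 𝟙 z) (F' := 𝟙 z ≫ 𝟙 z)
        fun i => (Cmp.ofIso (λ_ (𝟙 (z i)))).symm).trans ((Cmp.ofIso ((Z.mu n).mapComp (κ ×ₘ 𝟙 z)
          (κ' ×ₘ 𝟙 z))).trans (φ.comp ψ)) = compCmp (Z.ev z) φ ψ := by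
    refine Eq.trans ?_ (compCmp_pf_comp (pair (Pseudofunctor.id (P.obj n)) (const (P.obj n) z))
      (Z.mu n) φ ψ).symm
    refine congrArg (Cmp.trans · _) (congrArg (Cmp.map (Z.mu n)) ?_)
    exact congrArg (Cmp.mk rfl rfl) (Iso.ext rfl)
  refine Compat.congr (Compat.trans (compat_muMap F (Cmp.ofIso (Iso.refl (κ ≫ κ'))) fun i =>
    (Compat.leftUnitor (e := h i) (idCmp F.toPF (h i))).symm)
      ((compat_mapComp F (κ := κ) (κ' := κ') (G := 𝟙 x) (L := 𝟙 x) (fun i => idCmp F.toPF (h i)) fun i =>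
        idCmp F.toPF (h i)).trans (e.comp e'))) (key X x φ ψ) (key Y x' φ' ψ') rfl rfl

theorem compat_idCmp (h : ∀ i, F.toPF.obj (x i) = x' i) {p : P.obj n} {a : X.carrier}
    {a' : Y.carrier} (e : (X.ev x).obj p = a) (e' : (Y.ev x').obj p = a')
    (e'' : F.toPF.obj a = a') :
    Compat F.toPF (idCmp (X.ev x) e) (idCmp (Y.ev x') e') (evC F (𝟙 p) h)
      (idCmp F.toPF e'') := by
  obtain rfl : (fun i => F.toPF.obj (x i)) = x' := funext h
  have key : F.toPF.obj ((X.mu n).obj (p, x)) = (Y.mu n).obj (p, fun i => F.toPF.obj (x i)) :=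
    (Same.of_pf (F.comm n) (𝟙 ((p, x) : P.obj n × (Fin n → X.carrier)))).src
  refine ((compat_mapId F p x key).trans (Compat.idCmp_cast e e' key e'')).congr ?_ ?_
    (evC_rfl F _ x).symm rfl
  · exact (congrArg (Cmp.trans · _) (idCmp_refl _ _)).trans (Pt.idCmp_ev_eq x p e).symm
  · exact (congrArg (Cmp.trans · _) (idCmp_refl _ _)).trans (Pt.idCmp_ev_eq _ p e').symm

end PAlg

end

end SMTwo

namespace SMTwo

section

variable {P : Operad.{w, v, u}} {X Y : PAlg.{w, v, u, w₁, v₁, u₁} P} {F : X ⟶ Y}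
  {χ : ChoiceOfMult P} {s : MonCells X.carrier} {s' : MonCells Y.carrier}

theorem PAlg.compat_of_eq (F : X ⟶ Y) {n : ℕ} {p q : P.obj n} {κ κ' : p ⟶ q} (h : κ = κ')
    {x y : Fin n → X.carrier} {x' y' : Fin n → Y.carrier} {G : x ⟶ y} {G' : x' ⟶ y'}
    (ω : ∀ i, Cmp (F.toPF.map (G i)) (G' i)) :
    Compat F.toPF (Cmp.ofHEq rfl rfl (by rw [h]) : Cmp (X.app κ G) (X.app κ' G))
      (Cmp.ofHEq rfl rfl (by rw [h]) : Cmp (Y.app κ G') (Y.app κ' G')) (appC F κ ω)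
      (appC F κ' ω) := by
  subst h
  exact Compat.refl _

theorem PAlg.compat_cast (F : X ⟶ Y) {n : ℕ} {p q p' q' : P.obj n} {κ : p ⟶ q} (h : p = p')
    (h' : q = q') {x : Fin n → X.carrier} {x' : Fin n → Y.carrier}
    (e : ∀ i, F.toPF.obj (x i) = x' i) {a b : X.carrier} {g : a ⟶ b} {a' b' : Y.carrier}
    {g' : a' ⟶ b'} {φ : Cmp ((X.ev x).map κ) g} {φ' : Cmp ((Y.ev x').map κ) g'}
    {ω : Cmp (F.toPF.map g) g'} (hφ : Compat F.toPF φ φ' (evC F κ e) ω) :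
    Compat F.toPF (InducedCells.castC κ h h' x φ) (InducedCells.castC κ h h' x' φ')
      (evC F (κ.cast h h') e) ω := by
  subst h h'
  exact (Compat.refl _).trans hφ

theorem PAlg.compat_actC (F : X ⟶ Y) {n : ℕ} (σ : Equiv.Perm (Fin n)) {p q : P.obj n} (κ : p ⟶ q)
    {x : Fin n → X.carrier} {x' : Fin n → Y.carrier} (e : ∀ i, F.toPF.obj (x i) = x' i)
    {a b : X.carrier} {g : a ⟶ b} {a' b' : Y.carrier} {g' : a' ⟶ b'}
    {φ : Cmp ((X.ev fun i => x (σ⁻¹ i)).map κ) g} {φ' : Cmp ((Y.ev fun i => x' (σ⁻¹ i)).map κ) g'}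
    {ω : Cmp (F.toPF.map g) g'} (hφ : Compat F.toPF φ φ' (evC F κ fun i => e (σ⁻¹ i)) ω) :
    Compat F.toPF (InducedCells.actC σ κ x φ) (InducedCells.actC σ κ x' φ')
      (evC F (P.dotMap κ σ) e) ω :=
  (compat_act F σ κ fun i => idCmp F.toPF (e i)).trans hφ

theorem PAlg.compat_oneC (F : X ⟶ Y) {x : Fin 1 → X.carrier} {x' : Fin 1 → Y.carrier}
    (e : ∀ i, F.toPF.obj (x i) = x' i) :
    Compat F.toPF (InducedCells.oneC X x) (InducedCells.oneC Y x') (evC F (𝟙 P.one) e)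
      (idCmp F.toPF (e 0)) :=
  compat_one F fun i => idCmp F.toPF (e i)

namespace StrictCells

open PAlg

variable (H : InducedCells χ X s) (H' : InducedCells χ Y s') (c : StrictCells F.toPF s s')

theorem compat_tens {x y : Fin 2 → X.carrier} {x' y' : Fin 2 → Y.carrier} {G : x ⟶ y}
    {G' : x' ⟶ y'} (ω : ∀ i, Cmp (F.toPF.map (G i)) (G' i)) :
    Compat F.toPF (H.tens_same G).cmp (H'.tens_same G').cmp (appC F (𝟙 χ.t) ω)
      (c.tC (ω 0) (ω 1)) :=
  Compat.of_natural (F := F.toPF) (Same.isEq _) (ι := Cmp.ofPF (F.comm 2) _)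
    (ι' := Cmp.ofPF c.tensor_eq _) (Cmp.ofPF_isEq _ _) (Cmp.ofPF_isEq _ _) (Same.isEq _)
    (H'.tens_natural (F := fun i => F.toPF.map (G i)) ω)

theorem compat_tenC {k₀ k₁ m : ℕ} (h : ∑ i, ![k₀, k₁] i = m) {q q' : P.obj k₀}
    {r r' : P.obj k₁} (g : q ⟶ q') (g' : r ⟶ r') {x y : Fin m → X.carrier}
    {x' y' : Fin m → Y.carrier} {G : x ⟶ y} {G' : x' ⟶ y'}
    (ω : ∀ i, Cmp (F.toPF.map (G i)) (G' i)) {a b d e : X.carrier} {K : a ⟶ b} {L : d ⟶ e}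
    {a' b' d' e' : Y.carrier} {K' : a' ⟶ b'} {L' : d' ⟶ e'}
    {φ : Cmp (X.app g (fun j => G (blocks ![k₀, k₁] h ⟨0, j⟩) :
      PAlg.blk ![k₀, k₁] h x 0 ⟶ PAlg.blk ![k₀, k₁] h y 0)) K}
    {ψ : Cmp (X.app g' (fun j => G (blocks ![k₀, k₁] h ⟨1, j⟩) :
      PAlg.blk ![k₀, k₁] h x 1 ⟶ PAlg.blk ![k₀, k₁] h y 1)) L}
    {φ' : Cmp (Y.app g (fun j => G' (blocks ![k₀, k₁] h ⟨0, j⟩) :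
      PAlg.blk ![k₀, k₁] h x' 0 ⟶ PAlg.blk ![k₀, k₁] h y' 0)) K'}
    {ψ' : Cmp (Y.app g' (fun j => G' (blocks ![k₀, k₁] h ⟨1, j⟩) :
      PAlg.blk ![k₀, k₁] h x' 1 ⟶ PAlg.blk ![k₀, k₁] h y' 1)) L'}
    {σ : Cmp (F.toPF.map K) K'} {τ : Cmp (F.toPF.map L) L'}
    (hφ : Compat F.toPF φ φ' (appC F g fun j => ω (blocks ![k₀, k₁] h ⟨0, j⟩)) σ)
    (hψ : Compat F.toPF ψ ψ' (appC F g' fun j => ω (blocks ![k₀, k₁] h ⟨1, j⟩)) τ) :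
    Compat F.toPF (H.tenC h g g' G φ ψ) (H'.tenC h g g' G' φ' ψ')
      (appC F (P.g₂Map h (𝟙 χ.t) g g') ω) (c.tC σ τ) := by
  let K₂ : (![a, d] : Fin 2 → X.carrier) ⟶ ![b, e] := fun i => match i with
    | 0 => K
    | 1 => L
  let K₂' : (![a', d'] : Fin 2 → Y.carrier) ⟶ ![b', e'] := fun i => match i with
    | 0 => K'
    | 1 => L'
  let σ₂ : ∀ i, Cmp (F.toPF.map (K₂ i)) (K₂' i) := fun i => match i with
    | 0 => σ
    | 1 => τ
  refine Compat.trans (compat_gamC F ![k₀, k₁] h (𝟙 χ.t) (Operad.fam₂Map g g') ω (K := K₂)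
    (K' := K₂') (σ := σ₂) fun i => ?_) (compat_tens H H' c σ₂)
  match i with
  | 0 => exact hφ
  | 1 => exact hψ

theorem compat_tenIdC {k₀ k₁ m : ℕ} (h : ∑ i, ![k₀, k₁] i = m) (q : P.obj k₀)
    (r : P.obj k₁) {x y : Fin m → X.carrier}
    {x' y' : Fin m → Y.carrier} {G : x ⟶ y} {G' : x' ⟶ y'}
    (ω : ∀ i, Cmp (F.toPF.map (G i)) (G' i)) {a b d e : X.carrier} {K : a ⟶ b} {L : d ⟶ e}
    {a' b' d' e' : Y.carrier} {K' : a' ⟶ b'} {L' : d' ⟶ e'}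
    {φ : Cmp (X.app (𝟙 q) (fun j => G (blocks ![k₀, k₁] h ⟨0, j⟩) :
      PAlg.blk ![k₀, k₁] h x 0 ⟶ PAlg.blk ![k₀, k₁] h y 0)) K}
    {ψ : Cmp (X.app (𝟙 r) (fun j => G (blocks ![k₀, k₁] h ⟨1, j⟩) :
      PAlg.blk ![k₀, k₁] h x 1 ⟶ PAlg.blk ![k₀, k₁] h y 1)) L}
    {φ' : Cmp (Y.app (𝟙 q) (fun j => G' (blocks ![k₀, k₁] h ⟨0, j⟩) :
      PAlg.blk ![k₀, k₁] h x' 0 ⟶ PAlg.blk ![k₀, k₁] h y' 0)) K'}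
    {ψ' : Cmp (Y.app (𝟙 r) (fun j => G' (blocks ![k₀, k₁] h ⟨1, j⟩) :
      PAlg.blk ![k₀, k₁] h x' 1 ⟶ PAlg.blk ![k₀, k₁] h y' 1)) L'}
    {σ : Cmp (F.toPF.map K) K'} {τ : Cmp (F.toPF.map L) L'}
    (hφ : Compat F.toPF φ φ' (appC F (𝟙 q) fun j => ω (blocks ![k₀, k₁] h ⟨0, j⟩)) σ)
    (hψ : Compat F.toPF ψ ψ' (appC F (𝟙 r) fun j => ω (blocks ![k₀, k₁] h ⟨1, j⟩)) τ) :
    Compat F.toPF (H.tenIdC h q r G φ ψ) (H'.tenIdC h q r G' φ' ψ')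
      (appC F (𝟙 (P.g₂ h χ.t q r)) ω) (c.tC σ τ) :=
  (compat_of_eq F (InducedCells.id_g₂ h χ.t q r) ω).trans
    (compat_tenC H H' c h (𝟙 q) (𝟙 r) ω hφ hψ)

theorem compat_tlC {x y : Fin 3 → X.carrier} {x' y' : Fin 3 → Y.carrier} {G : x ⟶ y}
    {G' : x' ⟶ y'} (ω : ∀ i, Cmp (F.toPF.map (G i)) (G' i)) :
    Compat F.toPF (H.tlC G) (H'.tlC G') (appC F (𝟙 (P.tl χ.t)) ω)
      (c.tC (c.tC (ω 0) (ω 1)) (ω 2)) :=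
  compat_tenIdC H H' c rfl χ.t P.one ω (compat_tens H H' c _) (compat_one F _)

theorem compat_trC {x y : Fin 3 → X.carrier} {x' y' : Fin 3 → Y.carrier} {G : x ⟶ y}
    {G' : x' ⟶ y'} (ω : ∀ i, Cmp (F.toPF.map (G i)) (G' i)) :
    Compat F.toPF (H.trC G) (H'.trC G') (appC F (𝟙 (P.tr χ.t)) ω)
      (c.tC (ω 0) (c.tC (ω 1) (ω 2))) :=
  compat_tenIdC H H' c rfl P.one χ.t ω (compat_one F _) (compat_tens H H' c _)

theorem compat_unitC {x y : Fin 0 → X.carrier} {x' y' : Fin 0 → Y.carrier} {G : x ⟶ y}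
    {G' : x' ⟶ y'} (ω : ∀ i, Cmp (F.toPF.map (G i)) (G' i)) :
    Compat F.toPF (H.unitC G) (H'.unitC G') (appC F (𝟙 χ.i) ω) c.uC := by
  obtain rfl : x = y := funext fun i => i.elim0
  obtain rfl : x' = y' := funext fun i => i.elim0
  obtain rfl : G = 𝟙 x := funext fun i => i.elim0
  obtain rfl : G' = 𝟙 x' := funext fun i => i.elim0
  obtain rfl : ω = fun i => idCmp F.toPF (i.elim0) := funext fun i => i.elim0
  exact (Compat.refl _).trans (compat_idCmp F (fun i => i.elim0) (H.unit x) (H'.unit x')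
    c.unit_eq)

theorem compat_ulC {x y : Fin 1 → X.carrier} {x' y' : Fin 1 → Y.carrier} {G : x ⟶ y}
    {G' : x' ⟶ y'} (ω : ∀ i, Cmp (F.toPF.map (G i)) (G' i)) :
    Compat F.toPF (H.ulC G) (H'.ulC G') (appC F (𝟙 (P.g₂ (m := 1) rfl χ.t χ.i P.one)) ω)
      (c.tC c.uC (ω 0)) :=
  compat_tenIdC H H' c rfl χ.i P.one ω (compat_unitC H H' c _) (compat_one F _)

theorem compat_urC {x y : Fin 1 → X.carrier} {x' y' : Fin 1 → Y.carrier} {G : x ⟶ y}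
    {G' : x' ⟶ y'} (ω : ∀ i, Cmp (F.toPF.map (G i)) (G' i)) :
    Compat F.toPF (H.urC G) (H'.urC G') (appC F (𝟙 (P.g₂ (m := 1) rfl χ.t P.one χ.i)) ω)
      (c.tC (ω 0) c.uC) :=
  compat_tenIdC H H' c rfl P.one χ.i ω (compat_one F _) (compat_unitC H H' c _)

theorem compat_dot {x y : Fin 2 → X.carrier} {x' y' : Fin 2 → Y.carrier} {G : x ⟶ y}
    {G' : x' ⟶ y'} (ω : ∀ i, Cmp (F.toPF.map (G i)) (G' i)) :
    Compat F.toPF (H.dot_same G).cmp (H'.dot_same G').cmp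
      (appC F (𝟙 (P.dot χ.t Operad.σ₁₂)) ω) (c.tC (ω 1) (ω 0)) := by
  have h := ((P.act_strict (Operad.σ₁₂ (n := 0))).1 χ.t).choose.symm
  refine (((compat_of_eq F h ω).trans (compat_act F Operad.σ₁₂ (𝟙 χ.t) ω)).trans
    (compat_tens H H' c (G := fun i => G (Operad.σ₁₂⁻¹ i)) (G' := fun i => G' (Operad.σ₁₂⁻¹ i))
      fun i => ω (Operad.σ₁₂⁻¹ i))).congr ?_ ?_ rfl rfl
  · exact (((Cmp.ofHEq_isEq _ _ _).trans (Same.isEq _)).trans (Same.isEq _)).unique (Same.isEq _)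
  · exact (((Cmp.ofHEq_isEq _ _ _).trans (Same.isEq _)).trans (Same.isEq _)).unique (Same.isEq _)

theorem compat_evC {k₀ k₁ m : ℕ} (h : ∑ i, ![k₀, k₁] i = m) {q q' : P.obj k₀}
    {r r' : P.obj k₁} (g : q ⟶ q') (g' : r ⟶ r') {x : Fin m → X.carrier}
    {x' : Fin m → Y.carrier} (o : ∀ i, F.toPF.obj (x i) = x' i)
    {a b d e : X.carrier} {K : a ⟶ b} {L : d ⟶ e}
    {a' b' d' e' : Y.carrier} {K' : a' ⟶ b'} {L' : d' ⟶ e'}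
    {φ : Cmp ((X.ev (PAlg.blk ![k₀, k₁] h x 0)).map g) K}
    {ψ : Cmp ((X.ev (PAlg.blk ![k₀, k₁] h x 1)).map g') L}
    {φ' : Cmp ((Y.ev (PAlg.blk ![k₀, k₁] h x' 0)).map g) K'}
    {ψ' : Cmp ((Y.ev (PAlg.blk ![k₀, k₁] h x' 1)).map g') L'}
    {σ : Cmp (F.toPF.map K) K'} {τ : Cmp (F.toPF.map L) L'}
    (hφ : Compat F.toPF φ φ' (evC F g fun j => o (blocks ![k₀, k₁] h ⟨0, j⟩)) σ)
    (hψ : Compat F.toPF ψ ψ' (evC F g' fun j => o (blocks ![k₀, k₁] h ⟨1, j⟩)) τ) :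
    Compat F.toPF (H.evC h g g' x φ ψ) (H'.evC h g g' x' φ' ψ')
      (evC F (P.g₂Map h (𝟙 χ.t) g g') o) (c.tC σ τ) :=
  compat_tenC H H' c h g g' (fun i => idCmp F.toPF (o i)) hφ hψ

end StrictCells

end

end SMTwo

namespace SMTwo

section

variable {P : Operad.{w, v, u}} {X Y : PAlg.{w, v, u, w₁, v₁, u₁} P} {F : X ⟶ Y}
  {χ : ChoiceOfMult P} {s : MonCells X.carrier} {s' : MonCells Y.carrier}

theorem PAlg.carries_nat (F : X ⟶ Y) {n : ℕ} {p q : P.obj n} (κ : p ⟶ q)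
    {x y : Fin n → X.carrier} {x' y' : Fin n → Y.carrier} {G : x ⟶ y} {G' : x' ⟶ y'}
    (ω : ∀ i, Cmp (F.toPF.map (G i)) (G' i)) (hx : ∀ i, F.toPF.obj (x i) = x' i)
    (hy : ∀ i, F.toPF.obj (y i) = y' i) :
    Carries (compCmp F.toPF (appC F (𝟙 p) ω) (evC F κ hy))
      (compCmp F.toPF (evC F κ hx) (appC F (𝟙 q) ω)) (F.toPF.map₂ (X.nat κ G).hom)
      (Y.nat κ G').hom :=
  carries_iff.2 (compat_nat F κ ω hx hy)

theorem PAlg.carries_evC (F : X ⟶ Y) {n : ℕ} {p q : P.obj n} {κ κ' : p ⟶ q} (θ : κ ⟶ κ')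
    {x : Fin n → X.carrier} {x' : Fin n → Y.carrier} (h : ∀ i, F.toPF.obj (x i) = x' i) :
    Carries (evC F κ h) (evC F κ' h) (F.toPF.map₂ ((X.ev x).map₂ θ)) ((Y.ev x').map₂ θ) :=
  carries_appC F θ _

namespace Canonical

open PAlg StrictCells

variable {H : InducedCells χ X s} {H' : InducedCells χ Y s'} {c : StrictCells F.toPF s s'}

theorem compat_a (hc : Canonical F H H' c) (x : Fin 3 → X.carrier) :
    Compat F.toPF (H.a x).cmp (H'.a fun i => F.toPF.obj (x i)).cmp
      (evC F χ.α.hom (x := x) fun i => rfl) (c.a _ _ _) :=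
  (show Compat F.toPF _ _ _ _ from hc.a x).congr rfl rfl (evC_rfl F _ x).symm rfl

theorem compat_ai (hc : Canonical F H H' c) (x : Fin 3 → X.carrier) :
    Compat F.toPF (H.ai x).cmp (H'.ai fun i => F.toPF.obj (x i)).cmp
      (evC F χ.α.inv (x := x) fun i => rfl) (c.ai _ _ _) :=
  (show Compat F.toPF _ _ _ _ from hc.ai x).congr rfl rfl (evC_rfl F _ x).symm rfl

theorem compat_l (hc : Canonical F H H' c) (x : Fin 1 → X.carrier) :
    Compat F.toPF (H.l x).cmp (H'.l fun i => F.toPF.obj (x i)).cmp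
      (evC F χ.l.hom (x := x) fun i => rfl) (c.l _) :=
  (show Compat F.toPF _ _ _ _ from hc.l x).congr rfl rfl (evC_rfl F _ x).symm rfl

theorem compat_li (hc : Canonical F H H' c) (x : Fin 1 → X.carrier) :
    Compat F.toPF (H.li x).cmp (H'.li fun i => F.toPF.obj (x i)).cmp
      (evC F χ.l.inv (x := x) fun i => rfl) (c.li _) :=
  (show Compat F.toPF _ _ _ _ from hc.li x).congr rfl rfl (evC_rfl F _ x).symm rfl

theorem compat_r (hc : Canonical F H H' c) (x : Fin 1 → X.carrier) :
    Compat F.toPF (H.r x).cmp (H'.r fun i => F.toPF.obj (x i)).cmp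
      (evC F χ.r.hom (x := x) fun i => rfl) (c.r _) :=
  (show Compat F.toPF _ _ _ _ from hc.r x).congr rfl rfl (evC_rfl F _ x).symm rfl

theorem compat_ri (hc : Canonical F H H' c) (x : Fin 1 → X.carrier) :
    Compat F.toPF (H.ri x).cmp (H'.ri fun i => F.toPF.obj (x i)).cmp
      (evC F χ.r.inv (x := x) fun i => rfl) (c.ri _) :=
  (show Compat F.toPF _ _ _ _ from hc.ri x).congr rfl rfl (evC_rfl F _ x).symm rfl

theorem compat_b (hc : Canonical F H H' c) (x : Fin 2 → X.carrier) :
    Compat F.toPF (H.b x).cmp (H'.b fun i => F.toPF.obj (x i)).cmp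
      (evC F χ.β.hom (x := x) fun i => rfl) (c.b _ _) :=
  (show Compat F.toPF _ _ _ _ from hc.b x).congr rfl rfl (evC_rfl F _ x).symm rfl

theorem compat_bi (hc : Canonical F H H' c) (x : Fin 2 → X.carrier) :
    Compat F.toPF (H.bi x).cmp (H'.bi fun i => F.toPF.obj (x i)).cmp
      (evC F χ.β.inv (x := x) fun i => rfl) (c.bi _ _) :=
  (show Compat F.toPF _ _ _ _ from hc.bi x).congr rfl rfl (evC_rfl F _ x).symm rfl

theorem compat_a_of_eq (hc : Canonical F H H' c) {x : Fin 3 → X.carrier}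
    {x' : Fin 3 → Y.carrier} (o : ∀ i, F.toPF.obj (x i) = x' i) :
    Compat F.toPF (H.a x).cmp (H'.a x').cmp (evC F χ.α.hom o) (c.aC (o 0) (o 1) (o 2)) := by
  obtain rfl : (fun i => F.toPF.obj (x i)) = x' := funext o
  exact (compat_a hc x).congr rfl rfl rfl (Cmp.trans_ofIso_refl _).symm

theorem compat_aC (hc : Canonical F H H' c) {k₀ k₁ k₂ m : ℕ} (h : ∑ i, ![k₀, k₁, k₂] i = m)
    (q : P.obj k₀) (q' : P.obj k₁) (q'' : P.obj k₂) {x : Fin m → X.carrier} {x' : Fin m → Y.carrier}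
    (o : ∀ i, F.toPF.obj (x i) = x' i) {y y₁ y₂ : X.carrier} {z z₁ z₂ : Y.carrier}
    (h₀ : (X.ev (PAlg.blk ![k₀, k₁, k₂] h x 0)).obj q = y)
    (h₀' : (Y.ev (PAlg.blk ![k₀, k₁, k₂] h x' 0)).obj q = z) (e₀ : F.toPF.obj y = z)
    (h₁ : (X.ev (PAlg.blk ![k₀, k₁, k₂] h x 1)).obj q' = y₁)
    (h₁' : (Y.ev (PAlg.blk ![k₀, k₁, k₂] h x' 1)).obj q' = z₁) (e₁ : F.toPF.obj y₁ = z₁)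
    (h₂ : (X.ev (PAlg.blk ![k₀, k₁, k₂] h x 2)).obj q'' = y₂)
    (h₂' : (Y.ev (PAlg.blk ![k₀, k₁, k₂] h x' 2)).obj q'' = z₂) (e₂ : F.toPF.obj y₂ = z₂) :
    Compat F.toPF (H.aC h q q' q'' x h₀ h₁ h₂) (H'.aC h q q' q'' x' h₀' h₁' h₂')
      (evC F (P.g₃Map h χ.α.hom (𝟙 q) (𝟙 q') (𝟙 q'')) o) (c.aC e₀ e₁ e₂) := by
  have o' : ∀ i, F.toPF.obj ((![y, y₁, y₂] : Fin 3 → X.carrier) i) =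
      (![z, z₁, z₂] : Fin 3 → Y.carrier) i := fun i => match i with
    | 0 => e₀
    | 1 => e₁
    | 2 => e₂
  refine Compat.trans (compat_gamC F ![k₀, k₁, k₂] h χ.α.hom (Operad.fam₃Map (𝟙 q) (𝟙 q') (𝟙 q''))
    (G := 𝟙 x) (G' := 𝟙 x') (fun i => idCmp F.toPF (o i)) (K := 𝟙 ![y, y₁, y₂])
    (K' := 𝟙 ![z, z₁, z₂]) (σ := fun i => idCmp F.toPF (o' i)) fun i => ?_)
      (compat_a_of_eq hc o')
  match i with
  | 0 => exact compat_idCmp F (fun j => o (blocks ![k₀, k₁, k₂] h ⟨0, j⟩)) h₀ h₀' e₀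
  | 1 => exact compat_idCmp F (fun j => o (blocks ![k₀, k₁, k₂] h ⟨1, j⟩)) h₁ h₁' e₁
  | 2 => exact compat_idCmp F (fun j => o (blocks ![k₀, k₁, k₂] h ⟨2, j⟩)) h₂ h₂' e₂

theorem compat_b_of_eq (hc : Canonical F H H' c) {x : Fin 2 → X.carrier}
    {x' : Fin 2 → Y.carrier} (o : ∀ i, F.toPF.obj (x i) = x' i) :
    Compat F.toPF (H.b x).cmp (H'.b x').cmp (evC F χ.β.hom o) (c.bC (o 0) (o 1)) := by
  obtain rfl : (fun i => F.toPF.obj (x i)) = x' := funext o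
  exact (compat_b hc x).congr rfl rfl rfl (Cmp.trans_ofIso_refl _).symm

theorem compat_bC (hc : Canonical F H H' c) {k₀ k₁ m : ℕ} (h : ∑ i, ![k₀, k₁] i = m)
    (q : P.obj k₀) (q' : P.obj k₁) {x : Fin m → X.carrier} {x' : Fin m → Y.carrier}
    (o : ∀ i, F.toPF.obj (x i) = x' i) {y y₁ : X.carrier} {z z₁ : Y.carrier}
    (h₀ : (X.ev (PAlg.blk ![k₀, k₁] h x 0)).obj q = y)
    (h₀' : (Y.ev (PAlg.blk ![k₀, k₁] h x' 0)).obj q = z) (e₀ : F.toPF.obj y = z)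
    (h₁ : (X.ev (PAlg.blk ![k₀, k₁] h x 1)).obj q' = y₁)
    (h₁' : (Y.ev (PAlg.blk ![k₀, k₁] h x' 1)).obj q' = z₁) (e₁ : F.toPF.obj y₁ = z₁) :
    Compat F.toPF (H.bC h q q' x h₀ h₁) (H'.bC h q q' x' h₀' h₁')
      (evC F (P.g₂Map h χ.β.hom (𝟙 q) (𝟙 q')) o) (c.bC e₀ e₁) := by
  have o' : ∀ i, F.toPF.obj ((![y, y₁] : Fin 2 → X.carrier) i) =
      (![z, z₁] : Fin 2 → Y.carrier) i := fun i => match i with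
    | 0 => e₀
    | 1 => e₁
  refine Compat.trans (compat_gamC F ![k₀, k₁] h χ.β.hom (Operad.fam₂Map (𝟙 q) (𝟙 q'))
    (G := 𝟙 x) (G' := 𝟙 x') (fun i => idCmp F.toPF (o i)) (K := 𝟙 ![y, y₁])
    (K' := 𝟙 ![z, z₁]) (σ := fun i => idCmp F.toPF (o' i)) fun i => ?_)
      (compat_b_of_eq hc o')
  match i with
  | 0 => exact compat_idCmp F (fun j => o (blocks ![k₀, k₁] h ⟨0, j⟩)) h₀ h₀' e₀
  | 1 => exact compat_idCmp F (fun j => o (blocks ![k₀, k₁] h ⟨1, j⟩)) h₁ h₁' e₁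

theorem compat_l_of_eq (hc : Canonical F H H' c) {x : Fin 1 → X.carrier}
    {x' : Fin 1 → Y.carrier} (o : ∀ i, F.toPF.obj (x i) = x' i) :
    Compat F.toPF (H.l x).cmp (H'.l x').cmp (evC F χ.l.hom o) (c.lC (o 0)) := by
  obtain rfl : (fun i => F.toPF.obj (x i)) = x' := funext o
  exact (compat_l hc x).congr rfl rfl rfl (Cmp.trans_ofIso_refl _).symm

theorem compat_lC (hc : Canonical F H H' c) {k m : ℕ} (h : ∑ i, ![k] i = m)
    (q : P.obj k) {x : Fin m → X.carrier} {x' : Fin m → Y.carrier}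
    (o : ∀ i, F.toPF.obj (x i) = x' i) {y : X.carrier} {z : Y.carrier}
    (h₀ : (X.ev (PAlg.blk ![k] h x 0)).obj q = y)
    (h₀' : (Y.ev (PAlg.blk ![k] h x' 0)).obj q = z) (e₀ : F.toPF.obj y = z) :
    Compat F.toPF (H.lC h q x h₀) (H'.lC h q x' h₀')
      (evC F (P.g₁Map h χ.l.hom (𝟙 q)) o) (c.lC e₀) := by
  have o' : ∀ i, F.toPF.obj ((![y] : Fin 1 → X.carrier) i) =
      (![z] : Fin 1 → Y.carrier) i := fun i => match i with
    | 0 => e₀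
  refine Compat.trans (compat_gamC F ![k] h χ.l.hom (Operad.fam₁Map (𝟙 q))
    (G := 𝟙 x) (G' := 𝟙 x') (fun i => idCmp F.toPF (o i)) (K := 𝟙 ![y])
    (K' := 𝟙 ![z]) (σ := fun i => idCmp F.toPF (o' i)) fun i => ?_)
      (compat_l_of_eq hc o')
  match i with
  | 0 => exact compat_idCmp F (fun j => o (blocks ![k] h ⟨0, j⟩)) h₀ h₀' e₀

theorem compat_r_of_eq (hc : Canonical F H H' c) {x : Fin 1 → X.carrier}
    {x' : Fin 1 → Y.carrier} (o : ∀ i, F.toPF.obj (x i) = x' i) :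
    Compat F.toPF (H.r x).cmp (H'.r x').cmp (evC F χ.r.hom o) (c.rC (o 0)) := by
  obtain rfl : (fun i => F.toPF.obj (x i)) = x' := funext o
  exact (compat_r hc x).congr rfl rfl rfl (Cmp.trans_ofIso_refl _).symm

theorem compat_rC (hc : Canonical F H H' c) {k m : ℕ} (h : ∑ i, ![k] i = m)
    (q : P.obj k) {x : Fin m → X.carrier} {x' : Fin m → Y.carrier}
    (o : ∀ i, F.toPF.obj (x i) = x' i) {y : X.carrier} {z : Y.carrier}
    (h₀ : (X.ev (PAlg.blk ![k] h x 0)).obj q = y)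
    (h₀' : (Y.ev (PAlg.blk ![k] h x' 0)).obj q = z) (e₀ : F.toPF.obj y = z) :
    Compat F.toPF (H.rC h q x h₀) (H'.rC h q x' h₀')
      (evC F (P.g₁Map h χ.r.hom (𝟙 q)) o) (c.rC e₀) := by
  have o' : ∀ i, F.toPF.obj ((![y] : Fin 1 → X.carrier) i) =
      (![z] : Fin 1 → Y.carrier) i := fun i => match i with
    | 0 => e₀
  refine Compat.trans (compat_gamC F ![k] h χ.r.hom (Operad.fam₁Map (𝟙 q))
    (G := 𝟙 x) (G' := 𝟙 x') (fun i => idCmp F.toPF (o i)) (K := 𝟙 ![y])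
    (K' := 𝟙 ![z]) (σ := fun i => idCmp F.toPF (o' i)) fun i => ?_)
      (compat_r_of_eq hc o')
  match i with
  | 0 => exact compat_idCmp F (fun j => o (blocks ![k] h ⟨0, j⟩)) h₀ h₀' e₀

theorem compat_blC (hc : Canonical F H H' c) (x : Fin 3 → X.carrier) :
    Compat F.toPF (H.blC x) (H'.blC fun i => F.toPF.obj (x i))
      (evC F (Operad.braidLeft χ.β.hom) (x := x) fun i => rfl)
      (c.tC (c.b (x 0) (x 1)) (iC F.toPF (x 2))) :=
  compat_cast F _ _ _ (compat_evC H H' c rfl χ.β.hom (𝟙 P.one) _ (compat_b hc _)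
    (compat_oneC F _))

theorem compat_brC (hc : Canonical F H H' c) (x : Fin 3 → X.carrier) :
    Compat F.toPF (H.brC x) (H'.brC fun i => F.toPF.obj (x i))
      (evC F (Operad.braidRight χ.β.hom) (x := x) fun i => rfl)
      (c.tC (iC F.toPF (x 0)) (c.b (x 1) (x 2))) :=
  compat_cast F _ _ _ (compat_evC H H' c rfl (𝟙 P.one) χ.β.hom _ (compat_oneC F _)
    (compat_b hc _))

end Canonical

end

end SMTwo

namespace SMTwo

section

variable {B : Type u₁} [Bicategory.{w₁, v₁} B]

/-- A family of one 1-cell. -/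
def famHom1 {x x' : B} (f : x ⟶ x') : (![x] : Fin 1 → B) ⟶ ![x'] := fun i => match i with
  | 0 => f

/-- A family of two 1-cells. -/
def famHom2 {x x' y y' : B} (f : x ⟶ x') (g : y ⟶ y') : (![x, y] : Fin 2 → B) ⟶ ![x', y'] :=
  fun i => match i with
  | 0 => f
  | 1 => g

/-- A family of three 1-cells. -/
def famHom3 {x x' y y' z z' : B} (f : x ⟶ x') (g : y ⟶ y') (h : z ⟶ z') :
    (![x, y, z] : Fin 3 → B) ⟶ ![x', y', z'] :=
  fun i => match i with
  | 0 => f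
  | 1 => g
  | 2 => h

end

section

variable {P : Operad.{w, v, u}} {X Y : PAlg.{w, v, u, w₁, v₁, u₁} P} {χ : ChoiceOfMult P}

namespace Canonical

open PAlg StrictCells

section

variable {s : SymMon X.carrier} {s' : SymMon Y.carrier} {F : X ⟶ Y}
  {c : StrictCells F.toPF s.toMonCells s'.toMonCells}

/-- The canonical comparisons make a morphism of algebras strictly symmetric monoidal. -/
def strictSymMon (K : Induced χ X s) (K' : Induced χ Y s') (hc : Canonical F K.cells K'.cells c) :
    StrictSymMon F.toPF s s' where
  toStrictCells := c
  map_aSq f g h := by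
    let G := famHom3 f g h
    exact Carries.transfer (K.aSq G) (K'.aSq fun i => F.toPF.map (G i))
      (carries_nat F χ.α.hom (G := G) (fun i => fC F.toPF (G i)) (fun i => rfl) fun i => rfl)
      ((compat_tlC K.cells K'.cells c (fun i => fC F.toPF (G i))).comp (compat_a hc _)) ((compat_a hc _).comp (compat_trC K.cells K'.cells c (fun i => fC F.toPF (G i))))
  map_aiSq f g h := by
    let G := famHom3 f g h
    exact Carries.transfer (K.aiSq G) (K'.aiSq fun i => F.toPF.map (G i))
      (carries_nat F χ.α.inv (G := G) (fun i => fC F.toPF (G i)) (fun i => rfl) fun i => rfl)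
      ((compat_trC K.cells K'.cells c (fun i => fC F.toPF (G i))).comp (compat_ai hc _)) ((compat_ai hc _).comp (compat_tlC K.cells K'.cells c (fun i => fC F.toPF (G i))))
  map_lSq f := by
    let G := famHom1 f
    exact Carries.transfer (K.lSq G) (K'.lSq fun i => F.toPF.map (G i))
      (carries_nat F χ.l.hom (G := G) (fun i => fC F.toPF (G i)) (fun i => rfl) fun i => rfl)
      ((compat_ulC K.cells K'.cells c (fun i => fC F.toPF (G i))).comp (compat_l hc _)) ((compat_l hc _).comp (compat_one F (fun i => fC F.toPF (G i))))
  map_liSq f := by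
    let G := famHom1 f
    exact Carries.transfer (K.liSq G) (K'.liSq fun i => F.toPF.map (G i))
      (carries_nat F χ.l.inv (G := G) (fun i => fC F.toPF (G i)) (fun i => rfl) fun i => rfl)
      ((compat_one F (fun i => fC F.toPF (G i))).comp (compat_li hc _)) ((compat_li hc _).comp (compat_ulC K.cells K'.cells c (fun i => fC F.toPF (G i))))
  map_rSq f := by
    let G := famHom1 f
    exact Carries.transfer (K.rSq G) (K'.rSq fun i => F.toPF.map (G i))
      (carries_nat F χ.r.hom (G := G) (fun i => fC F.toPF (G i)) (fun i => rfl) fun i => rfl)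
      ((compat_one F (fun i => fC F.toPF (G i))).comp (compat_r hc _)) ((compat_r hc _).comp (compat_urC K.cells K'.cells c (fun i => fC F.toPF (G i))))
  map_riSq f := by
    let G := famHom1 f
    exact Carries.transfer (K.riSq G) (K'.riSq fun i => F.toPF.map (G i))
      (carries_nat F χ.r.inv (G := G) (fun i => fC F.toPF (G i)) (fun i => rfl) fun i => rfl)
      ((compat_urC K.cells K'.cells c (fun i => fC F.toPF (G i))).comp (compat_ri hc _)) ((compat_ri hc _).comp (compat_one F (fun i => fC F.toPF (G i))))
  map_bSq f g := by
    let G := famHom2 f g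
    exact Carries.transfer (K.bSq G) (K'.bSq fun i => F.toPF.map (G i))
      (carries_nat F χ.β.hom (G := G) (fun i => fC F.toPF (G i)) (fun i => rfl) fun i => rfl)
      ((compat_tens K.cells K'.cells c (fun i => fC F.toPF (G i))).comp (compat_b hc _)) ((compat_b hc _).comp (compat_dot K.cells K'.cells c (fun i => fC F.toPF (G i))))
  map_biSq f g := by
    let G := famHom2 f g
    exact Carries.transfer (K.biSq G) (K'.biSq fun i => F.toPF.map (G i))
      (carries_nat F χ.β.inv (G := G) (fun i => fC F.toPF (G i)) (fun i => rfl) fun i => rfl)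
      ((compat_dot K.cells K'.cells c (fun i => fC F.toPF (G i))).comp (compat_bi hc _)) ((compat_bi hc _).comp (compat_tens K.cells K'.cells c (fun i => fC F.toPF (G i))))
  map_aUnit x y z := by
    let v : Fin 3 → X.carrier := ![x, y, z]
    exact Carries.transfer (K.aUnit v) (K'.aUnit fun i => F.toPF.obj (v i))
      (carries_evC F χ.α.unit.hom fun i => rfl)
      (compat_idCmp F (fun i => rfl) _ _ _)
      (compat_compCmp F (fun i => rfl) (compat_a hc _) (compat_ai hc _))
  map_aCounit x y z := by
    let v : Fin 3 → X.carrier := ![x, y, z]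
    exact Carries.transfer (K.aCounit v) (K'.aCounit fun i => F.toPF.obj (v i))
      (carries_evC F χ.α.counit.hom fun i => rfl)
      (compat_compCmp F (fun i => rfl) (compat_ai hc _) (compat_a hc _))
      (compat_idCmp F (fun i => rfl) _ _ _)
  map_lUnit x := by
    let v : Fin 1 → X.carrier := ![x]
    exact Carries.transfer (K.lUnit v) (K'.lUnit fun i => F.toPF.obj (v i))
      (carries_evC F χ.l.unit.hom fun i => rfl)
      (compat_idCmp F (fun i => rfl) _ _ _)
      (compat_compCmp F (fun i => rfl) (compat_l hc _) (compat_li hc _))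
  map_lCounit x := by
    let v : Fin 1 → X.carrier := ![x]
    exact Carries.transfer (K.lCounit v) (K'.lCounit fun i => F.toPF.obj (v i))
      (carries_evC F χ.l.counit.hom fun i => rfl)
      (compat_compCmp F (fun i => rfl) (compat_li hc _) (compat_l hc _))
      (compat_idCmp F (fun i => rfl) _ _ _)
  map_rUnit x := by
    let v : Fin 1 → X.carrier := ![x]
    exact Carries.transfer (K.rUnit v) (K'.rUnit fun i => F.toPF.obj (v i))
      (carries_evC F χ.r.unit.hom fun i => rfl)
      (compat_idCmp F (fun i => rfl) _ _ _)
      (compat_compCmp F (fun i => rfl) (compat_r hc _) (compat_ri hc _))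
  map_rCounit x := by
    let v : Fin 1 → X.carrier := ![x]
    exact Carries.transfer (K.rCounit v) (K'.rCounit fun i => F.toPF.obj (v i))
      (carries_evC F χ.r.counit.hom fun i => rfl)
      (compat_compCmp F (fun i => rfl) (compat_ri hc _) (compat_r hc _))
      (compat_idCmp F (fun i => rfl) _ _ _)
  map_bUnit x y := by
    let v : Fin 2 → X.carrier := ![x, y]
    exact Carries.transfer (K.bUnit v) (K'.bUnit fun i => F.toPF.obj (v i))
      (carries_evC F χ.β.unit.hom fun i => rfl)
      (compat_idCmp F (fun i => rfl) _ _ _)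
      (compat_compCmp F (fun i => rfl) (compat_b hc _) (compat_bi hc _))
  map_bCounit x y := by
    let v : Fin 2 → X.carrier := ![x, y]
    exact Carries.transfer (K.bCounit v) (K'.bCounit fun i => F.toPF.obj (v i))
      (carries_evC F χ.β.counit.hom fun i => rfl)
      (compat_compCmp F (fun i => rfl) (compat_bi hc _) (compat_b hc _))
      (compat_idCmp F (fun i => rfl) _ _ _)
  map_pi x y z w := by
    let v : Fin 4 → X.carrier := ![x, y, z, w]
    exact Carries.transfer (K.pi v) (K'.pi fun i => F.toPF.obj (v i))
      (carries_evC F χ.π.hom fun i => rfl)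
      (compat_compCmp F (fun i => rfl) (compat_evC K.cells K'.cells c _ _ _ _ (compat_a hc _) (compat_oneC F _)) (compat_compCmp F (fun i => rfl) (compat_cast F _ _ _ (compat_aC hc _ _ _ _ (fun i => rfl) _ _ _ _ _ _ _ _ _)) (compat_evC K.cells K'.cells c _ _ _ _ (compat_oneC F _) (compat_a hc _))))
      (compat_compCmp F (fun i => rfl) (compat_cast F _ _ _ (compat_aC hc _ _ _ _ (fun i => rfl) _ _ _ _ _ _ _ _ _)) (compat_cast F _ _ _ (compat_aC hc _ _ _ _ (fun i => rfl) _ _ _ _ _ _ _ _ _)))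
  map_mu x y := by
    let v : Fin 2 → X.carrier := ![x, y]
    exact Carries.transfer (K.mu v) (K'.mu fun i => F.toPF.obj (v i))
      (carries_evC F χ.μ.hom fun i => rfl)
      (compat_compCmp F (fun i => rfl) (compat_evC K.cells K'.cells c _ _ _ _ (compat_r hc _) (compat_oneC F _)) (compat_compCmp F (fun i => rfl) (compat_cast F _ _ _ (compat_aC hc _ _ _ _ (fun i => rfl) _ _ _ _ _ _ _ _ _)) (compat_evC K.cells K'.cells c _ _ _ _ (compat_oneC F _) (compat_l hc _))))
      (compat_idCmp F (fun i => rfl) _ _ _)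
  map_lam x y := by
    let v : Fin 2 → X.carrier := ![x, y]
    exact Carries.transfer (K.lam v) (K'.lam fun i => F.toPF.obj (v i))
      (carries_evC F χ.lam.hom fun i => rfl)
      (compat_evC K.cells K'.cells c _ _ _ _ (compat_l hc _) (compat_oneC F _))
      (compat_compCmp F (fun i => rfl) (compat_cast F _ _ _ (compat_aC hc _ _ _ _ (fun i => rfl) _ _ _ _ _ _ _ _ _)) (compat_cast F _ _ _ (compat_lC hc _ _ (fun i => rfl) _ _ _)))
  map_rho x y := by
    let v : Fin 2 → X.carrier := ![x, y]
    exact Carries.transfer (K.rho v) (K'.rho fun i => F.toPF.obj (v i))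
      (carries_evC F χ.ρ.hom fun i => rfl)
      (compat_evC K.cells K'.cells c _ _ _ _ (compat_oneC F _) (compat_r hc _))
      (compat_compCmp F (fun i => rfl) (compat_cast F _ _ _ (compat_rC hc _ _ (fun i => rfl) _ _ _)) (compat_cast F _ _ _ (compat_aC hc _ _ _ _ (fun i => rfl) _ _ _ _ _ _ _ _ _)))
  map_R x y z := by
    let v : Fin 3 → X.carrier := ![x, y, z]
    exact Carries.transfer (K.R v) (K'.R fun i => F.toPF.obj (v i))
      (carries_evC F χ.R.hom fun i => rfl)
      (compat_compCmp F (fun i => rfl) (compat_blC hc _) (compat_compCmp F (fun i => rfl) (compat_actC F _ _ _ (compat_a hc _)) (compat_cast F _ _ _ (compat_actC F _ _ _ (compat_brC hc _)))))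
      (compat_compCmp F (fun i => rfl) (compat_a hc _) (compat_compCmp F (fun i => rfl) (compat_cast F _ _ _ (compat_bC hc _ _ _ (fun i => rfl) _ _ _ _ _ _)) (compat_actC F _ _ _ (compat_a hc _))))
  map_S x y z := by
    let v : Fin 3 → X.carrier := ![x, y, z]
    exact Carries.transfer (K.S v) (K'.S fun i => F.toPF.obj (v i))
      (carries_evC F χ.S.hom fun i => rfl)
      (compat_compCmp F (fun i => rfl) (compat_brC hc _) (compat_compCmp F (fun i => rfl) (compat_actC F _ _ _ (compat_ai hc _)) (compat_cast F _ _ _ (compat_actC F _ _ _ (compat_blC hc _)))))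
      (compat_compCmp F (fun i => rfl) (compat_ai hc _) (compat_compCmp F (fun i => rfl) (compat_cast F _ _ _ (compat_bC hc _ _ _ (fun i => rfl) _ _ _ _ _ _)) (compat_actC F _ _ _ (compat_ai hc _))))
  map_syl x y := by
    let v : Fin 2 → X.carrier := ![x, y]
    exact Carries.transfer (K.syl v) (K'.syl fun i => F.toPF.obj (v i))
      (carries_evC F χ.v.hom fun i => rfl)
      (compat_compCmp F (fun i => rfl) (compat_b hc _) (compat_cast F _ _ _ (compat_actC F _ _ _ (compat_b hc _))))
      (compat_idCmp F (fun i => rfl) _ _ _)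

end

end Canonical

end

end SMTwo

namespace SMTwo

section

variable {B : Type u₁} [Bicategory.{w₁, v₁} B] {C : Type u₂} [Bicategory.{w₂, v₂} C]
  {D : Type u₃} [Bicategory.{w₃, v₃} D]

theorem Compat.comp_pf {F : B ⥤ᵖ C} {G : C ⥤ᵖ D} {a b a' b' : B} {f : a ⟶ b} {g : a' ⟶ b'}
    {c d c' d' : C} {f₁ : c ⟶ d} {g₁ : c' ⟶ d'} {e k e' k' : D} {f₂ : e ⟶ k} {g₂ : e' ⟶ k'}
    {φ : Cmp f g} {φ₁ : Cmp f₁ g₁} {φ₂ : Cmp f₂ g₂} {ω : Cmp (F.map f) f₁}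
    {ω' : Cmp (F.map g) g₁} {σ : Cmp (G.map f₁) f₂} {σ' : Cmp (G.map g₁) g₂}
    (h : Compat F φ φ₁ ω ω') (h' : Compat G φ₁ φ₂ σ σ') :
    Compat (F.comp G) φ φ₂ ((ω.map G).trans σ) ((ω'.map G).trans σ') := by
  have h : (φ.map F).trans ω' = ω.trans φ₁ := h
  have h' : (φ₁.map G).trans σ' = σ.trans φ₂ := h'
  have e : ((φ.map F).map G).trans ((ω'.map G).trans σ') =
      ((ω.map G).trans σ).trans φ₂ := by
    rw [Cmp.trans_assoc, ← h', ← Cmp.trans_assoc, ← Cmp.trans_assoc, ← Cmp.map_trans,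
      ← Cmp.map_trans, h]
  exact (congrArg (Cmp.trans · _) (Cmp.map_comp F G φ)).trans e

end

section

variable {P : Operad.{w, v, u}} {X Y Z : PAlg.{w, v, u, w₁, v₁, u₁} P} {χ : ChoiceOfMult P}

theorem PAlg.homC_isEq (F : X ⟶ Y) (hF : IsTwoFunctor F.toPF) {n : ℕ} {p q : P.obj n} (κ : p ⟶ q)
    (x : Fin n → X.carrier) : (homC F κ x).IsEq := by
  refine (Cmp.ofPF_isEq (F.comm n) _).trans (Cmp.muMap_isEq (Cmp.IsEq.refl _) fun i => ?_)
  rw [← idCmp_refl]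
  exact idCmp_isEq hF _

theorem PAlg.homC_comp (F : X ⟶ Y) (G : Y ⟶ Z) {n : ℕ} {p q : P.obj n} (κ : p ⟶ q)
    (x : Fin n → X.carrier) : homC (F ≫ G) κ x =
      ((homC F κ x).map G.toPF).trans (homC G κ fun i => F.toPF.obj (x i)) := by
  have h := map_muMap_appC G (Cmp.ofIso (Iso.refl κ)) (G := fun i => F.toPF.map (𝟙 (x i)))
    (K := 𝟙 fun i => F.toPF.obj (x i)) (K' := 𝟙 fun i => G.toPF.obj (F.toPF.obj (x i)))
    (fun i => Cmp.ofIso (F.toPF.mapId (x i))) fun i => Cmp.ofIso (G.toPF.mapId (F.toPF.obj (x i)))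
  have h' := Cmp.map_trans G.toPF (Cmp.ofPF (F.comm n) (κ ×ₘ 𝟙 x))
    (Cmp.muMap Y (F := fun i => F.toPF.map (𝟙 (x i))) (F' := 𝟙 fun i => F.toPF.obj (x i))
      (Cmp.ofIso (Iso.refl κ)) fun i => Cmp.ofIso (F.toPF.mapId (x i)))
  refine Eq.trans ?_ ((congrArg (Cmp.trans · (homC G κ fun i => F.toPF.obj (x i))) h').trans
    (Cmp.trans_assoc _ _ _)).symm
  refine Eq.trans ?_ (congrArg (Cmp.trans _) h).symm
  refine Eq.trans ?_ (Cmp.trans_assoc _ _ _)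
  refine congrArg (Cmp.trans · _) ?_
  exact (Cmp.ofPF_isEq ((F ≫ G).comm n) _).unique (((Cmp.ofPF_isEq _ _).map _).trans (Cmp.ofPF_isEq (G.comm n) _))

namespace Canonical

variable {s : MonCells X.carrier} {s' : MonCells Y.carrier} {s'' : MonCells Z.carrier}
  {H : InducedCells χ X s} {H' : InducedCells χ Y s'} {H'' : InducedCells χ Z s''}

theorem unique {F : X ⟶ Y} {c d : StrictCells F.toPF s s'} (hc : Canonical F H H' c)
    (hd : Canonical F H H' d) : c = d := by
  refine StrictCells.ext' ?_ ?_ ?_ ?_ ?_ ?_ ?_ ?_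
  · exact funext₃ fun x y z => Cmp.trans_left_cancel ((hc.a ![x, y, z]).trans (hd.a _).symm)
  · exact funext₃ fun x y z => Cmp.trans_left_cancel ((hc.ai ![x, y, z]).trans (hd.ai _).symm)
  · exact funext fun x => Cmp.trans_left_cancel ((hc.l ![x]).trans (hd.l _).symm)
  · exact funext fun x => Cmp.trans_left_cancel ((hc.li ![x]).trans (hd.li _).symm)
  · exact funext fun x => Cmp.trans_left_cancel ((hc.r ![x]).trans (hd.r _).symm)
  · exact funext fun x => Cmp.trans_left_cancel ((hc.ri ![x]).trans (hd.ri _).symm)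
  · exact funext₂ fun x y => Cmp.trans_left_cancel ((hc.b ![x, y]).trans (hd.b _).symm)
  · exact funext₂ fun x y => Cmp.trans_left_cancel ((hc.bi ![x, y]).trans (hd.bi _).symm)

theorem ident (H : InducedCells χ X s) : Canonical (𝟙 X) H H (StrictCells.ident s) := by
  constructor <;> intro x <;> exact Cmp.IsEq.unique (((Same.isEq _).map _).trans (Cmp.IsEq.refl _))
    ((PAlg.homC_isEq (𝟙 X) isTwoFunctor_id _ _).trans (Same.isEq _))

theorem comp {F : X ⟶ Y} {G : Y ⟶ Z} {c : StrictCells F.toPF s s'} {d : StrictCells G.toPF s' s''}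
    (hc : Canonical F H H' c) (hd : Canonical G H' H'' d) :
    Canonical (F ≫ G) H H'' (StrictCells.comp c d) := by
  have key {n : ℕ} {p q : P.obj n} {κ : p ⟶ q} {x : Fin n → X.carrier} {a b : X.carrier}
      {f : a ⟶ b} {a' b' : Y.carrier} {f' : a' ⟶ b'} {a'' b'' : Z.carrier} {f'' : a'' ⟶ b''}
      {φ : Cmp ((X.ev x).map κ) f} {φ' : Cmp ((Y.ev fun i => F.toPF.obj (x i)).map κ) f'}
      {φ'' : Cmp ((Z.ev fun i => G.toPF.obj (F.toPF.obj (x i))).map κ) f''}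
      {ω : Cmp (F.toPF.map f) f'} {σ : Cmp (G.toPF.map f') f''}
      (h : Compat F.toPF φ φ' (PAlg.homC F κ x) ω) (h' : Compat G.toPF φ' φ'' (PAlg.homC G κ _) σ) :
      Compat (F ≫ G).toPF φ φ'' (PAlg.homC (F ≫ G) κ x) ((ω.map G.toPF).trans σ) :=
    (h.comp_pf h').congr rfl rfl (PAlg.homC_comp F G κ x).symm rfl
  exact ⟨fun x => key (hc.a x) (hd.a _), fun x => key (hc.ai x) (hd.ai _),
    fun x => key (hc.l x) (hd.l _), fun x => key (hc.li x) (hd.li _),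
    fun x => key (hc.r x) (hd.r _), fun x => key (hc.ri x) (hd.ri _),
    fun x => key (hc.b x) (hd.b _), fun x => key (hc.bi x) (hd.bi _)⟩

theorem isStrict {F : X ⟶ Y} (hF : IsTwoFunctor F.toPF) {c : StrictCells F.toPF s s'}
    (hc : Canonical F H H' c) : c.IsStrict := by
  have key {n : ℕ} {p q : P.obj n} {κ : p ⟶ q} {x : Fin n → X.carrier} {a b : X.carrier}
      {f : a ⟶ b} {a' b' : Y.carrier} {f' : a' ⟶ b'} {φ : Same ((X.ev x).map κ) f}
      {φ' : Same ((Y.ev fun i => F.toPF.obj (x i)).map κ) f'} {ω : Cmp (F.toPF.map f) f'}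
      (h : (φ.cmp.map F.toPF).trans ω = (PAlg.homC F κ x).trans φ'.cmp) : ω.IsEq := by
    rw [Cmp.trans_eq_iff.1 h]
    exact ((Same.isEq φ).map _).symm.trans ((PAlg.homC_isEq F hF κ x).trans (Same.isEq _))
  exact ⟨fun x y z => key (hc.a ![x, y, z]), fun x y z => key (hc.ai ![x, y, z]),
    fun x => key (hc.l ![x]), fun x => key (hc.li ![x]), fun x => key (hc.r ![x]),
    fun x => key (hc.ri ![x]), fun x y => key (hc.b ![x, y]), fun x y => key (hc.bi ![x, y])⟩

theorem tensor_eq (H : InducedCells χ X s) (H' : InducedCells χ Y s') (F : X ⟶ Y) :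
    s.tensor.comp F.toPF = (prodMap F.toPF F.toPF).comp s'.tensor := by
  rw [H.tensor, H'.tensor, PAlg.tens, PAlg.tens, pf_assoc, F.comm, ← pf_assoc, ← pf_assoc]
  refine congrArg (Pseudofunctor.comp · (Y.mu 2)) ?_
  simp only [prodMap, powMap, comp_pair, comp_lift, ← pf_assoc, pair_fst, pair_snd, lift_proj]
  refine congrArg₂ pair ?_ (congrArg lift (funext fun i => ?_))
  · exact (pf_comp_id _).trans (comp_const _ _).symm
  · match i with
    | 0 => exact (pair_fst _ _).symm
    | 1 => exact (pair_snd _ _).symm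

theorem unit_eq (H : InducedCells χ X s) (H' : InducedCells χ Y s') (F : X ⟶ Y) :
    F.toPF.obj s.e = s'.e := by
  let x : Fin 0 → X.carrier := fun i => i.elim0
  rw [← H.unit x, ← H'.unit fun i => F.toPF.obj (x i)]
  exact (Same.of_pf (F.comm 0) (𝟙 ((χ.i, x) : P.obj 0 × (Fin 0 → X.carrier)))).src

/-- The comparison obtained from the unit constraints of a morphism. -/
def cmp (F : X ⟶ Y) {n : ℕ} {p q : P.obj n} {κ : p ⟶ q} {x : Fin n → X.carrier} {a b : X.carrier}
    {f : a ⟶ b} {a' b' : Y.carrier} {f' : a' ⟶ b'} (φ : Same ((X.ev x).map κ) f)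
    (φ' : Same ((Y.ev fun i => F.toPF.obj (x i)).map κ) f') : Cmp (F.toPF.map f) f' :=
  (φ.cmp.map F.toPF).symm.trans ((PAlg.homC F κ x).trans φ'.cmp)

/-- The canonical comparisons of the structural 1-cells. -/
def strictCells (H : InducedCells χ X s) (H' : InducedCells χ Y s') (F : X ⟶ Y) :
    StrictCells F.toPF s s' where
  tensor_eq := tensor_eq H H' F
  unit_eq := unit_eq H H' F
  a x y z := cmp F (H.a ![x, y, z]) (H'.a _)
  ai x y z := cmp F (H.ai ![x, y, z]) (H'.ai _)
  l x := cmp F (H.l ![x]) (H'.l _)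
  li x := cmp F (H.li ![x]) (H'.li _)
  r x := cmp F (H.r ![x]) (H'.r _)
  ri x := cmp F (H.ri ![x]) (H'.ri _)
  b x y := cmp F (H.b ![x, y]) (H'.b _)
  bi x y := cmp F (H.bi ![x, y]) (H'.bi _)

theorem strictCells_canonical (H : InducedCells χ X s) (H' : InducedCells χ Y s') (F : X ⟶ Y) :
    Canonical F H H' (strictCells H H' F) := by
  have h₁ (x : Fin 1 → X.carrier) : ∃ a, x = ![a] := ⟨x 0, funext fun i => match i with
    | 0 => rfl⟩
  have h₂ (x : Fin 2 → X.carrier) : ∃ a b, x = ![a, b] := ⟨x 0, x 1, funext fun i => match i with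
    | 0 => rfl
    | 1 => rfl⟩
  have h₃ (x : Fin 3 → X.carrier) : ∃ a b c, x = ![a, b, c] :=
    ⟨x 0, x 1, x 2, funext fun i => match i with
    | 0 => rfl
    | 1 => rfl
    | 2 => rfl⟩
  constructor <;> intro x
  · obtain ⟨a, b, c, rfl⟩ := h₃ x
    exact Cmp.symm_trans_trans _ _
  · obtain ⟨a, b, c, rfl⟩ := h₃ x
    exact Cmp.symm_trans_trans _ _
  · obtain ⟨a, rfl⟩ := h₁ x
    exact Cmp.symm_trans_trans _ _
  · obtain ⟨a, rfl⟩ := h₁ x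
    exact Cmp.symm_trans_trans _ _
  · obtain ⟨a, rfl⟩ := h₁ x
    exact Cmp.symm_trans_trans _ _
  · obtain ⟨a, rfl⟩ := h₁ x
    exact Cmp.symm_trans_trans _ _
  · obtain ⟨a, b, rfl⟩ := h₂ x
    exact Cmp.symm_trans_trans _ _
  · obtain ⟨a, b, rfl⟩ := h₂ x
    exact Cmp.symm_trans_trans _ _

end Canonical

end

end SMTwo

namespace SMTwo

section

variable {P : Operad.{w, v, u}} {χ : ChoiceOfMult P}
  {s : ∀ X : PAlg.{w, v, u, w₁, v₁, u₁} P, SymMon X.carrier} (hs : ∀ X, Induced χ X (s X))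

/-- The strictly symmetric monoidal structure of a morphism of algebras. -/
def Induced.hom {X Y : PAlg.{w, v, u, w₁, v₁, u₁} P} (F : X ⟶ Y) :
    StrictSymMon F.toPF (s X) (s Y) :=
  (Canonical.strictCells_canonical (hs X).cells (hs Y).cells F).strictSymMon (hs X) (hs Y)

theorem Induced.hom_canonical {X Y : PAlg.{w, v, u, w₁, v₁, u₁} P} (F : X ⟶ Y) :
    Canonical F (hs X).cells (hs Y).cells (Induced.hom hs F).toStrictCells :=
  Canonical.strictCells_canonical _ _ F

/-- The functor from algebras to symmetric monoidal 2-categories. -/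
def Induced.functor : PAlg.{w, v, u, w₁, v₁, u₁} P ⥤ SMTwoCatPs.{w₁, v₁, u₁} where
  obj X := SMTwoCatPs.mk X.carrier (s X)
  map F := SMTwoCatPs.Hom.mk F.toPF (Induced.hom hs F)
  map_id X :=
    have h : Induced.hom hs (𝟙 X) = StrictSymMon.ident (s X) :=
      StrictSymMon.ext' ((Induced.hom_canonical hs (𝟙 X)).unique (Canonical.ident (hs X).cells))
    congrArg (fun d => SMTwoCatPs.Hom.mk (X := SMTwoCatPs.mk X.carrier (s X))
      (Y := SMTwoCatPs.mk X.carrier (s X)) (Pseudofunctor.id X.carrier) d) h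
  map_comp {X Y Z} F G :=
    have h : Induced.hom hs (F ≫ G) = (Induced.hom hs F).comp (Induced.hom hs G) :=
      StrictSymMon.ext' ((Induced.hom_canonical hs (F ≫ G)).unique
        ((Induced.hom_canonical hs F).comp (Induced.hom_canonical hs G)))
    congrArg (fun d => SMTwoCatPs.Hom.mk (X := SMTwoCatPs.mk X.carrier (s X))
      (Y := SMTwoCatPs.mk Z.carrier (s Z)) (F.toPF.comp G.toPF) d) h

/-- The functor from algebras and 2-functors to symmetric monoidal 2-categories and strict
functors. -/
def Induced.strictFunctor : PTwoCat.{w, v, u, w₁, v₁, u₁} P ⥤ SMTwoCatS.{w₁, v₁, u₁} where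
  obj X := ⟨(Induced.functor hs).obj X.obj⟩
  map F := ⟨(Induced.functor hs).map F.hom,
    show IsTwoFunctor F.hom.toPF from F.property, (Induced.hom_canonical hs F.hom).isStrict F.property⟩
  map_id X := WideSubcategory.hom_ext _ ((Induced.functor hs).map_id X.obj)
  map_comp F G := WideSubcategory.hom_ext _ ((Induced.functor hs).map_comp F.hom G.hom)

end

end SMTwo

theorem theorem3 (P : SMTwo.Operad.{w, v, u})
    (hP : ∀ n ≤ 5, SMTwo.IsContractible (P.obj n)) (χ : SMTwo.ChoiceOfMult P) :
    ∃ (s : ∀ X : SMTwo.PAlg.{w, v, u, w₁, v₁, u₁} P, SMTwo.SymMon X.carrier)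
      (hs : ∀ X, SMTwo.Induced χ X (s X))
      (c : ∀ {X Y : SMTwo.PAlg.{w, v, u, w₁, v₁, u₁} P} (F : X ⟶ Y),
        SMTwo.StrictSymMon F.toPF (s X) (s Y))
      (Φ : SMTwo.PAlg.{w, v, u, w₁, v₁, u₁} P ⥤ SMTwo.SMTwoCatPs.{w₁, v₁, u₁})
      (Ψ : SMTwo.PTwoCat.{w, v, u, w₁, v₁, u₁} P ⥤ SMTwo.SMTwoCatS.{w₁, v₁, u₁}),
      (∀ {X Y : SMTwo.PAlg.{w, v, u, w₁, v₁, u₁} P} (F : X ⟶ Y),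
        SMTwo.Canonical F (hs X).cells (hs Y).cells (c F).toStrictCells) ∧
      (∀ X, Φ.obj X = SMTwo.SMTwoCatPs.mk X.carrier (s X)) ∧
      (∀ {X Y : SMTwo.PAlg.{w, v, u, w₁, v₁, u₁} P} (F : X ⟶ Y),
        HEq (Φ.map F) (SMTwo.SMTwoCatPs.Hom.mk (X := SMTwo.SMTwoCatPs.mk X.carrier (s X))
          (Y := SMTwo.SMTwoCatPs.mk Y.carrier (s Y)) F.toPF (c F))) ∧
      Φ ⋙ SMTwo.SMTwoCatPs.forget = SMTwo.PAlg.forget P ∧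
      Ψ ⋙ wideSubcategoryInclusion _ = wideSubcategoryInclusion _ ⋙ Φ := by
  choose s hs using fun X : SMTwo.PAlg.{w, v, u, w₁, v₁, u₁} P => SMTwo.exists_induced X hP χ
  exact ⟨s, hs, fun F => SMTwo.Induced.hom hs F, SMTwo.Induced.functor hs,
    SMTwo.Induced.strictFunctor hs, fun F => SMTwo.Induced.hom_canonical hs F, fun _ => rfl,
    fun _ => HEq.rfl, rfl, rfl⟩
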